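/- **Setting.** Let $M=\begin{pmatrix}2&1\\1&2\end{pmatrix}$, $0<T<1$, $0<\varepsilon'<\epsilon$, $T^{\epsilon}<S<T^{\varepsilon'}$, and let $t>0$ be small, namely $t(1+T^{\varepsilon'-\epsilon})\le 1$. Let $\tilde Y$ be the smooth toric threefold whose fan is the cone over the triangulation of $\mathbb R^2\times\{1\}$ by the integral translates of the triangles $\mathrm{conv}(0,e_1,e_2)$ and $\mathrm{conv}(0,-e_1,-e_2)$ (equivalently, with moment polytope $\eta\ge\max_{n\in\mathbb Z^2}(\langle n,\xi\rangle-\tfrac12n^{T}Mn)$), with toric coordinates $x_1,x_2,v_0$ on the dense torus, where $v_0=y_0y_1y_2$ in every toric chart $\mathbb C^3$. Put $W_0=T^{\epsilon}(v_0-1)$. Let $Y$ be the quotient of $\{|W_0|<T^{\varepsilon'}\}\subset\tilde Y$ by $\mathbb Z^2$, where $m\in\mathbb Z^2$ acts by $x\mapsto t^{-Mm}(-v_0)^{-m}x$, $v_0\mapsto v_0$, and let $Y^0=Y\setminus W_0^{-1}(0)$. The only critical value of $W_0:Y\to\mathbb C$ is $-T^\epsilon$; the other fibres are four-tori. Let $\omega$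 be any Kähler form on $Y$ for which the two-torus rotating $x_1,x_2$ acts in a Hamiltonian way, with moment map $\xi=(\xi_1,\xi_2)$ on the cover satisfying $\xi(m\cdot y)=\xi(y)+Mm$. With $\theta_i=\frac1{2\pi}\arg x_i$ and $a=M^{-1}\xi$, the fibre over $-S$ is $T^4=(\mathbb R^2/\mathbb Z^2)_a\times(\mathbb R^2/\mathbb Z^2)_\theta$; put $\ell_k=\{\theta=-kM^{-1}\xi\}$ in it. Parallel transport is along the $\omega$-orthogonal complement of the fibres of $W_0$. For a smooth embedded U-shaped path $\gamma:\mathbb R\to\mathbb C^*\setminus\{-T^\epsilon\}$ with $\gamma(0)=-S$ and eventually radial ends, $L_j$ is the union of the parallel transports of $\ell_j$ from $-S$ along $\gamma$. For a smooth embedded arc $\kappa:[0,\infty)\to\mathbb C\setminus\{-T^\epsilon\}$ with $\kappa(0)=-S$, $\kappa(1)=0$ and eventually radial end, $K_j$ is the union, over times $\tau>1$, of the parallel transports of $\ell_j$ along $\kappa|_{[0,\tau]}$. Let $j_1,j_2,j_3$ be distinct integers, and let $L_{j_1},L_{j_2},K_{j_3}$ be defined by U-shaped paths $\gamma_1,\gamma_2$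 and an arc $\kappa$. Let $D\subset\mathbb C^*\setminus\{-T^\epsilon\}$, inside the base disc, be a triangle with one vertex $-S$, two sides on $\gamma_1$ and $\gamma_2$ issuing from $-S$, and third side on $\kappa((1,\infty))$, which meets $\gamma_1,\gamma_2,\kappa((1,\infty))$ only in these sides. It is parametrized by a smooth $\delta:[0,1]^2\to D$, which is injective on $s<1$, with $\partial_t\delta\ne0$ for $s<1$, $\delta(s,1)\in\gamma_1$, $\delta(s,0)\in\gamma_2$, $\delta(0,t)\in\kappa$, and $\delta(1,t)=-S$ attained only for $s=1$ (the induced reparametrizations of $\gamma_1,\gamma_2,\kappa$ along the sides being smooth). Assume that the path along $\kappa$ from $-S$ to $\delta(0,0)$ is homotopic, with fixed ends, in the base disc minus $-T^\epsilon$, to the side of $D$ on $\gamma_2$ from $-S$ to $\delta(0,0)$. For a Hamiltonian diffeomorphism $\Phi$ of $Y^0$, an *isotopy of $\Phi(K_{j_3})$ over $\delta$* is a smooth family $\psi_s$, $0\le s\le1$, of maps from the part $\Phi(K_{j_3})|_D\cong[0,1]\times T^2$ of $\Phi(K_{j_3})$ over $D$, which lies over $\delta(0,\cdot)$, to $Y^0$,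 such that $\psi_0$ is the inclusion, $\psi_s$ sends the fibre over $\delta(0,t)$ into the fibre over $\delta(s,t)$, $\psi_s$ is a Lagrangian embedding for $s<1$, and $\psi_1$ sends each fibre over $\delta(0,t)$ onto $\ell_{j_3}$ in the fibre over $-S$. **Claim.** (1) There are a Hamiltonian diffeomorphism $\Phi$ of $Y^0$ and an isotopy of $\Phi(K_{j_3})$ over $\delta$. (2) Let $\Phi,\psi$ be any such pair, let $J$ be any $\omega$-compatible almost complex structure on $Y^0$, and let $u$ be a $J$-holomorphic triangle with $W_0(u)=D$ and boundary, in counterclockwise order, on $L_{j_1},L_{j_2},\Phi(K_{j_3})$, which contributes to $HF(L_{j_2},K_{j_3}[-1])\otimes HF(L_{j_1},L_{j_2})\to HF(L_{j_1},K_{j_3}[-1])$ in the sense that the degree of its output corner is the sum of the degrees of its input corners. Here these degrees are the fibrewise ones, $0$ for $CF(\ell_i,\ell_j)$ with $i<j$ and $2$ for $i>j$, the base contributions being $0$. Suppose that $\psi$ carries the two corners of $u$ on $\Phi(K_{j_3})$ through points of $L_{j_2}$, respectively $L_{j_1}$, so that at $s=1$ all three corners lie in the fibre over $-S$. Let $u'$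 be the continuous triangle obtained from $u$ by attaching the trace under $\psi$ of its edge on $\Phi(K_{j_3})$. Then, for each $c>0$, there is a flat holomorphic triangle $u''$ in the fibre $T^4$ over $-S$ (in the complex coordinates $a+ic\theta$ on the universal cover it is the restriction of a complex affine map to a positively oriented Euclidean triangle), with its three edges on $\ell_{j_1},\ell_{j_2},\ell_{j_3}$ and with the same corners as $u'$, such that $$[u']=[u'']\in H_2\bigl(Y^0,\;L_{j_1}\cup L_{j_2}\cup\psi_1(\Phi(K_{j_3})|_D);\mathbb Z\bigr).$$ -/

import Mathlib

open Set Filter Topology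
open scoped ContDiff

noncomputable section

/-! ### Singular chains and relative homology -/

/-- The standard topological `n`-simplex. -/
abbrev Splx (n : ℕ) : Type := stdSimplex ℝ (Fin (n + 1))

/-- The `i`-th face inclusion `Δⁿ → Δⁿ⁺¹`. -/
def faceMap (n : ℕ) (i : Fin (n + 2)) : C(Splx n, Splx (n + 1)) :=
  ⟨stdSimplex.map i.succAbove, stdSimplex.continuous_map _⟩

/-- Singular `n`-chains with integer coefficients. -/
abbrev SingChain (X : Type) [TopologicalSpace X] (n : ℕ) : Type := C(Splx n, X) →₀ ℤ

/-- The singular boundary operator. -/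
def singBoundary {X : Type} [TopologicalSpace X] (n : ℕ) (c : SingChain X (n + 1)) :
    SingChain X n :=
  c.sum fun σ k => ∑ i : Fin (n + 2), Finsupp.single (σ.comp (faceMap n i)) ((-1) ^ (i : ℕ) * k)

/-- The chain is supported on simplices lying in the subset `A`, i.e. it is a chain of `A`. -/
def ChainIn {X : Type} [TopologicalSpace X] (A : Set X) {n : ℕ} (c : SingChain X n) : Prop :=
  ∀ σ ∈ c.support, range σ ⊆ A

/-- `σ` is a relative 2-cycle of the pair `(B, A)`. -/
def IsRelCycle {X : Type} [TopologicalSpace X] (B A : Set X) (σ : C(Splx 2, X)) : Prop :=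
  range σ ⊆ B ∧ ChainIn A (singBoundary 1 (Finsupp.single σ (1 : ℤ)))

/-- `σ` and `σ'` are relative cycles with the same class in the singular homology group
`H₂(B, A; ℤ)`. -/
def RelHomologous {X : Type} [TopologicalSpace X] (B A : Set X) (σ σ' : C(Splx 2, X)) : Prop :=
  IsRelCycle B A σ ∧ IsRelCycle B A σ' ∧
    ∃ (c : SingChain X 3) (d : SingChain X 2), ChainIn B c ∧ ChainIn A d ∧
      Finsupp.single σ (1 : ℤ) - Finsupp.single σ' 1 = singBoundary 2 c + d

/-! ### The Landau-Ginzburg model `(Y, W₀)` -/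

/-- Local coordinates `(y₀, y₁, y₂)` of a toric chart. -/
abbrev C3 : Type := Fin 3 → ℂ

/-- Numerical parameters: the degeneration parameter `t` of the abelian surface, the
value `T ∈ (0,1)` of the Novikov parameter, the exponents `veps < eps`, and the modulus `S` of the
base point `-S`.  The last condition says that the group by which one divides acts freely
and properly over the disc `|W₀| < T ^ veps` (where `|v₀| < 1 / t`); it holds for all small `t`. -/
structure LGParams where
  t : ℝ
  T : ℝ
  eps : ℝ
  veps : ℝ
  S : ℝ
  t_pos : 0 < t
  T_pos : 0 < T
  T_lt : T < 1
  veps_pos : 0 < veps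
  veps_lt : veps < eps
  lt_S : T ^ eps < S
  S_lt : S < T ^ veps
  small : t * (1 + T ^ (veps - eps)) ≤ 1

/-- The matrix `(2 1; 1 2)` acting on ℝ². -/
def matM {R : Type} [CommRing R] (m : Fin 2 → R) : Fin 2 → R :=
  ![2 * m 0 + m 1, m 0 + 2 * m 1]

/-- The sign of a chart type: `1` for upward and `-1` for downward triangles. -/
def sgn (s : Bool) : ℤ := if s then 1 else -1

/-- The fan of the toric variety is the cone over the triangulation of ℝ² (placed at height one)
whose triangles are the integral translates of the triangles with vertices `0, e₁, e₂`
(type `true`) and `0, -e₁, -e₂` (type `false`); `vert s k` is the `k`-th vertex. -/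
def vert (s : Bool) (k : Fin 3) : Fin 2 → ℤ := fun i => if k = i.succ then sgn s else 0

/-- Barycentric coordinates of a lattice point with respect to the triangle of type `s`. -/
def bary (s : Bool) (l : Fin 3) (p : Fin 2 → ℤ) : ℤ :=
  ![1 - sgn s * (p 0 + p 1), sgn s * p 0, sgn s * p 1] l

/-- The toric coordinate `v₀ = y₀ y₁ y₂`. -/
def v0 (y : C3) : ℂ := ∏ k, y k

namespace LGParams

/-- Minus the critical value of `W₀`. -/
def crit (P : LGParams) : ℝ := P.T ^ P.eps

/-- The radius of the base disc. -/
def rad (P : LGParams) : ℝ := P.T ^ P.veps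

/-- The superpotential `W₀ = T^ε (v₀ - 1)` in a chart. -/
def Wc (P : LGParams) (y : C3) : ℂ := (P.crit : ℂ) * (v0 y - 1)

/-- The part of the chart `ℂ³` lying over the base disc. -/
def region (P : LGParams) : Set C3 := {y | ‖P.Wc y‖ < P.rad}

/-- Constants in the coordinate change between charts. -/
def coef (P : LGParams) (s : Bool) (m : Fin 2 → ℤ) (l : Fin 3) : ℂ :=
  let K : Fin 2 → ℂ := fun i => (-1) ^ m i * (P.t : ℂ) ^ (sgn s * matM m i)
  ![(K 0 * K 1)⁻¹, K 0, K 1] l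

/-- The change of coordinates from the chart of type `s` to that of type `s'`, after the action of
`m ∈ ℤ²`.  On the dense torus, with `x_i = y_i ^ (-s)` and `v₀ = y₀ y₁ y₂`, the element `m` acts by
`x ↦ t ^ (-M m) (-v₀) ^ (-m) x`, which moves the triangles of the fan by `m`. -/
def trans (P : LGParams) (s s' : Bool) (m : Fin 2 → ℤ) (y : C3) : C3 :=
  fun l => P.coef s' m l * ∏ k, y k ^ bary s' l (m + vert s k)

/-- Domain of the change of coordinates: a coordinate may vanish only if its vertex is a vertex of
the target triangle too. -/
def transDom (s s' : Bool) (m : Fin 2 → ℤ) : Set C3 :=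
  {y | ∀ k, y k = 0 → ∃ l, m + vert s k = vert s' l}

/-- Disjoint union of the two types of charts, over the base disc. -/
abbrev Charts (P : LGParams) : Type := {p : Bool × C3 // p.2 ∈ P.region}

/-- Two chart points represent the same point of `Y`. -/
def glue (P : LGParams) (p q : P.Charts) : Prop :=
  ∃ m, p.1.2 ∈ transDom p.1.1 q.1.1 m ∧ q.1.2 = P.trans p.1.1 q.1.1 m p.1.2

/-- The space `Y`: the toric Calabi-Yau threefold of the periodic triangulation, restricted to the
base disc and divided by the group ℤ². Each chart maps to it by a local homeomorphism. -/
def Y (P : LGParams) : Type := Quot P.glue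

instance (P : LGParams) : TopologicalSpace P.Y := inferInstanceAs (TopologicalSpace (Quot P.glue))

theorem coef_prod (P : LGParams) (s : Bool) (m : Fin 2 → ℤ) : ∏ l, P.coef s m l = 1 := by
  have ht : (P.t : ℂ) ≠ 0 := by exact_mod_cast P.t_pos.ne'
  have h1 : ∀ i, ((-1 : ℂ) ^ m i * (P.t : ℂ) ^ (sgn s * matM m i)) ≠ 0 := fun i =>
    mul_ne_zero (zpow_ne_zero _ (by norm_num)) (zpow_ne_zero _ ht)
  have h0 := h1 0
  have h2 := h1 1
  simp only [coef, Fin.prod_univ_three]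
  simp only [Matrix.cons_val_zero, Matrix.cons_val_one, Matrix.cons_val]
  rw [mul_assoc, inv_mul_cancel₀ (mul_ne_zero h0 h2)]

theorem bary_sum (s : Bool) (p : Fin 2 → ℤ) : ∑ l, bary s l p = 1 := by
  simp [bary, Fin.sum_univ_three]; ring

theorem bary_vert (s : Bool) (l : Fin 3) : bary s l (vert s l) = 1 := by
  cases s <;> fin_cases l <;> simp [bary, vert, sgn]

theorem v0_trans (P : LGParams) (s s' : Bool) (m : Fin 2 → ℤ) (y : C3)
    (h : y ∈ transDom s s' m) : v0 (P.trans s s' m y) = v0 y := by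
  by_cases hz : ∃ k, y k = 0
  · obtain ⟨k, hk⟩ := hz
    obtain ⟨l, hl⟩ := h k hk
    have h1 : v0 y = 0 := Finset.prod_eq_zero (Finset.mem_univ k) hk
    rw [h1]
    refine Finset.prod_eq_zero (Finset.mem_univ l) ?_
    refine mul_eq_zero_of_right _ (Finset.prod_eq_zero (Finset.mem_univ k) ?_)
    rw [hl, bary_vert, hk, zpow_one]
  · push Not at hz
    simp only [v0, trans]
    rw [Finset.prod_mul_distrib, coef_prod, one_mul, Finset.prod_comm]
    refine Finset.prod_congr rfl fun k _ => ?_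
    have : ∀ f : Fin 3 → ℤ, ∏ l, y k ^ f l = y k ^ ∑ l, f l := fun f => by
      simp [Fin.prod_univ_three, Fin.sum_univ_three, zpow_add₀ (hz k)]
    rw [this, bary_sum, zpow_one]

/-- The superpotential `W₀ : Y → ℂ`. -/
def W (P : LGParams) : P.Y → ℂ :=
  Quot.lift (fun p => P.Wc p.1.2) (by
    rintro p q ⟨m, hm, hq⟩
    simp only [Wc, hq, v0_trans P _ _ m _ hm])

/-- `Y⁰`: the complement in `Y` of the fibre `v₀ = 1`, that is `W₀ = 0`. -/
def Y0 (P : LGParams) : Set P.Y := {p | P.W p ≠ 0}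

/-- The chart point `y` in the chart of type `s` represents the point `p` of `Y`. -/
def IsLift (P : LGParams) (s : Bool) (y : C3) (p : P.Y) : Prop :=
  ∃ h : y ∈ P.region, p = Quot.mk _ ⟨(s, y), h⟩

/-- The function `f` on `Y` written in the chart of type `s` (and `0` outside the chart). -/
def inChart (P : LGParams) (f : P.Y → ℝ) (s : Bool) (y : C3) : ℝ :=
  open Classical in if h : y ∈ P.region then f (Quot.mk _ ⟨(s, y), h⟩) else 0

end LGParams

/-- Multiplication by `i` on the tangent space of a chart. -/
def iMul (v : C3) : C3 := fun k => Complex.I * v k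

/-- The vector field `∂/∂θ_j` in the chart of type `s`, where `θ_j` is the argument of `x_j`
divided by `2π`. -/
def rotField (s : Bool) (j : Fin 2) (y : C3) : C3 := fun k =>
  2 * Real.pi * Complex.I * (sgn s : ℂ) *
    (if k = 0 then y k else if k = j.succ then -y k else 0)

/-- A Kähler form on `Y`, given in the charts, for which the action of the two-torus rotating
`x₁, x₂` is Hamiltonian; its moment map `xi = (ξ₁, ξ₂)` consists of the first two polytope coordinates,
on which `m ∈ ℤ²` acts by translation by `M m`. -/
structure ToricKaehler (P : LGParams) where
  form : Bool → C3 → C3 [⋀^Fin 2]→L[ℝ] ℝ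
  xi : Bool → C3 → Fin 2 → ℝ
  form_smooth : ∀ s, ContDiffOn ℝ ∞ (form s) P.region
  form_closed : ∀ s, ∀ y ∈ P.region, extDeriv (form s) y = 0
  form_type : ∀ s, ∀ y ∈ P.region, ∀ v w, form s y ![iMul v, iMul w] = form s y ![v, w]
  form_pos : ∀ s, ∀ y ∈ P.region, ∀ v, v ≠ 0 → 0 < form s y ![v, iMul v]
  form_glue : ∀ s s' m, ∀ y ∈ P.region, y ∈ LGParams.transDom s s' m →
    (form s' (P.trans s s' m y)).compContinuousLinearMap (fderiv ℝ (P.trans s s' m) y) = form s y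
  xi_smooth : ∀ s, ContDiffOn ℝ ∞ (xi s) P.region
  xi_moment : ∀ s, ∀ y ∈ P.region, ∀ v j,
    fderiv ℝ (xi s) y v j = form s y ![v, rotField s j y]
  xi_glue : ∀ s s' m, ∀ y ∈ P.region, y ∈ LGParams.transDom s s' m →
    xi s' (P.trans s s' m y) = fun i => xi s y i + ((matM m i : ℤ) : ℝ)

/-- An almost complex structure on `Y⁰`, given in the charts, compatible with the symplectic form. -/
structure CompatibleJ {P : LGParams} (Ω : ToricKaehler P) where
  J : Bool → C3 → C3 →L[ℝ] C3
  smooth : ∀ s, ContDiffOn ℝ ∞ (J s) {y | y ∈ P.region ∧ P.Wc y ≠ 0}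
  sq : ∀ s, ∀ y ∈ P.region, P.Wc y ≠ 0 → ∀ v, J s y (J s y v) = -v
  compat : ∀ s, ∀ y ∈ P.region, P.Wc y ≠ 0 → ∀ v w,
    Ω.form s y ![J s y v, J s y w] = Ω.form s y ![v, w]
  tame : ∀ s, ∀ y ∈ P.region, P.Wc y ≠ 0 → ∀ v, v ≠ 0 → 0 < Ω.form s y ![v, J s y v]
  glue : ∀ s s' m, ∀ y ∈ P.region, P.Wc y ≠ 0 → y ∈ LGParams.transDom s s' m → ∀ v,
    J s' (P.trans s s' m y) (fderiv ℝ (P.trans s s' m) y v) =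
      fderiv ℝ (P.trans s s' m) y (J s y v)

namespace ToricKaehler

variable {P : LGParams}

/-! ### Parallel transport and the Lagrangians -/

/-- `c` is a horizontal lift of the base path `γ` over the time interval `I`: its velocity is
symplectically orthogonal to the fibres of `W₀`. -/
def IsHorizontal (Ω : ToricKaehler P) (γ : ℝ → ℂ) (I : Set ℝ) (c : ℝ → P.Y) : Prop :=
  ∀ τ ∈ I, P.W (c τ) = γ τ ∧ ∃ (s : Bool) (F : ℝ → C3) (d : C3),
    (∀ᶠ x in 𝓝[I] τ, P.IsLift s (F x) (c x)) ∧ HasDerivWithinAt F d I τ ∧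
      ∀ v, fderiv ℝ v0 (F τ) v = 0 → Ω.form s (F τ) ![d, v] = 0

/-- The image of `A` under parallel transport along `γ` from time `a` to time `b`. -/
def transport (Ω : ToricKaehler P) (γ : ℝ → ℂ) (a b : ℝ) (A : Set P.Y) : Set P.Y :=
  {p | ∃ c : ℝ → P.Y, Ω.IsHorizontal γ (uIcc a b) c ∧ c a ∈ A ∧ c b = p}

/-- The point `p` of the fibre over `-S` has flat coordinates `(a, θ)`, where `ξ = M a`.  They
identify this fibre with the four-torus `(ℝ²/ℤ²) × (ℝ²/ℤ²)`. -/
def HasCoord (Ω : ToricKaehler P) (p : P.Y) (a θ : Fin 2 → ℝ) : Prop :=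
  P.W p = -(P.S : ℂ) ∧ ∃ s y, P.IsLift s y p ∧ Ω.xi s y = matM a ∧
    ∀ i : Fin 2, y i.succ =
      (‖y i.succ‖ : ℂ) * Complex.exp (-(2 * Real.pi * Complex.I * (sgn s : ℂ) * (θ i : ℂ)))

/-- The linear Lagrangian `ℓ_k = {θ = -k M⁻¹ ξ}` in the fibre over `-S`. -/
def ell (Ω : ToricKaehler P) (k : ℤ) : Set P.Y :=
  {p | ∃ a : Fin 2 → ℝ, Ω.HasCoord p a (fun i => -(k : ℝ) * a i)}

end ToricKaehler

/-- A U-shaped path `r e^{2πiθ}` in `ℂ^* \ {-T^ε}` through `-S` at time `0`, embedded, with both ends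
eventually radial, at angles `θ₁ < θ₂`.  Such paths include those obtained by wrapping the ends. -/
structure UPath (P : LGParams) where
  r : ℝ → ℝ
  θ : ℝ → ℝ
  path : ℝ → ℂ
  path_eq : ∀ τ, path τ = (r τ : ℂ) * Complex.exp (2 * Real.pi * Complex.I * (θ τ : ℂ))
  r_smooth : ContDiff ℝ ∞ r
  θ_smooth : ContDiff ℝ ∞ θ
  r_pos : ∀ τ, 0 < r τ
  r_zero : r 0 = P.S
  θ_zero : θ 0 = -(1 / 2)
  inj : Function.Injective path
  immersed : ∀ τ, deriv path τ ≠ 0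
  avoid : ∀ τ, path τ ≠ -(P.crit : ℂ)
  ends : ∃ θ₁ ∈ Ioo (-(1 / 2) : ℝ) (1 / 2), ∃ θ₂ ∈ Ioo (-(1 / 2) : ℝ) (1 / 2), θ₁ < θ₂ ∧
    (∀ᶠ τ in atTop, deriv r τ = 1 ∧ θ τ = θ₁) ∧ (∀ᶠ τ in atBot, deriv r τ = -1 ∧ θ τ = θ₂)

/-- An embedded arc which starts at `-S`, avoids `-T^ε`, passes through `0` at time `1` and
eventually goes radially to infinity. -/
structure KPath (P : LGParams) where
  path : ℝ → ℂ
  smooth : ContDiff ℝ ∞ path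
  at_zero : path 0 = -(P.S : ℂ)
  at_one : path 1 = 0
  inj : InjOn path (Ici 0)
  immersed : ∀ τ ∈ Ici (0 : ℝ), deriv path τ ≠ 0
  avoid : ∀ τ ∈ Ici (0 : ℝ), path τ ≠ -(P.crit : ℂ)
  ends : ∃ θ ∈ Ioo (-(1 / 2) : ℝ) (1 / 2), ∀ᶠ τ : ℝ in atTop,
    path τ = ((τ - 1 : ℝ) : ℂ) * Complex.exp (2 * Real.pi * Complex.I * (θ : ℂ))

namespace ToricKaehler

variable {P : LGParams}

/-- The Lagrangian `L_k` over a U-shaped path. -/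
def lagL (Ω : ToricKaehler P) (γ : UPath P) (k : ℤ) : Set P.Y :=
  ⋃ τ : ℝ, Ω.transport γ.path 0 τ (Ω.ell k)

/-- The Lagrangian `K_k` over an arc: parallel transport starts over `-S`, and the Lagrangian is the
part over times `τ > 1`. -/
def lagK (Ω : ToricKaehler P) (κ : KPath P) (k : ℤ) : Set P.Y :=
  ⋃ τ ∈ Ioi (1 : ℝ), Ω.transport κ.path 0 τ (Ω.ell k)

/-- `Φ` is a Hamiltonian diffeomorphism of `Y⁰`: the time-one map of the complete flow `φ` of the
vector field `X` with `ι_X Ω = dH`, for a smooth time-dependent function `H` on `Y⁰`. -/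
def IsHamiltonianDiffeo (Ω : ToricKaehler P) (Φ : P.Y → P.Y) : Prop :=
  ∃ (H : ℝ → P.Y → ℝ) (φ : ℝ → P.Y → P.Y),
    (∀ s, ContDiffOn ℝ ∞ (fun q : ℝ × C3 => P.inChart (H q.1) s q.2)
      {q | q.2 ∈ P.region ∧ P.Wc q.2 ≠ 0}) ∧
    (∀ p ∈ P.Y0, φ 0 p = p ∧ φ 1 p = Φ p) ∧
    (∀ τ ∈ Icc (0 : ℝ) 1, BijOn (φ τ) P.Y0 P.Y0) ∧
    ∀ p ∈ P.Y0, ∀ τ ∈ Icc (0 : ℝ) 1, ∃ (s : Bool) (F : ℝ → C3) (X : C3),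
      (∀ᶠ x in 𝓝[Icc 0 1] τ, P.IsLift s (F x) (φ x p)) ∧
      HasDerivWithinAt F X (Icc 0 1) τ ∧
      ∀ v, Ω.form s (F τ) ![X, v] = fderiv ℝ (P.inChart (H τ) s) (F τ) v

end ToricKaehler

/-! ### The base triangle -/

/-- A triangle in the base with vertex `-S`, two sides on the U-shaped paths `γ₁, γ₂` and the third side
on the arc `κ`, parametrized by a map `δ` of the square which sends the sides `t = 1` and `t = 0` to
the sides on `γ₁` and `γ₂`, the side `s = 0` to the side on `κ`, and collapses `s = 1` to `-S`.  The
triangle avoids the critical value and the puncture, and meets the three curves only in its sides. -/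
structure BaseTriangle (P : LGParams) (γ₁ γ₂ : UPath P) (κ : KPath P) where
  δ : ℝ → ℝ → ℂ
  a₁ : ℝ → ℝ
  a₂ : ℝ → ℝ
  aK : ℝ → ℝ
  smooth : ContDiff ℝ ∞ (fun q : ℝ × ℝ => δ q.1 q.2)
  a₁_smooth : ContDiff ℝ ∞ a₁
  a₂_smooth : ContDiff ℝ ∞ a₂
  aK_smooth : ContDiff ℝ ∞ aK
  side₁ : ∀ s ∈ Icc (0 : ℝ) 1, δ s 1 = γ₁.path (a₁ s)
  side₂ : ∀ s ∈ Icc (0 : ℝ) 1, δ s 0 = γ₂.path (a₂ s)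
  sideK : ∀ t ∈ Icc (0 : ℝ) 1, 1 < aK t ∧ δ 0 t = κ.path (aK t)
  apex : ∀ t ∈ Icc (0 : ℝ) 1, δ 1 t = -(P.S : ℂ)
  inj : InjOn (fun q : ℝ × ℝ => δ q.1 q.2) (Ico 0 1 ×ˢ Icc 0 1)
  apex_only : ∀ s ∈ Ico (0 : ℝ) 1, ∀ t ∈ Icc (0 : ℝ) 1, δ s t ≠ -(P.S : ℂ)
  immersed : ∀ s ∈ Ico (0 : ℝ) 1, ∀ t ∈ Icc (0 : ℝ) 1, deriv (δ s) t ≠ 0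
  in_disc : ∀ s ∈ Icc (0 : ℝ) 1, ∀ t ∈ Icc (0 : ℝ) 1,
    ‖δ s t‖ < P.rad ∧ δ s t ≠ -(P.crit : ℂ) ∧ δ s t ≠ 0
  meets₁ : ∀ τ, ∀ s ∈ Icc (0 : ℝ) 1, ∀ t ∈ Icc (0 : ℝ) 1, γ₁.path τ = δ s t →
    ∃ s' ∈ Icc (0 : ℝ) 1, γ₁.path τ = δ s' 1
  meets₂ : ∀ τ, ∀ s ∈ Icc (0 : ℝ) 1, ∀ t ∈ Icc (0 : ℝ) 1, γ₂.path τ = δ s t →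
    ∃ s' ∈ Icc (0 : ℝ) 1, γ₂.path τ = δ s' 0
  meetsK : ∀ τ ∈ Ioi (1 : ℝ), ∀ s ∈ Icc (0 : ℝ) 1, ∀ t ∈ Icc (0 : ℝ) 1, κ.path τ = δ s t →
    ∃ t' ∈ Icc (0 : ℝ) 1, κ.path τ = δ 0 t'
  /-- The loop which follows `κ` from `-S` to the triangle and returns along the side on `γ₂` does not
  enclose the critical value: its two halves are homotopic in the complement. -/
  loop : ∃ h : ℝ → ℝ → ℂ, ContinuousOn (fun q : ℝ × ℝ => h q.1 q.2) (Icc 0 1 ×ˢ Icc 0 1) ∧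
    (∀ x ∈ Icc (0 : ℝ) 1, h 0 x = κ.path (x * aK 0) ∧ h 1 x = δ (1 - x) 0 ∧
      h x 0 = -(P.S : ℂ) ∧ h x 1 = δ 0 0) ∧
    ∀ z ∈ Icc (0 : ℝ) 1, ∀ x ∈ Icc (0 : ℝ) 1, ‖h z x‖ < P.rad ∧ h z x ≠ -(P.crit : ℂ)

namespace BaseTriangle

variable {P : LGParams} {γ₁ γ₂ : UPath P} {κ : KPath P}

/-- The region covered by the triangle. -/
def region (Δ : BaseTriangle P γ₁ γ₂ κ) : Set ℂ :=
  (fun q : ℝ × ℝ => Δ.δ q.1 q.2) '' (Icc 0 1 ×ˢ Icc 0 1)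

/-- A Lagrangian isotopy, over the homotopy `δ (s, ·)` of base arcs, of the part over the triangle of a
Lagrangian `K`.  The part of `K` is parametrized by `[0,1] × (ℝ²/ℤ²)`, with `Ψ s t a` over `δ s t`.
For `s < 1` the map is a Lagrangian embedding, and at time `s = 1` all of it has been moved
into the single fibre over `-S`, where it becomes the linear Lagrangian `ℓ_k`. -/
structure IsIsotopy (Δ : BaseTriangle P γ₁ γ₂ κ) (Ω : ToricKaehler P) (k : ℤ) (K : Set P.Y)
    (Ψ : ℝ → ℝ → (Fin 2 → ℝ) → P.Y) : Prop where
  start : {p | ∃ t ∈ Icc (0 : ℝ) 1, ∃ a, p = Ψ 0 t a} = {p | p ∈ K ∧ P.W p ∈ Δ.region}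
  covers : ∀ s ∈ Icc (0 : ℝ) 1, ∀ t ∈ Icc (0 : ℝ) 1, ∀ a, P.W (Ψ s t a) = Δ.δ s t
  periodic : ∀ s ∈ Icc (0 : ℝ) 1, ∀ t ∈ Icc (0 : ℝ) 1, ∀ a, ∀ m : Fin 2 → ℤ,
    Ψ s t (fun i => a i + m i) = Ψ s t a
  inj : ∀ s ∈ Ico (0 : ℝ) 1, ∀ t ∈ Icc (0 : ℝ) 1, ∀ a a', Ψ s t a = Ψ s t a' →
    ∃ m : Fin 2 → ℤ, ∀ i, a' i = a i + m i
  /-- Smoothness in all variables, and for `s < 1` the maps `Ψ s` are isotropic immersions. -/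
  smooth_lagrangian : ∀ s ∈ Icc (0 : ℝ) 1, ∀ t ∈ Icc (0 : ℝ) 1, ∀ a,
    ∃ (c : Bool) (F : ℝ × ℝ × (Fin 2 → ℝ) → C3),
      ContDiffAt ℝ ∞ F (s, t, a) ∧
      (∀ᶠ q in 𝓝[Icc 0 1 ×ˢ Icc 0 1 ×ˢ univ] (s, t, a), P.IsLift c (F q) (Ψ q.1 q.2.1 q.2.2)) ∧
      (s < 1 →
        (∀ v, fderiv ℝ F (s, t, a) (0, v) = 0 → v = 0) ∧
        ∀ v w, Ω.form c (F (s, t, a))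
          ![fderiv ℝ F (s, t, a) (0, v), fderiv ℝ F (s, t, a) (0, w)] = 0)
  finish : ∀ t ∈ Icc (0 : ℝ) 1, range (Ψ 1 t) = Ω.ell k

end BaseTriangle

/-! ### Holomorphic triangles -/

/-- The vertices `τ 0, τ 1, τ 2` of a triangle in ℂ are in counterclockwise position. Every disc with
three cyclically ordered boundary points is conformally equivalent to such a triangle. -/
def IsPositive (τ : Fin 3 → ℂ) : Prop :=
  0 < ((starRingEnd ℂ) (τ 1 - τ 0) * (τ 2 - τ 0)).im

/-- The point of the triangle `τ` with barycentric coordinates `μ`. -/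
def triPoint (τ : Fin 3 → ℂ) (μ : Splx 2) : ℂ := ∑ i, (μ i : ℂ) * τ i

/-- `u` is a `J`-holomorphic triangle, for the conformal structure of the triangle `τ`. -/
def IsJHolomorphic {P : LGParams} {Ω : ToricKaehler P} (J : CompatibleJ Ω) (τ : Fin 3 → ℂ)
    (u : C(Splx 2, P.Y)) : Prop :=
  IsPositive τ ∧ ∀ μ : Splx 2, (∀ i, 0 < μ i) → ∃ (s : Bool) (F : ℂ → C3),
    ContDiffAt ℝ ∞ F (triPoint τ μ) ∧
    (∀ᶠ z in 𝓝 (triPoint τ μ), ∀ ν : Splx 2, triPoint τ ν = z → P.IsLift s (F z) (u ν)) ∧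
    ∀ v : ℂ, fderiv ℝ F (triPoint τ μ) (Complex.I * v) =
      J.J s (F (triPoint τ μ)) (fderiv ℝ F (triPoint τ μ) v)

/-- The edges of the triangle `u` opposite to the vertices `1, 2, 0` lie on `A₁, A₂, A₃`; thus the
vertices `0, 1, 2` are mapped to `A₁ ∩ A₂`, `A₂ ∩ A₃`, `A₁ ∩ A₃`, and `A₁, A₂, A₃` is the
counterclockwise order along the boundary. -/
def HasBoundaryOn {X : Type} [TopologicalSpace X] (u : C(Splx 2, X)) (A₁ A₂ A₃ : Set X) : Prop :=
  ∀ μ : Splx 2, (μ 1 = 0 → u μ ∈ A₁) ∧ (μ 2 = 0 → u μ ∈ A₂) ∧ (μ 0 = 0 → u μ ∈ A₃)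

/-- The fibrewise part of the degree of the generators of `CF(ℓ_i, ℓ_j)`, for `i ≠ j`. (In the product
considered here the base part of the degree is zero at all three corners.) -/
def fibreDeg (i j : ℤ) : ℕ := if i < j then 0 else 2

/-- The triangle `u` contributes to the product
`HF(L_{j₂}, K_{j₃}[-1]) ⊗ HF(L_{j₁}, L_{j₂}) → HF(L_{j₁}, K_{j₃}[-1])`, with `K` in place of `K_{j₃}`:
it is `J`-holomorphic, has its boundary on the three Lagrangians in the right order, its projection
covers the base triangle, and the degree of its output corner is the sum of those of the inputs. -/
def ContributesToProduct {P : LGParams} {γ₁ γ₂ : UPath P} {κ : KPath P}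
    (Δ : BaseTriangle P γ₁ γ₂ κ) {Ω : ToricKaehler P} (J : CompatibleJ Ω) (j₁ j₂ j₃ : ℤ)
    (K : Set P.Y) (u : C(Splx 2, P.Y)) : Prop :=
  (∃ τ, IsJHolomorphic J τ u) ∧ HasBoundaryOn u (Ω.lagL γ₁ j₁) (Ω.lagL γ₂ j₂) K ∧
    P.W '' range u = Δ.region ∧ fibreDeg j₁ j₃ = fibreDeg j₂ j₃ + fibreDeg j₁ j₂

/-- The isotopy `Ψ` carries the corners `u(1) ∈ L₂ ∩ K` and `u(2) ∈ L₁ ∩ K` of the triangle `u` through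
intersection points of the moving Lagrangian with `L₂` and `L₁`. -/
def CarriesCorners {X : Type} [TopologicalSpace X] (Ψ : ℝ → ℝ → (Fin 2 → ℝ) → X)
    (u : C(Splx 2, X)) (L₁ L₂ : Set X) : Prop :=
  ∀ t ∈ Icc (0 : ℝ) 1, ∀ a,
    (Ψ 0 t a = u (stdSimplex.vertex (S := ℝ) (1 : Fin 3)) →
      ∀ s ∈ Icc (0 : ℝ) 1, Ψ s t a ∈ L₂) ∧
    (Ψ 0 t a = u (stdSimplex.vertex (S := ℝ) (2 : Fin 3)) →
      ∀ s ∈ Icc (0 : ℝ) 1, Ψ s t a ∈ L₁)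

/-- `u'` is obtained from the triangle `u` by moving its edge on `K` by the isotopy `Ψ`: on the half
`μ₀ ≥ 1/2` it is `u`, rescaled, and on the collar `μ₀ ≤ 1/2` it is the trace of the edge. -/
def IsMovedTriangle {X : Type} [TopologicalSpace X] (Ψ : ℝ → ℝ → (Fin 2 → ℝ) → X)
    (u u' : C(Splx 2, X)) : Prop :=
  ∀ μ ν : Splx 2,
    (1 / 2 ≤ μ 0 → ν 0 = 2 * μ 0 - 1 → ν 1 = 2 * μ 1 → ν 2 = 2 * μ 2 → u' μ = u ν) ∧
    (μ 0 ≤ 1 / 2 → ν 0 = 0 → ν 1 * (μ 1 + μ 2) = μ 1 → ν 2 * (μ 1 + μ 2) = μ 2 →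
      ∀ t ∈ Icc (0 : ℝ) 1, ∀ a, Ψ 0 t a = u ν → u' μ = Ψ (1 - 2 * μ 0) t a)

/-- `u` is a flat holomorphic triangle in the fibre over `-S`: in the coordinates `a + i c θ` on the
universal cover `ℂ²` of the fibre it is the restriction of a complex affine map to a positively
oriented triangle `τ`. -/
def IsFlatHolomorphic {P : LGParams} (Ω : ToricKaehler P) (c : ℝ) (u : C(Splx 2, P.Y)) : Prop :=
  ∃ τ, IsPositive τ ∧ ∃ A B : Fin 2 → ℂ, ∀ μ : Splx 2,
    Ω.HasCoord (u μ) (fun i => (A i + B i * triPoint τ μ).re)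
      (fun i => (A i + B i * triPoint τ μ).im / c)

end

/-!
Over the regular values, `Y` is a bundle of four-tori with coordinates given by the moment map `ξ`, the
angles `θ` and the base point `b`: on a regular fibre the moment map is injective modulo rotations by
positivity of the Kähler form (`lxi_injective`), and onto because its image is open and, by equivariance
under the lattice, closed (`exists_lxi_eq`). A periodicity argument shows that the orbits of the two-torus
are isotropic (`lform_dθ_dθ`), and in these coordinates the Kähler form is `β + dξ ∧ dθ`, with `β` a closed
form in `(ξ, b)` which vanishes on the fibres (`lform_act`). So the orthogonal complement of the fibres is
a connection: a horizontal lift of a path keeps `ξ` and shifts `θ` by the integral `hol` of the connection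
form (`isHorizontal_pt`, `horizontal_unique`), and the transports of `ℓ_k` are explicit
(`mem_transport_ell_iff`). The lattice shifts `hol` by multiples of the winding of `v₀` (`hol_add_latt`).

For the first claim, closedness of `β` has two consequences. The shift `hol` is a closed one-form in `ξ`
(`hol_symm`); and the curvature of the connection is the `ξ`-derivative of an area form on the base which
is invariant under the lattice, so that the flux of `hol` through a loop of values of the moment map is the
integral of a closed one-form on the base (`fluxForm_symm`). Hence, for paths which are homotopic in the
set of regular values, the difference of the two shifts is the gradient of a function of `ξ` with period
lattice `Mℤ²` (`exists_periodic_primitive`). Applied to `κ` and to the side of `D` on `γ₂`, this gives a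
function whose flow `Φ` rotates the transport of `ℓ_k` along `κ` into its transport along that side
(`exists_hamiltonian_rotation`). The isotopy then consists of the transports of `ℓ_k` from the apex to the
points of `D`, which are Lagrangian over each curve `δ (s, ·)` (`iso_isotropic`, `exists_isotopy`).

For the second claim, radial parallel transport from the apex trivializes `Y` over `D` (`triv`), and in the
trivialization the Lagrangians over the two sides at the apex are the linear ones `θ = -j a`
(`triv_mem_lagL`). Attaching the trace of the edge gives a triangle with edges on `L_{j₁}`, `L_{j₂}`,
`ℓ_{j₃}` and corners over `-S` (`IsIsotopy.exists_movedTriangle`). It lifts to the universal cover of the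
fibres (`exists_lift_triangle`), where each component of `θ + j a` is a constant integer along an edge. This
condition is affine, hence survives the straight-line homotopy to the affine triangle with the same corners;
the projection to the base is contracted radially at the same time. The prism of the homotopy gives the
equality of relative classes (`relHomologous_of_homotopy`, `exists_flat`). Finally, the affine triangle has
edges of the three slopes `-j₁`, `-j₂`, `-j₃` in both components of `(a, θ)`, so that its components are real
multiples of one triangle in `ℂ`, up to translation (`exists_complex_affine`), and the condition on the
degrees says that this triangle is positively oriented (`slopes_pos`).
-/

noncomputable section

/-! ### Logarithmic coordinates on the dense torus -/

/-- Logarithmic coordinates `(ρ, θ, b)`: the toric coordinates are `x_j = exp (ρ_j + 2πi θ_j)`, and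
`b` is the value of the superpotential. -/
abbrev LogPt : Type := (Fin 2 → ℝ) × (Fin 2 → ℝ) × ℂ

/-- The logarithm of the toric coordinate `x_j`. -/
def LogPt.z (q : LogPt) (j : Fin 2) : ℂ := (q.1 j : ℂ) + 2 * Real.pi * Complex.I * (q.2.1 j : ℂ)

theorem sgn_cast_mul_self {R : Type*} [CommRing R] (s : Bool) : (sgn s : R) * (sgn s : R) = 1 := by
  cases s <;> simp [sgn]

namespace LGParams

variable (P : LGParams)

theorem crit_pos : 0 < P.crit := Real.rpow_pos_of_pos P.T_pos _

theorem crit_ne : (P.crit : ℂ) ≠ 0 := by exact_mod_cast P.crit_pos.ne'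

theorem rad_pos : 0 < P.rad := Real.rpow_pos_of_pos P.T_pos _

theorem S_pos : 0 < P.S := P.crit_pos.trans P.lt_S

/-- The value of `v₀` over the point `b` of the base. -/
def nu (b : ℂ) : ℂ := 1 + b / P.crit

/-- The regular values in the base disc. -/
def reg : Set ℂ := {b | ‖b‖ < P.rad ∧ b ≠ -(P.crit : ℂ)}

theorem isOpen_reg : IsOpen P.reg :=
  (isOpen_lt continuous_norm continuous_const).inter isOpen_ne

theorem nu_ne_zero {b : ℂ} : P.nu b ≠ 0 ↔ b ≠ -(P.crit : ℂ) := by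
  have h := P.crit_ne
  have : P.nu b = (P.crit + b) / P.crit := by rw [nu]; field_simp
  rw [this, Ne, div_eq_zero_iff, not_or]
  constructor
  · rintro ⟨h1, -⟩ rfl; exact h1 (by ring)
  · intro h1; exact ⟨fun h2 => h1 (by linear_combination h2), h⟩

theorem norm_nu_lt {b : ℂ} (hb : ‖b‖ < P.rad) : P.t * ‖P.nu b‖ < 1 := by
  have h1 : ‖P.nu b‖ < 1 + P.T ^ (P.veps - P.eps) := by
    have h2 : ‖b / (P.crit : ℂ)‖ < P.T ^ (P.veps - P.eps) := by
      rw [norm_div, Complex.norm_real, Real.norm_of_nonneg P.crit_pos.le, Real.rpow_sub P.T_pos]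
      exact div_lt_div_of_pos_right hb P.crit_pos
    calc ‖P.nu b‖ ≤ ‖(1 : ℂ)‖ + ‖b / (P.crit : ℂ)‖ := norm_add_le _ _
      _ < _ := by rw [norm_one]; linarith
  exact (mul_lt_mul_of_pos_left h1 P.t_pos).trans_le P.small

theorem neg_S_mem_reg : -(P.S : ℂ) ∈ P.reg := by
  refine ⟨?_, ?_⟩
  · rw [norm_neg, Complex.norm_real, Real.norm_of_nonneg P.S_pos.le]; exact P.S_lt
  · rw [Ne, neg_inj]; exact_mod_cast P.lt_S.ne'

theorem nu_neg_S : P.nu (-(P.S : ℂ)) = -(‖P.nu (-(P.S : ℂ))‖ : ℂ) := by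
  have h : P.nu (-(P.S : ℂ)) = ((1 - P.S / P.crit : ℝ) : ℂ) := by
    rw [nu]; push_cast; ring
  have h1 : 1 < P.S / P.crit := (one_lt_div P.crit_pos).2 P.lt_S
  rw [h, Complex.norm_real, Real.norm_of_nonpos (by linarith)]
  push_cast; ring

/-- The point of the dense torus with given logarithmic coordinates, in the chart of type `s`. -/
def torusPt (s : Bool) (q : LogPt) : C3 :=
  ![P.nu q.2.2 * Complex.exp ((sgn s : ℂ) * (q.z 0 + q.z 1)), Complex.exp (-((sgn s : ℂ) * q.z 0)),
    Complex.exp (-((sgn s : ℂ) * q.z 1))]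

variable {P}

theorem torusPt_succ (s : Bool) (q : LogPt) (j : Fin 2) :
    P.torusPt s q j.succ = Complex.exp (-((sgn s : ℂ) * q.z j)) := by
  fin_cases j <;> rfl

theorem torusPt_zero (s : Bool) (q : LogPt) :
    P.torusPt s q 0 = P.nu q.2.2 * Complex.exp ((sgn s : ℂ) * (q.z 0 + q.z 1)) := rfl

theorem v0_eq (y : C3) : v0 y = y 0 * (y 1 * y 2) := by
  rw [v0, Fin.prod_univ_three, mul_assoc]

theorem v0_torusPt (s : Bool) (q : LogPt) : v0 (P.torusPt s q) = P.nu q.2.2 := by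
  have e1 := torusPt_succ (P := P) s q 0
  have e2 := torusPt_succ (P := P) s q 1
  simp only [Fin.succ_zero_eq_one, Fin.succ_one_eq_two] at e1 e2
  rw [v0_eq, e1, e2, torusPt_zero, ← Complex.exp_add, mul_assoc, ← Complex.exp_add]
  ring_nf; simp

theorem Wc_eq {y : C3} {b : ℂ} : P.Wc y = b ↔ v0 y = P.nu b := by
  have h := P.crit_ne
  rw [Wc, nu]
  constructor
  · rintro rfl; field_simp; ring
  · intro h1; rw [h1]; field_simp; ring

theorem Wc_torusPt (s : Bool) (q : LogPt) : P.Wc (P.torusPt s q) = q.2.2 :=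
  Wc_eq.2 (v0_torusPt s q)

theorem torusPt_mem_region {s : Bool} {q : LogPt} :
    P.torusPt s q ∈ P.region ↔ ‖q.2.2‖ < P.rad := by
  rw [region, mem_ofPred_eq, Wc_torusPt]

theorem isOpen_region : IsOpen P.region := by
  refine isOpen_lt (Continuous.norm ?_) continuous_const
  unfold Wc v0
  fun_prop

/-- A point with nonzero last two coordinates is determined by `v₀` and these coordinates. -/
theorem C3_ext {y y' : C3} (h : ∀ j : Fin 2, y j.succ = y' j.succ) (h0 : ∀ j : Fin 2, y j.succ ≠ 0)
    (hv : v0 y = v0 y') : y = y' := by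
  have h1 := h 0
  have h2 := h 1
  have n1 := h0 0
  have n2 := h0 1
  simp only [Fin.succ_zero_eq_one, Fin.succ_one_eq_two] at h1 h2 n1 n2
  rw [v0_eq, v0_eq, ← h1, ← h2] at hv
  funext k
  fin_cases k
  · exact mul_right_cancel₀ (mul_ne_zero n1 n2) hv
  · exact h1
  · exact h2

theorem torusPt_succ_ne (s : Bool) (q : LogPt) (j : Fin 2) : P.torusPt s q j.succ ≠ 0 := by
  rw [torusPt_succ]; exact Complex.exp_ne_zero _

theorem torusPt_ne {s : Bool} {q : LogPt} (hb : q.2.2 ≠ -(P.crit : ℂ)) (k : Fin 3) :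
    P.torusPt s q k ≠ 0 := by
  refine Fin.cases ?_ (fun j => torusPt_succ_ne s q j) k
  rw [torusPt_zero]
  exact mul_ne_zero (P.nu_ne_zero.2 hb) (Complex.exp_ne_zero _)

variable (P)

/-- Principal logarithmic coordinates of a point of the dense torus. -/
def logPt (s : Bool) (y : C3) : LogPt :=
  (fun j => -(sgn s : ℝ) * Real.log ‖y j.succ‖,
    fun j => -(sgn s : ℝ) * ((y j.succ).arg / (2 * Real.pi)), P.Wc y)

variable {P}

theorem z_logPt (s : Bool) (y : C3) (j : Fin 2) :
    (P.logPt s y).z j = -(sgn s : ℂ) * Complex.log (y j.succ) := by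
  have hpi : (Real.pi : ℂ) ≠ 0 := by exact_mod_cast Real.pi_ne_zero
  rw [LogPt.z, logPt, Complex.log]
  push_cast
  field_simp
  ring

theorem torusPt_logPt {s : Bool} {y : C3} (h : ∀ j : Fin 2, y j.succ ≠ 0) :
    P.torusPt s (P.logPt s y) = y := by
  refine C3_ext (fun j => ?_) (torusPt_succ_ne s _) ?_
  · rw [torusPt_succ, z_logPt]
    rw [show -((sgn s : ℂ) * (-(sgn s : ℂ) * Complex.log (y j.succ))) =
      ((sgn s : ℂ) * (sgn s : ℂ)) * Complex.log (y j.succ) by ring, sgn_cast_mul_self, one_mul,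
      Complex.exp_log (h j)]
  · rw [v0_torusPt]; exact (Wc_eq.1 rfl).symm

theorem ne_zero_of_v0 {y : C3} (h : v0 y ≠ 0) (k : Fin 3) : y k ≠ 0 :=
  fun hk => h (Finset.prod_eq_zero (Finset.mem_univ k) hk)

theorem mem_transDom {s s' : Bool} {m : Fin 2 → ℤ} {y : C3} (h : v0 y ≠ 0) : y ∈ transDom s s' m :=
  fun k hk => absurd hk (ne_zero_of_v0 h k)

variable (P)

/-- `φ` is an argument of `-v₀` over `b`. -/
def IsArg (φ : ℝ) (b : ℂ) : Prop := P.nu b = -((‖P.nu b‖ : ℂ) * Complex.exp (φ * Complex.I))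

theorem exists_isArg (b : ℂ) : ∃ φ, P.IsArg φ b :=
  ⟨(-(P.nu b)).arg, by
    have := Complex.norm_mul_exp_arg_mul_I (-(P.nu b))
    rw [norm_neg] at this
    rw [IsArg, this, neg_neg]⟩

theorem isArg_neg_S : P.IsArg 0 (-(P.S : ℂ)) := by
  rw [IsArg]; simpa using P.nu_neg_S

/-- The action of `m ∈ ℤ²` in logarithmic coordinates, where `φ` is an argument of `-v₀`. -/
def deck (m : Fin 2 → ℤ) (φ : ℝ) (q : LogPt) : LogPt :=
  (fun j => q.1 j - Real.log P.t * (matM m j : ℤ) - Real.log ‖P.nu q.2.2‖ * m j,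
    fun j => q.2.1 j - φ / (2 * Real.pi) * m j, q.2.2)

variable {P}

theorem trans_torusPt {s s' : Bool} {m : Fin 2 → ℤ} {φ : ℝ} {q : LogPt}
    (hb : q.2.2 ≠ -(P.crit : ℂ)) (hφ : P.IsArg φ q.2.2) :
    P.trans s s' m (P.torusPt s q) = P.torusPt s' (P.deck m φ q) := by
  have hn : P.nu q.2.2 ≠ 0 := P.nu_ne_zero.2 hb
  have hv : v0 (P.torusPt s q) ≠ 0 := by rwa [v0_torusPt]
  symm
  refine C3_ext (fun j => ?_) (torusPt_succ_ne s' _) ?_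
  swap
  · rw [v0_trans P _ _ _ _ (mem_transDom hv), v0_torusPt, v0_torusPt]; rfl
  have hbary : ∀ k, bary s' j.succ (m + vert s k) = sgn s' * m j + sgn s' * vert s k j := by
    intro k; fin_cases j <;> simp [bary] <;> ring
  have hcoef : P.coef s' m j.succ = (-1) ^ m j * (P.t : ℂ) ^ (sgn s' * matM m j) := by
    fin_cases j <;> rfl
  have hne := torusPt_ne (s := s) hb
  simp only [LGParams.trans, hbary, hcoef]
  have hvert : ∏ k, P.torusPt s q k ^ (sgn s' * vert s k j) =
      P.torusPt s q j.succ ^ (sgn s' * sgn s) := by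
    rw [Finset.prod_eq_single j.succ]
    · simp [vert]
    · intro k _ hk; simp [vert, hk]
    · simp
  have hprod : ∏ k, P.torusPt s q k ^ (sgn s' * m j + sgn s' * vert s k j) =
      P.nu q.2.2 ^ (sgn s' * m j) * P.torusPt s q j.succ ^ (sgn s' * sgn s) := by
    simp_rw [fun k => zpow_add₀ (hne k)]
    rw [Finset.prod_mul_distrib, Finset.prod_zpow, hvert, ← v0_torusPt s q, v0]
  rw [hprod, torusPt_succ, torusPt_succ]
  have hnpos : (0 : ℝ) < ‖P.nu q.2.2‖ := norm_pos_iff.2 hn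
  have hnu : P.nu q.2.2 = (-1) * Complex.exp (Real.log ‖P.nu q.2.2‖ + φ * Complex.I) := by
    rw [Complex.exp_add, ← Complex.ofReal_exp, Real.exp_log hnpos, neg_one_mul]
    exact hφ
  have ht : (P.t : ℂ) = Complex.exp (Real.log P.t) := by
    rw [← Complex.ofReal_exp, Real.exp_log P.t_pos]
  rw [ht, hnu, mul_zpow, ← Complex.exp_int_mul, ← Complex.exp_int_mul, ← Complex.exp_int_mul]
  have hsign : ((-1 : ℂ)) ^ m j * (-1) ^ (sgn s' * m j) = 1 := by
    rw [← zpow_add₀ (by norm_num)]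
    refine Even.neg_one_zpow ?_
    cases s' <;> simp [sgn, ← two_mul]
  calc _ = ((-1 : ℂ) ^ m j * (-1) ^ (sgn s' * m j)) *
        Complex.exp (((sgn s' * matM m j : ℤ) : ℂ) * (Real.log P.t : ℂ) +
          (((sgn s' * m j : ℤ) : ℂ) * ((Real.log ‖P.nu q.2.2‖ : ℂ) + φ * Complex.I) +
          ((sgn s' * sgn s : ℤ) : ℂ) * (-((sgn s : ℂ) * q.z j)))) := by
        rw [hsign, one_mul]
        congr 1
        have hpi : (Real.pi : ℂ) ≠ 0 := by exact_mod_cast Real.pi_ne_zero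
        have hs := sgn_cast_mul_self (R := ℂ) s
        simp only [LogPt.z, deck]
        push_cast
        field_simp
        linear_combination ((sgn s' : ℂ) * ((q.1 j : ℂ) + 2 * Real.pi * Complex.I * q.2.1 j)) * hs
    _ = _ := by rw [Complex.exp_add, Complex.exp_add]; ring

end LGParams

namespace LGParams

variable {P : LGParams}

/-! ### The points of `Y` over the regular values -/

/-- Translation of the angles. -/
def rotLog (n : Fin 2 → ℝ) (q : LogPt) : LogPt := (q.1, fun j => q.2.1 j + n j, q.2.2)

theorem torusPt_eq_iff {s : Bool} {q q' : LogPt} :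
    P.torusPt s q = P.torusPt s q' ↔ ∃ n : Fin 2 → ℤ, q' = rotLog (fun j => n j) q := by
  constructor
  · intro h
    have hb : q.2.2 = q'.2.2 := by rw [← Wc_torusPt (P := P) s q, h, Wc_torusPt]
    have hz : ∀ j, ∃ n : ℤ, q'.z j = q.z j + n * (2 * Real.pi * Complex.I) := by
      intro j
      have h1 := congrFun h j.succ
      rw [torusPt_succ, torusPt_succ, Complex.exp_eq_exp_iff_exists_int] at h1
      obtain ⟨n, hn⟩ := h1
      refine ⟨sgn s * n, ?_⟩
      have hs := sgn_cast_mul_self (R := ℂ) s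
      push_cast
      linear_combination (q.z j - q'.z j) * hs + (sgn s : ℂ) * hn
    choose n hn using hz
    refine ⟨n, ?_⟩
    have hre : ∀ j, q'.1 j = q.1 j := fun j => by
      have := congrArg Complex.re (hn j)
      simpa [LogPt.z] using this
    have him : ∀ j, q'.2.1 j = q.2.1 j + n j := fun j => by
      have := congrArg Complex.im (hn j)
      simp [LogPt.z] at this
      have hpi := Real.pi_pos
      have h2 : 2 * Real.pi * (q'.2.1 j - (q.2.1 j + n j)) = 0 := by linarith
      have := (mul_eq_zero.1 h2).resolve_left (by positivity)
      linarith
    exact Prod.ext (funext hre) (Prod.ext (funext him) hb.symm)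
  · rintro ⟨n, rfl⟩
    refine C3_ext (fun j => ?_) (torusPt_succ_ne s _) ?_
    · rw [torusPt_succ, torusPt_succ, Complex.exp_eq_exp_iff_exists_int]
      refine ⟨sgn s * n j, ?_⟩
      simp only [LogPt.z, rotLog]
      push_cast; ring
    · rw [v0_torusPt, v0_torusPt]; rfl

theorem deck_add (m m' : Fin 2 → ℤ) (φ : ℝ) (q : LogPt) :
    P.deck m φ (P.deck m' φ q) = P.deck (m + m') φ q := by
  refine Prod.ext (funext fun j => ?_) (Prod.ext (funext fun j => ?_) rfl)
  · fin_cases j <;> simp [deck, matM] <;> ring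
  · simp [deck]; ring

theorem deck_zero (φ : ℝ) (q : LogPt) : P.deck 0 φ q = q := by
  refine Prod.ext (funext fun j => ?_) (Prod.ext (funext fun j => ?_) rfl)
  · fin_cases j <;> simp [deck, matM]
  · simp [deck]

theorem deck_rotLog (m : Fin 2 → ℤ) (φ : ℝ) (n : Fin 2 → ℝ) (q : LogPt) :
    P.deck m φ (rotLog n q) = rotLog n (P.deck m φ q) := by
  refine Prod.ext (funext fun j => ?_) (Prod.ext (funext fun j => ?_) rfl)
  · simp [deck, rotLog]
  · simp [deck, rotLog]; ring

theorem trans_trans_torusPt {s s' s'' : Bool} {m m' : Fin 2 → ℤ} {q : LogPt}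
    (hb : q.2.2 ≠ -(P.crit : ℂ)) :
    P.trans s' s'' m' (P.trans s s' m (P.torusPt s q)) = P.trans s s'' (m' + m) (P.torusPt s q) := by
  obtain ⟨φ, hφ⟩ := P.exists_isArg q.2.2
  rw [trans_torusPt hb hφ, trans_torusPt hb hφ, trans_torusPt (by exact hb) (by exact hφ), deck_add]

theorem trans_zero_torusPt {s s' : Bool} {q : LogPt} (hb : q.2.2 ≠ -(P.crit : ℂ)) :
    P.trans s s' 0 (P.torusPt s q) = P.torusPt s' q := by
  obtain ⟨φ, hφ⟩ := P.exists_isArg q.2.2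
  rw [trans_torusPt hb hφ, deck_zero]

/-- The orbit of logarithmic coordinates of a point of a chart. -/
def orbit (p : P.Charts) : Set LogPt :=
  {q | q.2.2 ≠ -(P.crit : ℂ) ∧ ∃ m, p.1.2 = P.trans true p.1.1 m (P.torusPt true q)}

theorem orbit_glue {p p' : P.Charts} (h : P.glue p p') : orbit p = orbit p' := by
  obtain ⟨m, hm, hp'⟩ := h
  have hv : v0 p'.1.2 = v0 p.1.2 := by rw [hp', v0_trans P _ _ _ _ hm]
  ext q
  refine and_congr_right fun hb => ?_
  constructor
  · rintro ⟨k, hk⟩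
    exact ⟨m + k, by rw [hp', hk, trans_trans_torusPt hb]⟩
  · rintro ⟨k, hk⟩
    have hq0 : v0 (P.torusPt true q) ≠ 0 := by rwa [v0_torusPt, P.nu_ne_zero]
    have h0 : v0 p.1.2 ≠ 0 := by
      rwa [← hv, hk, v0_trans P _ _ _ _ (mem_transDom hq0)]
    obtain ⟨L, hL⟩ : ∃ L, P.torusPt p.1.1 L = p.1.2 :=
      ⟨_, torusPt_logPt fun j => ne_zero_of_v0 h0 j.succ⟩
    have hLb : L.2.2 = q.2.2 := by
      have h1 := v0_trans P true p'.1.1 k _ (mem_transDom hq0)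
      rw [← hk, hv, ← hL] at h1
      rw [← Wc_torusPt (P := P) p.1.1 L, ← Wc_torusPt (P := P) true q, Wc, Wc, h1]
    obtain ⟨φ, hφ⟩ := P.exists_isArg q.2.2
    rw [hp', ← hL, trans_torusPt (hLb ▸ hb) (hLb ▸ hφ), trans_torusPt hb hφ, torusPt_eq_iff] at hk
    obtain ⟨n, hn⟩ := hk
    refine ⟨-m + k, ?_⟩
    rw [← hL, trans_torusPt hb hφ, torusPt_eq_iff]
    refine ⟨n, ?_⟩
    rw [← deck_add, hn, deck_rotLog, deck_add, neg_add_cancel, deck_zero]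

variable (P) in
/-- The point of `Y` with given logarithmic coordinates (of interest over the base disc only). -/
def toY (q : LogPt) : P.Y :=
  open Classical in if h : ‖q.2.2‖ < P.rad then
    Quot.mk _ ⟨(true, P.torusPt true q), torusPt_mem_region.2 h⟩
  else Quot.mk _ ⟨(true, P.torusPt true 0), torusPt_mem_region.2 (by simpa using P.rad_pos)⟩

theorem toY_eq {q : LogPt} (h : ‖q.2.2‖ < P.rad) :
    P.toY q = Quot.mk _ ⟨(true, P.torusPt true q), torusPt_mem_region.2 h⟩ := dif_pos h

theorem IsLift.of_trans {s s' : Bool} {m : Fin 2 → ℤ} {y : C3} {p : P.Y} (h : P.IsLift s y p)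
    (hy : y ∈ transDom s s' m) : P.IsLift s' (P.trans s s' m y) p := by
  obtain ⟨hr, rfl⟩ := h
  have hr' : P.trans s s' m y ∈ P.region := by
    rw [region, mem_ofPred_eq, Wc, v0_trans P _ _ _ _ hy]; exact hr
  exact ⟨hr', Quot.sound ⟨m, hy, rfl⟩⟩

theorem IsLift.W_eq {s : Bool} {y : C3} {p : P.Y} (h : P.IsLift s y p) : P.W p = P.Wc y := by
  obtain ⟨hr, rfl⟩ := h; rfl

theorem IsLift.unique {s : Bool} {y : C3} {p p' : P.Y} (h : P.IsLift s y p)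
    (h' : P.IsLift s y p') : p = p' := by
  obtain ⟨hr, rfl⟩ := h
  obtain ⟨hr', rfl⟩ := h'
  rfl

theorem isLift_toY (s : Bool) {q : LogPt} (h : q.2.2 ∈ P.reg) :
    P.IsLift s (P.torusPt s q) (P.toY q) := by
  have h1 : P.IsLift true (P.torusPt true q) (P.toY q) := ⟨torusPt_mem_region.2 h.1, toY_eq h.1⟩
  have := h1.of_trans (s' := s) (m := 0) (mem_transDom (by rw [v0_torusPt, P.nu_ne_zero]; exact h.2))
  rwa [trans_zero_torusPt h.2] at this

theorem W_toY {q : LogPt} (h : ‖q.2.2‖ < P.rad) : P.W (P.toY q) = q.2.2 := by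
  rw [toY_eq h]; exact Wc_torusPt true q

theorem norm_W_lt (p : P.Y) : ‖P.W p‖ < P.rad := by
  induction p using Quot.ind with
  | mk a => exact a.2

theorem exists_isLift (p : P.Y) : ∃ s y, P.IsLift s y p := by
  induction p using Quot.ind with
  | mk a => exact ⟨a.1.1, a.1.2, a.2, rfl⟩

theorem IsLift.eq_toY {s : Bool} {q : LogPt} {p : P.Y} (h : P.IsLift s (P.torusPt s q) p)
    (hb : q.2.2 ≠ -(P.crit : ℂ)) : p = P.toY q :=
  h.unique (isLift_toY s ⟨torusPt_mem_region.1 h.1, hb⟩)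

theorem exists_toY {p : P.Y} (h : P.W p ≠ -(P.crit : ℂ)) : ∃ q : LogPt, q.2.2 ∈ P.reg ∧ P.toY q = p := by
  obtain ⟨s, y, hy⟩ := exists_isLift p
  have hv : v0 y ≠ 0 := by
    rw [Wc_eq.1 hy.W_eq.symm]; exact P.nu_ne_zero.2 h
  have hL := torusPt_logPt (P := P) (s := s) fun j => ne_zero_of_v0 hv j.succ
  rw [← hL] at hy
  have hb : (P.logPt s y).2.2 ≠ -(P.crit : ℂ) := by
    rwa [hy.W_eq, Wc_torusPt] at h
  exact ⟨_, ⟨torusPt_mem_region.1 hy.1, hb⟩, (hy.eq_toY hb).symm⟩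

theorem toY_eq_toY_iff {q q' : LogPt} {φ : ℝ} (h : q.2.2 ∈ P.reg) (h' : q'.2.2 ∈ P.reg)
    (hφ : P.IsArg φ q.2.2) :
    P.toY q = P.toY q' ↔ ∃ m n : Fin 2 → ℤ, q' = rotLog (fun j => n j) (P.deck m φ q) := by
  constructor
  · intro heq
    rw [toY_eq h.1, toY_eq h'.1] at heq
    have h1 := congrArg (Quot.lift orbit fun _ _ => orbit_glue) heq
    have h2 : q ∈ orbit (⟨(true, P.torusPt true q), torusPt_mem_region.2 h.1⟩ : P.Charts) :=
      ⟨h.2, 0, (trans_zero_torusPt h.2).symm⟩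
    have h3 : q ∈ orbit (⟨(true, P.torusPt true q'), torusPt_mem_region.2 h'.1⟩ : P.Charts) := by
      rwa [show orbit (⟨(true, P.torusPt true q), torusPt_mem_region.2 h.1⟩ : P.Charts) = _ from h1]
        at h2
    obtain ⟨-, m, hm⟩ := h3
    simp only at hm
    rw [trans_torusPt h.2 hφ, eq_comm, torusPt_eq_iff] at hm
    exact ⟨m, hm⟩
  · rintro ⟨m, n, rfl⟩
    have h1 := (isLift_toY true h).of_trans (s' := true) (m := m)
      (mem_transDom (by rw [v0_torusPt, P.nu_ne_zero]; exact h.2))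
    rw [trans_torusPt h.2 hφ, (torusPt_eq_iff (P := P)).2 ⟨n, rfl⟩] at h1
    exact h1.eq_toY h.2

/-! ### The differential of the exponential coordinates -/

theorem contDiff_torusPt (s : Bool) {n : WithTop ℕ∞} : ContDiff ℝ n (P.torusPt s) := by
  have hz : ∀ j, ContDiff ℝ n fun q : LogPt => q.z j := fun j => by
    have h1 : ContDiff ℝ n fun x : ℝ => (x : ℂ) := Complex.ofRealCLM.contDiff
    unfold LogPt.z
    exact (h1.comp (by fun_prop)).add (contDiff_const.mul (h1.comp (by fun_prop)))
  rw [contDiff_pi]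
  refine Fin.cases ?_ fun j => ?_
  · simp only [torusPt_zero, nu]
    exact (by fun_prop : ContDiff ℝ n fun q : LogPt => 1 + q.2.2 / (P.crit : ℂ)).mul
      (contDiff_const.mul ((hz 0).add (hz 1))).cexp
  · simp only [torusPt_succ]
    exact (contDiff_const.mul (hz j)).neg.cexp

theorem differentiable_torusPt (s : Bool) : Differentiable ℝ (P.torusPt s) :=
  (contDiff_torusPt s (n := 1)).differentiable (by norm_num)

theorem fderiv_torusPt (s : Bool) (q v : LogPt) :
    (fderiv ℝ (P.torusPt s) q v 0 = v.2.2 / P.crit * Complex.exp ((sgn s : ℂ) * (q.z 0 + q.z 1)) +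
      (sgn s : ℂ) * (v.z 0 + v.z 1) * P.torusPt s q 0) ∧
    ∀ j : Fin 2, fderiv ℝ (P.torusPt s) q v j.succ = -((sgn s : ℂ) * v.z j) * P.torusPt s q j.succ := by
  have h1 : HasDerivAt (fun x : ℝ => P.torusPt s (q + x • v)) (fderiv ℝ (P.torusPt s) q v) 0 := by
    have h2 : HasDerivAt (fun x : ℝ => q + x • v) v 0 := by
      simpa using ((hasDerivAt_id (0 : ℝ)).smul_const v).const_add q
    have h3 : HasFDerivAt (P.torusPt s) (fderiv ℝ (P.torusPt s) q) (q + (0 : ℝ) • v) := by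
      rw [zero_smul, add_zero]; exact (differentiable_torusPt s q).hasFDerivAt
    exact h3.comp_hasDerivAt (0 : ℝ) h2
  rw [hasDerivAt_pi] at h1
  have hx : HasDerivAt (fun x : ℝ => (x : ℂ)) 1 0 := Complex.ofRealCLM.hasDerivAt
  have hz : ∀ j, HasDerivAt (fun x : ℝ => (q + x • v).z j) (v.z j) 0 := fun j => by
    have e : (fun x : ℝ => (q + x • v).z j) = fun x : ℝ => q.z j + (x : ℂ) * v.z j := by
      funext x; simp [LogPt.z]; ring
    rw [e]
    simpa using (hx.mul_const (v.z j)).const_add (q.z j)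
  constructor
  · refine (h1 0).unique ?_
    have hb : HasDerivAt (fun x : ℝ => P.nu (q + x • v).2.2) (v.2.2 / P.crit) 0 := by
      have e : (fun x : ℝ => P.nu (q + x • v).2.2) =
          fun x : ℝ => P.nu q.2.2 + (x : ℂ) * (v.2.2 / P.crit) := by
        funext x; simp [nu]; ring
      rw [e]
      simpa using (hx.mul_const (v.2.2 / P.crit)).const_add (P.nu q.2.2)
    have h := hb.mul (((hz 0).add (hz 1)).const_mul (sgn s : ℂ)).cexp
    refine h.congr_deriv ?_
    simp only [zero_smul, add_zero, torusPt_zero]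
    simp; ring
  · intro j
    refine (h1 j.succ).unique ?_
    simp only [torusPt_succ]
    have h := ((hz j).const_mul (sgn s : ℂ)).neg.cexp
    refine h.congr_deriv ?_
    simp
    ring

/-- The constant vector field `∂/∂ρ_j`, extended linearly. -/
def dρ (c : Fin 2 → ℝ) : LogPt := (c, 0, 0)

/-- The constant vector field `∂/∂θ_j`, extended linearly. -/
def dθ (c : Fin 2 → ℝ) : LogPt := (0, c, 0)

theorem fderiv_torusPt_dθ (s : Bool) (q : LogPt) (j : Fin 2) :
    fderiv ℝ (P.torusPt s) q (dθ (Pi.single j 1)) = rotField s j (P.torusPt s q) := by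
  obtain ⟨h0, h1⟩ := fderiv_torusPt (P := P) s q (dθ (Pi.single j 1))
  funext k
  refine Fin.cases ?_ (fun i => ?_) k
  · rw [h0]
    fin_cases j <;> simp [rotField, dθ, LogPt.z] <;> left <;> ring
  · rw [h1]
    fin_cases j <;> fin_cases i <;> simp [rotField, dθ, LogPt.z] <;> left <;> ring

theorem fderiv_torusPt_dρ (s : Bool) (q : LogPt) (c : Fin 2 → ℝ) :
    fderiv ℝ (P.torusPt s) q (dθ c) = iMul (fderiv ℝ (P.torusPt s) q (dρ ((2 * Real.pi) • c))) := by
  obtain ⟨h0, h1⟩ := fderiv_torusPt (P := P) s q (dθ c)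
  obtain ⟨g0, g1⟩ := fderiv_torusPt (P := P) s q (dρ ((2 * Real.pi) • c))
  funext k
  refine Fin.cases ?_ (fun i => ?_) k
  · simp only [iMul, h0, g0]
    simp [dθ, dρ, LogPt.z]; ring
  · simp only [iMul, h1, g1]
    simp [dθ, dρ, LogPt.z]; ring

theorem fderiv_torusPt_dρ_ne_zero (s : Bool) (q : LogPt) {c : Fin 2 → ℝ} (hc : c ≠ 0) :
    fderiv ℝ (P.torusPt s) q (dρ c) ≠ 0 := by
  intro h
  obtain ⟨j, hj⟩ := Function.ne_iff.1 hc
  have h1 := (fderiv_torusPt (P := P) s q (dρ c)).2 j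
  rw [h] at h1
  have h2 := torusPt_succ_ne (P := P) s q j
  have h3 : (sgn s : ℂ) ≠ 0 := by cases s <;> simp [sgn]
  have h4 := (mul_eq_zero.1 h1.symm).resolve_right h2
  rw [neg_eq_zero] at h4
  have h5 := (mul_eq_zero.1 h4).resolve_left h3
  simp [dρ, LogPt.z] at h5
  exact hj h5

theorem fderiv_v0_torusPt (s : Bool) (q v : LogPt) :
    fderiv ℝ v0 (P.torusPt s q) (fderiv ℝ (P.torusPt s) q v) = v.2.2 / P.crit := by
  have hv : DifferentiableAt ℝ v0 (P.torusPt s q) := by unfold v0; fun_prop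
  have h1 := fderiv_comp q hv (differentiable_torusPt s q)
  have h2 : v0 ∘ P.torusPt s = fun q : LogPt => P.nu q.2.2 := funext fun q => v0_torusPt s q
  rw [h2] at h1
  rw [← ContinuousLinearMap.comp_apply, ← h1]
  have h3 : HasFDerivAt (fun q : LogPt => P.nu q.2.2)
      ((P.crit : ℂ)⁻¹ • (ContinuousLinearMap.snd ℝ (Fin 2 → ℝ) ℂ).comp
        (ContinuousLinearMap.snd ℝ (Fin 2 → ℝ) ((Fin 2 → ℝ) × ℂ))) q := by
    have := ((ContinuousLinearMap.snd ℝ (Fin 2 → ℝ) ℂ).comp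
        (ContinuousLinearMap.snd ℝ (Fin 2 → ℝ) ((Fin 2 → ℝ) × ℂ))).hasFDerivAt (x := q)
    have h4 := (this.const_mul ((P.crit : ℂ)⁻¹)).const_add 1
    refine HasFDerivAt.congr_of_eventuallyEq h4 (Eventually.of_forall fun x => ?_)
    simp [nu, div_eq_inv_mul]
  rw [h3.fderiv]
  simp [div_eq_inv_mul]

/-- Every tangent vector at a point of the dense torus comes from the logarithmic coordinates. -/
theorem exists_fderiv_torusPt_eq (s : Bool) {q : LogPt} (v : C3) :
    ∃ w : LogPt, fderiv ℝ (P.torusPt s) q w = v := by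
  set ζ : Fin 2 → ℂ := fun j => -((sgn s : ℂ) * (v j.succ / P.torusPt s q j.succ)) with hζ
  have hpi := Real.pi_ne_zero
  have hs := sgn_cast_mul_self (R := ℂ) s
  set w : LogPt := (fun j => (ζ j).re, fun j => (ζ j).im / (2 * Real.pi),
    P.crit * (v 0 - (sgn s : ℂ) * (ζ 0 + ζ 1) * P.torusPt s q 0) /
      Complex.exp ((sgn s : ℂ) * (q.z 0 + q.z 1))) with hw
  have hz : ∀ j, w.z j = ζ j := fun j => by
    rw [LogPt.z, hw]
    conv_rhs => rw [← Complex.re_add_im (ζ j)]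
    have : (Real.pi : ℂ) ≠ 0 := by exact_mod_cast hpi
    push_cast
    field_simp
  refine ⟨w, ?_⟩
  obtain ⟨h0, h1⟩ := fderiv_torusPt (P := P) s q w
  funext k
  refine Fin.cases ?_ (fun i => ?_) k
  · rw [h0, hz, hz, hw]
    have := P.crit_ne
    have := Complex.exp_ne_zero ((sgn s : ℂ) * (q.z 0 + q.z 1))
    field_simp
    ring
  · rw [h1, hz, hζ]
    have := torusPt_succ_ne (P := P) s q i
    field_simp
    linear_combination v i.succ * hs

end LGParams

/-! ### Two-forms -/

section TwoForm

variable {E : Type*} [NormedAddCommGroup E] [NormedSpace ℝ E]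

theorem alt_swap (α : E [⋀^Fin 2]→L[ℝ] ℝ) (u v : E) : α ![u, v] = -α ![v, u] := by
  have h := α.toAlternatingMap.map_swap ![v, u] (show (0 : Fin 2) ≠ 1 by decide)
  rw [← ContinuousAlternatingMap.coe_toAlternatingMap, ← h]
  congr 1
  funext i
  fin_cases i <;> rfl

theorem alt_self (α : E [⋀^Fin 2]→L[ℝ] ℝ) (u : E) : α ![u, u] = 0 := by
  have := alt_swap α u u; linarith

theorem alt_add_left (α : E [⋀^Fin 2]→L[ℝ] ℝ) (u u' v : E) :
    α ![u + u', v] = α ![u, v] + α ![u', v] := by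
  have h : ∀ w, Function.update ![u, v] 0 w = ![w, v] := fun w => by
    funext i; fin_cases i <;> simp
  have := α.toAlternatingMap.map_update_add ![u, v] 0 u u'
  simp only [h] at this
  exact this

theorem alt_smul_left (α : E [⋀^Fin 2]→L[ℝ] ℝ) (c : ℝ) (u v : E) :
    α ![c • u, v] = c * α ![u, v] := by
  have h : ∀ w, Function.update ![u, v] 0 w = ![w, v] := fun w => by
    funext i; fin_cases i <;> simp
  have := α.toAlternatingMap.map_update_smul ![u, v] 0 c u
  simp only [h] at this
  exact this

theorem alt_add_right (α : E [⋀^Fin 2]→L[ℝ] ℝ) (u v v' : E) :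
    α ![u, v + v'] = α ![u, v] + α ![u, v'] := by
  rw [alt_swap, alt_add_left, alt_swap α v, alt_swap α v']; ring

theorem alt_smul_right (α : E [⋀^Fin 2]→L[ℝ] ℝ) (c : ℝ) (u v : E) :
    α ![u, c • v] = c * α ![u, v] := by
  rw [alt_swap, alt_smul_left, alt_swap α v]; ring

theorem alt_zero_left (α : E [⋀^Fin 2]→L[ℝ] ℝ) (v : E) : α ![0, v] = 0 := by
  have := alt_smul_left α 0 0 v; simpa using this

theorem alt_zero_right (α : E [⋀^Fin 2]→L[ℝ] ℝ) (v : E) : α ![v, 0] = 0 := by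
  rw [alt_swap, alt_zero_left, neg_zero]

theorem alt_comp {F : Type*} [NormedAddCommGroup F] [NormedSpace ℝ F] (α : F [⋀^Fin 2]→L[ℝ] ℝ)
    (f : E →L[ℝ] F) (u v : E) : α.compContinuousLinearMap f ![u, v] = α ![f u, f v] := by
  rw [ContinuousAlternatingMap.compContinuousLinearMap_apply]
  congr 1
  funext i; fin_cases i <;> rfl

/-- A closed two-form evaluated on three constant vector fields. -/
theorem closed_identity {α : E → E [⋀^Fin 2]→L[ℝ] ℝ} {x : E} (hd : DifferentiableAt ℝ α x)
    (hc : extDeriv α x = 0) (u v w : E) :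
    fderiv ℝ (fun x => α x ![v, w]) x u - fderiv ℝ (fun x => α x ![u, w]) x v +
      fderiv ℝ (fun x => α x ![u, v]) x w = 0 := by
  have h := extDeriv_apply hd ![u, v, w]
  rw [hc, Fin.sum_univ_three] at h
  have e0 : (0 : Fin 3).removeNth ![u, v, w] = ![v, w] := by
    funext i; fin_cases i <;> rfl
  have e1 : (1 : Fin 3).removeNth ![u, v, w] = ![u, w] := by
    funext i; fin_cases i <;> rfl
  have e2 : (2 : Fin 3).removeNth ![u, v, w] = ![u, v] := by
    funext i; fin_cases i <;> rfl
  rw [e0, e1, e2] at h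
  simp at h
  linarith

theorem contDiffAt_alt_apply {F : Type*} [NormedAddCommGroup F] [NormedSpace ℝ F] {n : WithTop ℕ∞}
    {α : F → E [⋀^Fin 2]→L[ℝ] ℝ}
    {f g : F → E} {x : F} (hα : ContDiffAt ℝ n α x) (hf : ContDiffAt ℝ n f x)
    (hg : ContDiffAt ℝ n g x) : ContDiffAt ℝ n (fun y => α y ![f y, g y]) x := by
  have h1 : ContDiffAt ℝ n (fun y => ContinuousAlternatingMap.toContinuousMultilinearMapCLM ℝ (α y)) x :=
    (ContinuousLinearMap.contDiff _).contDiffAt.comp x hα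
  have h2 : ContDiffAt ℝ n (fun y => (![f y, g y] : Fin 2 → E)) x := by
    rw [contDiffAt_pi]
    intro i; fin_cases i
    · exact hf
    · exact hg
  let B := (ContinuousLinearMap.id ℝ
    (ContinuousMultilinearMap ℝ (fun _ : Fin 2 => E) ℝ)).continuousMultilinearMapOption
  have h3 : ContDiffAt ℝ n (fun y => B fun _ =>
      (ContinuousAlternatingMap.toContinuousMultilinearMapCLM ℝ (α y), ![f y, g y])) x :=
    B.contDiff.contDiffAt.comp x (contDiffAt_pi.2 fun _ => h1.prodMk h2)
  exact h3

variable {F : Type*} [NormedAddCommGroup F] [NormedSpace ℝ F]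

/-- The pullback of a two-form. -/
def pull (α : F → F [⋀^Fin 2]→L[ℝ] ℝ) (f : E → F) (x : E) : E [⋀^Fin 2]→L[ℝ] ℝ :=
  (α (f x)).compContinuousLinearMap (fderiv ℝ f x)

theorem pull_apply (α : F → F [⋀^Fin 2]→L[ℝ] ℝ) (f : E → F) (x u v : E) :
    pull α f x ![u, v] = α (f x) ![fderiv ℝ f x u, fderiv ℝ f x v] := alt_comp _ _ _ _

theorem differentiableAt_pull {α : F → F [⋀^Fin 2]→L[ℝ] ℝ} {f : E → F} {x : E}
    (hα : DifferentiableAt ℝ α (f x)) (hf : ContDiffAt ℝ ∞ f x) :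
    DifferentiableAt ℝ (pull α f) x :=
  (hα.comp x (hf.differentiableAt (by simp))).continuousAlternatingMapCompContinuousLinearMap
    ((hf.fderiv_right (m := 1) (by norm_cast)).differentiableAt one_ne_zero)

theorem extDeriv_pull_eq_zero {α : F → F [⋀^Fin 2]→L[ℝ] ℝ} {f : E → F} {x : E}
    (hα : DifferentiableAt ℝ α (f x)) (hf : ContDiffAt ℝ ∞ f x) (h : extDeriv α (f x) = 0) :
    extDeriv (pull α f) x = 0 := by
  have h1 : ContDiffAt ℝ 2 f x := hf.of_le (by norm_cast)
  have := extDeriv_pullback hα h1 (by simp)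
  rw [h] at this
  rw [show extDeriv (pull α f) x = _ from this]
  ext v; simp

theorem contDiffAt_pull_apply {α : F → F [⋀^Fin 2]→L[ℝ] ℝ} {f : E → F} {x : E}
    (hα : ContDiffAt ℝ ∞ α (f x)) (hf : ContDiffAt ℝ ∞ f x) (u v : E) :
    ContDiffAt ℝ ∞ (fun y => pull α f y ![u, v]) x := by
  simp only [pull_apply]
  have h1 : ContDiffAt ℝ ∞ (fderiv ℝ f) x := hf.fderiv_right (m := ∞) (by norm_cast)
  exact contDiffAt_alt_apply (hα.comp x hf) (h1.clm_apply contDiffAt_const)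
    (h1.clm_apply contDiffAt_const)

end TwoForm

namespace LGParams

variable (P : LGParams)

/-- The domain of the logarithmic coordinates: points over the regular values. -/
def logReg : Set LogPt := {q | q.2.2 ∈ P.reg}

theorem isOpen_logReg : IsOpen P.logReg := P.isOpen_reg.preimage (by fun_prop)

variable {P}

theorem torusPt_mem_of_logReg (s : Bool) {q : LogPt} (h : q ∈ P.logReg) :
    P.torusPt s q ∈ P.region := torusPt_mem_region.2 h.1

theorem torusPt_mem_transDom {s s' : Bool} {m : Fin 2 → ℤ} {q : LogPt} (h : q ∈ P.logReg) :
    P.torusPt s q ∈ transDom s s' m :=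
  mem_transDom (by rw [v0_torusPt, P.nu_ne_zero]; exact h.2)

theorem differentiableAt_trans {s s' : Bool} {m : Fin 2 → ℤ} {y : C3} (h : ∀ k, y k ≠ 0) :
    DifferentiableAt ℝ (P.trans s s' m) y := by
  have : DifferentiableAt ℂ (P.trans s s' m) y := by
    rw [differentiableAt_pi]
    intro l
    have hk : ∀ k (n : ℤ), DifferentiableAt ℂ (fun y : C3 => y k ^ n) y := fun k n =>
      (by fun_prop : DifferentiableAt ℂ (fun y : C3 => y k) y).zpow (Or.inl (h k))
    simp only [trans, Fin.prod_univ_three]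
    exact (((hk 0 _).mul (hk 1 _)).mul (hk 2 _)).const_mul _
  exact this.restrictScalars ℝ

end LGParams

namespace ToricKaehler

open LGParams

variable {P : LGParams} (Ω : ToricKaehler P)

/-! ### The Kähler form and the moment map in logarithmic coordinates -/

theorem contDiffAt_form (s : Bool) {y : C3} (hy : y ∈ P.region) : ContDiffAt ℝ ∞ (Ω.form s) y :=
  (Ω.form_smooth s).contDiffAt (isOpen_region.mem_nhds hy)

theorem contDiffAt_xi (s : Bool) {y : C3} (hy : y ∈ P.region) : ContDiffAt ℝ ∞ (Ω.xi s) y :=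
  (Ω.xi_smooth s).contDiffAt (isOpen_region.mem_nhds hy)

/-- The Kähler form in logarithmic coordinates. -/
def lform : LogPt → LogPt [⋀^Fin 2]→L[ℝ] ℝ := pull (Ω.form true) (P.torusPt true)

/-- The moment map in logarithmic coordinates. -/
def lxi (q : LogPt) : Fin 2 → ℝ := Ω.xi true (P.torusPt true q)

theorem form_of_trans {s s' : Bool} {m : Fin 2 → ℤ} {D : LogPt → LogPt} {q : LogPt}
    (hq : q ∈ P.logReg) (hD : DifferentiableAt ℝ D q)
    (h : ∀ᶠ x in 𝓝 q, P.trans s s' m (P.torusPt s x) = P.torusPt s' (D x)) (u v : LogPt) :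
    Ω.form s' (P.torusPt s' (D q)) ![fderiv ℝ (P.torusPt s') (D q) (fderiv ℝ D q u),
      fderiv ℝ (P.torusPt s') (D q) (fderiv ℝ D q v)] =
    Ω.form s (P.torusPt s q) ![fderiv ℝ (P.torusPt s) q u, fderiv ℝ (P.torusPt s) q v] := by
  have h1 := Ω.form_glue s s' m _ (torusPt_mem_of_logReg s hq) (torusPt_mem_transDom hq)
  rw [← h1, alt_comp, h.self_of_nhds]
  have h2 : fderiv ℝ (P.trans s s' m ∘ P.torusPt s) q = fderiv ℝ (P.torusPt s' ∘ D) q :=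
    Filter.EventuallyEq.fderiv_eq h
  rw [fderiv_comp q (differentiableAt_trans (torusPt_ne hq.2)) (differentiable_torusPt s q),
    fderiv_comp q (differentiable_torusPt s' _) hD] at h2
  have h3 : ∀ w, fderiv ℝ (P.trans s s' m) (P.torusPt s q) (fderiv ℝ (P.torusPt s) q w) =
      fderiv ℝ (P.torusPt s') (D q) (fderiv ℝ D q w) := fun w => congrFun (congrArg DFunLike.coe h2) w
  rw [h3, h3]

theorem form_torusPt (s : Bool) {q : LogPt} (hq : q ∈ P.logReg) (u v : LogPt) :
    Ω.form s (P.torusPt s q) ![fderiv ℝ (P.torusPt s) q u, fderiv ℝ (P.torusPt s) q v] =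
      Ω.lform q ![u, v] := by
  have h : ∀ᶠ x in 𝓝 q, P.trans true s 0 (P.torusPt true x) = P.torusPt s (id x) := by
    filter_upwards [P.isOpen_logReg.mem_nhds hq] with x hx
    exact trans_zero_torusPt hx.2
  have := Ω.form_of_trans hq differentiableAt_id h u v
  simpa [lform, pull_apply] using this

theorem xi_torusPt (s : Bool) {q : LogPt} (hq : q ∈ P.logReg) :
    Ω.xi s (P.torusPt s q) = Ω.lxi q := by
  have h := Ω.xi_glue true s 0 _ (torusPt_mem_of_logReg true hq) (torusPt_mem_transDom hq)
  rw [trans_zero_torusPt hq.2] at h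
  rw [h]
  funext i
  fin_cases i <;> simp [matM, lxi]

theorem lxi_deck {m : Fin 2 → ℤ} {φ : ℝ} {q : LogPt} (hq : q ∈ P.logReg) (hφ : P.IsArg φ q.2.2) :
    Ω.lxi (P.deck m φ q) = fun i => Ω.lxi q i + ((matM m i : ℤ) : ℝ) := by
  have h := Ω.xi_glue true true m _ (torusPt_mem_of_logReg true hq) (torusPt_mem_transDom hq)
  rwa [trans_torusPt hq.2 hφ] at h

theorem contDiffAt_lxi {q : LogPt} (hq : q ∈ P.logReg) : ContDiffAt ℝ ∞ Ω.lxi q :=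
  (Ω.contDiffAt_xi true (torusPt_mem_of_logReg true hq)).comp q (contDiff_torusPt true).contDiffAt

theorem fderiv_lxi {q : LogPt} (hq : q ∈ P.logReg) (v : LogPt) (j : Fin 2) :
    fderiv ℝ Ω.lxi q v j = Ω.lform q ![v, dθ (Pi.single j 1)] := by
  have hy := torusPt_mem_of_logReg true hq
  have h : fderiv ℝ Ω.lxi q = _ := fderiv_comp (g := Ω.xi true) q
    ((Ω.contDiffAt_xi true hy).differentiableAt (by simp)) (differentiable_torusPt true q)
  rw [h, ContinuousLinearMap.comp_apply, Ω.xi_moment true _ hy, lform, pull_apply,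
    fderiv_torusPt_dθ]

theorem contDiffAt_lform {q : LogPt} (hq : q ∈ P.logReg) (u v : LogPt) :
    ContDiffAt ℝ ∞ (fun x => Ω.lform x ![u, v]) q :=
  contDiffAt_pull_apply (Ω.contDiffAt_form true (torusPt_mem_of_logReg true hq))
    (contDiff_torusPt true).contDiffAt u v

theorem differentiableAt_lform {q : LogPt} (hq : q ∈ P.logReg) : DifferentiableAt ℝ Ω.lform q :=
  differentiableAt_pull ((Ω.contDiffAt_form true (torusPt_mem_of_logReg true hq)).differentiableAt
    (by simp)) (contDiff_torusPt true).contDiffAt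

theorem extDeriv_lform {q : LogPt} (hq : q ∈ P.logReg) : extDeriv Ω.lform q = 0 :=
  extDeriv_pull_eq_zero ((Ω.contDiffAt_form true (torusPt_mem_of_logReg true hq)).differentiableAt
    (by simp)) (contDiff_torusPt true).contDiffAt (Ω.form_closed true _ (torusPt_mem_of_logReg true hq))

theorem dθ_eq (c : Fin 2 → ℝ) : dθ c = c 0 • dθ (Pi.single 0 1) + c 1 • dθ (Pi.single 1 1) := by
  refine Prod.ext (by simp [dθ]) (Prod.ext (funext fun j => ?_) (by simp [dθ]))
  fin_cases j <;> simp [dθ]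

theorem lform_dθ {q : LogPt} (hq : q ∈ P.logReg) (v : LogPt) (c : Fin 2 → ℝ) :
    Ω.lform q ![v, dθ c] = fderiv ℝ Ω.lxi q v 0 * c 0 + fderiv ℝ Ω.lxi q v 1 * c 1 := by
  rw [dθ_eq, alt_add_right, alt_smul_right, alt_smul_right, fderiv_lxi Ω hq, fderiv_lxi Ω hq]
  ring

/-- The form is invariant under the rotations of the torus: infinitesimally, this is Cartan's formula. -/
theorem fderiv_lform_dθ {q : LogPt} (hq : q ∈ P.logReg) (v w : LogPt) (j : Fin 2) :
    fderiv ℝ (fun x => Ω.lform x ![v, w]) q (dθ (Pi.single j 1)) = 0 := by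
  have h := closed_identity (Ω.differentiableAt_lform hq) (Ω.extDeriv_lform hq)
    (dθ (Pi.single j 1)) v w
  have h2 : ContDiffAt ℝ 1 (fderiv ℝ Ω.lxi) q := (Ω.contDiffAt_lxi hq).fderiv_right (by norm_cast)
  have h3 : ∀ v w, fderiv ℝ (fun x => Ω.lform x ![dθ (Pi.single j 1), v]) q w =
      -fderiv ℝ (fderiv ℝ Ω.lxi) q w v j := by
    intro v w
    have e : (fun x => Ω.lform x ![dθ (Pi.single j 1), v]) =ᶠ[𝓝 q]
        fun x => -fderiv ℝ Ω.lxi x v j := by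
      filter_upwards [P.isOpen_logReg.mem_nhds hq] with x hx
      rw [alt_swap, fderiv_lxi Ω hx]
    rw [e.fderiv_eq]
    have h4 : HasFDerivAt (fun x => fderiv ℝ Ω.lxi x v) ((fderiv ℝ (fderiv ℝ Ω.lxi) q).flip v) q :=
      (h2.differentiableAt one_ne_zero).hasFDerivAt.clm_apply (hasFDerivAt_const v q) |>.congr_fderiv
        (ContinuousLinearMap.ext fun w => by simp)
    have h5 := hasFDerivAt_pi'.1 h4 j
    rw [fderiv_fun_neg, h5.fderiv]; rfl
  have h6 := ((Ω.contDiffAt_lxi hq).isSymmSndFDerivAt (by simp; norm_cast)).eq v w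
  rw [h3, h3, h6] at h
  linarith

theorem mem_logReg_add_dθ {q : LogPt} (hq : q ∈ P.logReg) (c : Fin 2 → ℝ) : q + dθ c ∈ P.logReg := by
  simpa [logReg, dθ] using hq

theorem rotLog_eq (n : Fin 2 → ℝ) (q : LogPt) : rotLog n q = q + dθ n := by
  simp [rotLog, dθ, Prod.ext_iff, funext_iff]

theorem hasDerivAt_line {F : Type*} [NormedAddCommGroup F] [NormedSpace ℝ F] {f : LogPt → F} {q v : LogPt}
    {x : ℝ} (hf : DifferentiableAt ℝ f (q + x • v)) :
    HasDerivAt (fun x : ℝ => f (q + x • v)) (fderiv ℝ f (q + x • v) v) x := by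
  have h2 : HasDerivAt (fun x : ℝ => q + x • v) v x := by
    simpa using ((hasDerivAt_id x).smul_const v).const_add q
  exact hf.hasFDerivAt.comp_hasDerivAt x h2

theorem smul_dθ (x : ℝ) (c : Fin 2 → ℝ) : x • dθ c = dθ (x • c) := by simp [dθ]

theorem lform_add_dθ {q : LogPt} (hq : q ∈ P.logReg) (v w : LogPt) (c : Fin 2 → ℝ) :
    Ω.lform (q + dθ c) ![v, w] = Ω.lform q ![v, w] := by
  have h : ∀ x : ℝ, HasDerivAt (fun x : ℝ => Ω.lform (q + x • dθ c) ![v, w]) 0 x := by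
    intro x
    have hx : q + x • dθ c ∈ P.logReg := by rw [smul_dθ]; exact mem_logReg_add_dθ hq _
    have h1 := hasDerivAt_line ((Ω.contDiffAt_lform hx v w).differentiableAt (by simp))
    refine h1.congr_deriv ?_
    rw [show fderiv ℝ (fun x => Ω.lform x ![v, w]) (q + x • dθ c) (dθ c) = fderiv ℝ
      (fun x => Ω.lform x ![v, w]) (q + x • dθ c) (c 0 • dθ (Pi.single 0 1) + c 1 • dθ (Pi.single 1 1))
      by rw [← dθ_eq], map_add, map_smul, map_smul, fderiv_lform_dθ Ω hx, fderiv_lform_dθ Ω hx]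
    simp
  have h1 := is_const_of_deriv_eq_zero (fun x => (h x).differentiableAt) (fun x => (h x).deriv) 1 0
  simpa using h1

theorem lxi_add_int {q : LogPt} (n : Fin 2 → ℤ) : Ω.lxi (q + dθ fun j => n j) = Ω.lxi q := by
  rw [lxi, lxi, ← rotLog_eq, ← (torusPt_eq_iff (P := P)).2 ⟨n, rfl⟩]

/-- The torus orbits are isotropic: a Hamiltonian whose flow is periodic cannot grow at a constant rate
along a periodic orbit. -/
theorem lform_dθ_dθ {q : LogPt} (hq : q ∈ P.logReg) (c c' : Fin 2 → ℝ) :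
    Ω.lform q ![dθ c, dθ c'] = 0 := by
  have key : Ω.lform q ![dθ (Pi.single 0 1), dθ (Pi.single 1 1)] = 0 := by
    set k := Ω.lform q ![dθ (Pi.single 0 1), dθ (Pi.single 1 1)] with hk
    have h : ∀ x : ℝ, HasDerivAt
        (fun x : ℝ => Ω.lxi (q + x • dθ (Pi.single 0 1)) 1 - x * k) 0 x := by
      intro x
      have hx : q + x • dθ (Pi.single 0 1) ∈ P.logReg := by
        rw [smul_dθ]; exact mem_logReg_add_dθ hq _
      have h1 := hasDerivAt_pi.1
        (hasDerivAt_line ((Ω.contDiffAt_lxi hx).differentiableAt (by simp))) 1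
      have h2 := h1.sub ((hasDerivAt_id x).mul_const k)
      refine h2.congr_deriv ?_
      rw [fderiv_lxi Ω hx, smul_dθ, lform_add_dθ Ω hq, ← hk]; ring
    have h1 := is_const_of_deriv_eq_zero (fun x => (h x).differentiableAt) (fun x => (h x).deriv) 1 0
    have h2 : (dθ (Pi.single 0 1)) = dθ fun j => ((Pi.single 0 1 : Fin 2 → ℤ) j : ℝ) := by
      congr 1; funext j; fin_cases j <;> simp
    simp only [one_smul, zero_smul, add_zero, one_mul, zero_mul, sub_zero] at h1
    rw [h2, lxi_add_int] at h1
    linarith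
  have key' : Ω.lform q ![dθ (Pi.single 1 1), dθ (Pi.single 0 1)] = 0 := by
    rw [alt_swap, key, neg_zero]
  rw [dθ_eq c, dθ_eq c']
  simp only [alt_add_left, alt_add_right, alt_smul_left, alt_smul_right, alt_self, key, key']
  ring

theorem fderiv_lxi_dθ {q : LogPt} (hq : q ∈ P.logReg) (c : Fin 2 → ℝ) :
    fderiv ℝ Ω.lxi q (dθ c) = 0 := by
  funext j
  rw [fderiv_lxi Ω hq, lform_dθ_dθ Ω hq]; rfl

theorem lxi_add_dθ {q : LogPt} (hq : q ∈ P.logReg) (c : Fin 2 → ℝ) : Ω.lxi (q + dθ c) = Ω.lxi q := by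
  have h : ∀ x : ℝ, HasDerivAt (fun x : ℝ => Ω.lxi (q + x • dθ c)) 0 x := by
    intro x
    have hx : q + x • dθ c ∈ P.logReg := by rw [smul_dθ]; exact mem_logReg_add_dθ hq _
    have h1 := hasDerivAt_line ((Ω.contDiffAt_lxi hx).differentiableAt (by simp))
    rwa [fderiv_lxi_dθ Ω hx] at h1
  have h1 := is_const_of_deriv_eq_zero (fun x => (h x).differentiableAt) (fun x => (h x).deriv) 1 0
  simpa using h1

theorem lform_dρ_dρ {q : LogPt} (hq : q ∈ P.logReg) (c c' : Fin 2 → ℝ) :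
    Ω.lform q ![dρ c, dρ c'] = 0 := by
  have hpi := Real.pi_pos
  have h := Ω.lform_dθ_dθ hq c c'
  rw [lform, pull_apply, fderiv_torusPt_dρ, fderiv_torusPt_dρ,
    Ω.form_type true _ (torusPt_mem_of_logReg true hq), ← pull_apply (Ω.form true)] at h
  have e : ∀ c, dρ ((2 * Real.pi) • c) = (2 * Real.pi) • dρ c := fun c => by simp [dρ]
  rw [e, e, alt_smul_left, alt_smul_right] at h
  have h2 : (2 * Real.pi) ≠ 0 := by positivity
  exact (mul_eq_zero.1 ((mul_eq_zero.1 h).resolve_left h2)).resolve_left h2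

theorem lform_dρ_dθ_pos {q : LogPt} (hq : q ∈ P.logReg) {c : Fin 2 → ℝ} (hc : c ≠ 0) :
    0 < Ω.lform q ![dρ c, dθ c] := by
  rw [lform, pull_apply, fderiv_torusPt_dρ]
  have e : iMul (fderiv ℝ (P.torusPt true) q (dρ ((2 * Real.pi) • c))) =
      (2 * Real.pi) • iMul (fderiv ℝ (P.torusPt true) q (dρ c)) := by
    rw [show dρ ((2 * Real.pi) • c) = (2 * Real.pi) • dρ c by simp [dρ], map_smul]
    funext k; simp [iMul]; ring
  rw [e, alt_smul_right]
  exact mul_pos (by positivity) (Ω.form_pos true _ (torusPt_mem_of_logReg true hq) _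
    (fderiv_torusPt_dρ_ne_zero true q hc))

end ToricKaehler

/-- The inverse of the matrix `(2 1; 1 2)`. -/
def invM (ξ : Fin 2 → ℝ) : Fin 2 → ℝ := ![(2 * ξ 0 - ξ 1) / 3, (2 * ξ 1 - ξ 0) / 3]

theorem invM_matM (a : Fin 2 → ℝ) : invM (matM a) = a := by
  funext i; fin_cases i <;> simp [invM, matM] <;> ring

theorem matM_invM (ξ : Fin 2 → ℝ) : matM (invM ξ) = ξ := by
  funext i; fin_cases i <;> simp [invM, matM] <;> ring

theorem invM_add (ξ ξ' : Fin 2 → ℝ) : invM (ξ + ξ') = invM ξ + invM ξ' := by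
  funext i; fin_cases i <;> simp [invM] <;> ring

theorem matM_add (ξ ξ' : Fin 2 → ℝ) : matM (ξ + ξ') = matM ξ + matM ξ' := by
  funext i; fin_cases i <;> simp [matM] <;> ring

theorem continuous_invM : Continuous invM := by
  rw [continuous_pi_iff]; intro i; fin_cases i <;> simp [invM] <;> fun_prop

theorem contDiff_matM {n : WithTop ℕ∞} : ContDiff ℝ n (matM : (Fin 2 → ℝ) → (Fin 2 → ℝ)) := by
  rw [contDiff_pi]; intro i; fin_cases i <;> simp [matM] <;> fun_prop

/-- The lattice vector `M m`, as a real vector. -/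
def latt (m : Fin 2 → ℤ) : Fin 2 → ℝ := matM fun j => (m j : ℝ)

theorem latt_apply (m : Fin 2 → ℤ) (j : Fin 2) : latt m j = ((matM m j : ℤ) : ℝ) := by
  fin_cases j <;> simp [latt, matM]

theorem invM_latt (m : Fin 2 → ℤ) : invM (latt m) = fun j => (m j : ℝ) := invM_matM _

theorem isClosed_range_latt : IsClosed (range latt) := by
  have h : range latt = {ξ | ∀ j, invM ξ j ∈ range (Int.cast : ℤ → ℝ)} := by
    ext ξ
    constructor
    · rintro ⟨m, rfl⟩ j
      exact ⟨m j, by rw [invM_latt]⟩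
    · intro h
      choose m hm using h
      refine ⟨m, ?_⟩
      rw [latt, show (fun j => (m j : ℝ)) = invM ξ from funext hm, matM_invM]
  rw [h, ofPred_forall]
  exact isClosed_iInter fun j => Int.isClosedEmbedding_coe_real.isClosed_range.preimage
    ((continuous_apply j).comp continuous_invM)

namespace ToricKaehler

open LGParams

variable {P : LGParams} (Ω : ToricKaehler P)

/-! ### The moment map parametrizes the fibres -/

theorem fderiv_lxi_dρ_pos {q : LogPt} (hq : q ∈ P.logReg) {c : Fin 2 → ℝ} (hc : c ≠ 0) :
    0 < fderiv ℝ Ω.lxi q (dρ c) 0 * c 0 + fderiv ℝ Ω.lxi q (dρ c) 1 * c 1 := by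
  rw [← lform_dθ Ω hq]; exact Ω.lform_dρ_dθ_pos hq hc

theorem lxi_eq_of_angles {q q' : LogPt} (hq : q ∈ P.logReg) (h1 : q.1 = q'.1) (h2 : q.2.2 = q'.2.2) :
    Ω.lxi q = Ω.lxi q' := by
  rw [← Ω.lxi_add_dθ hq (q'.2.1 - q.2.1)]
  congr 1
  simp [dθ, Prod.ext_iff, h1, h2]

/-- The moment map restricted to a regular fibre is monotone, hence injective modulo rotations. -/
theorem lxi_injective {q q' : LogPt} (hq : q ∈ P.logReg) (h2 : q.2.2 = q'.2.2)
    (h : Ω.lxi q = Ω.lxi q') : q.1 = q'.1 := by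
  by_contra hne
  set c : Fin 2 → ℝ := q'.1 - q.1 with hc
  have hc0 : c ≠ 0 := sub_ne_zero.2 (Ne.symm hne)
  have hx : ∀ x : ℝ, q + x • dρ c ∈ P.logReg := fun x => by simpa [logReg, dρ] using hq
  have hd : ∀ x : ℝ, HasDerivAt
      (fun x : ℝ => Ω.lxi (q + x • dρ c) 0 * c 0 + Ω.lxi (q + x • dρ c) 1 * c 1)
      (fderiv ℝ Ω.lxi (q + x • dρ c) (dρ c) 0 * c 0 +
        fderiv ℝ Ω.lxi (q + x • dρ c) (dρ c) 1 * c 1) x := by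
    intro x
    have h1 := hasDerivAt_pi.1
        (hasDerivAt_line (q := q) (v := dρ c) ((Ω.contDiffAt_lxi (hx x)).differentiableAt (by simp)))
    exact ((h1 0).mul_const _).add ((h1 1).mul_const _)
  have hm := strictMono_of_hasDerivAt_pos hd fun x => Ω.fderiv_lxi_dρ_pos (hx x) hc0
  have h3 := hm one_pos
  have h4 : Ω.lxi (q + dρ c) = Ω.lxi q := by
    rw [h]
    refine Ω.lxi_eq_of_angles (by simpa using hx 1) ?_ ?_
    · simp [dρ, hc]
    · simp [dρ, h2]
  simp [h4] at h3

/-- The translations of the logarithmic radii over `b` by the action of `ℤ²` have a bounded fundamental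
domain. They are given by the matrix `-log t • M - log |v₀| • 1`, whose eigenvalues
`-3 log t - log |v₀|` and `-log t - log |v₀|` are positive because `t |v₀| < 1` and `t < 1`. -/
theorem exists_deck_bounded {b : ℂ} (hb : b ∈ P.reg) : ∃ L : (Fin 2 → ℝ) → (Fin 2 → ℝ), Continuous L ∧
    ∀ ρ, ∃ (x : Fin 2 → ℝ) (m : Fin 2 → ℤ), x ∈ Icc (0 : Fin 2 → ℝ) 1 ∧
      ρ = fun j => L x j - Real.log P.t * (matM m j : ℤ) - Real.log ‖P.nu b‖ * m j := by
  set l := -Real.log P.t with hl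
  set n := Real.log ‖P.nu b‖ with hn
  have hnu : 0 < ‖P.nu b‖ := norm_pos_iff.2 (P.nu_ne_zero.2 hb.2)
  have h1 : n < l := by
    have := Real.log_neg (mul_pos P.t_pos hnu) (P.norm_nu_lt hb.1)
    rw [Real.log_mul P.t_pos.ne' hnu.ne'] at this
    linarith
  have ht : P.t < 1 := by
    have := P.small
    have h2 : 0 < P.T ^ (P.veps - P.eps) := Real.rpow_pos_of_pos P.T_pos _
    nlinarith [P.t_pos]
  have hl0 : 0 < l := by rw [hl]; linarith [Real.log_neg P.t_pos ht]
  have hA : 3 * l - n ≠ 0 := by linarith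
  have hB : l - n ≠ 0 := by linarith
  let L : (Fin 2 → ℝ) → (Fin 2 → ℝ) := fun x j => l * matM x j - n * x j
  refine ⟨L, ?_, fun ρ => ?_⟩
  · have := contDiff_matM (n := 0).continuous
    fun_prop
  -- solve the linear system in the eigenvectors `(1, 1)` and `(1, -1)`
  obtain ⟨u, hu⟩ : ∃ u, (3 * l - n) * u = ρ 0 + ρ 1 := ⟨(ρ 0 + ρ 1) / (3 * l - n), by field_simp⟩
  obtain ⟨v, hv⟩ : ∃ v, (l - n) * v = ρ 0 - ρ 1 := ⟨(ρ 0 - ρ 1) / (l - n), by field_simp⟩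
  let y : Fin 2 → ℝ := ![(u + v) / 2, (u - v) / 2]
  have hLy : L y = ρ := by
    funext j
    fin_cases j
    · simp [L, y, matM]; linear_combination hu / 2 + hv / 2
    · simp [L, y, matM]; linear_combination hu / 2 - hv / 2
  refine ⟨fun j => Int.fract (y j), fun j => ⌊y j⌋,
    ⟨fun j => Int.fract_nonneg _, fun j => (Int.fract_lt_one _).le⟩, ?_⟩
  have hy : ∀ (k : Fin 2 → ℤ) j, L y j = L (fun j => y j - k j) j - Real.log P.t * (matM k j : ℤ) -
      n * k j := by
    intro k j
    fin_cases j <;> simp [L, matM, hl] <;> ring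
  rw [← hLy]
  exact funext (hy _)

/-- Restricted to a regular fibre, the moment map is a local diffeomorphism in the radii. -/
theorem isOpen_range_lxi {b : ℂ} (hb : b ∈ P.reg) :
    IsOpen (range fun ρ : Fin 2 → ℝ => Ω.lxi (ρ, 0, b)) := by
  rw [isOpen_iff_mem_nhds]
  rintro _ ⟨ρ, rfl⟩
  let ι : (Fin 2 → ℝ) → LogPt := fun ρ => (ρ, 0, b)
  have hq : ι ρ ∈ P.logReg := hb
  have hι : ContDiff ℝ ∞ ι := by fun_prop
  have hf : ContDiffAt ℝ ∞ (Ω.lxi ∘ ι) ρ := (Ω.contDiffAt_lxi hq).comp ρ hι.contDiffAt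
  have hd : ∀ c, fderiv ℝ (Ω.lxi ∘ ι) ρ c = fderiv ℝ Ω.lxi (ι ρ) (dρ c) := by
    intro c
    have hι' : HasFDerivAt ι (ContinuousLinearMap.inl ℝ _ _) ρ := hasFDerivAt_prodMk_left ρ (0, b)
    rw [fderiv_comp ρ ((Ω.contDiffAt_lxi hq).differentiableAt (by simp)) hι'.differentiableAt,
      hι'.fderiv]
    rfl
  have hinj : Function.Injective (fderiv ℝ (Ω.lxi ∘ ι) ρ) := by
    rw [injective_iff_map_eq_zero]
    intro c hc
    by_contra hc0
    have := Ω.fderiv_lxi_dρ_pos hq hc0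
    rw [← hd, hc] at this
    simp at this
  have hsurj : Function.Surjective (fderiv ℝ (Ω.lxi ∘ ι) ρ) :=
    (LinearMap.injective_iff_surjective (f := (fderiv ℝ (Ω.lxi ∘ ι) ρ).toLinearMap)).1 hinj
  have h := (hf.hasStrictFDerivAt (by simp)).map_nhds_eq_of_surj (LinearMap.range_eq_top.2 hsurj)
  change range (Ω.lxi ∘ ι) ∈ 𝓝 ((Ω.lxi ∘ ι) ρ)
  rw [← h]
  exact range_mem_map

/-- By equivariance, the image of the moment map on a fibre is the sum of the lattice and of the image of
a compact fundamental domain. -/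
theorem isClosed_range_lxi {b : ℂ} (hb : b ∈ P.reg) :
    IsClosed (range fun ρ : Fin 2 → ℝ => Ω.lxi (ρ, 0, b)) := by
  obtain ⟨L, hL, h⟩ := exists_deck_bounded hb
  obtain ⟨φ, hφ⟩ := P.exists_isArg b
  have hc : Continuous fun ρ : Fin 2 → ℝ => Ω.lxi (ρ, 0, b) := by
    rw [continuous_iff_continuousAt]
    intro ρ
    exact ContinuousAt.comp (g := Ω.lxi) (Ω.contDiffAt_lxi (q := (ρ, 0, b)) hb).continuousAt (by fun_prop)
  have hdeck : ∀ ρ (m : Fin 2 → ℤ), Ω.lxi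
      (fun j => ρ j - Real.log P.t * (matM m j : ℤ) - Real.log ‖P.nu b‖ * m j, 0, b) =
      Ω.lxi (ρ, 0, b) + latt m := by
    intro ρ m
    refine (Ω.lxi_eq_of_angles (q := (_, 0, b)) (q' := P.deck m φ (ρ, 0, b)) hb rfl rfl).trans ?_
    rw [Ω.lxi_deck (q := (ρ, 0, b)) hb hφ]
    funext j; simp [latt_apply]
  have hK : IsCompact ((fun x => Ω.lxi (L x, 0, b)) '' Icc (0 : Fin 2 → ℝ) 1) :=
    isCompact_Icc.image (hc.comp hL)
  convert isClosed_range_latt.add_right_of_isCompact hK using 1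
  ext ξ
  rw [Set.mem_add]
  constructor
  · rintro ⟨ρ, rfl⟩
    obtain ⟨x, m, hx, hρ⟩ := h ρ
    refine ⟨_, ⟨m, rfl⟩, _, ⟨x, hx, rfl⟩, ?_⟩
    dsimp only
    conv_rhs => rw [hρ, hdeck]
    rw [add_comm]
  · rintro ⟨_, ⟨m, rfl⟩, _, ⟨x, hx, rfl⟩, rfl⟩
    exact ⟨_, (hdeck (L x) m).trans (add_comm _ _)⟩

/-- The moment map on a regular fibre is onto: its image is open and closed. -/
theorem exists_lxi_eq {b : ℂ} (hb : b ∈ P.reg) (ξ : Fin 2 → ℝ) : ∃ ρ, Ω.lxi (ρ, 0, b) = ξ := by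
  have h : range (fun ρ : Fin 2 → ℝ => Ω.lxi (ρ, 0, b)) = univ :=
    IsClopen.eq_univ ⟨Ω.isClosed_range_lxi hb, Ω.isOpen_range_lxi hb⟩ (range_nonempty _)
  exact h.symm.subset (mem_univ ξ)

/-- The logarithmic radii `ρ` as functions of the moment map and of the point of the base. -/
def radii (x : (Fin 2 → ℝ) × ℂ) : Fin 2 → ℝ :=
  open Classical in if h : x.2 ∈ P.reg then (Ω.exists_lxi_eq h x.1).choose else 0

theorem lxi_radii {x : (Fin 2 → ℝ) × ℂ} (h : x.2 ∈ P.reg) (θ : Fin 2 → ℝ) :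
    Ω.lxi (Ω.radii x, θ, x.2) = x.1 := by
  have h1 : Ω.lxi (Ω.radii x, 0, x.2) = x.1 := by
    rw [radii, dif_pos h]; exact (Ω.exists_lxi_eq h x.1).choose_spec
  rw [← h1]
  exact Ω.lxi_eq_of_angles h rfl rfl

theorem radii_lxi {q : LogPt} (h : q ∈ P.logReg) : Ω.radii (Ω.lxi q, q.2.2) = q.1 :=
  Ω.lxi_injective (q := (Ω.radii (Ω.lxi q, q.2.2), 0, q.2.2)) h rfl (Ω.lxi_radii (x := (Ω.lxi q, q.2.2)) h 0)

/-- The radii are smooth, by the inverse function theorem for `(ρ, b) ↦ (ξ, b)`: near `x`, they agree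
with the local inverse because the moment map is injective on the fibres. -/
theorem contDiffAt_radii {x : (Fin 2 → ℝ) × ℂ} (h : x.2 ∈ P.reg) : ContDiffAt ℝ ∞ Ω.radii x := by
  let ι : (Fin 2 → ℝ) × ℂ → LogPt := fun y => (y.1, 0, y.2)
  let f : (Fin 2 → ℝ) × ℂ → (Fin 2 → ℝ) × ℂ := fun y => (Ω.lxi (ι y), y.2)
  let y0 : (Fin 2 → ℝ) × ℂ := (Ω.radii x, x.2)
  have hfy : f y0 = x := Prod.ext (Ω.lxi_radii h 0) rfl
  have hq : ι y0 ∈ P.logReg := h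
  have hι : ContDiff ℝ ∞ ι := by fun_prop
  have hf : ContDiffAt ℝ ∞ f y0 :=
    ((Ω.contDiffAt_lxi hq).comp y0 hι.contDiffAt).prodMk contDiffAt_snd
  have hlxi := ((Ω.contDiffAt_lxi hq).differentiableAt (by simp)).hasFDerivAt
  have hι' : HasFDerivAt ι (fderiv ℝ ι y0) y0 := (hι.differentiable (by simp) y0).hasFDerivAt
  have hιv : ∀ c, fderiv ℝ ι y0 (c, 0) = dρ c := by
    intro c
    have h1 : HasFDerivAt ι ((ContinuousLinearMap.fst ℝ (Fin 2 → ℝ) ℂ).prod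
      ((0 : (Fin 2 → ℝ) × ℂ →L[ℝ] (Fin 2 → ℝ)).prod (ContinuousLinearMap.snd ℝ (Fin 2 → ℝ) ℂ))) y0 :=
      hasFDerivAt_fst.prodMk ((hasFDerivAt_const _ _).prodMk hasFDerivAt_snd)
    rw [h1.fderiv]; rfl
  have hf' : HasFDerivAt f (((fderiv ℝ Ω.lxi (ι y0)).comp (fderiv ℝ ι y0)).prod
      (ContinuousLinearMap.snd ℝ (Fin 2 → ℝ) ℂ)) y0 := (hlxi.comp y0 hι').prodMk hasFDerivAt_snd
  have hinj : Function.Injective (((fderiv ℝ Ω.lxi (ι y0)).comp (fderiv ℝ ι y0)).prod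
      (ContinuousLinearMap.snd ℝ (Fin 2 → ℝ) ℂ)) := by
    rw [injective_iff_map_eq_zero]
    rintro ⟨c, u⟩ hv
    have h1 := congrArg Prod.fst hv
    have h2 := congrArg Prod.snd hv
    simp only [ContinuousLinearMap.prod_apply, ContinuousLinearMap.comp_apply,
      ContinuousLinearMap.coe_snd', Prod.fst_zero, Prod.snd_zero] at h1 h2
    subst h2
    rw [hιv] at h1
    by_contra hc
    have hc0 : c ≠ 0 := by rintro rfl; exact hc rfl
    have := Ω.fderiv_lxi_dρ_pos hq hc0
    simp [h1] at this
  let e := (LinearEquiv.ofInjectiveEndo _ hinj).toContinuousLinearEquiv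
  have he : HasFDerivAt f (e : (Fin 2 → ℝ) × ℂ →L[ℝ] (Fin 2 → ℝ) × ℂ) y0 := hf'
  have h1 := hf.to_localInverse he (by simp)
  have h2 := (hf.hasStrictFDerivAt' he (by simp)).eventually_right_inverse
  rw [hfy] at h1 h2
  refine (contDiffAt_fst.comp x h1).congr_of_eventuallyEq ?_
  have h3 : ∀ᶠ y in 𝓝 x, y.2 ∈ P.reg :=
    continuous_snd.continuousAt.eventually (P.isOpen_reg.mem_nhds h)
  filter_upwards [h2, h3] with y hy hyr
  set z := hf.localInverse he (by simp) y with hz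
  have hy' : f z = y := hy
  have hz2 : z.2 = y.2 := (congrArg Prod.snd hy' : (f z).2 = y.2)
  have hz1 : Ω.lxi (ι z) = y.1 := (congrArg Prod.fst hy' : (f z).1 = y.1)
  have := Ω.radii_lxi (q := ι z) (by simpa [logReg, ι, hz2] using hyr)
  rw [hz1] at this
  simp only [ι, hz2] at this
  exact this

theorem radii_add_latt {ξ : Fin 2 → ℝ} {b : ℂ} (h : b ∈ P.reg) (m : Fin 2 → ℤ) :
    Ω.radii (ξ + latt m, b) =
      fun j => Ω.radii (ξ, b) j - Real.log P.t * (matM m j : ℤ) - Real.log ‖P.nu b‖ * m j := by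
  obtain ⟨φ, hφ⟩ := P.exists_isArg b
  have hq : ((Ω.radii (ξ, b), 0, b) : LogPt) ∈ P.logReg := h
  have h1 := Ω.lxi_deck (m := m) hq hφ
  rw [Ω.lxi_radii (x := (ξ, b)) h] at h1
  have h2 := Ω.radii_lxi (q := P.deck m φ (Ω.radii (ξ, b), 0, b)) h
  rw [h1] at h2
  have e : ξ + latt m = fun i => ξ i + ((matM m i : ℤ) : ℝ) := funext fun i => by
    rw [Pi.add_apply, latt_apply]
  rw [e]
  exact h2

end ToricKaehler

/-- A value of the moment map and a point of the base. -/
abbrev BasePt : Type := (Fin 2 → ℝ) × ℂ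

theorem LGParams.differentiableAt_nu {P : LGParams} {b : ℂ} : DifferentiableAt ℝ P.nu b := by
  unfold LGParams.nu; fun_prop

namespace ToricKaehler

open LGParams

variable {P : LGParams} (Ω : ToricKaehler P)

/-! ### Moment-angle coordinates and the connection -/

/-- The section `θ = 0`, as a function of the moment map and of the point of the base. -/
def sec (x : BasePt) : LogPt := (Ω.radii x, 0, x.2)

/-- The point with moment map `ξ`, angles `θ` and base point `b`, in logarithmic coordinates. -/
def act (x : LogPt) : LogPt := (Ω.radii (x.1, x.2.2), x.2.1, x.2.2)

/-- The moment map, the angles and the base point, in terms of logarithmic coordinates. -/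
def mom (q : LogPt) : LogPt := (Ω.lxi q, q.2.1, q.2.2)

theorem act_mem {x : LogPt} (h : x ∈ P.logReg) : Ω.act x ∈ P.logReg := h

theorem mom_mem {q : LogPt} (h : q ∈ P.logReg) : Ω.mom q ∈ P.logReg := h

theorem mom_act {x : LogPt} (h : x ∈ P.logReg) : Ω.mom (Ω.act x) = x :=
  Prod.ext (Ω.lxi_radii (x := (x.1, x.2.2)) h x.2.1) rfl

theorem act_mom {q : LogPt} (h : q ∈ P.logReg) : Ω.act (Ω.mom q) = q :=
  Prod.ext (Ω.radii_lxi h) rfl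

theorem contDiffAt_sec {x : BasePt} (h : x.2 ∈ P.reg) : ContDiffAt ℝ ∞ Ω.sec x :=
  (Ω.contDiffAt_radii h).prodMk (contDiffAt_const.prodMk contDiffAt_snd)

theorem contDiffAt_act {x : LogPt} (h : x ∈ P.logReg) : ContDiffAt ℝ ∞ Ω.act x := by
  have h1 : ContDiffAt ℝ ∞ (fun x : LogPt => Ω.radii (x.1, x.2.2)) x :=
    ContDiffAt.comp (g := Ω.radii) (f := fun x : LogPt => ((x.1, x.2.2) : BasePt)) x
      (Ω.contDiffAt_radii h) (by fun_prop)
  exact h1.prodMk (by fun_prop)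

theorem contDiffAt_mom {q : LogPt} (h : q ∈ P.logReg) : ContDiffAt ℝ ∞ Ω.mom q :=
  (Ω.contDiffAt_lxi h).prodMk (by fun_prop)

theorem act_eq (x : LogPt) : Ω.act x = Ω.sec (x.1, x.2.2) + dθ x.2.1 := by
  simp [act, sec, dθ]

theorem fderiv_act {x : LogPt} (h : x ∈ P.logReg) (v : LogPt) :
    fderiv ℝ Ω.act x v = fderiv ℝ Ω.sec (x.1, x.2.2) (v.1, v.2.2) + dθ v.2.1 := by
  let p : LogPt →L[ℝ] BasePt := (ContinuousLinearMap.fst ℝ _ _).prod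
    ((ContinuousLinearMap.snd ℝ _ _).comp (ContinuousLinearMap.snd ℝ _ _))
  let r : LogPt →L[ℝ] LogPt := (0 : LogPt →L[ℝ] (Fin 2 → ℝ)).prod
    (((ContinuousLinearMap.fst ℝ _ _).comp (ContinuousLinearMap.snd ℝ _ _)).prod 0)
  have h1 : HasFDerivAt Ω.sec (fderiv ℝ Ω.sec (p x)) (p x) :=
    ((Ω.contDiffAt_sec (x := p x) h).differentiableAt (by simp)).hasFDerivAt
  have h2 := (h1.comp x p.hasFDerivAt).add (r.hasFDerivAt (x := x))
  have h3 : Ω.act = (Ω.sec ∘ p) + r := funext fun x => Ω.act_eq x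
  rw [h3, h2.fderiv]
  rfl

theorem act_mom_fderiv {q : LogPt} (h : q ∈ P.logReg) (w : LogPt) :
    fderiv ℝ Ω.act (Ω.mom q) (fderiv ℝ Ω.mom q w) = w := by
  have h1 : Ω.act ∘ Ω.mom =ᶠ[𝓝 q] id := by
    filter_upwards [P.isOpen_logReg.mem_nhds h] with x hx
    exact Ω.act_mom hx
  have h2 := h1.fderiv_eq (𝕜 := ℝ)
  rw [fderiv_comp q ((Ω.contDiffAt_act (Ω.mom_mem h)).differentiableAt (by simp))
    ((Ω.contDiffAt_mom h).differentiableAt (by simp)), fderiv_id] at h2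
  exact congrArg (fun L : LogPt →L[ℝ] LogPt => L w) h2

theorem fderiv_mom {q : LogPt} (h : q ∈ P.logReg) (w : LogPt) :
    fderiv ℝ Ω.mom q w = (fderiv ℝ Ω.lxi q w, w.2.1, w.2.2) := by
  have h1 : HasFDerivAt Ω.lxi (fderiv ℝ Ω.lxi q) q :=
    ((Ω.contDiffAt_lxi h).differentiableAt (by simp)).hasFDerivAt
  have h2 : HasFDerivAt Ω.mom ((fderiv ℝ Ω.lxi q).prod
      (ContinuousLinearMap.snd ℝ (Fin 2 → ℝ) ((Fin 2 → ℝ) × ℂ))) q := h1.prodMk hasFDerivAt_snd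
  rw [h2.fderiv]; rfl

theorem fderiv_lxi_sec {x : BasePt} (h : x.2 ∈ P.reg) (v : BasePt) :
    fderiv ℝ Ω.lxi (Ω.sec x) (fderiv ℝ Ω.sec x v) = v.1 := by
  have h1 : Ω.lxi ∘ Ω.sec =ᶠ[𝓝 x] Prod.fst := by
    filter_upwards [continuous_snd.continuousAt.eventually (P.isOpen_reg.mem_nhds h)] with y hy
    exact Ω.lxi_radii hy 0
  have h2 := h1.fderiv_eq (𝕜 := ℝ)
  rw [fderiv_comp x ((Ω.contDiffAt_lxi (q := Ω.sec x) h).differentiableAt (by simp))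
    ((Ω.contDiffAt_sec h).differentiableAt (by simp)), fderiv_fst] at h2
  exact congrArg (fun L : BasePt →L[ℝ] (Fin 2 → ℝ) => L v) h2

theorem fderiv_sec_snd {x : BasePt} (h : x.2 ∈ P.reg) (v : BasePt) :
    (fderiv ℝ Ω.sec x v).2 = (0, v.2) := by
  have h1 : HasFDerivAt Ω.radii (fderiv ℝ Ω.radii x) x :=
    ((Ω.contDiffAt_radii h).differentiableAt (by simp)).hasFDerivAt
  have h2 : HasFDerivAt Ω.sec ((fderiv ℝ Ω.radii x).prod
      ((0 : BasePt →L[ℝ] (Fin 2 → ℝ)).prod (ContinuousLinearMap.snd ℝ _ _))) x :=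
    h1.prodMk ((hasFDerivAt_const _ _).prodMk hasFDerivAt_snd)
  rw [h2.fderiv]; rfl

/-- The two-form induced on the section `θ = 0`. -/
def beta : BasePt → BasePt [⋀^Fin 2]→L[ℝ] ℝ := pull Ω.lform Ω.sec

/-- The connection form of the bundle of tori `ξ = const` over the base. -/
def conn (x : BasePt) (u : ℂ) : Fin 2 → ℝ := fun i => Ω.beta x ![(0, u), (Pi.single i 1, 0)]

theorem prod_split (e : Fin 2 → ℝ) (u : ℂ) : ((e, u) : BasePt) =
    (0, u) + (e 0 • ((Pi.single 0 1 : Fin 2 → ℝ), (0 : ℂ)) +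
      e 1 • ((Pi.single 1 1 : Fin 2 → ℝ), (0 : ℂ))) := by
  refine Prod.ext (funext fun i => ?_) (by simp)
  fin_cases i <;> simp

theorem beta_horizontal (x : BasePt) (u : ℂ) (e : Fin 2 → ℝ) :
    Ω.beta x ![(0, u), (e, 0)] = dotProduct (Ω.conn x u) e := by
  rw [prod_split e 0, show ((0, 0) : BasePt) = 0 from rfl, zero_add, alt_add_right, alt_smul_right,
    alt_smul_right]
  simp [conn, dotProduct, Fin.sum_univ_two]; ring

theorem beta_vertical {x : BasePt} (h : x.2 ∈ P.reg) (e e' : Fin 2 → ℝ) :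
    Ω.beta x ![(e, 0), (e', 0)] = 0 := by
  have h1 : ∀ e : Fin 2 → ℝ, ∃ c, fderiv ℝ Ω.sec x (e, 0) = dρ c := fun e =>
    ⟨(fderiv ℝ Ω.sec x (e, 0)).1, Prod.ext rfl (Ω.fderiv_sec_snd h _)⟩
  obtain ⟨c, hc⟩ := h1 e
  obtain ⟨c', hc'⟩ := h1 e'
  rw [beta, pull_apply, hc, hc', Ω.lform_dρ_dρ (q := Ω.sec x) h]

/-- The Kähler form in moment-angle coordinates: `β + dξ ∧ dθ`, where `β` is pulled back from `(ξ, b)`. -/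
theorem lform_act {x : LogPt} (h : x ∈ P.logReg) (v v' : LogPt) :
    Ω.lform (Ω.act x) ![fderiv ℝ Ω.act x v, fderiv ℝ Ω.act x v'] =
      Ω.beta (x.1, x.2.2) ![(v.1, v.2.2), (v'.1, v'.2.2)] - dotProduct v.2.1 v'.1 +
        dotProduct v'.2.1 v.1 := by
  have hs : Ω.sec (x.1, x.2.2) ∈ P.logReg := h
  have hd : ∀ (w : BasePt) (c : Fin 2 → ℝ), Ω.lform (Ω.sec (x.1, x.2.2))
      ![fderiv ℝ Ω.sec (x.1, x.2.2) w, dθ c] = dotProduct c w.1 := by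
    intro w c
    rw [lform_dθ Ω hs, Ω.fderiv_lxi_sec (x := (x.1, x.2.2)) h]
    simp [dotProduct, Fin.sum_univ_two]; ring
  rw [Ω.act_eq, Ω.lform_add_dθ hs, Ω.fderiv_act h, Ω.fderiv_act h]
  simp only [alt_add_left, alt_add_right, hd, Ω.lform_dθ_dθ hs]
  rw [alt_swap _ (dθ _), hd, beta, pull_apply]
  ring

theorem contDiffAt_beta {F : Type*} [NormedAddCommGroup F] [NormedSpace ℝ F] {f g k : F → BasePt} {y : F}
    (hy : (k y).2 ∈ P.reg) (hk : ContDiffAt ℝ ∞ k y) (hf : ContDiffAt ℝ ∞ f y)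
    (hg : ContDiffAt ℝ ∞ g y) : ContDiffAt ℝ ∞ (fun y => Ω.beta (k y) ![f y, g y]) y := by
  simp only [beta, lform, pull_apply]
  have h1 : ContDiffAt ℝ ∞ (fun y => Ω.sec (k y)) y := (Ω.contDiffAt_sec hy).comp y hk
  have h2 : ContDiffAt ℝ ∞ (fun y => P.torusPt true (Ω.sec (k y))) y :=
    (contDiff_torusPt true).contDiffAt.comp y h1
  have h3 : ContDiffAt ℝ ∞ (fun y => Ω.form true (P.torusPt true (Ω.sec (k y)))) y :=
    (Ω.contDiffAt_form true (torusPt_mem_of_logReg true hy)).comp y h2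
  have h4 : ContDiffAt ℝ ∞ (fun y => fderiv ℝ (P.torusPt true) (Ω.sec (k y))) y :=
    ((contDiff_torusPt true).fderiv_right (m := ∞) (by norm_cast)).contDiffAt.comp y h1
  have h5 : ContDiffAt ℝ ∞ (fun y => fderiv ℝ Ω.sec (k y)) y :=
    ((Ω.contDiffAt_sec hy).fderiv_right (m := ∞) (by norm_cast)).comp y hk
  exact contDiffAt_alt_apply h3 (h4.clm_apply (h5.clm_apply hf)) (h4.clm_apply (h5.clm_apply hg))

theorem contDiffAt_conn {F : Type*} [NormedAddCommGroup F] [NormedSpace ℝ F] {k : F → BasePt} {w : F → ℂ}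
    {y : F} (hy : (k y).2 ∈ P.reg) (hk : ContDiffAt ℝ ∞ k y) (hw : ContDiffAt ℝ ∞ w y) :
    ContDiffAt ℝ ∞ (fun y => Ω.conn (k y) (w y)) y :=
  contDiffAt_pi.2 fun _ => Ω.contDiffAt_beta hy hk (contDiffAt_const.prodMk hw) contDiffAt_const

theorem conn_smul (x : BasePt) (c : ℝ) (u : ℂ) : Ω.conn x (c • u) = c • Ω.conn x u := by
  funext i
  simp only [conn, Pi.smul_apply, smul_eq_mul]
  rw [← alt_smul_left]; simp

theorem conn_add (x : BasePt) (u u' : ℂ) : Ω.conn x (u + u') = Ω.conn x u + Ω.conn x u' := by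
  funext i
  simp only [conn, Pi.add_apply]
  rw [← alt_add_left]; simp

theorem beta_closed {x : BasePt} (h : x.2 ∈ P.reg) (u v w : BasePt) :
    fderiv ℝ (fun x => Ω.beta x ![v, w]) x u - fderiv ℝ (fun x => Ω.beta x ![u, w]) x v +
      fderiv ℝ (fun x => Ω.beta x ![u, v]) x w = 0 :=
  closed_identity (differentiableAt_pull (Ω.differentiableAt_lform (q := Ω.sec x) h) (Ω.contDiffAt_sec h))
    (extDeriv_pull_eq_zero (Ω.differentiableAt_lform (q := Ω.sec x) h) (Ω.contDiffAt_sec h)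
      (Ω.extDeriv_lform (q := Ω.sec x) h)) u v w

/-- The derivative of the connection form along the fibre is symmetric: parallel transport is
fibrewise symplectic. -/
theorem conn_symm {x : BasePt} (h : x.2 ∈ P.reg) (u : ℂ) (e e' : Fin 2 → ℝ) :
    fderiv ℝ (fun x => dotProduct (Ω.conn x u) e') x (e, 0) =
      fderiv ℝ (fun x => dotProduct (Ω.conn x u) e) x (e', 0) := by
  have h1 := Ω.beta_closed h (0, u) (e, 0) (e', 0)
  have h2 : (fun x => Ω.beta x ![((e, 0) : BasePt), (e', 0)]) =ᶠ[𝓝 x] fun _ => 0 := by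
    filter_upwards [continuous_snd.continuousAt.eventually (P.isOpen_reg.mem_nhds h)] with y hy
    exact Ω.beta_vertical hy _ _
  rw [h2.fderiv_eq] at h1
  simp only [beta_horizontal] at h1
  have h3 : fderiv ℝ (fun _ : BasePt => (0 : ℝ)) x (0, u) = 0 := by simp
  rw [h3] at h1
  linarith

/-- The curvature of the connection is the derivative along the fibre of the area form of the reduced
spaces. -/
theorem conn_curv {x : BasePt} (h : x.2 ∈ P.reg) (u u' : ℂ) (e : Fin 2 → ℝ) :
    fderiv ℝ (fun x => dotProduct (Ω.conn x u) e) x (0, u') -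
      fderiv ℝ (fun x => dotProduct (Ω.conn x u') e) x (0, u) =
      fderiv ℝ (fun x => Ω.beta x ![(0, u), (0, u')]) x (e, 0) := by
  have h1 := Ω.beta_closed h (0, u) (0, u') (e, 0)
  simp only [beta_horizontal] at h1
  linarith

/-! ### The action of the lattice -/

/-- The rate of change of an argument of `v₀` in the direction `u`. -/
def dArg (P : LGParams) (b u : ℂ) : ℝ := (u / (P.crit + b)).im

/-- A branch of the argument of `-v₀` near `b`, with its derivative. -/
theorem _root_.LGParams.exists_arg_branch {b : ℂ} (hb : b ∈ P.reg) {φ₀ : ℝ} (h₀ : P.IsArg φ₀ b) :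
    ∃ (φ : ℂ → ℝ) (φ' : ℂ →L[ℝ] ℝ), φ b = φ₀ ∧ (∀ z, P.nu z ≠ 0 → P.IsArg (φ z) z) ∧
      HasFDerivAt φ φ' b ∧ ∀ u, φ' u = dArg P b u := by
  have hn : P.nu b ≠ 0 := P.nu_ne_zero.2 hb.2
  have hc := P.crit_ne
  have hnb : P.nu b = (P.crit + b) / P.crit := by rw [nu]; field_simp
  have hcb : (P.crit : ℂ) + b ≠ 0 := by
    intro h; rw [hnb, h, zero_div] at hn; exact hn rfl
  have h1 : HasDerivAt (fun z => Complex.log (P.nu z / P.nu b)) (1 / (P.crit + b)) b := by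
    have h2 : HasDerivAt (fun z => P.nu z / P.nu b) ((1 / P.crit) / P.nu b) b := by
      have h3 := (((hasDerivAt_id b).div_const (P.crit : ℂ)).const_add 1).div_const (P.nu b)
      exact h3
    have h4 := h2.clog (by rw [div_self hn]; simp)
    refine h4.congr_deriv ?_
    rw [div_self hn, div_one, hnb]
    field_simp
  have h5 := (h1.hasFDerivAt.restrictScalars ℝ)
  refine ⟨fun z => φ₀ + (Complex.log (P.nu z / P.nu b)).im, _, by simp [div_self hn], ?_,
    (Complex.imCLM.hasFDerivAt.comp b h5).const_add φ₀, ?_⟩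
  · intro z hz
    have hq : P.nu z / P.nu b ≠ 0 := div_ne_zero hz hn
    have e1 := Complex.norm_mul_exp_arg_mul_I (P.nu z / P.nu b)
    have hnn : (‖P.nu b‖ : ℂ) ≠ 0 := by exact_mod_cast norm_ne_zero_iff.2 hn
    rw [norm_div] at e1
    simp only [IsArg, Complex.log_im]
    push_cast at e1 ⊢
    rw [add_mul, Complex.exp_add]
    generalize (P.nu z / P.nu b).arg = α at *
    have e2 : (‖P.nu z‖ : ℂ) * Complex.exp (α * Complex.I) = P.nu z / P.nu b * ‖P.nu b‖ := by
      rw [← e1]; field_simp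
    calc P.nu z = P.nu z / P.nu b * P.nu b := by field_simp
      _ = P.nu z / P.nu b * -(‖P.nu b‖ * Complex.exp (φ₀ * Complex.I)) := congrArg _ h₀
      _ = -(P.nu z / P.nu b * ‖P.nu b‖ * Complex.exp (φ₀ * Complex.I)) := by ring
      _ = _ := by rw [← e2]; ring
  · intro u
    simp [dArg, div_eq_mul_inv]

theorem fderiv_deck {m : Fin 2 → ℤ} {q : LogPt} (hq : q ∈ P.logReg) {φ : ℂ → ℝ} {φ' : ℂ →L[ℝ] ℝ}
    (h : HasFDerivAt φ φ' q.2.2) : DifferentiableAt ℝ (fun x : LogPt => P.deck m (φ x.2.2) x) q := by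
  have hb : DifferentiableAt ℝ (fun x : LogPt => x.2.2) q := by fun_prop
  have hφ : DifferentiableAt ℝ (fun x : LogPt => φ x.2.2) q := h.differentiableAt.comp q hb
  have hn : DifferentiableAt ℝ (fun x : LogPt => P.nu x.2.2) q := differentiableAt_nu.comp q hb
  have hl : DifferentiableAt ℝ (fun x : LogPt => Real.log ‖P.nu x.2.2‖) q :=
    (hn.norm ℝ (P.nu_ne_zero.2 hq.2)).log (norm_ne_zero_iff.2 (P.nu_ne_zero.2 hq.2))
  unfold deck
  refine DifferentiableAt.prodMk ?_ (DifferentiableAt.prodMk ?_ hb)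
  · rw [differentiableAt_pi]; intro j; fun_prop
  · rw [differentiableAt_pi]; intro j; fun_prop

theorem deck_act {x : LogPt} (h : x ∈ P.logReg) (m : Fin 2 → ℤ) (φ : ℝ) :
    P.deck m φ (Ω.act x) =
      Ω.act (x.1 + latt m, fun j => x.2.1 j - φ / (2 * Real.pi) * m j, x.2.2) :=
  Prod.ext (Ω.radii_add_latt (ξ := x.1) h m).symm rfl

/-- The change of `β` under the lattice. The action of `m` carries the section `θ = 0` to the section
`θ = -φ m / 2π`, where `φ` is an argument of `-v₀`; this adds the terms with `dφ`. -/
theorem beta_add_latt {x : BasePt} (h : x.2 ∈ P.reg) (m : Fin 2 → ℤ) (v v' : BasePt) :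
    Ω.beta x ![v, v'] = Ω.beta (x.1 + latt m, x.2) ![v, v'] +
      dArg P x.2 v.2 / (2 * Real.pi) * dotProduct (fun j => (m j : ℝ)) v'.1 -
      dArg P x.2 v'.2 / (2 * Real.pi) * dotProduct (fun j => (m j : ℝ)) v.1 := by
  obtain ⟨φ₀, h₀⟩ := P.exists_isArg x.2
  obtain ⟨φ, φ', hφb, hφ, hd, hφ'⟩ := exists_arg_branch h h₀
  let D : LogPt → LogPt := fun x => P.deck m (φ x.2.2) x
  have hs : Ω.sec x ∈ P.logReg := h
  have hD : DifferentiableAt ℝ D (Ω.sec x) := fderiv_deck hs hd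
  have e1 : ∀ᶠ y in 𝓝 (Ω.sec x), P.trans true true m (P.torusPt true y) = P.torusPt true (D y) := by
    filter_upwards [P.isOpen_logReg.mem_nhds hs] with y hy
    exact trans_torusPt hy.2 (hφ _ (P.nu_ne_zero.2 hy.2))
  have e2 := Ω.form_of_trans hs hD e1 (fderiv ℝ Ω.sec x v) (fderiv ℝ Ω.sec x v')
  rw [Ω.form_torusPt true hs, Ω.form_torusPt true (q := D (Ω.sec x)) hs] at e2
  let K : BasePt → LogPt := fun y => (y.1 + latt m, fun j => 0 - φ y.2 / (2 * Real.pi) * m j, y.2)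
  have e3 : D ∘ Ω.sec =ᶠ[𝓝 x] Ω.act ∘ K := by
    filter_upwards [continuous_snd.continuousAt.eventually (P.isOpen_reg.mem_nhds h)] with y hy
    exact Ω.deck_act (x := (y.1, 0, y.2)) hy m (φ y.2)
  have hK : HasFDerivAt K ((ContinuousLinearMap.fst ℝ (Fin 2 → ℝ) ℂ).prod
      ((ContinuousLinearMap.pi fun j => -((m j : ℝ) / (2 * Real.pi)) •
        φ'.comp (ContinuousLinearMap.snd ℝ (Fin 2 → ℝ) ℂ)).prod
        (ContinuousLinearMap.snd ℝ (Fin 2 → ℝ) ℂ))) x := by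
    refine (hasFDerivAt_fst.add_const _).prodMk (HasFDerivAt.prodMk ?_ hasFDerivAt_snd)
    rw [hasFDerivAt_pi]
    intro j
    have h6 : HasFDerivAt (fun y : BasePt => φ y.2)
      (φ'.comp (ContinuousLinearMap.snd ℝ (Fin 2 → ℝ) ℂ)) x := hd.comp x hasFDerivAt_snd
    have h7 := h6.const_mul (-((m j : ℝ) / (2 * Real.pi)))
    refine h7.congr_of_eventuallyEq (Eventually.of_forall fun y => ?_)
    ring
  have hKm : K x ∈ P.logReg := h
  have e4 := e3.fderiv_eq (𝕜 := ℝ)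
  rw [fderiv_comp x hD ((Ω.contDiffAt_sec h).differentiableAt (by simp)),
    fderiv_comp x ((Ω.contDiffAt_act hKm).differentiableAt (by simp)) hK.differentiableAt,
    hK.fderiv] at e4
  have e5 : ∀ w, fderiv ℝ D (Ω.sec x) (fderiv ℝ Ω.sec x w) = _ :=
    fun w => congrArg (fun L : BasePt →L[ℝ] LogPt => L w) e4
  rw [e5, e5, show D (Ω.sec x) = Ω.act (K x) from e3.self_of_nhds,
    ContinuousLinearMap.comp_apply, ContinuousLinearMap.comp_apply, Ω.lform_act hKm] at e2
  have hb : Ω.beta x ![v, v'] =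
      Ω.lform (Ω.sec x) ![fderiv ℝ Ω.sec x v, fderiv ℝ Ω.sec x v'] := pull_apply _ _ _ _ _
  rw [hb, ← e2]
  simp [K, hφ', dotProduct, Fin.sum_univ_two]
  ring

theorem conn_add_latt {ξ : Fin 2 → ℝ} {b : ℂ} (h : b ∈ P.reg) (m : Fin 2 → ℤ) (u : ℂ) :
    Ω.conn (ξ + latt m, b) u = fun j => Ω.conn (ξ, b) u j - dArg P b u / (2 * Real.pi) * m j := by
  funext j
  have := Ω.beta_add_latt (x := (ξ, b)) h m (0, u) (Pi.single j 1, 0)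
  simp only [conn]
  rw [this]
  simp

/-- The area form of the reduced spaces is invariant under the lattice. -/
theorem area_add_latt {ξ : Fin 2 → ℝ} {b : ℂ} (h : b ∈ P.reg) (m : Fin 2 → ℤ) (u u' : ℂ) :
    Ω.beta (ξ + latt m, b) ![(0, u), (0, u')] = Ω.beta (ξ, b) ![(0, u), (0, u')] := by
  have := Ω.beta_add_latt (x := (ξ, b)) h m (0, u) (0, u')
  simp at this
  exact this.symm

end ToricKaehler

theorem eq_of_hasDerivWithinAt_zero {F : Type*} [NormedAddCommGroup F] [NormedSpace ℝ F] {f : ℝ → F}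
    {s : Set ℝ} (hs : Convex ℝ s) (h : ∀ x ∈ s, HasDerivWithinAt f 0 s x) {x y : ℝ} (hx : x ∈ s)
    (hy : y ∈ s) : f x = f y := by
  have := hs.norm_image_sub_le_of_norm_hasDerivWithin_le (C := 0) h (fun _ _ => by simp) hx hy
  rw [zero_mul, norm_le_zero_iff, sub_eq_zero] at this
  exact this.symm

namespace ToricKaehler

open LGParams

variable {P : LGParams} (Ω : ToricKaehler P)

/-! ### Points of `Y` in moment-angle coordinates -/

/-- The point of `Y` with moment map `ξ`, angles `θ` and base point `b`. -/
def pt (x : LogPt) : P.Y := P.toY (Ω.act x)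

theorem W_pt {x : LogPt} (h : x ∈ P.logReg) : P.W (Ω.pt x) = x.2.2 := W_toY (q := Ω.act x) h.1

theorem isLift_pt (s : Bool) {x : LogPt} (h : x ∈ P.logReg) :
    P.IsLift s (P.torusPt s (Ω.act x)) (Ω.pt x) := isLift_toY s (q := Ω.act x) h

theorem toY_eq_pt {q : LogPt} (h : q ∈ P.logReg) : P.toY q = Ω.pt (Ω.mom q) := by
  rw [pt, Ω.act_mom h]

theorem exists_pt {p : P.Y} (h : P.W p ≠ -(P.crit : ℂ)) : ∃ x ∈ P.logReg, Ω.pt x = p := by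
  obtain ⟨q, hq, rfl⟩ := exists_toY h
  exact ⟨Ω.mom q, hq, (Ω.toY_eq_pt hq).symm⟩

theorem pt_eq_pt_iff {x x' : LogPt} {φ : ℝ} (h : x ∈ P.logReg) (h' : x' ∈ P.logReg)
    (hφ : P.IsArg φ x.2.2) : Ω.pt x = Ω.pt x' ↔ ∃ m n : Fin 2 → ℤ,
      x' = (x.1 + latt m, fun j => x.2.1 j - φ / (2 * Real.pi) * m j + n j, x.2.2) := by
  rw [pt, pt, toY_eq_toY_iff (q := Ω.act x) (q' := Ω.act x') h h' hφ]
  refine exists_congr fun m => exists_congr fun n => ?_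
  rw [Ω.deck_act h]
  constructor
  · intro h1
    have h2 := congrArg Ω.mom h1
    rw [Ω.mom_act h'] at h2
    rw [h2]
    exact Ω.mom_act (x := (x.1 + latt m, fun j => x.2.1 j - φ / (2 * Real.pi) * m j + n j, x.2.2)) h
  · rintro rfl; rfl

theorem pt_add_latt {ξ θ : Fin 2 → ℝ} {b : ℂ} {φ : ℝ} (h : b ∈ P.reg) (hφ : P.IsArg φ b)
    (m n : Fin 2 → ℤ) :
    Ω.pt (ξ + latt m, fun j => θ j - φ / (2 * Real.pi) * m j + n j, b) = Ω.pt (ξ, θ, b) :=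
  ((Ω.pt_eq_pt_iff (x := (ξ, θ, b)) h h hφ).2 ⟨m, n, rfl⟩).symm

theorem latt_zero : latt 0 = 0 := by funext i; fin_cases i <;> simp [latt, matM]

theorem pt_add_int {ξ θ : Fin 2 → ℝ} {b : ℂ} (h : b ∈ P.reg) (n : Fin 2 → ℤ) :
    Ω.pt (ξ, fun j => θ j + n j, b) = Ω.pt (ξ, θ, b) := by
  obtain ⟨φ, hφ⟩ := P.exists_isArg b
  simpa [latt_zero] using Ω.pt_add_latt (ξ := ξ) (θ := θ) h hφ 0 n

theorem latt_injective : Function.Injective latt := fun m m' h => by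
  have := congrArg invM h
  rw [invM_latt, invM_latt] at this
  funext j
  exact_mod_cast congrFun this j

theorem pt_eq_iff_of_xi {ξ θ θ' : Fin 2 → ℝ} {b : ℂ} (h : b ∈ P.reg) :
    Ω.pt (ξ, θ, b) = Ω.pt (ξ, θ', b) ↔ ∃ n : Fin 2 → ℤ, θ' = fun j => θ j + n j := by
  obtain ⟨φ, hφ⟩ := P.exists_isArg b
  rw [Ω.pt_eq_pt_iff (x := (ξ, θ, b)) (x' := (ξ, θ', b)) h h hφ]
  constructor
  · rintro ⟨m, n, hmn⟩
    have h1 : ξ = ξ + latt m := congrArg Prod.fst hmn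
    have h2 : m = 0 := latt_injective (by rw [latt_zero]; exact left_eq_add.1 h1)
    subst h2
    refine ⟨n, ?_⟩
    have h3 := congrArg (fun x : LogPt => x.2.1) hmn
    simpa using h3
  · rintro ⟨n, rfl⟩
    exact ⟨0, n, by simp [latt_zero]⟩

theorem hasCoord_iff {p : P.Y} {a θ : Fin 2 → ℝ} :
    Ω.HasCoord p a θ ↔ p = Ω.pt (matM a, θ, -(P.S : ℂ)) := by
  have hS := P.neg_S_mem_reg
  constructor
  · rintro ⟨hW, s, y, hy, hxi, hθ⟩
    have hv : v0 y ≠ 0 := by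
      rw [Wc_eq.1 (hy.W_eq.symm.trans hW)]; exact P.nu_ne_zero.2 hS.2
    have hne := fun j : Fin 2 => ne_zero_of_v0 hv j.succ
    set q : LogPt := (fun j => -(sgn s : ℝ) * Real.log ‖y j.succ‖, θ, -(P.S : ℂ)) with hq
    have hqy : P.torusPt s q = y := by
      refine C3_ext (fun j => ?_) (torusPt_succ_ne s _) ?_
      · rw [torusPt_succ, hθ j]
        have h1 : (‖y j.succ‖ : ℂ) = Complex.exp (Real.log ‖y j.succ‖) := by
          rw [← Complex.ofReal_exp, Real.exp_log (norm_pos_iff.2 (hne j))]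
        conv_rhs => rw [h1]
        rw [← Complex.exp_add]
        congr 1
        simp only [LogPt.z, hq]
        push_cast
        linear_combination (Real.log ‖y j.succ‖ : ℂ) * sgn_cast_mul_self (R := ℂ) s
      · rw [v0_torusPt, Wc_eq.1 (hy.W_eq.symm.trans hW)]
    have hqr : q ∈ P.logReg := hS
    rw [← hqy] at hy hxi
    rw [hy.eq_toY hS.2, Ω.toY_eq_pt hqr, mom, ← Ω.xi_torusPt s hqr, hxi]
  · rintro rfl
    refine ⟨Ω.W_pt hS, true, _, Ω.isLift_pt true hS, ?_, fun i => ?_⟩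
    · rw [Ω.xi_torusPt true (q := Ω.act (matM a, θ, -(P.S : ℂ))) hS]
      exact congrArg Prod.fst (Ω.mom_act (x := (matM a, θ, -(P.S : ℂ))) hS)
    · rw [torusPt_succ, Complex.norm_exp, Complex.ofReal_exp, ← Complex.exp_add]
      congr 1
      simp [LogPt.z, act, sgn]
      ring

theorem mem_ell {k : ℤ} {p : P.Y} :
    p ∈ Ω.ell k ↔ ∃ ξ, p = Ω.pt (ξ, fun j => -(k : ℝ) * invM ξ j, -(P.S : ℂ)) := by
  constructor
  · rintro ⟨a, ha⟩
    exact ⟨matM a, by rw [invM_matM]; exact Ω.hasCoord_iff.1 ha⟩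
  · rintro ⟨ξ, hξ⟩
    exact ⟨invM ξ, Ω.hasCoord_iff.2 (by rw [matM_invM]; exact hξ)⟩

/-! ### Parallel transport -/

/-- A differentiable curve in the dense torus has logarithms of its coordinates near each time. -/
theorem _root_.LGParams.exists_log_lift {s : Bool} {F : ℝ → C3} {d : C3} {I : Set ℝ} {τ : ℝ}
    (hF : HasDerivWithinAt F d I τ) (hv : v0 (F τ) ≠ 0) :
    ∃ q : ℝ → LogPt, DifferentiableWithinAt ℝ q I τ ∧ P.torusPt s (q τ) = F τ ∧
      ∀ᶠ x in 𝓝[I] τ, P.torusPt s (q x) = F x := by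
  have hne := fun j : Fin 2 => ne_zero_of_v0 hv j.succ
  let z : ℝ → Fin 2 → ℂ := fun x j =>
    (P.logPt s (F τ)).z j - (sgn s : ℂ) * Complex.log (F x j.succ / F τ j.succ)
  have hpi : (Real.pi : ℂ) ≠ 0 := by exact_mod_cast Real.pi_ne_zero
  let q : ℝ → LogPt := fun x => (fun j => (z x j).re, fun j => (z x j).im / (2 * Real.pi), P.Wc (F x))
  have hz : ∀ x j, (q x).z j = z x j := by
    intro x j
    simp only [LogPt.z, q]
    conv_rhs => rw [← Complex.re_add_im (z x j)]
    push_cast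
    field_simp
  have key : ∀ x, (∀ j : Fin 2, F x j.succ ≠ 0) → P.torusPt s (q x) = F x := by
    intro x hx
    refine C3_ext (fun j => ?_) (torusPt_succ_ne s _) ?_
    · have h1 : -((sgn s : ℂ) * z x j) = Complex.log (F τ j.succ) +
          Complex.log (F x j.succ / F τ j.succ) := by
        have hs := sgn_cast_mul_self (R := ℂ) s
        simp only [z, z_logPt]
        linear_combination (Complex.log (F τ j.succ) +
          Complex.log (F x j.succ / F τ j.succ)) * hs
      rw [torusPt_succ, hz, h1, Complex.exp_add, Complex.exp_log (hne j),
        Complex.exp_log (div_ne_zero (hx j) (hne j))]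
      field_simp [hne j]
    · rw [v0_torusPt]; exact (Wc_eq.1 rfl).symm
  have hFk : ∀ k, HasDerivWithinAt (fun x => F x k) (d k) I τ := hasDerivWithinAt_pi.1 hF
  refine ⟨q, ?_, key τ hne, ?_⟩
  · have hzd : ∀ j, DifferentiableWithinAt ℝ (fun x => z x j) I τ := by
      intro j
      have h1 : DifferentiableWithinAt ℝ (fun x => F x j.succ / F τ j.succ) I τ :=
        (hFk j.succ).differentiableWithinAt.div_const _
      have h2 := (h1.hasDerivWithinAt.clog_real (by rw [div_self (hne j)]; simp)).differentiableWithinAt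
      exact (h2.const_mul _).const_sub _
    have hW : DifferentiableWithinAt ℝ (fun x => P.Wc (F x)) I τ := by
      have h1 : Differentiable ℝ P.Wc := by unfold Wc v0; fun_prop
      exact (h1 _).comp_differentiableWithinAt τ hF.differentiableWithinAt
    refine DifferentiableWithinAt.prodMk ?_ (DifferentiableWithinAt.prodMk ?_ hW)
    · rw [differentiableWithinAt_pi]
      intro j
      exact (Complex.reCLM.differentiable _).comp_differentiableWithinAt τ (hzd j)
    · rw [differentiableWithinAt_pi]
      intro j
      exact ((Complex.imCLM.differentiable _).comp_differentiableWithinAt τ (hzd j)).div_const _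
  · have h1 : ∀ j : Fin 2, ∀ᶠ x in 𝓝[I] τ, F x j.succ ≠ 0 := fun j =>
      (hFk j.succ).continuousWithinAt.eventually_ne (hne j)
    filter_upwards [h1 0, h1 1] with x h0 h1
    exact key x fun j => by fin_cases j; exacts [h0, h1]

/-- A horizontal curve in `Y` is locally given by a curve in moment-angle coordinates, along which the
moment map has derivative zero and the angles change according to the connection form. -/
theorem horizontal_local {s : Bool} {F : ℝ → C3} {d : C3} {I : Set ℝ} {τ : ℝ} {c : ℝ → P.Y}
    (hτ : τ ∈ I) (hI : UniqueDiffWithinAt ℝ I τ) (hW : P.W (c τ) ≠ -(P.crit : ℂ))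
    (hl : ∀ᶠ x in 𝓝[I] τ, P.IsLift s (F x) (c x)) (hF : HasDerivWithinAt F d I τ)
    (hd : ∀ v, fderiv ℝ v0 (F τ) v = 0 → Ω.form s (F τ) ![d, v] = 0) :
    ∃ (x : ℝ → LogPt) (u : ℂ), x τ ∈ P.logReg ∧
      HasDerivWithinAt x (0, Ω.conn ((x τ).1, (x τ).2.2) u, u) I τ ∧
      ∀ᶠ r in 𝓝[I] τ, x r ∈ P.logReg ∧ c r = Ω.pt (x r) := by
  have hlτ := hl.self_of_nhdsWithin hτ
  have hv : v0 (F τ) ≠ 0 := by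
    rw [Wc_eq.1 hlτ.W_eq.symm]; exact P.nu_ne_zero.2 hW
  obtain ⟨q, hq, hqτ, hqF⟩ := exists_log_lift (P := P) (s := s) hF hv
  have hb : (q τ).2.2 = P.W (c τ) := by rw [hlτ.W_eq, ← hqτ, Wc_torusPt]
  have hqr : q τ ∈ P.logReg := ⟨by rw [hb]; exact norm_W_lt _, by rw [hb]; exact hW⟩
  have hev : ∀ᶠ r in 𝓝[I] τ, q r ∈ P.logReg :=
    hq.continuousWithinAt.eventually (P.isOpen_logReg.mem_nhds hqr)
  set x : ℝ → LogPt := fun r => Ω.mom (q r) with hx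
  have hxd : DifferentiableWithinAt ℝ x I τ :=
    ((Ω.contDiffAt_mom hqr).differentiableAt (by simp)).comp_differentiableWithinAt τ hq
  have hxτ : x τ ∈ P.logReg := hqr
  have hxev : ∀ᶠ r in 𝓝[I] τ, x r ∈ P.logReg ∧ c r = Ω.pt (x r) := by
    filter_upwards [hev, hqF, hl] with r h1 h2 h3
    refine ⟨h1, ?_⟩
    rw [← h2] at h3
    rw [h3.eq_toY h1.2, Ω.toY_eq_pt h1]
  obtain ⟨x', hx'⟩ : ∃ x', HasDerivWithinAt x x' I τ := ⟨_, hxd.hasDerivWithinAt⟩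
  have hFd : HasDerivWithinAt F
      (fderiv ℝ (P.torusPt s) (Ω.act (x τ)) (fderiv ℝ Ω.act (x τ) x')) I τ := by
    have h1 := ((Ω.contDiffAt_act hxτ).differentiableAt (by simp)).hasFDerivAt.comp_hasDerivWithinAt τ hx'
    have h2 := (differentiable_torusPt (P := P) s _).hasFDerivAt.comp_hasDerivWithinAt τ h1
    refine h2.congr_of_eventuallyEq ?_ ?_
    · filter_upwards [hev, hqF] with r h3 h4
      simp only [Function.comp, hx, Ω.act_mom h3, h4]
    · simp only [Function.comp, hx, Ω.act_mom hqr, hqτ]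
  have hdd : d = _ := hI.eq_deriv _ hF hFd
  have hFτ : F τ = P.torusPt s (Ω.act (x τ)) := by rw [hx, Ω.act_mom hqr, hqτ]
  have hor : ∀ e c : Fin 2 → ℝ, Ω.beta ((x τ).1, (x τ).2.2) ![(x'.1, x'.2.2), (e, 0)] -
      dotProduct x'.2.1 e + dotProduct c x'.1 = 0 := by
    intro e c
    have h1 := hd (fderiv ℝ (P.torusPt s) (Ω.act (x τ)) (fderiv ℝ Ω.act (x τ) (e, c, 0))) (by
      rw [hFτ, fderiv_v0_torusPt, Ω.fderiv_act hxτ]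
      simp [Ω.fderiv_sec_snd (x := ((x τ).1, (x τ).2.2)) hxτ, dθ])
    rw [hdd, hFτ, Ω.form_torusPt s (Ω.act_mem hxτ), Ω.lform_act hxτ] at h1
    exact h1
  have hx1 : x'.1 = 0 := by
    have h1 := hor 0 x'.1
    rw [show ((0, 0) : BasePt) = 0 from rfl, alt_zero_right] at h1
    simp only [dotProduct_zero, sub_zero, zero_add] at h1
    exact dotProduct_self_eq_zero.1 h1
  have hx2 : x'.2.1 = Ω.conn ((x τ).1, (x τ).2.2) x'.2.2 := by
    funext j
    have h1 := hor (Pi.single j 1) 0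
    rw [hx1, Ω.beta_horizontal] at h1
    simp at h1
    linarith
  refine ⟨x, x'.2.2, hxτ, ?_, hxev⟩
  rw [← hx1, ← hx2]
  exact hx'

/-- The change of the angles under parallel transport along the path `γ` from time `a` to time `b`. -/
def hol (γ : ℝ → ℂ) (a b : ℝ) (ξ : Fin 2 → ℝ) : Fin 2 → ℝ :=
  ∫ τ in a..b, Ω.conn (ξ, γ τ) (deriv γ τ)

theorem continuousOn_conn_path {γ : ℝ → ℂ} (hγ : ContDiff ℝ ∞ γ) (ξ : Fin 2 → ℝ) :
    ContinuousOn (fun τ => Ω.conn (ξ, γ τ) (deriv γ τ)) {τ | γ τ ∈ P.reg} := by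
  intro τ hτ
  have h1 : ContDiff ℝ ∞ (deriv γ) := (contDiff_infty_iff_deriv.1 hγ).2
  exact (Ω.contDiffAt_conn (k := fun τ => (ξ, γ τ)) hτ (contDiffAt_const.prodMk hγ.contDiffAt)
    h1.contDiffAt).continuousAt.continuousWithinAt

theorem hasDerivAt_hol {γ : ℝ → ℂ} (hγ : ContDiff ℝ ∞ γ) (ξ : Fin 2 → ℝ) {a τ : ℝ}
    (h : ∀ r ∈ uIcc a τ, γ r ∈ P.reg) :
    HasDerivAt (fun τ => Ω.hol γ a τ ξ) (Ω.conn (ξ, γ τ) (deriv γ τ)) τ := by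
  have hc := Ω.continuousOn_conn_path hγ ξ
  have hO : IsOpen {τ | γ τ ∈ P.reg} := P.isOpen_reg.preimage hγ.continuous
  have hτ : γ τ ∈ P.reg := h τ right_mem_uIcc
  exact intervalIntegral.integral_hasDerivAt_right (hc.mono h).intervalIntegrable
    (hc.stronglyMeasurableAtFilter hO τ hτ) (hc.continuousAt (hO.mem_nhds hτ))

theorem uIcc_left_subset {a b τ : ℝ} (h : τ ∈ uIcc a b) : uIcc a τ ⊆ uIcc a b :=
  uIcc_subset_uIcc left_mem_uIcc h

/-- The horizontal lifts of a path: `ξ` is constant, and the angles are moved by `hol`. -/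
theorem isHorizontal_pt {γ : ℝ → ℂ} (hγ : ContDiff ℝ ∞ γ) {a b : ℝ} (h : ∀ r ∈ uIcc a b, γ r ∈ P.reg)
    (ξ θ : Fin 2 → ℝ) :
    Ω.IsHorizontal γ (uIcc a b) fun τ => Ω.pt (ξ, θ + Ω.hol γ a τ ξ, γ τ) := by
  intro τ hτ
  set x : ℝ → LogPt := fun τ => (ξ, θ + Ω.hol γ a τ ξ, γ τ) with hx
  have hxτ : x τ ∈ P.logReg := h τ hτ
  refine ⟨Ω.W_pt hxτ, true, fun r => P.torusPt true (Ω.act (x r)),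
    fderiv ℝ (P.torusPt true) (Ω.act (x τ))
      (fderiv ℝ Ω.act (x τ) (0, Ω.conn (ξ, γ τ) (deriv γ τ), deriv γ τ)), ?_, ?_, ?_⟩
  · filter_upwards [self_mem_nhdsWithin] with r hr
    exact Ω.isLift_pt true (x := x r) (h r hr)
  · have h1 : HasDerivAt x (0, Ω.conn (ξ, γ τ) (deriv γ τ), deriv γ τ) τ :=
      (hasDerivAt_const _ _).prodMk
        (((Ω.hasDerivAt_hol hγ ξ fun r hr => h r (uIcc_left_subset hτ hr)).const_add θ).prodMk
          ((hγ.differentiable (by simp)) τ).hasDerivAt)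
    have h2 := ((Ω.contDiffAt_act hxτ).differentiableAt (by simp)).hasFDerivAt.comp_hasDerivAt τ h1
    exact ((differentiable_torusPt (P := P) true _).hasFDerivAt.comp_hasDerivAt τ h2).hasDerivWithinAt
  · intro v hv
    obtain ⟨w, rfl⟩ := exists_fderiv_torusPt_eq (P := P) true (q := Ω.act (x τ)) v
    have hw : w.2.2 = 0 := by
      rw [fderiv_v0_torusPt, div_eq_zero_iff] at hv
      exact hv.resolve_right P.crit_ne
    have h3 := Ω.act_mom_fderiv (Ω.act_mem hxτ) w
    rw [Ω.mom_act hxτ, Ω.fderiv_mom (Ω.act_mem hxτ)] at h3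
    rw [← h3, Ω.form_torusPt true (Ω.act_mem hxτ), Ω.lform_act hxτ, hw]
    simp only [hx, Ω.beta_horizontal]
    simp

end ToricKaehler

/-- The point of the circle with the angle `2πx`. -/
def unitExp (x : ℝ) : ℂ := Complex.exp (2 * Real.pi * Complex.I * (x : ℂ))

theorem unitExp_eq_iff {x y : ℝ} : unitExp x = unitExp y ↔ ∃ n : ℤ, y = x + n := by
  rw [unitExp, unitExp, eq_comm, Complex.exp_eq_exp_iff_exists_int]
  refine exists_congr fun n => ?_
  have h := Complex.two_pi_I_ne_zero
  constructor
  · intro h1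
    have h2 : (y : ℂ) = x + n := mul_left_cancel₀ h (by rw [h1]; ring)
    exact_mod_cast h2
  · rintro rfl
    push_cast; ring

theorem unitExp_add_int (x : ℝ) (n : ℤ) : unitExp (x + n) = unitExp x :=
  (unitExp_eq_iff.2 ⟨n, rfl⟩).symm

theorem hasDerivWithinAt_unitExp {f : ℝ → ℝ} {f' : ℝ} {I : Set ℝ} {τ : ℝ}
    (h : HasDerivWithinAt f f' I τ) : HasDerivWithinAt (fun r => unitExp (f r))
      (unitExp (f τ) * (2 * Real.pi * Complex.I * (f' : ℂ))) I τ :=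
  (h.ofReal_comp.const_mul _).cexp

theorem exists_vec_int {x y : Fin 2 → ℝ} (h : ∀ j, unitExp (x j) = unitExp (y j)) :
    ∃ n : Fin 2 → ℤ, y = fun j => x j + n j := by
  choose n hn using fun j => unitExp_eq_iff.1 (h j)
  exact ⟨n, funext hn⟩

namespace ToricKaehler

open LGParams

variable {P : LGParams} (Ω : ToricKaehler P)

/-- The image of the moment map in the torus `ℝ² / Mℤ²`, in terms of `M⁻¹ξ`. -/
def fibXi (p : P.Y) (j : Fin 2) : ℂ :=
  open Classical in if h : P.W p ≠ -(P.crit : ℂ) then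
    unitExp (invM (Ω.exists_pt h).choose.1 j) else 0

theorem fibXi_pt {x : LogPt} (hx : x ∈ P.logReg) (j : Fin 2) :
    Ω.fibXi (Ω.pt x) j = unitExp (invM x.1 j) := by
  have h : P.W (Ω.pt x) ≠ -(P.crit : ℂ) := by rw [Ω.W_pt hx]; exact hx.2
  obtain ⟨φ, hφ⟩ := P.exists_isArg x.2.2
  rw [fibXi, dif_pos h]
  have hs := (Ω.exists_pt h).choose_spec
  obtain ⟨m, n, hmn⟩ := (Ω.pt_eq_pt_iff hx hs.1 hφ).1 hs.2.symm
  rw [hmn, invM_add, invM_latt]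
  exact unitExp_add_int _ _

theorem eq_add_latt {ξ ξ' : Fin 2 → ℝ} (h : ∀ j, unitExp (invM ξ j) = unitExp (invM ξ' j)) :
    ∃ m, ξ' = ξ + latt m := by
  obtain ⟨m, hm⟩ := exists_vec_int h
  refine ⟨m, ?_⟩
  have := congrArg matM hm
  rw [matM_invM] at this
  rw [this, show (fun j => invM ξ j + (m j : ℝ)) = invM ξ + fun j => (m j : ℝ) from rfl, matM_add,
    matM_invM]
  rfl

theorem exists_pt_of_fibXi {p : P.Y} {ξ : Fin 2 → ℝ} (hp : P.W p ≠ -(P.crit : ℂ))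
    (h : ∀ j, Ω.fibXi p j = unitExp (invM ξ j)) : ∃ θ, p = Ω.pt (ξ, θ, P.W p) := by
  obtain ⟨x, hx, rfl⟩ := Ω.exists_pt hp
  rw [Ω.W_pt hx]
  obtain ⟨m, hm⟩ := eq_add_latt fun j => ((h j).symm.trans (Ω.fibXi_pt hx j))
  obtain ⟨φ, hφ⟩ := P.exists_isArg x.2.2
  refine ⟨fun j => x.2.1 j + φ / (2 * Real.pi) * m j, ?_⟩
  rw [← Ω.pt_add_latt (φ := φ) (ξ := ξ) hx hφ m 0]
  congr 1
  exact Prod.ext hm (Prod.ext (by funext j; simp) rfl)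

theorem eventually_eq_add_latt {ξ : Fin 2 → ℝ} {X : Type*} {l : Filter X} {f : X → Fin 2 → ℝ}
    {m : Fin 2 → ℤ} (hf : Tendsto f l (𝓝 (ξ + latt m)))
    (h : ∀ᶠ r in l, ∃ n, f r = ξ + latt n) : ∀ᶠ r in l, f r = ξ + latt m := by
  have h1 : Tendsto (fun r => invM (f r)) l (𝓝 (invM (ξ + latt m))) :=
    (continuous_invM.tendsto _).comp hf
  filter_upwards [h, Metric.tendsto_nhds.1 h1 1 one_pos] with r ⟨n, hn⟩ hr
  rw [hn, invM_add, invM_add, invM_latt, invM_latt, dist_add_left] at hr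
  have : n = m := funext fun j => by
    have h2 := (dist_le_pi_dist (fun j => (n j : ℝ)) (fun j => (m j : ℝ)) j).trans_lt hr
    rw [Int.dist_cast_real, Int.dist_eq] at h2
    have h3 : |n j - m j| < 1 := by exact_mod_cast h2
    have h4 := Int.abs_lt_one_iff.1 h3
    omega
  rw [hn, this]

/-- A horizontal curve is the lift described by `hol`. The curve has only local logarithmic coordinates,
which differ by deck transformations; what is defined globally are points of the circle, whose derivatives
vanish. -/
theorem horizontal_unique {γ : ℝ → ℂ} (hγ : ContDiff ℝ ∞ γ) {a b : ℝ}
    (h : ∀ r ∈ uIcc a b, γ r ∈ P.reg) {c : ℝ → P.Y} (hc : Ω.IsHorizontal γ (uIcc a b) c)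
    {ξ θ : Fin 2 → ℝ} (h0 : c a = Ω.pt (ξ, θ, γ a)) :
    c b = Ω.pt (ξ, θ + Ω.hol γ a b ξ, γ b) := by
  rcases eq_or_ne a b with rfl | hab
  · simpa [hol] using h0
  have hI : UniqueDiffOn ℝ (uIcc a b) :=
    uniqueDiffOn_convex (convex_uIcc a b) (by
      rw [uIcc, interior_Icc]; exact nonempty_Ioo.2 (by simpa using hab.symm))
  have hW : ∀ τ ∈ uIcc a b, P.W (c τ) ≠ -(P.crit : ℂ) := fun τ hτ => by
    rw [(hc τ hτ).1]; exact (h τ hτ).2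
  have hloc : ∀ τ ∈ uIcc a b, ∃ (x : ℝ → LogPt) (u : ℂ), x τ ∈ P.logReg ∧
      HasDerivWithinAt x (0, Ω.conn ((x τ).1, (x τ).2.2) u, u) (uIcc a b) τ ∧
      ∀ᶠ r in 𝓝[uIcc a b] τ, x r ∈ P.logReg ∧ c r = Ω.pt (x r) := fun τ hτ => by
    obtain ⟨_, s, F, d, h1, h2, h3⟩ := hc τ hτ
    exact Ω.horizontal_local hτ (hI τ hτ) (hW τ hτ) h1 h2 h3
  have ha : a ∈ uIcc a b := left_mem_uIcc
  -- the moment map, modulo the lattice, is constant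
  have p1 : ∀ τ ∈ uIcc a b, ∀ j, Ω.fibXi (c τ) j = unitExp (invM ξ j) := by
    intro τ hτ j
    have h1 : ∀ τ ∈ uIcc a b, HasDerivWithinAt (fun τ => Ω.fibXi (c τ) j) 0 (uIcc a b) τ := by
      intro τ hτ
      obtain ⟨x, u, hxτ, hx, hev⟩ := hloc τ hτ
      have h2 : HasDerivWithinAt (fun r => (x r).1) 0 (uIcc a b) τ := hx.fst
      have h3 : HasDerivWithinAt (fun r => invM (x r).1 j) 0 (uIcc a b) τ := by
        have e : ∀ j, HasDerivWithinAt (fun r => (x r).1 j) 0 (uIcc a b) τ := hasDerivWithinAt_pi.1 h2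
        have e0 := e 0
        have e1 := e 1
        fin_cases j
        · simpa [invM] using ((e0.const_mul 2).sub e1).div_const 3
        · simpa [invM] using ((e1.const_mul 2).sub e0).div_const 3
      have h4 := hasDerivWithinAt_unitExp h3
      simp only [Complex.ofReal_zero, mul_zero] at h4
      refine h4.congr_of_eventuallyEq ?_ ?_
      · filter_upwards [hev] with r hr
        rw [hr.2, Ω.fibXi_pt hr.1]
      · rw [(hev.self_of_nhdsWithin hτ).2, Ω.fibXi_pt hxτ]
    have h2 := eq_of_hasDerivWithinAt_zero (convex_uIcc a b) h1 hτ ha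
    rw [h2, h0, Ω.fibXi_pt (x := (ξ, θ, γ a)) (h a ha)]
  have p2 : ∀ τ, ∃ θ', τ ∈ uIcc a b → c τ = Ω.pt (ξ, θ', γ τ) := by
    intro τ
    by_cases hτ : τ ∈ uIcc a b
    · obtain ⟨θ', h1⟩ := Ω.exists_pt_of_fibXi (hW τ hτ) (p1 τ hτ)
      rw [(hc τ hτ).1] at h1
      exact ⟨θ', fun _ => h1⟩
    · exact ⟨0, fun h => absurd h hτ⟩
  choose Θ hΘ using p2
  -- the angles of the curve, with the transport subtracted, are constant in the circle; the local coordinates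
  -- may lie over `ξ + latt m`, which contributes the argument of `v₀`
  have p3 : ∀ j, ∀ τ ∈ uIcc a b,
      HasDerivWithinAt (fun τ => unitExp (Θ τ j - Ω.hol γ a τ ξ j)) 0 (uIcc a b) τ := by
    intro j τ hτ
    obtain ⟨x, u, hxτ, hx, hev⟩ := hloc τ hτ
    have hx1 : HasDerivWithinAt (fun r => (x r).1) 0 (uIcc a b) τ := hx.fst
    have hx2 : HasDerivWithinAt (fun r => (x r).2.1)
      (Ω.conn ((x τ).1, (x τ).2.2) u) (uIcc a b) τ := hx.snd.fst
    have hx3 : HasDerivWithinAt (fun r => (x r).2.2) u (uIcc a b) τ := hx.snd.snd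
    have hb : ∀ r ∈ uIcc a b, x r ∈ P.logReg → c r = Ω.pt (x r) → (x r).2.2 = γ r := by
      intro r hr h1 h2
      rw [← Ω.W_pt h1, ← h2, (hc r hr).1]
    have hbτ := hb τ hτ hxτ (hev.self_of_nhdsWithin hτ).2
    have hlat : ∀ r ∈ uIcc a b, x r ∈ P.logReg → c r = Ω.pt (x r) →
        ∃ m, (x r).1 = ξ + latt m := by
      intro r hr h1 h2
      refine eq_add_latt fun j => ?_
      rw [← p1 r hr, h2, Ω.fibXi_pt h1]
    obtain ⟨m, hm⟩ := hlat τ hτ hxτ (hev.self_of_nhdsWithin hτ).2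
    have hev2 : ∀ᶠ r in 𝓝[uIcc a b] τ, (x r).1 = ξ + latt m := by
      refine eventually_eq_add_latt ?_ ?_
      · rw [← hm]; exact hx1.continuousWithinAt
      · filter_upwards [hev, self_mem_nhdsWithin] with r h1 h2
        exact hlat r h2 h1.1 h1.2
    obtain ⟨φ₀, h₀⟩ := P.exists_isArg (γ τ)
    obtain ⟨φ, φ', hφ0, hφ, hφd, hφ'⟩ := exists_arg_branch (h τ hτ) h₀
    have hu : HasDerivWithinAt γ u (uIcc a b) τ := by
      refine hx3.congr_of_eventuallyEq ?_ hbτ.symm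
      filter_upwards [hev, self_mem_nhdsWithin] with r h1 h2
      exact (hb r h2 h1.1 h1.2).symm
    have hu' : u = deriv γ τ :=
      (hI τ hτ).eq_deriv _ hu ((hγ.differentiable (by simp)) τ).hasDerivAt.hasDerivWithinAt
    -- the angles of `c r` with respect to the lift `ξ` of the moment map
    have key : ∀ r ∈ uIcc a b, x r ∈ P.logReg → c r = Ω.pt (x r) → (x r).1 = ξ + latt m →
        unitExp (Θ r j - Ω.hol γ a r ξ j) =
          unitExp ((x r).2.1 j + φ (γ r) / (2 * Real.pi) * m j - Ω.hol γ a r ξ j) := by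
      intro r hr h1 h2 h3
      have h4 := Ω.pt_add_latt (ξ := ξ) (θ := fun j => (x r).2.1 j + φ (γ r) / (2 * Real.pi) * m j)
        (h r hr) (hφ _ (P.nu_ne_zero.2 (h r hr).2)) m 0
      have h5 : x r = (ξ + latt m, fun j => (fun j => (x r).2.1 j + φ (γ r) / (2 * Real.pi) * m j) j -
          φ (γ r) / (2 * Real.pi) * m j + ((0 : Fin 2 → ℤ) j : ℝ), γ r) :=
        Prod.ext h3 (Prod.ext (by funext j; simp) (hb r hr h1 h2))
      rw [hΘ r hr, h5, h4] at h2
      obtain ⟨n, hn⟩ := (Ω.pt_eq_iff_of_xi (h r hr)).1 h2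
      rw [unitExp_eq_iff]
      have h6 := congrFun hn j
      exact ⟨n j, by rw [h6]; ring⟩
    have hd : HasDerivWithinAt
        (fun r => (x r).2.1 j + φ (γ r) / (2 * Real.pi) * m j - Ω.hol γ a r ξ j) 0 (uIcc a b) τ := by
      have e1 : HasDerivWithinAt (fun r => (x r).2.1 j)
          (Ω.conn ((x τ).1, (x τ).2.2) u j) (uIcc a b) τ := (hasDerivWithinAt_pi.1 hx2) j
      have e2 : HasDerivWithinAt (fun r => φ (γ r)) (φ' u) (uIcc a b) τ :=
        hφd.comp_hasDerivWithinAt τ hu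
      have e3 : HasDerivWithinAt (fun r => Ω.hol γ a r ξ j) (Ω.conn (ξ, γ τ) (deriv γ τ) j)
          (uIcc a b) τ := (hasDerivAt_pi.1 (Ω.hasDerivAt_hol hγ ξ fun r hr =>
            h r (uIcc_left_subset hτ hr)) j).hasDerivWithinAt
      refine ((e1.add ((e2.div_const (2 * Real.pi)).mul_const (m j : ℝ))).sub e3).congr_deriv ?_
      rw [hbτ, hm, Ω.conn_add_latt (h τ hτ), hφ', hu']
      ring
    have h4 := hasDerivWithinAt_unitExp hd
    simp only [Complex.ofReal_zero, mul_zero] at h4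
    refine h4.congr_of_eventuallyEq ?_ (key τ hτ hxτ (hev.self_of_nhdsWithin hτ).2 hm)
    filter_upwards [hev, hev2, self_mem_nhdsWithin] with r h1 h2 h3
    exact key r h3 h1.1 h1.2 h2
  have hbm : b ∈ uIcc a b := right_mem_uIcc
  rw [hΘ b hbm]
  have p4 : ∀ j, unitExp (Θ b j - Ω.hol γ a b ξ j) = unitExp (θ j) := by
    intro j
    have h1 := eq_of_hasDerivWithinAt_zero (convex_uIcc a b) (p3 j) hbm ha
    rw [h1, hΘ a ha] at *
    obtain ⟨n, hn⟩ := (Ω.pt_eq_iff_of_xi (h a ha)).1 h0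
    rw [hn, unitExp_add_int]
    simp [hol]
  obtain ⟨n, hn⟩ := exists_vec_int p4
  refine (Ω.pt_eq_iff_of_xi (h b hbm)).2 ⟨n, funext fun j => ?_⟩
  simp only [Pi.add_apply, hn]
  ring

/-- Parallel transport along a path of regular values. -/
theorem mem_transport_iff {γ : ℝ → ℂ} (hγ : ContDiff ℝ ∞ γ) {a b : ℝ}
    (h : ∀ r ∈ uIcc a b, γ r ∈ P.reg) {A : Set P.Y} {p : P.Y} :
    p ∈ Ω.transport γ a b A ↔
      ∃ ξ θ, Ω.pt (ξ, θ, γ a) ∈ A ∧ p = Ω.pt (ξ, θ + Ω.hol γ a b ξ, γ b) := by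
  constructor
  · rintro ⟨c, hc, hcA, rfl⟩
    have ha : a ∈ uIcc a b := left_mem_uIcc
    have hW : P.W (c a) ≠ -(P.crit : ℂ) := by rw [(hc a ha).1]; exact (h a ha).2
    obtain ⟨x, hx, hxc⟩ := Ω.exists_pt hW
    have hb : x.2.2 = γ a := by rw [← Ω.W_pt hx, hxc, (hc a ha).1]
    have hx' : x = (x.1, x.2.1, γ a) := Prod.ext rfl (Prod.ext rfl hb)
    rw [hx'] at hxc
    exact ⟨x.1, x.2.1, hxc ▸ hcA, Ω.horizontal_unique hγ h hc hxc.symm⟩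
  · rintro ⟨ξ, θ, hA, rfl⟩
    exact ⟨_, Ω.isHorizontal_pt hγ h ξ θ, by simpa [hol] using hA, rfl⟩

/-- The points of the parallel transport of `ℓ_k`. -/
theorem mem_transport_ell_iff {γ : ℝ → ℂ} (hγ : ContDiff ℝ ∞ γ) {a b : ℝ}
    (h : ∀ r ∈ uIcc a b, γ r ∈ P.reg) (ha : γ a = -(P.S : ℂ)) {k : ℤ} {p : P.Y} :
    p ∈ Ω.transport γ a b (Ω.ell k) ↔
      ∃ ξ, p = Ω.pt (ξ, fun j => -(k : ℝ) * invM ξ j + Ω.hol γ a b ξ j, γ b) := by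
  rw [Ω.mem_transport_iff hγ h]
  have hS := P.neg_S_mem_reg
  constructor
  · rintro ⟨ξ, θ, hp, rfl⟩
    obtain ⟨ξ', h1⟩ := Ω.mem_ell.1 hp
    rw [ha] at h1
    obtain ⟨m, n, hmn⟩ := (Ω.pt_eq_pt_iff (x := (ξ, θ, -(P.S : ℂ)))
      (x' := (ξ', fun j => -(k : ℝ) * invM ξ' j, -(P.S : ℂ))) hS hS P.isArg_neg_S).1 h1
    have e1 : ξ' = ξ + latt m := congrArg Prod.fst hmn
    have e2 : (fun j => -(k : ℝ) * invM ξ' j) = fun j => θ j - 0 / (2 * Real.pi) * m j + n j :=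
      congrArg (fun x : LogPt => x.2.1) hmn
    refine ⟨ξ, (Ω.pt_eq_iff_of_xi (h b right_mem_uIcc)).2 ⟨k • m + n, ?_⟩⟩
    funext j
    have e3 := congrFun e2 j
    rw [e1, invM_add, invM_latt] at e3
    simp only [Pi.add_apply, zero_div, zero_mul, sub_zero, Pi.smul_apply, smul_eq_mul] at e3 ⊢
    push_cast
    linarith
  · rintro ⟨ξ, rfl⟩
    exact ⟨ξ, fun j => -(k : ℝ) * invM ξ j, by rw [ha]; exact Ω.mem_ell.2 ⟨ξ, rfl⟩, rfl⟩

end ToricKaehler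

/-! ### Integrals depending on a parameter -/

section ParametricIntegral

universe u

theorem eventually_forall_Icc {X : Type*} [TopologicalSpace X] {O : Set (X × ℝ)} (hO : IsOpen O) {x₀ : X}
    (h : ∀ r ∈ Icc (0 : ℝ) 1, (x₀, r) ∈ O) : ∀ᶠ x in 𝓝 x₀, ∀ r ∈ Icc (0 : ℝ) 1, (x, r) ∈ O := by
  obtain ⟨u, v, hu, _, hxu, hv, huv⟩ := generalized_tube_lemma (isCompact_singleton (x := x₀))
    (isCompact_Icc (a := (0 : ℝ)) (b := 1)) hO (by rintro ⟨x, r⟩ ⟨rfl, hr⟩; exact h r hr)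
  filter_upwards [hu.mem_nhds (hxu rfl)] with x hx r hr
  exact huv ⟨hx, hv hr⟩

variable {E F : Type u} [NormedAddCommGroup E] [NormedSpace ℝ E] [NormedAddCommGroup F] [NormedSpace ℝ F]

/-- Differentiation under the integral sign on a compact interval; the dominating constant is a bound of the
derivative near the interval over `x₀`. -/
theorem hasFDerivAt_integral_param {f : E × ℝ → F} {O : Set (E × ℝ)} (hO : IsOpen O)
    (hf : ContDiffOn ℝ ∞ f O) {x₀ : E} (h : ∀ r ∈ Icc (0 : ℝ) 1, (x₀, r) ∈ O) :
    HasFDerivAt (fun x => ∫ r in (0 : ℝ)..1, f (x, r))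
      (∫ r in (0 : ℝ)..1, (fderiv ℝ f (x₀, r)).comp (ContinuousLinearMap.inl ℝ E ℝ)) x₀ := by
  have hf' : ContinuousOn (fun q => (fderiv ℝ f q).comp (ContinuousLinearMap.inl ℝ E ℝ)) O :=
    (hf.continuousOn_fderiv_of_isOpen hO (by simp)).clm_comp continuousOn_const
  have hslice : ∀ x : E, ContinuousOn (fun r : ℝ => (x, r)) (Icc 0 1) := fun x => by fun_prop
  have hI : uIoc (0 : ℝ) 1 ⊆ Icc 0 1 := by rw [uIoc_of_le zero_le_one]; exact Ioc_subset_Icc_self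
  have hI' : uIcc (0 : ℝ) 1 = Icc 0 1 := uIcc_of_le zero_le_one
  obtain ⟨C, hC⟩ := (isCompact_Icc (a := (0 : ℝ)) (b := 1)).exists_bound_of_continuousOn
    (hf'.comp (hslice x₀) fun r hr => h r hr)
  have hO' : IsOpen (O ∩ {q | ‖(fderiv ℝ f q).comp (ContinuousLinearMap.inl ℝ E ℝ)‖ < C + 1}) :=
    hf'.norm.isOpen_inter_preimage hO isOpen_Iio
  have hev := eventually_forall_Icc hO' (x₀ := x₀) fun r hr =>
    ⟨h r hr, lt_of_le_of_lt (hC r hr) (lt_add_one C)⟩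
  have hcont : ∀ x, (∀ r ∈ Icc (0 : ℝ) 1, (x, r) ∈ O) → ContinuousOn (fun r => f (x, r)) (Icc 0 1) :=
    fun x hx => hf.continuousOn.comp (hslice x) fun r hr => hx r hr
  refine intervalIntegral.hasFDerivAt_integral_of_dominated_of_fderiv_le (bound := fun _ => C + 1)
    hev ?_ ?_ ?_ ?_ intervalIntegrable_const ?_
    (F' := fun x r => (fderiv ℝ f (x, r)).comp (ContinuousLinearMap.inl ℝ E ℝ))
  · filter_upwards [hev] with x hx
    exact ((hcont x fun r hr => (hx r hr).1).aestronglyMeasurable measurableSet_Icc).mono_set hI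
  · exact ContinuousOn.intervalIntegrable (by rw [hI']; exact hcont x₀ h)
  · exact ((hf'.comp (hslice x₀) fun r hr => h r hr).aestronglyMeasurable measurableSet_Icc).mono_set hI
  · exact Eventually.of_forall fun r hr x hx => (hx r (hI hr)).2.le
  · refine Eventually.of_forall fun r hr x hx => ?_
    have h1 : HasFDerivAt f (fderiv ℝ f (x, r)) (x, r) :=
      ((hf.contDiffAt (hO.mem_nhds (hx r (hI hr)).1)).differentiableAt (by simp)).hasFDerivAt
    exact h1.comp x (hasFDerivAt_prodMk_left x r)

theorem contDiffOn_integral_param {f : E × ℝ → F} {O : Set (E × ℝ)} (hO : IsOpen O)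
    (hf : ContDiffOn ℝ ∞ f O) :
    ContDiffOn ℝ ∞ (fun x => ∫ r in (0 : ℝ)..1, f (x, r)) {x | ∀ r ∈ Icc (0 : ℝ) 1, (x, r) ∈ O} := by
  have hV : IsOpen {x : E | ∀ r ∈ Icc (0 : ℝ) 1, (x, r) ∈ O} :=
    isOpen_iff_mem_nhds.2 fun x hx => eventually_forall_Icc hO hx
  rw [contDiffOn_infty]
  intro n
  induction n generalizing F with
  | zero =>
    exact contDiffOn_zero.2 fun x hx =>
      (hasFDerivAt_integral_param hO hf hx).continuousAt.continuousWithinAt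
  | succ n ih =>
    push_cast
    rw [contDiffOn_succ_iff_fderiv_of_isOpen hV]
    refine ⟨fun x hx => (hasFDerivAt_integral_param hO hf hx).differentiableAt.differentiableWithinAt,
      by simp, ?_⟩
    have h1 : ContDiffOn ℝ ∞ (fun q => (fderiv ℝ f q).comp (ContinuousLinearMap.inl ℝ E ℝ)) O :=
      (hf.fderiv_of_isOpen hO (by norm_cast)).clm_comp contDiffOn_const
    refine (ih h1).congr fun x hx => (hasFDerivAt_integral_param hO hf hx).fderiv

end ParametricIntegral

/-! ### Homotopy invariance of integrals of closed one-forms -/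

section Homotopy

variable {η : ℂ → ℂ →L[ℝ] ℝ} {U : Set ℂ}

/-- Primitives of a one-form on balls of a fixed radius around the points of a compact set. -/
theorem exists_local_primitives (hU : IsOpen U) (hη : DifferentiableOn ℝ η U)
    (hsymm : ∀ b ∈ U, ∀ u u', fderiv ℝ η b u u' = fderiv ℝ η b u' u) {K : Set ℂ} (hK : IsCompact K)
    (hKU : K ⊆ U) : ∃ ε > 0, ∃ f : ℂ → ℂ → ℝ, ∀ c ∈ K, ∀ b ∈ Metric.ball c ε,
      HasFDerivAt (f c) (η b) b := by
  obtain ⟨ε, hε, hεU⟩ := hK.exists_thickening_subset_open hU hKU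
  refine ⟨ε, hε, ?_⟩
  have : ∀ c, ∃ g : ℂ → ℝ, c ∈ K → ∀ b ∈ Metric.ball c ε, HasFDerivAt g (η b) b := by
    intro c
    by_cases hc : c ∈ K
    · have hB : Metric.ball c ε ⊆ U := (Metric.ball_subset_thickening hc ε).trans hεU
      obtain ⟨g, hg⟩ := (convex_ball c ε).exists_forall_hasFDerivAt_of_fderiv_symmetric
        Metric.isOpen_ball (hη.mono hB) fun b hb => hsymm b (hB hb)
      exact ⟨g, fun _ => hg⟩
    · exact ⟨0, fun h => absurd h hc⟩
  choose f hf using this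
  exact ⟨f, fun c hc => hf c hc⟩

theorem sub_eq_sub_of_primitives {s : Set ℂ} (hs : Convex ℝ s) {f g : ℂ → ℝ}
    (hf : ∀ b ∈ s, HasFDerivAt f (η b) b) (hg : ∀ b ∈ s, HasFDerivAt g (η b) b) {b b' : ℂ}
    (hb : b ∈ s) (hb' : b' ∈ s) : f b' - f b = g b' - g b := by
  have h1 : ∀ x ∈ s, HasFDerivWithinAt (fun x => f x - g x) (0 : ℂ →L[ℝ] ℝ) s x := fun x hx => by
    have h3 := ((hf x hx).sub (hg x hx)).hasFDerivWithinAt (s := s)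
    rw [sub_self] at h3
    exact h3
  have h2 := hs.norm_image_sub_le_of_norm_hasFDerivWithin_le (C := 0) h1 (fun _ _ => by simp) hb hb'
  rw [zero_mul, norm_le_zero_iff] at h2
  linarith

/-- The integral of a closed one-form along a path does not change under a homotopy with fixed ends. -/
theorem integral_eq_of_homotopy (hU : IsOpen U) (hη : DifferentiableOn ℝ η U)
    (hsymm : ∀ b ∈ U, ∀ u u', fderiv ℝ η b u u' = fderiv ℝ η b u' u) {h : ℝ → ℝ → ℂ}
    (hh : ContinuousOn (fun q : ℝ × ℝ => h q.1 q.2) (Icc 0 1 ×ˢ Icc 0 1))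
    (hhU : ∀ z ∈ Icc (0 : ℝ) 1, ∀ x ∈ Icc (0 : ℝ) 1, h z x ∈ U) {p q : ℂ}
    (h0 : ∀ z ∈ Icc (0 : ℝ) 1, h z 0 = p) (h1 : ∀ z ∈ Icc (0 : ℝ) 1, h z 1 = q)
    {γ₀ γ₁ : ℝ → ℂ} (hγ₀ : ContDiff ℝ 1 γ₀) (hγ₁ : ContDiff ℝ 1 γ₁)
    (e0 : ∀ x ∈ Icc (0 : ℝ) 1, h 0 x = γ₀ x) (e1 : ∀ x ∈ Icc (0 : ℝ) 1, h 1 x = γ₁ x) :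
    ∫ x in (0 : ℝ)..1, η (γ₀ x) (deriv γ₀ x) = ∫ x in (0 : ℝ)..1, η (γ₁ x) (deriv γ₁ x) := by
  have hQ : IsCompact (Icc (0 : ℝ) 1 ×ˢ Icc (0 : ℝ) 1) := isCompact_Icc.prod isCompact_Icc
  set K := (fun q : ℝ × ℝ => h q.1 q.2) '' (Icc 0 1 ×ˢ Icc 0 1) with hKdef
  have hK : IsCompact K := hQ.image_of_continuousOn hh
  have hKU : K ⊆ U := by rintro _ ⟨⟨z, x⟩, ⟨hz, hx⟩, rfl⟩; exact hhU z hz x hx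
  have hmem : ∀ z ∈ Icc (0 : ℝ) 1, ∀ x ∈ Icc (0 : ℝ) 1, h z x ∈ K := fun z hz x hx =>
    ⟨(z, x), ⟨hz, hx⟩, rfl⟩
  obtain ⟨ε, hε, f, hf⟩ := exists_local_primitives hU hη hsymm hK hKU
  obtain ⟨d, hd, hdist⟩ := Metric.uniformContinuousOn_iff.1 (hQ.uniformContinuousOn_of_continuous hh) ε hε
  obtain ⟨N, hN⟩ := exists_nat_one_div_lt hd
  -- the points of a fine grid
  let n : ℕ → ℝ := fun i => i / (N + 1 : ℝ)
  have hN0 : (0 : ℝ) < N + 1 := by positivity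
  have hnI : ∀ i ≤ N + 1, n i ∈ Icc (0 : ℝ) 1 := fun i hi =>
    ⟨by positivity, (div_le_one hN0).2 (by exact_mod_cast hi)⟩
  have hn0 : n 0 = 0 := by simp [n]
  have hn1 : n (N + 1) = 1 := by simp only [n]; push_cast; exact div_self hN0.ne'
  have hns : ∀ i, n (i + 1) = n i + 1 / (N + 1 : ℝ) := fun i => by simp only [n]; push_cast; ring
  -- the increment from `c` to `b` of the primitive centred at `c`
  let S : ℂ → ℂ → ℝ := fun c b => f c b - f c c
  have hS : ∀ c ∈ K, ∀ b ∈ K, ∀ b', dist b c < ε → dist b' c < ε → dist b' b < ε →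
      S c b + S b b' = S c b' := by
    intro c hc b hb b' h1 h2 h3
    have := sub_eq_sub_of_primitives (s := Metric.ball c ε ∩ Metric.ball b ε)
      ((convex_ball _ _).inter (convex_ball _ _))
      (fun x hx => hf c hc x hx.1) (fun x hx => hf b hb x hx.2)
      (b := b) (b' := b') ⟨h1, Metric.mem_ball_self hε⟩ ⟨h2, h3⟩
    simp only [S]; linarith
  have hclose : ∀ z ∈ Icc (0 : ℝ) 1, ∀ x ∈ Icc (0 : ℝ) 1, ∀ z' ∈ Icc (0 : ℝ) 1, ∀ x' ∈ Icc (0 : ℝ) 1,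
      |z - z'| ≤ 1 / (N + 1 : ℝ) → |x - x'| ≤ 1 / (N + 1 : ℝ) → dist (h z x) (h z' x') < ε := by
    intro z hz x hx z' hz' x' hx' h1 h2
    refine hdist (z, x) ⟨hz, hx⟩ (z', x') ⟨hz', hx'⟩ ?_
    rw [Prod.dist_eq, Real.dist_eq, Real.dist_eq]
    exact max_lt (h1.trans_lt hN) (h2.trans_lt hN)
  have hstep : ∀ i, |n (i + 1) - n i| ≤ 1 / (N + 1 : ℝ) := fun i => by
    rw [hns, add_sub_cancel_left, abs_of_nonneg (by positivity)]
  have hzero : ∀ x : ℝ, |x - x| ≤ 1 / (N + 1 : ℝ) := fun x => by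
    rw [sub_self, abs_zero]; positivity
  let row : ℕ → ℝ := fun i => ∑ j ∈ Finset.range (N + 1), S (h (n i) (n j)) (h (n i) (n (j + 1)))
  -- two neighbouring rows of the grid differ by a telescoping sum
  have hrow : ∀ i < N + 1, row i = row (i + 1) := by
    intro i hi
    have hsq : ∀ j ∈ Finset.range (N + 1), S (h (n i) (n j)) (h (n i) (n (j + 1))) -
        S (h (n (i + 1)) (n j)) (h (n (i + 1)) (n (j + 1))) =
        -(S (h (n i) (n (j + 1))) (h (n (i + 1)) (n (j + 1))) -
          S (h (n i) (n j)) (h (n (i + 1)) (n j))) := by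
      intro j hj
      have hj := Finset.mem_range.1 hj
      have i0 := hnI i hi.le
      have i1 := hnI (i + 1) hi
      have j0 := hnI j hj.le
      have j1 := hnI (j + 1) hj
      have a1 := hS _ (hmem _ i0 _ j0) _ (hmem _ i0 _ j1) (h (n (i + 1)) (n (j + 1)))
        (hclose _ i0 _ j1 _ i0 _ j0 (hzero _) (hstep _))
        (hclose _ i1 _ j1 _ i0 _ j0 (hstep _) (hstep _))
        (hclose _ i1 _ j1 _ i0 _ j1 (hstep _) (hzero _))
      have a2 := hS _ (hmem _ i0 _ j0) _ (hmem _ i1 _ j0) (h (n (i + 1)) (n (j + 1)))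
        (hclose _ i1 _ j0 _ i0 _ j0 (hstep _) (hzero _))
        (hclose _ i1 _ j1 _ i0 _ j0 (hstep _) (hstep _))
        (hclose _ i1 _ j1 _ i1 _ j0 (hzero _) (hstep _))
      linarith
    have hsum := Finset.sum_congr rfl hsq
    rw [Finset.sum_sub_distrib, Finset.sum_neg_distrib,
      Finset.sum_range_sub (fun j => S (h (n i) (n j)) (h (n (i + 1)) (n j))), hn0, hn1,
      h0 _ (hnI i hi.le), h0 _ (hnI (i + 1) hi), h1 _ (hnI i hi.le), h1 _ (hnI (i + 1) hi)] at hsum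
    simp only [S, sub_self, neg_zero] at hsum
    exact sub_eq_zero.1 hsum
  have hrows : ∀ i ≤ N + 1, row i = row 0 := by
    intro i
    induction i with
    | zero => intro _; rfl
    | succ i ih => intro hi; rw [← hrow i hi, ih (Nat.le_of_succ_le hi)]
  have hint : ∀ z ∈ Icc (0 : ℝ) 1, ∀ γ : ℝ → ℂ, ContDiff ℝ 1 γ → (∀ x ∈ Icc (0 : ℝ) 1, h z x = γ x) →
      ∫ x in (0 : ℝ)..1, η (γ x) (deriv γ x) =
        ∑ j ∈ Finset.range (N + 1), S (h z (n j)) (h z (n (j + 1))) := by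
    intro z hz γ hγ hzγ
    have hγU : ∀ x ∈ Icc (0 : ℝ) 1, γ x ∈ U := fun x hx => hzγ x hx ▸ hhU z hz x hx
    have hc : ContinuousOn (fun x => η (γ x) (deriv γ x)) (Icc 0 1) :=
      (hη.continuousOn.comp hγ.continuous.continuousOn hγU).clm_apply
        (hγ.continuous_deriv le_rfl).continuousOn
    have hsub : ∀ j < N + 1, uIcc (n j) (n (j + 1)) ⊆ Icc 0 1 := fun j hj =>
      uIcc_subset_Icc (hnI j hj.le) (hnI (j + 1) hj)
    have h2 := intervalIntegral.sum_integral_adjacent_intervals (a := n) (n := N + 1)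
      (f := fun x => η (γ x) (deriv γ x)) (μ := MeasureTheory.volume)
      fun j hj => (hc.mono (hsub j hj)).intervalIntegrable
    rw [hn0, hn1] at h2
    rw [← h2]
    refine Finset.sum_congr rfl fun j hj => ?_
    have hj := Finset.mem_range.1 hj
    have j0 := hnI j hj.le
    have j1 := hnI (j + 1) hj
    have h3 : ∀ x ∈ uIcc (n j) (n (j + 1)),
        HasDerivAt (fun x => f (h z (n j)) (γ x)) (η (γ x) (deriv γ x)) x := by
      intro x hx
      have hxI := hsub j hj hx
      have h4 : γ x ∈ Metric.ball (h z (n j)) ε := by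
        rw [← hzγ x hxI]
        refine hclose z hz x hxI z hz _ j0 (hzero _) ?_
        have h5 : n j ≤ n (j + 1) := by rw [hns]; linarith [show 0 ≤ 1 / (N + 1 : ℝ) by positivity]
        rw [uIcc_of_le h5] at hx
        rw [abs_of_nonneg (by linarith [hx.1])]
        have := hns j
        linarith [hx.2]
      exact (hf _ (hmem z hz _ j0) _ h4).comp_hasDerivAt x
        ((hγ.differentiable one_ne_zero) x).hasDerivAt
    rw [intervalIntegral.integral_eq_sub_of_hasDerivAt h3 (hc.mono (hsub j hj)).intervalIntegrable,
      ← hzγ _ j0, ← hzγ _ j1]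
  rw [hint 0 (left_mem_Icc.2 zero_le_one) γ₀ hγ₀ e0, hint 1 (right_mem_Icc.2 zero_le_one) γ₁ hγ₁ e1]
  have h3 := hrows (N + 1) le_rfl
  simp only [row, hn0, hn1] at h3
  exact h3.symm

end Homotopy

namespace ToricKaehler

open LGParams

variable {P : LGParams} (Ω : ToricKaehler P)

/-! ### Dependence of parallel transport on parameters -/

theorem affine_mem_uIcc (a b : ℝ) {r : ℝ} (hr : r ∈ Icc (0 : ℝ) 1) : (b - a) * r + a ∈ uIcc a b := by
  have h1 := (convex_uIcc a b).add_smul_sub_mem (left_mem_uIcc) (right_mem_uIcc) hr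
  simpa [mul_comm, add_comm] using h1

theorem hol_eq (γ : ℝ → ℂ) (a b : ℝ) (ξ : Fin 2 → ℝ) : Ω.hol γ a b ξ =
    ∫ r in (0 : ℝ)..1, Ω.conn (ξ, γ ((b - a) * r + a)) ((b - a) • deriv γ ((b - a) * r + a)) := by
  have h1 := intervalIntegral.smul_integral_comp_mul_add (a := 0) (b := 1)
    (fun τ => Ω.conn (ξ, γ τ) (deriv γ τ)) (b - a) a
  simp only [mul_zero, zero_add, mul_one, sub_add_cancel] at h1
  rw [hol, ← h1, ← intervalIntegral.integral_smul]
  simp only [Ω.conn_smul]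

section Smooth

variable {E : Type} [NormedAddCommGroup E] [NormedSpace ℝ E] {Γ : E → ℝ → ℂ} {a b : E → ℝ}
  {ξ : E → Fin 2 → ℝ}

theorem contDiff_deriv_param (hΓ : ContDiff ℝ ∞ fun q : E × ℝ => Γ q.1 q.2) :
    ContDiff ℝ ∞ fun q : E × ℝ => deriv (Γ q.1) q.2 := by
  have h1 : (fun q : E × ℝ => deriv (Γ q.1) q.2) =
      fun q : E × ℝ => fderiv ℝ (fun q : E × ℝ => Γ q.1 q.2) q (0, 1) := by
    funext q
    have h2 : HasFDerivAt (fun q : E × ℝ => Γ q.1 q.2)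
        (fderiv ℝ (fun q : E × ℝ => Γ q.1 q.2) q) (q.1, q.2) :=
      ((hΓ.differentiable (by simp)) q).hasFDerivAt
    have h3 : HasDerivAt (fun τ : ℝ => (q.1, τ)) (0, 1) q.2 :=
      (hasDerivAt_const _ _).prodMk (hasDerivAt_id _)
    exact (h2.comp_hasDerivAt q.2 h3).deriv
  rw [h1]
  exact (hΓ.fderiv_right (m := ∞) (by norm_cast)).clm_apply contDiff_const

/-- Parallel transport depends smoothly on all parameters. -/
theorem contDiffAt_hol (hΓ : ContDiff ℝ ∞ fun q : E × ℝ => Γ q.1 q.2) (ha : ContDiff ℝ ∞ a)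
    (hb : ContDiff ℝ ∞ b) (hξ : ContDiff ℝ ∞ ξ) {x : E} (h : ∀ r ∈ uIcc (a x) (b x), Γ x r ∈ P.reg) :
    ContDiffAt ℝ ∞ (fun x => Ω.hol (Γ x) (a x) (b x) (ξ x)) x := by
  have hg : ContDiff ℝ ∞ fun q : E × ℝ => (q.1, (b q.1 - a q.1) * q.2 + a q.1) := by fun_prop
  have hΓg : ContDiff ℝ ∞ fun q : E × ℝ => Γ q.1 ((b q.1 - a q.1) * q.2 + a q.1) := hΓ.comp hg
  have hΓg' : ContDiff ℝ ∞ fun q : E × ℝ =>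
    (b q.1 - a q.1) • deriv (Γ q.1) ((b q.1 - a q.1) * q.2 + a q.1) :=
    ContDiff.smul (f := fun q : E × ℝ => b q.1 - a q.1) (by fun_prop) ((contDiff_deriv_param hΓ).comp hg)
  let O : Set (E × ℝ) := {q | Γ q.1 ((b q.1 - a q.1) * q.2 + a q.1) ∈ P.reg}
  have hO : IsOpen O := P.isOpen_reg.preimage hΓg.continuous
  have hf : ContDiffOn ℝ ∞ (fun q : E × ℝ => Ω.conn (ξ q.1, Γ q.1 ((b q.1 - a q.1) * q.2 + a q.1))
      ((b q.1 - a q.1) • deriv (Γ q.1) ((b q.1 - a q.1) * q.2 + a q.1))) O := fun q hq =>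
    (Ω.contDiffAt_conn (k := fun q : E × ℝ => (ξ q.1, Γ q.1 ((b q.1 - a q.1) * q.2 + a q.1))) hq
      (ContDiff.contDiffAt (ContDiff.prodMk (by fun_prop) hΓg)) hΓg'.contDiffAt).contDiffWithinAt
  have hV : {x | ∀ r ∈ Icc (0 : ℝ) 1, (x, r) ∈ O} ∈ 𝓝 x :=
    eventually_forall_Icc hO fun r hr => h _ (affine_mem_uIcc _ _ hr)
  have h1 := (contDiffOn_integral_param hO hf).contDiffAt hV
  simpa only [Ω.hol_eq] using h1

end Smooth

theorem dotProduct_integral {f : ℝ → Fin 2 → ℝ} {a b : ℝ}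
    (hf : IntervalIntegrable f MeasureTheory.volume a b) (e : Fin 2 → ℝ) :
    dotProduct (∫ r in a..b, f r) e = ∫ r in a..b, dotProduct (f r) e := by
  let L : (Fin 2 → ℝ) →L[ℝ] ℝ := LinearMap.toContinuousLinearMap
    { toFun := fun v => dotProduct v e, map_add' := fun _ _ => add_dotProduct _ _ _,
      map_smul' := fun _ _ => smul_dotProduct _ _ _ }
  exact (L.intervalIntegral_comp_comm hf).symm

theorem hol_dot {γ : ℝ → ℂ} (hγ : ContDiff ℝ ∞ γ) {a b : ℝ} (h : ∀ r ∈ uIcc a b, γ r ∈ P.reg)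
    (ξ e : Fin 2 → ℝ) :
    dotProduct (Ω.hol γ a b ξ) e = ∫ τ in a..b, dotProduct (Ω.conn (ξ, γ τ) (deriv γ τ)) e :=
  dotProduct_integral ((Ω.continuousOn_conn_path hγ ξ).mono h).intervalIntegrable e

/-- Parallel transport is fibrewise symplectic: its shift of the angles is a closed one-form in the
moment map. -/
theorem hol_symm {γ : ℝ → ℂ} (hγ : ContDiff ℝ ∞ γ) {a b : ℝ} (h : ∀ r ∈ uIcc a b, γ r ∈ P.reg)
    (ξ e e' : Fin 2 → ℝ) :
    fderiv ℝ (fun ξ => dotProduct (Ω.hol γ a b ξ) e') ξ e =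
      fderiv ℝ (fun ξ => dotProduct (Ω.hol γ a b ξ) e) ξ e' := by
  have key : ∀ e e' : Fin 2 → ℝ, fderiv ℝ (fun ξ => dotProduct (Ω.hol γ a b ξ) e') ξ e =
      ∫ r in (0 : ℝ)..1, fderiv ℝ (fun x : BasePt => dotProduct
        (Ω.conn x ((b - a) • deriv γ ((b - a) * r + a))) e') (ξ, γ ((b - a) * r + a)) (e, 0) := by
    intro e e'
    have hγ' : ContDiff ℝ ∞ (deriv γ) := (contDiff_infty_iff_deriv.1 hγ).2
    have hg : ContDiff ℝ ∞ fun q : (Fin 2 → ℝ) × ℝ => (b - a) * q.2 + a := by fun_prop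
    have hΓg : ContDiff ℝ ∞ fun q : (Fin 2 → ℝ) × ℝ => γ ((b - a) * q.2 + a) := hγ.comp hg
    have hΓg' : ContDiff ℝ ∞ fun q : (Fin 2 → ℝ) × ℝ => (b - a) • deriv γ ((b - a) * q.2 + a) :=
      (hγ'.comp hg).const_smul _
    let O : Set ((Fin 2 → ℝ) × ℝ) := {q | γ ((b - a) * q.2 + a) ∈ P.reg}
    have hO : IsOpen O := P.isOpen_reg.preimage hΓg.continuous
    let f : (Fin 2 → ℝ) × ℝ → ℝ := fun q => dotProduct (Ω.conn (q.1, γ ((b - a) * q.2 + a))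
        ((b - a) • deriv γ ((b - a) * q.2 + a))) e'
    have hdot : ∀ {V : Type} [NormedAddCommGroup V] [NormedSpace ℝ V] {k : V → Fin 2 → ℝ} {y : V},
        ContDiffAt ℝ ∞ k y → ContDiffAt ℝ ∞ (fun y => dotProduct (k y) e') y := by
      intro V _ _ k y hk
      have := contDiffAt_pi.1 hk
      simp only [dotProduct, Fin.sum_univ_two]
      exact ((this 0).mul contDiffAt_const).add ((this 1).mul contDiffAt_const)
    have hf : ContDiffOn ℝ ∞ f O := fun q hq =>
      (hdot (Ω.contDiffAt_conn (k := fun q : (Fin 2 → ℝ) × ℝ => (q.1, γ ((b - a) * q.2 + a))) hq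
        (ContDiff.contDiffAt (contDiff_fst.prodMk hΓg)) hΓg'.contDiffAt)).contDiffWithinAt
    have hmem : ∀ r ∈ Icc (0 : ℝ) 1, (ξ, r) ∈ O := fun r hr => h _ (affine_mem_uIcc _ _ hr)
    have h1 := hasFDerivAt_integral_param hO hf hmem
    have hI' : uIcc (0 : ℝ) 1 = Icc 0 1 := uIcc_of_le zero_le_one
    have h2 : (fun ξ => dotProduct (Ω.hol γ a b ξ) e') = fun x => ∫ r in (0 : ℝ)..1, f (x, r) := by
      funext x
      rw [hol_eq, dotProduct_integral]
      refine ContinuousOn.intervalIntegrable fun r hr => ContinuousAt.continuousWithinAt ?_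
      rw [hI'] at hr
      have h3 := (Ω.contDiffAt_conn (k := fun r => (x, γ ((b - a) * r + a)))
        (w := fun r : ℝ => (b - a) • deriv γ ((b - a) * r + a)) (y := r) (hmem r hr)
        (contDiffAt_const.prodMk (ContDiff.contDiffAt (hγ.comp (by fun_prop))))
        (ContDiff.contDiffAt ((hγ'.comp (by fun_prop)).const_smul _)))
      exact h3.continuousAt
    rw [h2, h1.fderiv, ContinuousLinearMap.intervalIntegral_apply]
    · refine intervalIntegral.integral_congr fun r hr => ?_
      rw [hI'] at hr
      let ι : (Fin 2 → ℝ) → BasePt := fun ξ => (ξ, γ ((b - a) * r + a))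
      have h4 : HasFDerivAt ι (ContinuousLinearMap.inl ℝ (Fin 2 → ℝ) ℂ) ξ :=
        hasFDerivAt_prodMk_left _ _
      have h5 : DifferentiableAt ℝ (fun x : BasePt => dotProduct
        (Ω.conn x ((b - a) • deriv γ ((b - a) * r + a))) e') (ι ξ) :=
        (hdot (Ω.contDiffAt_conn (k := id) (y := ι ξ) (hmem r hr) contDiffAt_id
          contDiffAt_const)).differentiableAt (by simp)
      have h6 := (h5.hasFDerivAt.comp ξ h4).fderiv
      have h7 : DifferentiableAt ℝ f (ξ, r) :=
        (hf.contDiffAt (hO.mem_nhds (hmem r hr))).differentiableAt (by simp)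
      have h8 := (h7.hasFDerivAt.comp (f := fun ξ => (ξ, r)) ξ (hasFDerivAt_prodMk_left ξ r)).fderiv
      have h9 := h8.symm.trans h6
      exact congrArg (fun L : (Fin 2 → ℝ) →L[ℝ] ℝ => L e) h9
    · refine ContinuousOn.intervalIntegrable ?_
      rw [hI']
      refine ContinuousOn.clm_comp ?_ continuousOn_const
      exact (hf.continuousOn_fderiv_of_isOpen hO (by simp)).comp (by fun_prop) hmem
  rw [key, key]
  refine intervalIntegral.integral_congr fun r hr => ?_
  rw [uIcc_of_le zero_le_one] at hr
  exact Ω.conn_symm (x := (ξ, γ ((b - a) * r + a))) (h _ (affine_mem_uIcc _ _ hr)) _ _ _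

/-! ### The winding of the argument of `v₀` -/

/-- The change of the argument of `v₀` along a path in the base. -/
def wind (P : LGParams) (γ : ℝ → ℂ) (a b : ℝ) : ℝ := ∫ τ in a..b, dArg P (γ τ) (deriv γ τ)

theorem crit_add_ne {b : ℂ} (h : b ∈ P.reg) : (P.crit : ℂ) + b ≠ 0 := fun h1 =>
  h.2 (eq_neg_of_add_eq_zero_right h1)

theorem continuousOn_logDeriv_path {γ : ℝ → ℂ} (hγ : ContDiff ℝ ∞ γ) :
    ContinuousOn (fun τ => deriv γ τ / (P.crit + γ τ)) {τ | γ τ ∈ P.reg} := by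
  have h1 : ContDiff ℝ ∞ (deriv γ) := (contDiff_infty_iff_deriv.1 hγ).2
  exact h1.continuous.continuousOn.div (by have := hγ.continuous; fun_prop) fun τ hτ => crit_add_ne hτ

theorem continuousOn_dArg_path {γ : ℝ → ℂ} (hγ : ContDiff ℝ ∞ γ) :
    ContinuousOn (fun τ => dArg P (γ τ) (deriv γ τ)) {τ | γ τ ∈ P.reg} :=
  Complex.continuous_im.comp_continuousOn (continuousOn_logDeriv_path hγ)

theorem hol_add_latt {γ : ℝ → ℂ} (hγ : ContDiff ℝ ∞ γ) {a b : ℝ} (h : ∀ r ∈ uIcc a b, γ r ∈ P.reg)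
    (ξ : Fin 2 → ℝ) (m : Fin 2 → ℤ) : Ω.hol γ a b (ξ + latt m) =
      fun j => Ω.hol γ a b ξ j - wind P γ a b / (2 * Real.pi) * m j := by
  have h0 : IntervalIntegrable (fun τ => dArg P (γ τ) (deriv γ τ)) MeasureTheory.volume a b :=
    ((continuousOn_dArg_path hγ).mono h).intervalIntegrable
  have h1 : IntervalIntegrable (fun τ => (dArg P (γ τ) (deriv γ τ) / (2 * Real.pi)) •
      (fun j => (m j : ℝ) : Fin 2 → ℝ)) MeasureTheory.volume a b :=
    ((((continuousOn_dArg_path hγ).mono h).div_const _).smul continuousOn_const).intervalIntegrable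
  have h2 : Ω.hol γ a b (ξ + latt m) = ∫ τ in a..b, (Ω.conn (ξ, γ τ) (deriv γ τ) -
      (dArg P (γ τ) (deriv γ τ) / (2 * Real.pi)) • (fun j => (m j : ℝ) : Fin 2 → ℝ)) := by
    refine intervalIntegral.integral_congr fun τ hτ => ?_
    simp only [Ω.conn_add_latt (h τ hτ)]
    rfl
  rw [h2, intervalIntegral.integral_sub ((Ω.continuousOn_conn_path hγ ξ).mono h).intervalIntegrable h1,
    intervalIntegral.integral_smul_const, intervalIntegral.integral_div]
  rfl

theorem wind_isArg {γ : ℝ → ℂ} (hγ : ContDiff ℝ ∞ γ) {a b : ℝ} (h : ∀ r ∈ uIcc a b, γ r ∈ P.reg)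
    {φ : ℝ} (hφ : P.IsArg φ (γ a)) : P.IsArg (φ + wind P γ a b) (γ b) := by
  have hc := P.crit_ne
  let l : ℝ → ℂ := fun τ => ∫ r in a..τ, deriv γ r / (P.crit + γ r)
  have hcont := continuousOn_logDeriv_path (P := P) hγ
  have hO : IsOpen {τ | γ τ ∈ P.reg} := P.isOpen_reg.preimage hγ.continuous
  have hl : ∀ τ ∈ uIcc a b, HasDerivAt l (deriv γ τ / (P.crit + γ τ)) τ := fun τ hτ =>
    intervalIntegral.integral_hasDerivAt_right
      (hcont.mono fun r hr => h r (uIcc_left_subset hτ hr)).intervalIntegrable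
      (hcont.stronglyMeasurableAtFilter hO τ (h τ hτ)) (hcont.continuousAt (hO.mem_nhds (h τ hτ)))
  have hd : ∀ τ ∈ uIcc a b,
      HasDerivWithinAt (fun τ => P.nu (γ τ) * Complex.exp (-l τ)) 0 (uIcc a b) τ := by
    intro τ hτ
    have h1 : HasDerivAt (fun τ => P.nu (γ τ)) (deriv γ τ / P.crit) τ :=
      ((((hγ.differentiable (by simp)) τ).hasDerivAt).div_const _).const_add 1
    refine ((h1.mul (hl τ hτ).neg.cexp).congr_deriv ?_).hasDerivWithinAt
    have h2 := crit_add_ne (h τ hτ)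
    have h3 : P.nu (γ τ) = (P.crit + γ τ) / P.crit := by rw [nu]; field_simp
    rw [h3]
    field_simp
    ring
  have h4 := eq_of_hasDerivWithinAt_zero (convex_uIcc a b) hd right_mem_uIcc left_mem_uIcc
  have h5 : l a = 0 := intervalIntegral.integral_same
  simp only [h5, neg_zero, Complex.exp_zero, mul_one] at h4
  have h6 : P.nu (γ b) = P.nu (γ a) * Complex.exp (l b) := by
    rw [← h4, mul_assoc, ← Complex.exp_add]; simp
  have h7 : (l b).im = wind P γ a b := by
    have hi : IntervalIntegrable (fun r => deriv γ r / (P.crit + γ r)) MeasureTheory.volume a b :=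
      (hcont.mono h).intervalIntegrable
    exact (Complex.imCLM.intervalIntegral_comp_comm hi).symm
  have h8 : ‖P.nu (γ b)‖ = ‖P.nu (γ a)‖ * Real.exp (l b).re := by
    rw [h6, norm_mul, Complex.norm_exp]
  have h9 : Complex.exp (l b) = Complex.exp ((l b).re : ℂ) * Complex.exp (wind P γ a b * Complex.I) := by
    rw [← Complex.exp_add, ← h7, Complex.re_add_im]
  rw [IsArg, h8, h6, h9]
  conv_lhs => rw [hφ]
  push_cast
  rw [add_mul, Complex.exp_add]
  ring

end ToricKaehler

/-- The pairing with a vector of `ℝ²`, as a linear form. -/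
def dotL : (Fin 2 → ℝ) →L[ℝ] (Fin 2 → ℝ) →L[ℝ] ℝ :=
  LinearMap.toContinuousLinearMap
    { toFun := fun v => LinearMap.toContinuousLinearMap
        { toFun := fun e => dotProduct v e, map_add' := fun _ _ => dotProduct_add _ _ _,
          map_smul' := fun _ _ => dotProduct_smul _ _ _ }
      map_add' := fun _ _ => by ext; simp
      map_smul' := fun _ _ => by ext; simp }

theorem dotL_apply (v e : Fin 2 → ℝ) : dotL v e = dotProduct v e := rfl

theorem ContDiffAt.dotProduct {V : Type*} [NormedAddCommGroup V] [NormedSpace ℝ V] {k : V → Fin 2 → ℝ}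
    {y : V} (hk : ContDiffAt ℝ ∞ k y) (e : Fin 2 → ℝ) :
    ContDiffAt ℝ ∞ (fun y => dotProduct (k y) e) y :=
  (dotL.contDiff.contDiffAt.comp y hk).clm_apply contDiffAt_const

namespace ToricKaehler

open LGParams

variable {P : LGParams} (Ω : ToricKaehler P)

/-! ### The flux of parallel transport along a loop -/

theorem deriv_comp_affine {γ : ℝ → ℂ} (c a r : ℝ) :
    deriv (fun r => γ (c * r + a)) r = c • deriv γ (c * r + a) := by
  have h := deriv_comp_mul_left c (fun x => γ (x + a)) r
  rw [deriv_comp_add_const] at h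
  exact h

theorem hol_affine (γ : ℝ → ℂ) (a b : ℝ) (ξ : Fin 2 → ℝ) :
    Ω.hol γ a b ξ = Ω.hol (fun r => γ ((b - a) * r + a)) 0 1 ξ := by
  rw [hol_eq, hol]
  simp only [deriv_comp_affine]

/-- The component of the connection form in the direction `e`. -/
def connL (e : Fin 2 → ℝ) (x : BasePt) : ℂ →L[ℝ] ℝ :=
  dotProduct (Ω.conn x 1) e • Complex.reCLM + dotProduct (Ω.conn x Complex.I) e • Complex.imCLM

theorem connL_apply (e : Fin 2 → ℝ) (x : BasePt) (u : ℂ) :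
    Ω.connL e x u = dotProduct (Ω.conn x u) e := by
  have h : u = u.re • (1 : ℂ) + u.im • Complex.I := by
    conv_lhs => rw [← Complex.re_add_im u]
    simp
  conv_rhs => rw [h, Ω.conn_add, Ω.conn_smul, Ω.conn_smul]
  simp [connL]
  ring

theorem contDiffAt_connL {V : Type*} [NormedAddCommGroup V] [NormedSpace ℝ V] {k : V → BasePt} {y : V}
    (hy : (k y).2 ∈ P.reg) (hk : ContDiffAt ℝ ∞ k y) (e : Fin 2 → ℝ) :
    ContDiffAt ℝ ∞ (fun y => Ω.connL e (k y)) y :=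
  (((Ω.contDiffAt_conn hy hk contDiffAt_const).dotProduct e).smul contDiffAt_const).add
    (((Ω.contDiffAt_conn hy hk contDiffAt_const).dotProduct e).smul contDiffAt_const)

/-- The one-form on the base whose integral along a loop is the flux, through the circle in the
direction `e` of the torus of values of the moment map, of parallel transport along the loop. -/
def fluxForm (e : Fin 2 → ℝ) (b : ℂ) : ℂ →L[ℝ] ℝ := ∫ r in (0 : ℝ)..1, Ω.connL e (r • e, b)

theorem contDiffOn_connL_line (e : Fin 2 → ℝ) :
    ContDiffOn ℝ ∞ (fun q : ℂ × ℝ => Ω.connL e (q.2 • e, q.1)) {q | q.1 ∈ P.reg} := fun q hq =>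
  (Ω.contDiffAt_connL (k := fun q : ℂ × ℝ => (q.2 • e, q.1)) hq (by fun_prop) e).contDiffWithinAt

theorem isOpen_reg_prod : IsOpen {q : ℂ × ℝ | q.1 ∈ P.reg} := P.isOpen_reg.preimage continuous_fst

theorem intervalIntegrable_connL (e : Fin 2 → ℝ) {b : ℂ} (h : b ∈ P.reg) :
    IntervalIntegrable (fun r : ℝ => Ω.connL e (r • e, b)) MeasureTheory.volume 0 1 :=
  ((Ω.contDiffOn_connL_line e).continuousOn.comp (f := fun r : ℝ => ((b, r) : ℂ × ℝ))
    (by fun_prop) fun _ _ => h).intervalIntegrable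

theorem fluxForm_apply (e : Fin 2 → ℝ) {b : ℂ} (h : b ∈ P.reg) (u : ℂ) :
    Ω.fluxForm e b u = ∫ r in (0 : ℝ)..1, dotProduct (Ω.conn (r • e, b) u) e := by
  rw [fluxForm, ContinuousLinearMap.intervalIntegral_apply (Ω.intervalIntegrable_connL e h)]
  simp only [connL_apply]

theorem hasFDerivAt_fluxForm (e : Fin 2 → ℝ) {b : ℂ} (h : b ∈ P.reg) :
    HasFDerivAt (Ω.fluxForm e) (∫ r in (0 : ℝ)..1,
      (fderiv ℝ (fun q : ℂ × ℝ => Ω.connL e (q.2 • e, q.1)) (b, r)).comp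
        (ContinuousLinearMap.inl ℝ ℂ ℝ)) b :=
  hasFDerivAt_integral_param isOpen_reg_prod (Ω.contDiffOn_connL_line e) fun _ _ => h

theorem fderiv_fluxForm (e : Fin 2 → ℝ) {b : ℂ} (h : b ∈ P.reg) (u u' : ℂ) :
    fderiv ℝ (Ω.fluxForm e) b u' u = ∫ r in (0 : ℝ)..1,
      fderiv ℝ (fun x : BasePt => dotProduct (Ω.conn x u) e) (r • e, b) (0, u') := by
  have hc : ContinuousOn (fun r : ℝ =>
      (fderiv ℝ (fun q : ℂ × ℝ => Ω.connL e (q.2 • e, q.1)) (b, r)).comp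
        (ContinuousLinearMap.inl ℝ ℂ ℝ)) (uIcc 0 1) :=
    ((((Ω.contDiffOn_connL_line e).continuousOn_fderiv_of_isOpen isOpen_reg_prod (by simp)).comp
      (f := fun r : ℝ => ((b, r) : ℂ × ℝ)) (by fun_prop) fun _ _ => h).clm_comp continuousOn_const)
  rw [(Ω.hasFDerivAt_fluxForm e h).fderiv,
    ContinuousLinearMap.intervalIntegral_apply hc.intervalIntegrable,
    ContinuousLinearMap.intervalIntegral_apply
      (hc.clm_apply continuousOn_const).intervalIntegrable]
  refine intervalIntegral.integral_congr fun r _ => ?_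
  have h1 : HasFDerivAt (fun q : ℂ × ℝ => Ω.connL e (q.2 • e, q.1))
      (fderiv ℝ (fun q : ℂ × ℝ => Ω.connL e (q.2 • e, q.1)) (b, r)) (b, r) :=
    (((Ω.contDiffOn_connL_line e).contDiffAt (isOpen_reg_prod.mem_nhds h)).differentiableAt
      (by simp)).hasFDerivAt
  have h2 := (h1.comp (f := fun b => (b, r)) b (hasFDerivAt_prodMk_left b r)).clm_apply
    (hasFDerivAt_const u b)
  have h3 : DifferentiableAt ℝ (fun x : BasePt => dotProduct (Ω.conn x u) e) (r • e, b) :=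
    ((Ω.contDiffAt_conn (k := id) (y := (r • e, b)) h contDiffAt_id contDiffAt_const).dotProduct
      e).differentiableAt (by simp)
  have h4 := h3.hasFDerivAt.comp (f := fun b => (r • e, b)) b (hasFDerivAt_prodMk_right (r • e) b)
  have h5 : (fun b => dotProduct (Ω.conn (r • e, b) u) e) = fun b => Ω.connL e (r • e, b) u :=
    funext fun b => (Ω.connL_apply _ _ _).symm
  have h6 := h4.fderiv
  simp only [Function.comp_def] at h6 h2
  rw [h5, h2.fderiv] at h6
  have h7 := congrArg (fun L : ℂ →L[ℝ] ℝ => L u') h6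
  simpa using h7

/-- The flux form is closed: its differential is the difference of the areas of the reduced spaces at
two values of the moment map which are equivalent under the lattice. -/
theorem fluxForm_symm (m : Fin 2 → ℤ) {b : ℂ} (h : b ∈ P.reg) (u u' : ℂ) :
    fderiv ℝ (Ω.fluxForm (latt m)) b u u' = fderiv ℝ (Ω.fluxForm (latt m)) b u' u := by
  have hd : ∀ u, ContinuousOn (fun x : BasePt => fderiv ℝ (fun x : BasePt =>
      dotProduct (Ω.conn x u) (latt m)) x) {x | x.2 ∈ P.reg} := fun u =>
    ContDiffOn.continuousOn_fderiv_of_isOpen (n := ∞) (fun x hx =>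
      ((Ω.contDiffAt_conn (k := id) (y := x) hx contDiffAt_id contDiffAt_const).dotProduct
        _).contDiffWithinAt) (P.isOpen_reg.preimage continuous_snd) (by simp)
  have hi : ∀ u u' : ℂ, IntervalIntegrable (fun r : ℝ => fderiv ℝ (fun x : BasePt =>
      dotProduct (Ω.conn x u) (latt m)) (r • latt m, b) (0, u')) MeasureTheory.volume 0 1 :=
    fun u u' => (((hd u).comp (f := fun r : ℝ => ((r • latt m, b) : BasePt)) (by fun_prop)
      fun _ _ => h).clm_apply continuousOn_const).intervalIntegrable
  rw [← sub_eq_zero, Ω.fderiv_fluxForm _ h, Ω.fderiv_fluxForm _ h,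
    ← intervalIntegral.integral_sub (hi _ _) (hi _ _)]
  have hB : ∀ x : BasePt, x.2 ∈ P.reg →
      ContDiffAt ℝ ∞ (fun x : BasePt => Ω.beta x ![(0, u'), (0, u)]) x := fun x hx =>
    Ω.contDiffAt_beta (k := id) hx contDiffAt_id contDiffAt_const contDiffAt_const
  have h1 : ∀ r : ℝ, HasDerivAt (fun r : ℝ => Ω.beta (r • latt m, b) ![(0, u'), (0, u)])
      (fderiv ℝ (fun x : BasePt => dotProduct (Ω.conn x u') (latt m)) (r • latt m, b) (0, u) -
      fderiv ℝ (fun x : BasePt => dotProduct (Ω.conn x u) (latt m)) (r • latt m, b) (0, u')) r := by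
    intro r
    rw [Ω.conn_curv (x := (r • latt m, b)) h]
    have h2 : HasDerivAt (fun r : ℝ => ((r • latt m, b) : BasePt)) (latt m, 0) r := by
      have := ((hasDerivAt_id r).smul_const (latt m)).prodMk (hasDerivAt_const r b)
      simpa using this
    exact ((hB (r • latt m, b) h).differentiableAt (by simp)).hasFDerivAt.comp_hasDerivAt r h2
  rw [intervalIntegral.integral_eq_sub_of_hasDerivAt (fun r _ => h1 r) ((hi _ _).sub (hi _ _))]
  have h3 := Ω.area_add_latt (ξ := 0) h m u' u
  rw [zero_add] at h3
  simp [h3]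

/-- The integral of the transport along a segment of values of the moment map is, by Fubini's theorem, the
integral of the flux form along the path. -/
theorem integral_hol_line {γ : ℝ → ℂ} (hγ : ContDiff ℝ ∞ γ) (h : ∀ r ∈ Icc (0 : ℝ) 1, γ r ∈ P.reg)
    (e : Fin 2 → ℝ) : ∫ r in (0 : ℝ)..1, dotProduct (Ω.hol γ 0 1 (r • e)) e =
      ∫ x in (0 : ℝ)..1, Ω.fluxForm e (γ x) (deriv γ x) := by
  have hI : uIcc (0 : ℝ) 1 = Icc 0 1 := uIcc_of_le zero_le_one
  have hγ' : ContDiff ℝ ∞ (deriv γ) := (contDiff_infty_iff_deriv.1 hγ).2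
  have h1 : ContinuousOn (fun q : ℝ × ℝ =>
      dotProduct (Ω.conn (q.1 • e, γ q.2) (deriv γ q.2)) e) (Icc 0 1 ×ˢ Icc 0 1) := fun q hq =>
    (((Ω.contDiffAt_conn (k := fun q : ℝ × ℝ => (q.1 • e, γ q.2)) (w := fun q : ℝ × ℝ => deriv γ q.2)
      (h _ hq.2) (ContDiff.contDiffAt (ContDiff.prodMk (by fun_prop) (hγ.comp contDiff_snd)))
      (hγ'.comp contDiff_snd).contDiffAt).dotProduct e).continuousAt).continuousWithinAt
  have h2 : MeasureTheory.IntegrableOn (Function.uncurry fun r x : ℝ =>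
      dotProduct (Ω.conn (r • e, γ x) (deriv γ x)) e) (uIoc 0 1 ×ˢ uIoc 0 1) := by
    refine (h1.integrableOn_compact (isCompact_Icc.prod isCompact_Icc)).mono_set ?_
    rw [uIoc_of_le zero_le_one]
    exact prod_mono Ioc_subset_Icc_self Ioc_subset_Icc_self
  have h3 := MeasureTheory.intervalIntegral_intervalIntegral_swap h2
  have h4 : ∀ r : ℝ, dotProduct (Ω.hol γ 0 1 (r • e)) e =
      ∫ x in (0 : ℝ)..1, dotProduct (Ω.conn (r • e, γ x) (deriv γ x)) e := fun r =>
    Ω.hol_dot hγ (by rw [hI]; exact h) _ _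
  simp only [h4]
  rw [h3]
  refine intervalIntegral.integral_congr fun x hx => ?_
  rw [hI] at hx
  exact (Ω.fluxForm_apply e (h x hx) _).symm

/-- The difference of the parallel transports along two paths, homotopic in the set of regular values, is
the gradient of a function which is periodic under the lattice. There is a primitive because the transports
are closed as one-forms in `ξ`; its periods are the difference of the fluxes along the two paths, which
vanishes because the flux form is closed on the base. -/
theorem exists_periodic_primitive {γ₀ γ₁ : ℝ → ℂ} (hγ₀ : ContDiff ℝ ∞ γ₀) (hγ₁ : ContDiff ℝ ∞ γ₁)
    {h : ℝ → ℝ → ℂ} (hh : ContinuousOn (fun q : ℝ × ℝ => h q.1 q.2) (Icc 0 1 ×ˢ Icc 0 1))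
    (hreg : ∀ z ∈ Icc (0 : ℝ) 1, ∀ x ∈ Icc (0 : ℝ) 1, h z x ∈ P.reg) {p q : ℂ}
    (h0 : ∀ z ∈ Icc (0 : ℝ) 1, h z 0 = p) (h1 : ∀ z ∈ Icc (0 : ℝ) 1, h z 1 = q)
    (e0 : ∀ x ∈ Icc (0 : ℝ) 1, h 0 x = γ₀ x) (e1 : ∀ x ∈ Icc (0 : ℝ) 1, h 1 x = γ₁ x) :
    ∃ g : (Fin 2 → ℝ) → ℝ, ContDiff ℝ ∞ g ∧ (∀ ξ m, g (ξ + latt m) = g ξ) ∧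
      ∀ ξ, fderiv ℝ g ξ = dotL (Ω.hol γ₀ 0 1 ξ - Ω.hol γ₁ 0 1 ξ) := by
  have hI : uIcc (0 : ℝ) 1 = Icc 0 1 := uIcc_of_le zero_le_one
  have r0 : ∀ x ∈ Icc (0 : ℝ) 1, γ₀ x ∈ P.reg := fun x hx =>
    e0 x hx ▸ hreg 0 (left_mem_Icc.2 zero_le_one) x hx
  have r1 : ∀ x ∈ Icc (0 : ℝ) 1, γ₁ x ∈ P.reg := fun x hx =>
    e1 x hx ▸ hreg 1 (right_mem_Icc.2 zero_le_one) x hx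
  have sm : ∀ {γ : ℝ → ℂ}, ContDiff ℝ ∞ γ → (∀ x ∈ Icc (0 : ℝ) 1, γ x ∈ P.reg) →
      ContDiff ℝ ∞ (Ω.hol γ 0 1) := fun {γ} hγ hr => contDiff_iff_contDiffAt.2 fun ξ =>
    Ω.contDiffAt_hol (E := Fin 2 → ℝ) (Γ := fun _ => γ) (a := fun _ => 0) (b := fun _ => 1) (ξ := id)
      (hγ.comp contDiff_snd) contDiff_const contDiff_const contDiff_id (by rw [hI]; exact hr)
  let f : (Fin 2 → ℝ) → (Fin 2 → ℝ) := fun ξ => Ω.hol γ₀ 0 1 ξ - Ω.hol γ₁ 0 1 ξ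
  have hf : ContDiff ℝ ∞ f := (sm hγ₀ r0).sub (sm hγ₁ r1)
  have hω : ContDiff ℝ ∞ (fun ξ => dotL (f ξ)) := dotL.contDiff.comp hf
  have hsymm : ∀ ξ e e', fderiv ℝ (fun ξ => dotL (f ξ)) ξ e e' =
      fderiv ℝ (fun ξ => dotL (f ξ)) ξ e' e := by
    have key : ∀ ξ e e', fderiv ℝ (fun ξ => dotL (f ξ)) ξ e e' =
        fderiv ℝ (fun ξ => dotProduct (Ω.hol γ₀ 0 1 ξ) e') ξ e -
          fderiv ℝ (fun ξ => dotProduct (Ω.hol γ₁ 0 1 ξ) e') ξ e := by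
      intro ξ e e'
      have a0 := ((sm hγ₀ r0).contDiffAt (x := ξ)).dotProduct e'
      have a1 := ((sm hγ₁ r1).contDiffAt (x := ξ)).dotProduct e'
      have k1 := ((hω.differentiable (by simp) ξ).hasFDerivAt.clm_apply
        (hasFDerivAt_const e' ξ)).fderiv
      have k2 := ((a0.differentiableAt (by simp)).hasFDerivAt.sub
        (a1.differentiableAt (by simp)).hasFDerivAt).fderiv
      have k3 : (fun ξ => dotL (f ξ) e') = (fun ξ => dotProduct (Ω.hol γ₀ 0 1 ξ) e') -
          fun ξ => dotProduct (Ω.hol γ₁ 0 1 ξ) e' := by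
        funext ξ; simp [f, dotL_apply]
      rw [← k3, k1] at k2
      simpa using congrArg (fun L : (Fin 2 → ℝ) →L[ℝ] ℝ => L e) k2
    intro ξ e e'
    rw [key, key, Ω.hol_symm hγ₀ (by rw [hI]; exact r0), Ω.hol_symm hγ₁ (by rw [hI]; exact r1)]
  obtain ⟨g, hg⟩ := convex_univ.exists_forall_hasFDerivAt_of_fderiv_symmetric isOpen_univ
    (hω.differentiable (by simp)).differentiableOn fun ξ _ => hsymm ξ
  have hg : ∀ ξ, HasFDerivAt g (dotL (f ξ)) ξ := fun ξ => hg ξ trivial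
  have hgs : ContDiff ℝ ∞ g := by
    rw [contDiff_infty_iff_fderiv]
    refine ⟨fun ξ => (hg ξ).differentiableAt, ?_⟩
    rw [show fderiv ℝ g = fun ξ => dotL (f ξ) from funext fun ξ => (hg ξ).fderiv]
    exact hω
  refine ⟨g, hgs, ?_, fun ξ => (hg ξ).fderiv⟩
  -- the winding numbers of the two paths agree
  have hwind : wind P γ₀ 0 1 = wind P γ₁ 0 1 := by
    let η : ℂ → ℂ →L[ℝ] ℝ := fun b => Complex.imCLM.comp
      ((ContinuousLinearMap.mul ℝ ℂ) ((P.crit + b)⁻¹))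
    have hη : ∀ b ∈ P.reg, HasFDerivAt η ((ContinuousLinearMap.compL ℝ ℂ ℂ ℝ Complex.imCLM).comp
        ((ContinuousLinearMap.mul ℝ ℂ).comp ((ContinuousLinearMap.toSpanSingleton ℂ
          (-((P.crit + b) ^ 2)⁻¹)).restrictScalars ℝ))) b := by
      intro b hb
      have h2 : HasDerivAt (fun b : ℂ => (P.crit + b)⁻¹) (-((P.crit + b) ^ 2)⁻¹) b := by
        have := ((hasDerivAt_id b).const_add (P.crit : ℂ)).inv (crit_add_ne hb)
        refine this.congr_deriv ?_
        rw [neg_div, one_div]; rfl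
      have h3 := h2.hasFDerivAt.restrictScalars ℝ
      exact (ContinuousLinearMap.compL ℝ ℂ ℂ ℝ Complex.imCLM).hasFDerivAt.comp b
        ((ContinuousLinearMap.mul ℝ ℂ).hasFDerivAt.comp b h3)
    have hap : ∀ b u, η b u = dArg P b u := fun b u => by
      simp [η, dArg, div_eq_mul_inv]; ring
    have h5 := integral_eq_of_homotopy (η := η) P.isOpen_reg
      (fun b hb => (hη b hb).differentiableAt.differentiableWithinAt)
      (fun b hb u u' => by rw [(hη b hb).fderiv]; simp; ring) hh hreg h0 h1 (hγ₀.of_le (by norm_cast))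
      (hγ₁.of_le (by norm_cast)) e0 e1
    simpa only [hap, wind] using h5
  intro ξ m
  have hfp : ∀ ξ, f (ξ + latt m) = f ξ := by
    intro ξ
    simp only [f]
    rw [Ω.hol_add_latt hγ₀ (by rw [hI]; exact r0), Ω.hol_add_latt hγ₁ (by rw [hI]; exact r1), hwind]
    funext j; simp
  -- the increment of `g` over a lattice vector does not depend on the point, since its gradient is periodic
  have hconst : g (ξ + latt m) - g ξ = g (0 + latt m) - g 0 := by
    have h2 : ∀ x, HasFDerivAt (fun x => g (x + latt m) - g x) (0 : (Fin 2 → ℝ) →L[ℝ] ℝ) x := by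
      intro x
      have h3 := (((hg (x + latt m)).comp x ((hasFDerivAt_id x).add_const (latt m))).sub (hg x))
      rw [hfp, ContinuousLinearMap.comp_id, sub_self] at h3
      exact h3
    exact is_const_of_fderiv_eq_zero (fun x => (h2 x).differentiableAt) (fun x => (h2 x).fderiv) ξ 0
  -- at the origin, this increment is the difference of the fluxes
  have hper : g (latt m) - g 0 = 0 := by
    have h2 : ∀ r : ℝ, HasDerivAt (fun r : ℝ => g (r • latt m)) (dotProduct (f (r • latt m)) (latt m)) r := by
      intro r
      have h3 := (hasDerivAt_id r).smul_const (latt m)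
      rw [one_smul] at h3
      exact (hg (r • latt m)).comp_hasDerivAt r h3
    have hcont : ∀ {γ : ℝ → ℂ}, ContDiff ℝ ∞ γ → (∀ x ∈ Icc (0 : ℝ) 1, γ x ∈ P.reg) →
        Continuous fun r : ℝ => dotProduct (Ω.hol γ 0 1 (r • latt m)) (latt m) := fun {γ} hγ hr => by
      have := (sm hγ hr).continuous
      exact (dotL.continuous.comp (this.comp (by fun_prop))).clm_apply continuous_const
    have h4 := intervalIntegral.integral_eq_sub_of_hasDerivAt (a := 0) (b := 1) (fun r _ => h2 r)
      (by
        refine Continuous.intervalIntegrable ?_ _ _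
        simp only [f, sub_dotProduct]
        exact (hcont hγ₀ r0).sub (hcont hγ₁ r1))
    simp only [one_smul, zero_smul] at h4
    rw [← h4]
    simp only [f, sub_dotProduct]
    rw [intervalIntegral.integral_sub ((hcont hγ₀ r0).intervalIntegrable _ _)
      ((hcont hγ₁ r1).intervalIntegrable _ _), Ω.integral_hol_line hγ₀ r0, Ω.integral_hol_line hγ₁ r1,
      sub_eq_zero]
    exact integral_eq_of_homotopy P.isOpen_reg
      (fun b hb => (Ω.hasFDerivAt_fluxForm _ hb).differentiableAt.differentiableWithinAt)
      (fun b hb u u' => Ω.fluxForm_symm m hb u u') hh hreg h0 h1 (hγ₀.of_le (by norm_cast))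
      (hγ₁.of_le (by norm_cast)) e0 e1
  rw [zero_add] at hconst
  linarith

end ToricKaehler

/-! ### Hamiltonian rotations -/

theorem unitExp_add (x y : ℝ) : unitExp (x + y) = unitExp x * unitExp y := by
  rw [unitExp, unitExp, unitExp, ← Complex.exp_add]; push_cast; ring_nf

theorem unitExp_zero : unitExp 0 = 1 := by simp [unitExp]

theorem unitExp_ne_zero (x : ℝ) : unitExp x ≠ 0 := Complex.exp_ne_zero _

theorem unitExp_zpow (x : ℝ) (n : ℤ) : unitExp x ^ n = unitExp (n * x) := by
  rw [unitExp, unitExp, ← Complex.exp_int_mul]; push_cast; ring_nf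

/-- The weights of the chart coordinates under the rotation of `x₁, x₂` by the angles `2πc`. -/
def rotWeight (s : Bool) (c : Fin 2 → ℝ) : Fin 3 → ℝ :=
  ![(sgn s : ℝ) * (c 0 + c 1), -((sgn s : ℝ) * c 0), -((sgn s : ℝ) * c 1)]

/-- The rotation of `x₁, x₂` by the angles `2πc` in a chart. -/
def rotC (s : Bool) (c : Fin 2 → ℝ) (y : C3) : C3 := fun k => unitExp (rotWeight s c k) * y k

theorem rotC_zero (s : Bool) (y : C3) : rotC s 0 y = y := by
  funext k; fin_cases k <;> simp [rotC, rotWeight, unitExp_zero]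

theorem rotC_add (s : Bool) (c c' : Fin 2 → ℝ) (y : C3) : rotC s c (rotC s c' y) = rotC s (c + c') y := by
  have h : ∀ k, rotWeight s (c + c') k = rotWeight s c k + rotWeight s c' k := by
    intro k; fin_cases k <;> simp [rotWeight] <;> ring
  funext k
  rw [rotC, rotC, rotC, h, unitExp_add, mul_assoc]

theorem v0_rotC (s : Bool) (c : Fin 2 → ℝ) (y : C3) : v0 (rotC s c y) = v0 y := by
  simp only [v0, rotC]
  rw [Finset.prod_mul_distrib, Fin.prod_univ_three (fun k => unitExp _), ← unitExp_add, ← unitExp_add,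
    show rotWeight s c 0 + rotWeight s c 1 + rotWeight s c 2 = 0 by simp [rotWeight]; ring,
    unitExp_zero, one_mul]

theorem rotC_eq_zero_iff {s : Bool} {c : Fin 2 → ℝ} {y : C3} {k : Fin 3} :
    rotC s c y k = 0 ↔ y k = 0 := by
  simp [rotC, unitExp_ne_zero]

theorem hasDerivAt_rotC (s : Bool) (c : Fin 2 → ℝ) (y : C3) (x : ℝ) :
    HasDerivAt (fun x : ℝ => rotC s (x • c) y)
      (∑ j, c j • rotField s j (rotC s (x • c) y)) x := by
  rw [hasDerivAt_pi]
  intro k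
  have h1 : HasDerivAt (fun x : ℝ => rotWeight s (x • c) k) (rotWeight s c k) x := by
    have : (fun x : ℝ => rotWeight s (x • c) k) = fun x => x * rotWeight s c k := by
      funext x; fin_cases k <;> simp [rotWeight] <;> ring
    rw [this]
    simpa using (hasDerivAt_id x).mul_const (rotWeight s c k)
  have h2 := (hasDerivWithinAt_unitExp (I := univ) h1.hasDerivWithinAt).hasDerivAt univ_mem
  refine (h2.mul_const (y k)).congr_deriv ?_
  rw [Fin.sum_univ_two]
  simp only [Pi.add_apply, Pi.smul_apply, rotField, Complex.real_smul]
  fin_cases k <;> simp [rotWeight, rotC] <;> ring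

namespace LGParams

variable {P : LGParams}

theorem Wc_rotC (s : Bool) (c : Fin 2 → ℝ) (y : C3) : P.Wc (rotC s c y) = P.Wc y := by
  rw [Wc, Wc, v0_rotC]

theorem rotC_mem_region {s : Bool} {c : Fin 2 → ℝ} {y : C3} : rotC s c y ∈ P.region ↔ y ∈ P.region := by
  rw [region, mem_ofPred_eq, mem_ofPred_eq, Wc_rotC]

theorem rotC_mem_transDom {s s' : Bool} {m : Fin 2 → ℤ} {c : Fin 2 → ℝ} {y : C3}
    (h : y ∈ transDom s s' m) : rotC s c y ∈ transDom s s' m :=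
  fun k hk => h k (rotC_eq_zero_iff.1 hk)

theorem trans_rotC (s s' : Bool) (m : Fin 2 → ℤ) (c : Fin 2 → ℝ) (y : C3) :
    P.trans s s' m (rotC s c y) = rotC s' c (P.trans s s' m y) := by
  funext l
  simp only [trans, rotC, mul_zpow, unitExp_zpow]
  rw [Finset.prod_mul_distrib, Fin.prod_univ_three (fun k => unitExp _), ← unitExp_add, ← unitExp_add]
  have h : (bary s' l (m + vert s 0) : ℝ) * rotWeight s c 0 + bary s' l (m + vert s 1) * rotWeight s c 1 +
      bary s' l (m + vert s 2) * rotWeight s c 2 = rotWeight s' c l := by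
    have e0 : vert s 0 = 0 := by funext i; fin_cases i <;> simp [vert]
    have e1 : vert s 1 = ![sgn s, 0] := by funext i; fin_cases i <;> simp [vert]
    have e2 : vert s 2 = ![0, sgn s] := by
      funext i; fin_cases i
      · simp only [vert]; rfl
      · simp only [vert]; rfl
    have hs := sgn_cast_mul_self (R := ℝ) s
    rw [e0, e1, e2]
    fin_cases l
    · simp [bary, rotWeight]
      linear_combination (sgn s' : ℝ) * (c 0 + c 1) * hs
    · simp [bary, rotWeight]
      linear_combination -(sgn s' : ℝ) * c 0 * hs
    · simp [bary, rotWeight]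
      linear_combination -(sgn s' : ℝ) * c 1 * hs
  rw [h]
  ring

theorem rotC_torusPt (s : Bool) (c : Fin 2 → ℝ) (q : LogPt) :
    rotC s c (P.torusPt s q) = P.torusPt s (rotLog c q) := by
  refine C3_ext (fun j => ?_) (fun j h => torusPt_succ_ne s q j (rotC_eq_zero_iff.1 h)) ?_
  · rw [torusPt_succ, rotC, torusPt_succ, unitExp, ← Complex.exp_add]
    congr 1
    fin_cases j <;> simp [rotWeight, LogPt.z, rotLog] <;> ring
  · rw [v0_rotC, v0_torusPt, v0_torusPt]; rfl

end LGParams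

namespace ToricKaehler

open LGParams

variable {P : LGParams} (Ω : ToricKaehler P)

/-- The moment map is invariant under rotations. At points with `v₀ = 0` this follows by continuity. -/
theorem xi_rotC (s : Bool) (c : Fin 2 → ℝ) {y : C3} (hy : y ∈ P.region) :
    Ω.xi s (rotC s c y) = Ω.xi s y := by
  have hreg : ∀ {y}, y ∈ P.region → v0 y ≠ 0 → Ω.xi s (rotC s c y) = Ω.xi s y := by
    intro y hy hv
    have hL := torusPt_logPt (P := P) (s := s) fun j => ne_zero_of_v0 hv j.succ
    have hb : P.Wc y ≠ -(P.crit : ℂ) := by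
      rw [← P.nu_ne_zero, ← (Wc_eq (P := P) (y := y)).1 rfl]; exact hv
    have hq : P.logPt s y ∈ P.logReg := ⟨hy, hb⟩
    have hq' : rotLog c (P.logPt s y) ∈ P.logReg := hq
    rw [← hL, rotC_torusPt, Ω.xi_torusPt s hq, Ω.xi_torusPt s hq', rotLog_eq, Ω.lxi_add_dθ hq]
  let f : ℂ → C3 := fun z k => y k + z
  have hf : Tendsto f (𝓝[≠] 0) (𝓝 y) := by
    have h1 : Continuous f := by fun_prop
    have h2 := h1.tendsto 0
    simp only [f, add_zero] at h2
    exact h2.mono_left nhdsWithin_le_nhds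
  have hv : ∀ᶠ z in 𝓝[≠] (0 : ℂ), v0 (f z) ≠ 0 := by
    have h1 : ∀ k, ∀ᶠ z in 𝓝[≠] (0 : ℂ), y k + z ≠ 0 := by
      intro k
      by_cases hk : y k = 0
      · filter_upwards [self_mem_nhdsWithin] with z hz
        rwa [hk, zero_add]
      · have h2 : Tendsto (fun z : ℂ => y k + z) (𝓝 0) (𝓝 (y k + 0)) := by
          exact (continuous_const.add continuous_id).tendsto 0
        rw [add_zero] at h2
        exact (h2.mono_left nhdsWithin_le_nhds).eventually_ne hk
    filter_upwards [h1 0, h1 1, h1 2] with z h0 h1 h2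
    refine Finset.prod_ne_zero_iff.2 fun k _ => ?_
    fin_cases k
    exacts [h0, h1, h2]
  have hr : ∀ᶠ z in 𝓝[≠] (0 : ℂ), f z ∈ P.region := hf.eventually (isOpen_region.mem_nhds hy)
  have hrot : Continuous (rotC s c) := by unfold rotC; fun_prop
  have t1 : Tendsto (fun z => Ω.xi s (f z)) (𝓝[≠] 0) (𝓝 (Ω.xi s y)) :=
    (Ω.contDiffAt_xi s hy).continuousAt.tendsto.comp hf
  have t2 : Tendsto (fun z => Ω.xi s (rotC s c (f z))) (𝓝[≠] 0) (𝓝 (Ω.xi s (rotC s c y))) :=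
    (Ω.contDiffAt_xi s (rotC_mem_region.2 hy)).continuousAt.tendsto.comp
      ((hrot.tendsto y).comp hf)
  refine tendsto_nhds_unique t2 (t1.congr' ?_)
  filter_upwards [hv, hr] with z h1 h2
  exact (hreg h2 h1).symm

theorem xi_trans {s s' : Bool} {m : Fin 2 → ℤ} {y : C3} (hy : y ∈ P.region) (h : y ∈ transDom s s' m) :
    Ω.xi s' (P.trans s s' m y) = Ω.xi s y + latt m := by
  rw [Ω.xi_glue s s' m y hy h]
  funext i
  rw [Pi.add_apply, latt_apply]

/-- A function of the moment map which is periodic under the lattice descends to `Y`. -/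
def ofXi {X : Type*} (f : (Fin 2 → ℝ) → X) (hf : ∀ ξ m, f (ξ + latt m) = f ξ) : P.Y → X :=
  Quot.lift (fun p => f (Ω.xi p.1.1 p.1.2)) (by
    rintro p q ⟨m, hm, hq⟩
    simp only [hq]
    rw [Ω.xi_trans p.2 hm, hf])

/-- The rotation of the angles by a function of the moment map which is periodic under the lattice. -/
def rotBy (f : (Fin 2 → ℝ) → (Fin 2 → ℝ)) (hf : ∀ ξ m, f (ξ + latt m) = f ξ) : P.Y → P.Y :=
  Quot.map (fun p => ⟨(p.1.1, rotC p.1.1 (f (Ω.xi p.1.1 p.1.2)) p.1.2), rotC_mem_region.2 p.2⟩) (by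
    rintro p q ⟨m, hm, hq⟩
    refine ⟨m, rotC_mem_transDom hm, ?_⟩
    simp only
    rw [trans_rotC, hq, Ω.xi_trans p.2 hm, hf])

theorem W_rotBy {f : (Fin 2 → ℝ) → (Fin 2 → ℝ)} (hf : ∀ ξ m, f (ξ + latt m) = f ξ) (p : P.Y) :
    P.W (Ω.rotBy f hf p) = P.W p := by
  induction p using Quot.ind with
  | mk a => exact Wc_rotC _ _ _

theorem rotBy_rotBy {f f' : (Fin 2 → ℝ) → (Fin 2 → ℝ)} (hf : ∀ ξ m, f (ξ + latt m) = f ξ)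
    (hf' : ∀ ξ m, f' (ξ + latt m) = f' ξ) (h : ∀ ξ, f ξ + f' ξ = 0) (p : P.Y) :
    Ω.rotBy f hf (Ω.rotBy f' hf' p) = p := by
  induction p using Quot.ind with
  | mk a =>
    refine congrArg (Quot.mk P.glue) (Subtype.ext (Prod.ext rfl ?_))
    simp only
    rw [Ω.xi_rotC _ _ a.2, rotC_add, h, rotC_zero]

theorem rotBy_pt {f : (Fin 2 → ℝ) → (Fin 2 → ℝ)} (hf : ∀ ξ m, f (ξ + latt m) = f ξ) {ξ θ : Fin 2 → ℝ}
    {b : ℂ} (hb : b ∈ P.reg) : Ω.rotBy f hf (Ω.pt (ξ, θ, b)) = Ω.pt (ξ, θ + f ξ, b) := by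
  have hx : ∀ θ : Fin 2 → ℝ, ‖(Ω.act (ξ, θ, b)).2.2‖ < P.rad := fun _ => hb.1
  rw [pt, pt, toY_eq (hx _), toY_eq (hx _)]
  refine congrArg (Quot.mk P.glue) (Subtype.ext (Prod.ext rfl ?_))
  have h1 : Ω.xi true (P.torusPt true (Ω.act (ξ, θ, b))) = ξ := by
    rw [Ω.xi_torusPt true (q := Ω.act (ξ, θ, b)) hb]
    exact congrArg Prod.fst (Ω.mom_act (x := (ξ, θ, b)) hb)
  simp only
  rw [h1, rotC_torusPt]
  rfl

/-- The Hamiltonian flow of a function of the moment map rotates the angles by minus its gradient. -/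
theorem exists_hamiltonian_rotation {g : (Fin 2 → ℝ) → ℝ} (hg : ContDiff ℝ ∞ g)
    (hper : ∀ ξ m, g (ξ + latt m) = g ξ) : ∃ Φ : P.Y → P.Y, Ω.IsHamiltonianDiffeo Φ ∧
      (∀ p, P.W (Φ p) = P.W p) ∧ ∀ ξ θ b, b ∈ P.reg → Φ (Ω.pt (ξ, θ, b)) =
        Ω.pt (ξ, θ - fun j => fderiv ℝ g ξ (Pi.single j 1), b) := by
  let G : (Fin 2 → ℝ) → Fin 2 → ℝ := fun ξ j => fderiv ℝ g ξ (Pi.single j 1)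
  have hG : ∀ ξ m, G (ξ + latt m) = G ξ := by
    intro ξ m
    have h1 : (fun x => g (x + latt m)) = g := funext fun x => hper x m
    have h2 : fderiv ℝ (fun x => g (x + latt m)) ξ = fderiv ℝ g (ξ + latt m) := fderiv_comp_add_right _
    rw [h1] at h2
    simp only [G, h2]
  have hτ : ∀ τ : ℝ, ∀ ξ m, (fun ξ => τ • -G ξ) (ξ + latt m) = (fun ξ => τ • -G ξ) ξ := fun τ ξ m => by
    simp only [hG]
  let φ : ℝ → P.Y → P.Y := fun τ => Ω.rotBy (fun ξ => τ • -G ξ) (hτ τ)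
  let H : P.Y → ℝ := Ω.ofXi g hper
  have hH : ∀ s y, y ∈ P.region → P.inChart H s y = g (Ω.xi s y) := fun s y hy => dif_pos hy
  have hinv : ∀ τ p, φ τ (φ (-τ) p) = p := fun τ p =>
    Ω.rotBy_rotBy _ _ (fun ξ => by simp) p
  have hW : ∀ τ p, P.W (φ τ p) = P.W p := fun τ p => Ω.W_rotBy _ p
  refine ⟨φ 1, ⟨fun _ => H, φ, ?_, ?_, ?_, ?_⟩, hW 1, ?_⟩
  · intro s
    have h1 : ContDiffOn ℝ ∞ (fun q : ℝ × C3 => g (Ω.xi s q.2)) {q | q.2 ∈ P.region ∧ P.Wc q.2 ≠ 0} :=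
      hg.comp_contDiffOn ((Ω.xi_smooth s).comp contDiff_snd.contDiffOn fun q hq => hq.1)
    exact h1.congr fun q hq => hH s q.2 hq.1
  · refine fun p _ => ⟨?_, rfl⟩
    induction p using Quot.ind with
    | mk a =>
      refine congrArg (Quot.mk P.glue) (Subtype.ext (Prod.ext rfl ?_))
      simp only [zero_smul]
      exact rotC_zero _ _
  · intro τ _
    refine ⟨fun p hp => ?_, fun p _ p' _ h => ?_, fun p hp => ⟨φ (-τ) p, ?_, hinv τ p⟩⟩
    · change P.W _ ≠ 0
      rw [hW]; exact hp
    · have h1 := congrArg (φ (-τ)) h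
      have h2 : ∀ p, φ (-τ) (φ τ p) = p := fun p => by
        have := hinv (-τ) p
        rwa [neg_neg] at this
      rwa [h2, h2] at h1
    · change P.W _ ≠ 0
      rw [hW]; exact hp
  · intro p _ τ _
    induction p using Quot.ind with
    | mk a =>
      obtain ⟨⟨s, y⟩, hy⟩ := a
      have hy : y ∈ P.region := hy
      let c := -G (Ω.xi s y)
      have hr : ∀ τ : ℝ, rotC s (τ • c) y ∈ P.region := fun τ => rotC_mem_region.2 hy
      refine ⟨s, fun τ => rotC s (τ • c) y, _, Eventually.of_forall fun x => ⟨hr x, rfl⟩,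
        (hasDerivAt_rotC s c y τ).hasDerivWithinAt, fun v => ?_⟩
      set z := rotC s (τ • c) y with hz
      have hzr : z ∈ P.region := hr τ
      have hxz : Ω.xi s z = Ω.xi s y := Ω.xi_rotC s _ hy
      have h1 : P.inChart H s =ᶠ[𝓝 z] fun y => g (Ω.xi s y) := by
        filter_upwards [isOpen_region.mem_nhds hzr] with y hy
        exact hH s y hy
      have h2 : HasFDerivAt (fun y => g (Ω.xi s y)) ((fderiv ℝ g (Ω.xi s z)).comp (fderiv ℝ (Ω.xi s) z)) z :=
        ((hg.differentiable (by simp)) _).hasFDerivAt.comp z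
          ((Ω.contDiffAt_xi s hzr).differentiableAt (by simp)).hasFDerivAt
      rw [h1.fderiv_eq, h2.fderiv, ContinuousLinearMap.comp_apply]
      have h3 : ∀ w : Fin 2 → ℝ, fderiv ℝ g (Ω.xi s z) w = G (Ω.xi s y) 0 * w 0 + G (Ω.xi s y) 1 * w 1 := by
        intro w
        have : w = w 0 • Pi.single 0 1 + w 1 • Pi.single 1 1 := by
          funext i; fin_cases i <;> simp
        conv_lhs => rw [this]
        rw [map_add, map_smul, map_smul, hxz]
        simp only [G, smul_eq_mul]
        ring
      rw [h3, Ω.xi_moment s z hzr v 0, Ω.xi_moment s z hzr v 1, Fin.sum_univ_two, alt_add_left,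
        alt_smul_left, alt_smul_left, alt_swap _ _ v, alt_swap _ _ v]
      simp only [c, Pi.neg_apply]
      ring
  · intro ξ θ b hb
    refine (Ω.rotBy_pt (hτ 1) hb).trans ?_
    rw [one_smul, ← sub_eq_add_neg]

end ToricKaehler

namespace ToricKaehler

open LGParams

variable {P : LGParams} (Ω : ToricKaehler P)

/-! ### Reparametrization of paths -/

theorem deriv_comp_of_eqOn {γ γ' : ℝ → ℂ} {α : ℝ → ℝ} (hγ : ContDiff ℝ ∞ γ) (hγ' : ContDiff ℝ ∞ γ')
    (hα : ContDiff ℝ ∞ α) {a b : ℝ} (hab : a ≠ b) (heq : ∀ x ∈ uIcc a b, γ' x = γ (α x)) {x : ℝ}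
    (hx : x ∈ uIcc a b) : deriv γ' x = deriv α x • deriv γ (α x) := by
  have hI : UniqueDiffOn ℝ (uIcc a b) :=
    uniqueDiffOn_convex (convex_uIcc a b) (by
      rw [uIcc, interior_Icc]; exact nonempty_Ioo.2 (by simpa using hab.symm))
  have h1 : HasDerivWithinAt γ' (deriv γ' x) (uIcc a b) x :=
    ((hγ'.differentiable (by simp)) x).hasDerivAt.hasDerivWithinAt
  have h2 : HasDerivAt (fun x => γ (α x)) (deriv α x • deriv γ (α x)) x :=
    ((hγ.differentiable (by simp)) (α x)).hasDerivAt.scomp x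
      ((hα.differentiable (by simp)) x).hasDerivAt
  exact (hI x hx).eq_deriv _ h1 (h2.hasDerivWithinAt.congr heq (heq x hx))

theorem hol_comp {γ γ' : ℝ → ℂ} {α : ℝ → ℝ} (hγ : ContDiff ℝ ∞ γ) (hγ' : ContDiff ℝ ∞ γ')
    (hα : ContDiff ℝ ∞ α) {a b : ℝ} (heq : ∀ x ∈ uIcc a b, γ' x = γ (α x))
    (hreg : ∀ x ∈ uIcc a b, γ' x ∈ P.reg) (ξ : Fin 2 → ℝ) :
    Ω.hol γ' a b ξ = Ω.hol γ (α a) (α b) ξ := by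
  rcases eq_or_ne a b with rfl | hab
  · simp [hol]
  have h1 := intervalIntegral.integral_deriv_smul_comp' (a := a) (b := b) (f := α) (f' := deriv α)
    (g := fun τ => Ω.conn (ξ, γ τ) (deriv γ τ))
    (fun x _ => ((hα.differentiable (by simp)) x).hasDerivAt)
    (hα.continuous_deriv (by simp)).continuousOn
    ((Ω.continuousOn_conn_path hγ ξ).mono (by
      rintro _ ⟨x, hx, rfl⟩
      change γ (α x) ∈ P.reg
      rw [← heq x hx]; exact hreg x hx))
  rw [hol, hol, ← h1]
  refine intervalIntegral.integral_congr fun x hx => ?_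
  simp only [Function.comp]
  rw [← Ω.conn_smul, ← deriv_comp_of_eqOn hγ hγ' hα hab heq hx, heq x hx]

theorem hol_add {γ : ℝ → ℂ} (hγ : ContDiff ℝ ∞ γ) {a b c : ℝ} (h1 : ∀ r ∈ uIcc a b, γ r ∈ P.reg)
    (h2 : ∀ r ∈ uIcc b c, γ r ∈ P.reg) (ξ : Fin 2 → ℝ) :
    Ω.hol γ a b ξ + Ω.hol γ b c ξ = Ω.hol γ a c ξ :=
  intervalIntegral.integral_add_adjacent_intervals
    ((Ω.continuousOn_conn_path hγ ξ).mono h1).intervalIntegrable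
    ((Ω.continuousOn_conn_path hγ ξ).mono h2).intervalIntegrable

theorem norm_lt_of_mem_transport {γ : ℝ → ℂ} {a b : ℝ} {A : Set P.Y} {p : P.Y}
    (h : p ∈ Ω.transport γ a b A) : ∀ r ∈ uIcc a b, ‖γ r‖ < P.rad := by
  obtain ⟨c, hc, _, _⟩ := h
  intro r hr
  rw [← (hc r hr).1]
  exact norm_W_lt _

end ToricKaehler

namespace BaseTriangle

open LGParams ToricKaehler

variable {P : LGParams} {γ₁ γ₂ : UPath P} {κ : KPath P} (Δ : BaseTriangle P γ₁ γ₂ κ)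

/-! ### The Lagrangian isotopy over the triangle -/

theorem mem_reg {s t : ℝ} (hs : s ∈ Icc (0 : ℝ) 1) (ht : t ∈ Icc (0 : ℝ) 1) : Δ.δ s t ∈ P.reg :=
  ⟨(Δ.in_disc s hs t ht).1, (Δ.in_disc s hs t ht).2.1⟩

theorem smooth_left (t : ℝ) : ContDiff ℝ ∞ fun s => Δ.δ s t :=
  Δ.smooth.comp (contDiff_id.prodMk contDiff_const)

theorem smooth_right (s : ℝ) : ContDiff ℝ ∞ (Δ.δ s) :=
  Δ.smooth.comp (contDiff_const.prodMk contDiff_id)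

theorem uIcc_subset_unit {a b : ℝ} (ha : a ∈ Icc (0 : ℝ) 1) (hb : b ∈ Icc (0 : ℝ) 1) {r : ℝ}
    (hr : r ∈ uIcc a b) : r ∈ Icc (0 : ℝ) 1 := uIcc_subset_Icc ha hb hr

theorem zero_mem : (0 : ℝ) ∈ Icc (0 : ℝ) 1 := ⟨le_rfl, zero_le_one⟩

theorem one_mem : (1 : ℝ) ∈ Icc (0 : ℝ) 1 := ⟨zero_le_one, le_rfl⟩

/-- Parallel transport from the apex of the triangle to `δ (s, t)`, along the side `t = 0` and then along
the arc with the given `s`. -/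
def tot (Ω : ToricKaehler P) (s t : ℝ) (ξ : Fin 2 → ℝ) : Fin 2 → ℝ :=
  Ω.hol (fun s => Δ.δ s 0) 1 s ξ + Ω.hol (Δ.δ s) 0 t ξ

variable (Ω : ToricKaehler P)

theorem contDiffAt_tot {s t : ℝ} (hs : s ∈ Icc (0 : ℝ) 1) (ht : t ∈ Icc (0 : ℝ) 1) (ξ : Fin 2 → ℝ) :
    ContDiffAt ℝ ∞ (fun q : ℝ × ℝ × (Fin 2 → ℝ) => Δ.tot Ω q.1 q.2.1 q.2.2) (s, t, ξ) := by
  refine ContDiffAt.add ?_ ?_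
  · exact Ω.contDiffAt_hol (E := ℝ × ℝ × (Fin 2 → ℝ)) (Γ := fun _ s => Δ.δ s 0) (a := fun _ => 1)
      (b := fun q => q.1) (ξ := fun q => q.2.2) ((Δ.smooth_left 0).comp contDiff_snd) contDiff_const
      contDiff_fst (by fun_prop) fun r hr => Δ.mem_reg (uIcc_subset_unit one_mem hs hr) zero_mem
  · exact Ω.contDiffAt_hol (E := ℝ × ℝ × (Fin 2 → ℝ)) (Γ := fun q => Δ.δ q.1) (a := fun _ => 0)
      (b := fun q => q.2.1) (ξ := fun q => q.2.2)
      (Δ.smooth.comp ((contDiff_fst.comp contDiff_fst).prodMk contDiff_snd)) contDiff_const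
      (by fun_prop) (by fun_prop) fun r hr => Δ.mem_reg hs (uIcc_subset_unit zero_mem ht hr)

/-- The total transport is a closed one-form in the moment map, as are its two parts. -/
theorem tot_symm {s t : ℝ} (hs : s ∈ Icc (0 : ℝ) 1) (ht : t ∈ Icc (0 : ℝ) 1) (ξ e e' : Fin 2 → ℝ) :
    dotProduct (fderiv ℝ (Δ.tot Ω s t) ξ e) e' = dotProduct (fderiv ℝ (Δ.tot Ω s t) ξ e') e := by
  have r1 : ∀ r ∈ uIcc 1 s, Δ.δ r 0 ∈ P.reg := fun r hr =>
    Δ.mem_reg (uIcc_subset_unit one_mem hs hr) zero_mem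
  have r2 : ∀ r ∈ uIcc 0 t, Δ.δ s r ∈ P.reg := fun r hr =>
    Δ.mem_reg hs (uIcc_subset_unit zero_mem ht hr)
  have c1 : ContDiffAt ℝ ∞ (Ω.hol (fun s => Δ.δ s 0) 1 s) ξ :=
    Ω.contDiffAt_hol (E := Fin 2 → ℝ) (Γ := fun _ s => Δ.δ s 0) (a := fun _ => 1) (b := fun _ => s)
      (ξ := id) ((Δ.smooth_left 0).comp contDiff_snd) contDiff_const contDiff_const contDiff_id r1
  have c2 : ContDiffAt ℝ ∞ (Ω.hol (Δ.δ s) 0 t) ξ :=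
    Ω.contDiffAt_hol (E := Fin 2 → ℝ) (Γ := fun _ => Δ.δ s) (a := fun _ => 0) (b := fun _ => t)
      (ξ := id) ((Δ.smooth_right s).comp contDiff_snd) contDiff_const contDiff_const contDiff_id r2
  have key : ∀ e e', dotProduct (fderiv ℝ (Δ.tot Ω s t) ξ e) e' =
      fderiv ℝ (fun ξ => dotProduct (Ω.hol (fun s => Δ.δ s 0) 1 s ξ) e') ξ e +
        fderiv ℝ (fun ξ => dotProduct (Ω.hol (Δ.δ s) 0 t ξ) e') ξ e := by
    intro e e'
    have hd : ∀ {k : (Fin 2 → ℝ) → Fin 2 → ℝ}, ContDiffAt ℝ ∞ k ξ →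
        fderiv ℝ (fun ξ => dotProduct (k ξ) e') ξ e = dotProduct (fderiv ℝ k ξ e) e' := by
      intro k hk
      have h1 := ((dotL.hasFDerivAt.comp ξ (hk.differentiableAt (by simp)).hasFDerivAt).clm_apply
        (hasFDerivAt_const e' ξ)).fderiv
      have h2 := congrArg (fun L : (Fin 2 → ℝ) →L[ℝ] ℝ => L e) h1
      refine Eq.trans h2 ?_
      simp [dotL_apply]
    rw [hd c1, hd c2, ← add_dotProduct]
    have h3 : fderiv ℝ (Δ.tot Ω s t) ξ = _ := fderiv_add (c1.differentiableAt (by simp))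
      (c2.differentiableAt (by simp))
    rw [h3]
    rfl
  rw [key, key, Ω.hol_symm (Δ.smooth_left 0) r1, Ω.hol_symm (Δ.smooth_right s) r2]

theorem exists_isArg_tot {s t : ℝ} (hs : s ∈ Icc (0 : ℝ) 1) (ht : t ∈ Icc (0 : ℝ) 1) :
    ∃ w, P.IsArg w (Δ.δ s t) ∧ ∀ ξ m, Δ.tot Ω s t (ξ + latt m) =
      fun j => Δ.tot Ω s t ξ j - w / (2 * Real.pi) * m j := by
  have r1 : ∀ r ∈ uIcc 1 s, Δ.δ r 0 ∈ P.reg := fun r hr =>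
    Δ.mem_reg (uIcc_subset_unit one_mem hs hr) zero_mem
  have r2 : ∀ r ∈ uIcc 0 t, Δ.δ s r ∈ P.reg := fun r hr =>
    Δ.mem_reg hs (uIcc_subset_unit zero_mem ht hr)
  have h0 : P.IsArg 0 (Δ.δ 1 0) := by rw [Δ.apex 0 zero_mem]; exact P.isArg_neg_S
  refine ⟨_, wind_isArg (Δ.smooth_right s) r2 (wind_isArg (Δ.smooth_left 0) r1 h0), fun ξ m => ?_⟩
  rw [tot, Ω.hol_add_latt (Δ.smooth_left 0) r1, Ω.hol_add_latt (Δ.smooth_right s) r2]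
  funext j
  simp only [tot, Pi.add_apply]
  ring

/-- Moment-angle coordinates of the points of the isotopy. -/
def isoCoord (k : ℤ) (q : ℝ × ℝ × (Fin 2 → ℝ)) : LogPt :=
  (matM q.2.2, fun j => -(k : ℝ) * q.2.2 j + Δ.tot Ω q.1 q.2.1 (matM q.2.2) j, Δ.δ q.1 q.2.1)

/-- The parallel transports of `ℓ_k` to the points of the triangle. -/
def iso (k : ℤ) (s t : ℝ) (a : Fin 2 → ℝ) : P.Y := Ω.pt (Δ.isoCoord Ω k (s, t, a))

theorem isoCoord_mem (k : ℤ) {s t : ℝ} (hs : s ∈ Icc (0 : ℝ) 1) (ht : t ∈ Icc (0 : ℝ) 1)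
    (a : Fin 2 → ℝ) : Δ.isoCoord Ω k (s, t, a) ∈ P.logReg := Δ.mem_reg hs ht

theorem matM_add_int (a : Fin 2 → ℝ) (m : Fin 2 → ℤ) : matM (fun i => a i + m i) = matM a + latt m :=
  matM_add a fun i => (m i : ℝ)

theorem iso_periodic (k : ℤ) {s t : ℝ} (hs : s ∈ Icc (0 : ℝ) 1) (ht : t ∈ Icc (0 : ℝ) 1)
    (a : Fin 2 → ℝ) (m : Fin 2 → ℤ) : Δ.iso Ω k s t (fun i => a i + m i) = Δ.iso Ω k s t a := by
  obtain ⟨w, hw, hm⟩ := Δ.exists_isArg_tot Ω hs ht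
  rw [iso, iso, isoCoord, isoCoord]
  simp only
  rw [matM_add_int, hm]
  refine Eq.trans ?_ (Ω.pt_add_latt (ξ := matM a)
    (θ := fun j => -(k : ℝ) * a j + Δ.tot Ω s t (matM a) j) (Δ.mem_reg hs ht) hw m (-(k • m)))
  congr 3
  funext j
  simp
  ring

theorem iso_inj (k : ℤ) {s t : ℝ} (hs : s ∈ Icc (0 : ℝ) 1) (ht : t ∈ Icc (0 : ℝ) 1)
    {a a' : Fin 2 → ℝ} (h : Δ.iso Ω k s t a = Δ.iso Ω k s t a') : ∃ m : Fin 2 → ℤ, ∀ i, a' i = a i + m i := by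
  obtain ⟨w, hw, -⟩ := Δ.exists_isArg_tot Ω hs ht
  obtain ⟨m, n, hmn⟩ := (Ω.pt_eq_pt_iff (Δ.isoCoord_mem Ω k hs ht a) (Δ.isoCoord_mem Ω k hs ht a') hw).1 h
  have h1 : matM a' = matM a + latt m := congrArg Prod.fst hmn
  have h2 := congrArg invM h1
  rw [invM_add, invM_latt, invM_matM, invM_matM] at h2
  exact ⟨m, congrFun h2⟩

theorem contDiffAt_isoCoord (k : ℤ) {s t : ℝ} (hs : s ∈ Icc (0 : ℝ) 1) (ht : t ∈ Icc (0 : ℝ) 1)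
    (a : Fin 2 → ℝ) : ContDiffAt ℝ ∞ (Δ.isoCoord Ω k) (s, t, a) := by
  have h1 : ContDiff ℝ ∞ fun q : ℝ × ℝ × (Fin 2 → ℝ) => (matM q.2.2 : Fin 2 → ℝ) :=
    contDiff_matM.comp (by fun_prop)
  have h2 : ContDiffAt ℝ ∞ (fun q : ℝ × ℝ × (Fin 2 → ℝ) => Δ.tot Ω q.1 q.2.1 (matM q.2.2)) (s, t, a) :=
    (Δ.contDiffAt_tot Ω hs ht (matM a)).comp
      (f := fun q : ℝ × ℝ × (Fin 2 → ℝ) => (q.1, q.2.1, (matM q.2.2 : Fin 2 → ℝ))) (s, t, a)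
      (ContDiff.contDiffAt (contDiff_fst.prodMk (ContDiff.prodMk (by fun_prop) h1)))
  have h3 : ContDiff ℝ ∞ fun q : ℝ × ℝ × (Fin 2 → ℝ) => Δ.δ q.1 q.2.1 :=
    Δ.smooth.comp (contDiff_fst.prodMk (contDiff_fst.comp contDiff_snd))
  refine h1.contDiffAt.prodMk (ContDiffAt.prodMk ?_ h3.contDiffAt)
  rw [contDiffAt_pi] at h2 ⊢
  intro j
  exact (ContDiff.contDiffAt (by fun_prop)).add (h2 j)

theorem fderiv_isoCoord (k : ℤ) {s t : ℝ} (hs : s ∈ Icc (0 : ℝ) 1) (ht : t ∈ Icc (0 : ℝ) 1)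
    (a : Fin 2 → ℝ) (v : ℝ × (Fin 2 → ℝ)) : fderiv ℝ (Δ.isoCoord Ω k) (s, t, a) (0, v) =
      (matM v.2, -(k : ℝ) • v.2 + (v.1 • Ω.conn (matM a, Δ.δ s t) (deriv (Δ.δ s) t) +
        fderiv ℝ (Δ.tot Ω s t) (matM a) (matM v.2)), v.1 • deriv (Δ.δ s) t) := by
  let T : ℝ × ℝ × (Fin 2 → ℝ) → Fin 2 → ℝ := fun q => Δ.tot Ω q.1 q.2.1 q.2.2
  have hT : HasFDerivAt T (fderiv ℝ T (s, t, matM a)) (s, t, matM a) :=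
    ((Δ.contDiffAt_tot Ω hs ht (matM a)).differentiableAt (by simp)).hasFDerivAt
  have hM : ∀ x : ℝ, matM (a + x • v.2) = matM a + x • matM v.2 := by
    intro x; funext i; fin_cases i <;> simp [matM] <;> ring
  -- the derivative in the direction `(0, v)` is computed along a line
  have hline : HasDerivAt (fun x : ℝ => ((s, t, a) : ℝ × ℝ × (Fin 2 → ℝ)) + x • (0, v)) (0, v) 0 := by
    simpa using ((hasDerivAt_id (0 : ℝ)).smul_const ((0, v) : ℝ × ℝ × (Fin 2 → ℝ))).const_add (s, t, a)
  have h1 := (((Δ.contDiffAt_isoCoord Ω k hs ht a).differentiableAt (by simp)).hasFDerivAt.comp_hasDerivAt_of_eq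
    (0 : ℝ) hline (by simp))
  have hx : HasDerivAt (fun x : ℝ => (t + x * v.1)) v.1 0 := by
    simpa using ((hasDerivAt_id (0 : ℝ)).mul_const v.1).const_add t
  have hξ : HasDerivAt (fun x : ℝ => (matM a + x • matM v.2 : Fin 2 → ℝ)) (matM v.2) 0 := by
    simpa using ((hasDerivAt_id (0 : ℝ)).smul_const (matM v.2 : Fin 2 → ℝ)).const_add (matM a)
  have hδ : HasDerivAt (fun x : ℝ => Δ.δ s (t + x * v.1)) (v.1 • deriv (Δ.δ s) t) 0 := by
    have h2 : HasDerivAt (Δ.δ s) (deriv (Δ.δ s) t) (t + 0 * v.1) := by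
      rw [zero_mul, add_zero]
      exact ((Δ.smooth_right s).differentiable (by simp) t).hasDerivAt
    exact h2.scomp 0 hx
  have hTv : HasDerivAt (fun x : ℝ => T (s, t + x * v.1, matM a + x • matM v.2))
      (fderiv ℝ T (s, t, matM a) (0, v.1, matM v.2)) 0 :=
    hT.comp_hasDerivAt_of_eq (0 : ℝ) ((hasDerivAt_const (0 : ℝ) s).prodMk (hx.prodMk hξ)) (by simp)
  have e1 : fderiv ℝ T (s, t, matM a) (0, 1, 0) = Ω.conn (matM a, Δ.δ s t) (deriv (Δ.δ s) t) := by
    have h0 : HasDerivAt (fun t : ℝ => ((s, t, matM a) : ℝ × ℝ × (Fin 2 → ℝ))) (0, 1, 0) t :=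
      (hasDerivAt_const t s).prodMk ((hasDerivAt_id t).prodMk (hasDerivAt_const t _))
    have h2 := hT.comp_hasDerivAt t h0
    have h3 := (Ω.hasDerivAt_hol (Δ.smooth_right s) (matM a) fun r hr =>
      Δ.mem_reg hs (uIcc_subset_unit zero_mem ht hr)).const_add
        (Ω.hol (fun s => Δ.δ s 0) 1 s (matM a))
    exact h2.unique h3
  have e2 : ∀ e, fderiv ℝ T (s, t, matM a) (0, 0, e) = fderiv ℝ (Δ.tot Ω s t) (matM a) e := by
    intro e
    have h2 : HasFDerivAt (fun ξ : Fin 2 → ℝ => ((s, t, ξ) : ℝ × ℝ × (Fin 2 → ℝ)))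
        ((0 : (Fin 2 → ℝ) →L[ℝ] ℝ).prod ((0 : (Fin 2 → ℝ) →L[ℝ] ℝ).prod
          (ContinuousLinearMap.id ℝ (Fin 2 → ℝ)))) (matM a) :=
      (hasFDerivAt_const _ _).prodMk ((hasFDerivAt_const _ _).prodMk (hasFDerivAt_id _))
    have h3 := (hT.comp (matM a) h2).fderiv
    have h4 : T ∘ (fun ξ : Fin 2 → ℝ => ((s, t, ξ) : ℝ × ℝ × (Fin 2 → ℝ))) = Δ.tot Ω s t := rfl
    rw [h4] at h3
    rw [h3]; rfl
  have e3 : fderiv ℝ T (s, t, matM a) (0, v.1, matM v.2) =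
      v.1 • Ω.conn (matM a, Δ.δ s t) (deriv (Δ.δ s) t) +
        fderiv ℝ (Δ.tot Ω s t) (matM a) (matM v.2) := by
    rw [← e1, ← e2, ← map_smul, ← map_add]
    simp
  have ha : HasDerivAt (fun x : ℝ => -(k : ℝ) • (a + x • v.2)) (-(k : ℝ) • v.2) 0 := by
    exact ((((hasDerivAt_id (0 : ℝ)).smul_const v.2).const_add a).const_smul (-(k : ℝ))).congr_deriv
      (by rw [one_smul])
  have h5 := hξ.prodMk ((ha.add (e3 ▸ hTv)).prodMk hδ)
  refine h1.unique (h5.congr_of_eventuallyEq (Eventually.of_forall fun x => ?_))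
  simp only [Function.comp, isoCoord, Prod.smul_mk, Prod.mk_add_mk, Prod.fst_add, Prod.snd_add,
    Prod.smul_fst, Prod.smul_snd, mul_zero, add_zero, hM, smul_eq_mul]
  rfl

/-- The isotopy is isotropic at each `s`: along the side the angles change according to the connection
form, and in the fibre the transport is closed as a one-form in `ξ`. -/
theorem iso_isotropic (k : ℤ) {s t : ℝ} (hs : s ∈ Icc (0 : ℝ) 1) (ht : t ∈ Icc (0 : ℝ) 1)
    (a : Fin 2 → ℝ) (v w : ℝ × (Fin 2 → ℝ)) :
    Ω.lform (Ω.act (Δ.isoCoord Ω k (s, t, a)))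
      ![fderiv ℝ Ω.act (Δ.isoCoord Ω k (s, t, a)) (fderiv ℝ (Δ.isoCoord Ω k) (s, t, a) (0, v)),
        fderiv ℝ Ω.act (Δ.isoCoord Ω k (s, t, a)) (fderiv ℝ (Δ.isoCoord Ω k) (s, t, a) (0, w))] = 0 := by
  have hb : Δ.δ s t ∈ P.reg := Δ.mem_reg hs ht
  rw [Ω.lform_act (Δ.isoCoord_mem Ω k hs ht a), Δ.fderiv_isoCoord Ω k hs ht,
    Δ.fderiv_isoCoord Ω k hs ht]
  simp only [isoCoord]
  set C := Ω.conn (matM a, Δ.δ s t) (deriv (Δ.δ s) t) with hC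
  set u := deriv (Δ.δ s) t with hu
  have split : ∀ (e : Fin 2 → ℝ) (z : ℂ), ((e, z) : BasePt) = (0, z) + (e, 0) := fun e z => by simp
  have h0 : Ω.beta (matM a, Δ.δ s t) ![((0, v.1 • u) : BasePt), (0, w.1 • u)] = 0 := by
    rw [show ((0, v.1 • u) : BasePt) = v.1 • ((0, u) : BasePt) by simp,
      show ((0, w.1 • u) : BasePt) = w.1 • ((0, u) : BasePt) by simp, alt_smul_left, alt_smul_right,
      alt_self]
    simp
  rw [split (matM v.2), split (matM w.2), alt_add_left, alt_add_right, alt_add_right, h0,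
    Ω.beta_vertical hb, alt_swap _ ((matM v.2, 0) : BasePt), Ω.beta_horizontal, Ω.beta_horizontal,
    Ω.conn_smul, Ω.conn_smul, ← hC]
  have h1 := Δ.tot_symm Ω hs ht (matM a) (matM v.2) (matM w.2)
  simp only [add_dotProduct, smul_dotProduct, h1]
  simp [dotProduct, Fin.sum_univ_two, matM]
  ring

theorem fderiv_torusPt_injective {s : Bool} {q w : LogPt} (h : fderiv ℝ (P.torusPt s) q w = 0) : w = 0 := by
  have h1 : w.2.2 = 0 := by
    have := fderiv_v0_torusPt (P := P) s q w
    rw [h, map_zero, eq_comm, div_eq_zero_iff] at this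
    exact this.resolve_right P.crit_ne
  have h2 : ∀ j, w.z j = 0 := by
    intro j
    have h3 := (fderiv_torusPt (P := P) s q w).2 j
    rw [h] at h3
    have h4 : (sgn s : ℂ) ≠ 0 := fun h => by
      have := sgn_cast_mul_self (R := ℂ) s
      rw [h] at this; simp at this
    have h5 := torusPt_succ_ne (P := P) s q j
    simpa [h4, h5] using h3
  have h6 : w.1 = 0 := by
    funext j
    have := congrArg Complex.re (h2 j)
    simpa [LogPt.z] using this
  have h7 : w.2.1 = 0 := by
    funext j
    have := congrArg Complex.im (h2 j)
    have hpi := Real.pi_ne_zero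
    simpa [LogPt.z, hpi] using this
  exact Prod.ext h6 (Prod.ext h7 h1)

theorem fderiv_act_injective {x w : LogPt} (hx : x ∈ P.logReg) (h : fderiv ℝ Ω.act x w = 0) : w = 0 := by
  have h1 : Ω.mom ∘ Ω.act =ᶠ[𝓝 x] id := by
    filter_upwards [P.isOpen_logReg.mem_nhds hx] with y hy
    exact Ω.mom_act hy
  have h2 := h1.fderiv_eq (𝕜 := ℝ)
  rw [fderiv_comp x ((Ω.contDiffAt_mom (Ω.act_mem hx)).differentiableAt (by simp))
    ((Ω.contDiffAt_act hx).differentiableAt (by simp)), fderiv_id] at h2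
  have h3 := congrArg (fun L : LogPt →L[ℝ] LogPt => L w) h2
  simp only [ContinuousLinearMap.comp_apply, h, map_zero] at h3
  exact h3.symm

theorem tot_one {t : ℝ} (ht : t ∈ Icc (0 : ℝ) 1) (ξ : Fin 2 → ℝ) : Δ.tot Ω 1 t ξ = 0 := by
  have h1 : Ω.hol (Δ.δ 1) 0 t ξ = 0 := by
    have h2 := Ω.hol_comp (γ := Δ.δ 1) (γ' := Δ.δ 1) (α := fun _ => 0) (a := 0) (b := t)
      (Δ.smooth_right 1) (Δ.smooth_right 1) contDiff_const (fun x hx => by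
        rw [Δ.apex x (uIcc_subset_unit zero_mem ht hx), Δ.apex 0 zero_mem])
      (fun x hx => Δ.mem_reg one_mem (uIcc_subset_unit zero_mem ht hx)) ξ
    rw [h2, hol, intervalIntegral.integral_same]
  rw [tot, h1, hol, intervalIntegral.integral_same, add_zero]

theorem aK_mem {t r : ℝ} (ht : t ∈ Icc (0 : ℝ) 1) (hr : r ∈ uIcc 0 (Δ.aK t)) : κ.path r ∈ P.reg := by
  have h0 : 1 < Δ.aK 0 := (Δ.sideK 0 zero_mem).1
  have h1 : 1 < Δ.aK t := (Δ.sideK t ht).1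
  rw [uIcc_of_le (by linarith)] at hr
  refine ⟨?_, κ.avoid r hr.1⟩
  rcases le_or_gt r (Δ.aK 0) with h | h
  · obtain ⟨H, -, hH, hreg⟩ := Δ.loop
    have hx : r / Δ.aK 0 ∈ Icc (0 : ℝ) 1 :=
      ⟨div_nonneg hr.1 (by linarith), (div_le_one (by linarith)).2 h⟩
    have h2 := (hH _ hx).1
    rw [div_mul_cancel₀ _ (by linarith)] at h2
    rw [← h2]
    exact (hreg 0 zero_mem _ hx).1
  · obtain ⟨t', ht', h2⟩ := intermediate_value_Icc ht.1 Δ.aK_smooth.continuous.continuousOn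
      ⟨h.le, hr.2⟩
    have ht'' : t' ∈ Icc (0 : ℝ) 1 := ⟨ht'.1, ht'.2.trans ht.2⟩
    rw [← h2, ← (Δ.sideK t' ht'').2]
    exact (Δ.mem_reg zero_mem ht'').1

/-- The part of `K_k` over the triangle. -/
theorem mem_lagK_over {k : ℤ} {p : P.Y} : p ∈ Ω.lagK κ k ∧ P.W p ∈ Δ.region ↔
    ∃ t ∈ Icc (0 : ℝ) 1, ∃ ξ, p = Ω.pt (ξ, fun j => -(k : ℝ) * invM ξ j +
      (Ω.hol κ.path 0 (Δ.aK 0) ξ + Ω.hol (Δ.δ 0) 0 t ξ) j, Δ.δ 0 t) := by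
  have hol_eq : ∀ t ∈ Icc (0 : ℝ) 1, ∀ ξ, Ω.hol κ.path 0 (Δ.aK 0) ξ + Ω.hol (Δ.δ 0) 0 t ξ =
      Ω.hol κ.path 0 (Δ.aK t) ξ := by
    intro t ht ξ
    have r0 : 1 < Δ.aK 0 := (Δ.sideK 0 zero_mem).1
    have r1 : 1 < Δ.aK t := (Δ.sideK t ht).1
    rw [Ω.hol_comp κ.smooth (Δ.smooth_right 0) Δ.aK_smooth
      (fun x hx => (Δ.sideK x (uIcc_subset_unit zero_mem ht hx)).2)
      (fun x hx => Δ.mem_reg zero_mem (uIcc_subset_unit zero_mem ht hx)),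
      Ω.hol_add κ.smooth (fun r hr => Δ.aK_mem zero_mem hr) fun r hr => ?_]
    rcases le_total (Δ.aK 0) (Δ.aK t) with h | h
    · refine Δ.aK_mem ht (r := r) ?_
      rw [uIcc_of_le h] at hr
      rw [uIcc_of_le (by linarith)]
      exact ⟨by linarith [hr.1], hr.2⟩
    · refine Δ.aK_mem zero_mem (r := r) ?_
      rw [uIcc_of_ge h] at hr
      rw [uIcc_of_le (by linarith)]
      exact ⟨by linarith [hr.1], hr.2⟩
  constructor
  · rintro ⟨hp, ⟨⟨s, t⟩, ⟨hs, ht⟩, hst⟩⟩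
    simp only [lagK, mem_iUnion] at hp
    obtain ⟨τ, hτ, hp⟩ := hp
    have hτ0 : (0 : ℝ) ≤ τ := by linarith [mem_Ioi.1 hτ]
    have hr : ∀ r ∈ uIcc 0 τ, κ.path r ∈ P.reg := fun r hr =>
      ⟨Ω.norm_lt_of_mem_transport hp r hr, κ.avoid r (by rw [uIcc_of_le hτ0] at hr; exact hr.1)⟩
    obtain ⟨ξ, rfl⟩ := (Ω.mem_transport_ell_iff κ.smooth hr κ.at_zero).1 hp
    rw [Ω.W_pt (hr τ right_mem_uIcc)] at hst
    obtain ⟨t', ht', h1⟩ := Δ.meetsK τ hτ s hs t ht hst.symm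
    have h2 := (Δ.sideK t' ht').2
    have h3 : τ = Δ.aK t' := κ.inj hτ0 (by
      have := (Δ.sideK t' ht').1
      exact mem_Ici.2 (by linarith)) (h1.trans h2)
    refine ⟨t', ht', ξ, ?_⟩
    rw [hol_eq t' ht', h2, h3]
  · rintro ⟨t, ht, ξ, rfl⟩
    refine ⟨?_, ?_⟩
    · simp only [lagK, mem_iUnion]
      refine ⟨Δ.aK t, (Δ.sideK t ht).1, (Ω.mem_transport_ell_iff κ.smooth
        (fun r hr => Δ.aK_mem ht hr) κ.at_zero).2 ⟨ξ, ?_⟩⟩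
      rw [hol_eq t ht, (Δ.sideK t ht).2]
    · rw [Ω.W_pt (Δ.mem_reg zero_mem ht)]
      exact ⟨(0, t), ⟨zero_mem, ht⟩, rfl⟩

/-- Two ways of transporting `ℓ_k` to the third side, along `κ` and along the side `t = 0`, differ by the
time-one flow of a function of the moment map. Once this flow has been applied, the transports of `ℓ_k` to
the points of the triangle form the isotopy. -/
theorem exists_isotopy (k : ℤ) : ∃ (Φ : P.Y → P.Y) (Ψ : ℝ → ℝ → (Fin 2 → ℝ) → P.Y),
    Ω.IsHamiltonianDiffeo Φ ∧ Δ.IsIsotopy Ω k (Φ '' Ω.lagK κ k) Ψ := by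
  obtain ⟨H, hH, hHe, hreg⟩ := Δ.loop
  have sκ : ContDiff ℝ ∞ fun r => κ.path ((Δ.aK 0 - 0) * r + 0) := κ.smooth.comp (by fun_prop)
  have sδ : ContDiff ℝ ∞ fun r => Δ.δ ((0 - 1) * r + 1) 0 :=
    (Δ.smooth_left 0).comp (g := fun s => Δ.δ s 0) (by fun_prop)
  obtain ⟨g, hg, hper, hgrad⟩ := Ω.exists_periodic_primitive (p := -(P.S : ℂ)) (q := Δ.δ 0 0) sκ sδ hH
    hreg (fun z hz => (hHe z hz).2.2.1) (fun z hz => (hHe z hz).2.2.2)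
    (fun x hx => by rw [(hHe x hx).1]; congr 1; ring)
    (fun x hx => by rw [(hHe x hx).2.1]; congr 1; ring)
  have hgrad' : ∀ ξ, (fun j => fderiv ℝ g ξ (Pi.single j 1)) =
      Ω.hol κ.path 0 (Δ.aK 0) ξ - Ω.hol (fun s => Δ.δ s 0) 1 0 ξ := by
    intro ξ
    funext j
    rw [hgrad, dotL_apply, ← Ω.hol_affine κ.path 0 (Δ.aK 0), ← Ω.hol_affine (fun s => Δ.δ s 0) 1 0]
    simp
  obtain ⟨Φ, hΦ, hΦW, hΦpt⟩ := Ω.exists_hamiltonian_rotation hg hper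
  refine ⟨Φ, Δ.iso Ω k, hΦ, ?_⟩
  -- `Φ` moves the transport of `ℓ_k` along `κ` to its transport along the side `t = 0`
  have hrot : ∀ t ∈ Icc (0 : ℝ) 1, ∀ ξ, Φ (Ω.pt (ξ, fun j => -(k : ℝ) * invM ξ j +
      (Ω.hol κ.path 0 (Δ.aK 0) ξ + Ω.hol (Δ.δ 0) 0 t ξ) j, Δ.δ 0 t)) = Δ.iso Ω k 0 t (invM ξ) := by
    intro t ht ξ
    rw [hΦpt _ _ _ (Δ.mem_reg zero_mem ht), hgrad', iso, isoCoord]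
    simp only [matM_invM]
    congr 3
    funext j
    simp only [Pi.sub_apply, Pi.add_apply, tot]
    ring
  refine ⟨?_, ?_, ?_, ?_, ?_, ?_⟩
  · ext p
    constructor
    · rintro ⟨t, ht, a, rfl⟩
      have h1 := hrot t ht (matM a)
      rw [invM_matM] at h1
      refine ⟨⟨_, ((Δ.mem_lagK_over Ω).2 ⟨t, ht, matM a, rfl⟩).1, ?_⟩, ?_⟩
      · rw [← h1, invM_matM]
      · rw [iso, Ω.W_pt (Δ.isoCoord_mem Ω k zero_mem ht a)]
        exact ⟨(0, t), ⟨zero_mem, ht⟩, rfl⟩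
    · rintro ⟨⟨p, hp, rfl⟩, hW⟩
      rw [hΦW] at hW
      obtain ⟨t, ht, ξ, rfl⟩ := (Δ.mem_lagK_over Ω).1 ⟨hp, hW⟩
      exact ⟨t, ht, invM ξ, hrot t ht ξ⟩
  · exact fun s hs t ht a => Ω.W_pt (Δ.isoCoord_mem Ω k hs ht a)
  · exact fun s hs t ht a m => Δ.iso_periodic Ω k hs ht a m
  · exact fun s hs t ht a a' h => Δ.iso_inj Ω k ⟨hs.1, hs.2.le⟩ ht h
  · intro s hs t ht a
    have hx := Δ.isoCoord_mem Ω k hs ht a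
    have h1 := Δ.contDiffAt_isoCoord Ω k hs ht a
    have h2 : ContDiffAt ℝ ∞ (fun q => Ω.act (Δ.isoCoord Ω k q)) (s, t, a) :=
      (Ω.contDiffAt_act hx).comp (s, t, a) h1
    have hfd : ∀ v, fderiv ℝ (fun q => P.torusPt true (Ω.act (Δ.isoCoord Ω k q))) (s, t, a) v =
        fderiv ℝ (P.torusPt true) (Ω.act (Δ.isoCoord Ω k (s, t, a)))
          (fderiv ℝ Ω.act (Δ.isoCoord Ω k (s, t, a)) (fderiv ℝ (Δ.isoCoord Ω k) (s, t, a) v)) := by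
      intro v
      have h3 := (differentiable_torusPt (P := P) true _).hasFDerivAt.comp (s, t, a)
        (((Ω.contDiffAt_act hx).differentiableAt (by simp)).hasFDerivAt.comp (s, t, a)
          (h1.differentiableAt (by simp)).hasFDerivAt)
      exact congrArg (fun L : ℝ × ℝ × (Fin 2 → ℝ) →L[ℝ] C3 => L v) h3.fderiv
    refine ⟨true, fun q => P.torusPt true (Ω.act (Δ.isoCoord Ω k q)),
      (contDiff_torusPt true).contDiffAt.comp (s, t, a) h2, ?_, fun hs1 => ⟨fun v hv => ?_, fun v w => ?_⟩⟩
    · filter_upwards [self_mem_nhdsWithin] with q hq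
      exact Ω.isLift_pt true (Δ.isoCoord_mem Ω k hq.1 hq.2.1 q.2.2)
    · rw [hfd] at hv
      have h3 := fderiv_act_injective Ω hx (fderiv_torusPt_injective hv)
      rw [Δ.fderiv_isoCoord Ω k hs ht] at h3
      have h4 : matM v.2 = 0 := congrArg Prod.fst h3
      have h5 : v.1 • deriv (Δ.δ s) t = 0 := congrArg (fun x : LogPt => x.2.2) h3
      have h6 : v.1 = 0 := (smul_eq_zero.1 h5).resolve_right (Δ.immersed s ⟨hs.1, hs1⟩ t ht)
      have h7 := congrArg invM h4
      rw [invM_matM] at h7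
      refine Prod.ext h6 (h7.trans ?_)
      funext j; fin_cases j <;> simp [invM]
    · rw [hfd, hfd, Ω.form_torusPt true (Ω.act_mem hx)]
      exact Δ.iso_isotropic Ω k hs ht a v w
  · intro t ht
    ext p
    have h1 : ∀ a, Δ.iso Ω k 1 t a = Ω.pt (matM a, fun j => -(k : ℝ) * a j, -(P.S : ℂ)) := by
      intro a
      rw [iso, isoCoord]
      simp only [Δ.tot_one Ω ht, Δ.apex t ht, Pi.zero_apply, add_zero]
    rw [Ω.mem_ell]
    constructor
    · rintro ⟨a, rfl⟩
      exact ⟨matM a, by rw [h1, invM_matM]⟩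
    · rintro ⟨ξ, rfl⟩
      exact ⟨invM ξ, by rw [h1, matM_invM]⟩

end BaseTriangle

/-! ### The prism of a homotopy of triangles -/

theorem faceMap_succAbove (n : ℕ) (i : Fin (n + 2)) (y : Splx n) (j : Fin (n + 1)) :
    faceMap n i y (i.succAbove j) = y j := by
  simp only [faceMap, ContinuousMap.coe_mk, stdSimplex.map_coe, FunOnFinite.linearMap_apply_apply]
  rw [Finset.sum_eq_single j]
  · intro b hb hbj
    exact absurd (Fin.succAbove_right_injective (Finset.mem_filter.1 hb).2) hbj
  · intro h; simp at h

theorem faceMap_self (n : ℕ) (i : Fin (n + 2)) (y : Splx n) : faceMap n i y i = 0 := by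
  simp only [faceMap, ContinuousMap.coe_mk, stdSimplex.map_coe, FunOnFinite.linearMap_apply_apply]
  refine Finset.sum_eq_zero fun b hb => absurd (Finset.mem_filter.1 hb).2 (Fin.succAbove_ne i b)

section Chains

variable {X : Type} [TopologicalSpace X] {A : Set X}

theorem ChainIn.add {n : ℕ} {c c' : SingChain X n} (h : ChainIn A c) (h' : ChainIn A c') :
    ChainIn A (c + c') := fun σ hσ => by
  classical
  rcases Finset.mem_union.1 (Finsupp.support_add hσ) with h1 | h1
  exacts [h σ h1, h' σ h1]

theorem ChainIn.single {n : ℕ} {σ : C(Splx n, X)} (h : ∀ x, σ x ∈ A) (k : ℤ) :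
    ChainIn A (Finsupp.single σ k) := fun τ hτ => by
  rw [Finset.mem_singleton.1 (Finsupp.support_single_subset hτ)]
  rintro _ ⟨x, rfl⟩
  exact h x

theorem singBoundary_add {n : ℕ} (c c' : SingChain X (n + 1)) :
    singBoundary n (c + c') = singBoundary n c + singBoundary n c' := by
  classical
  refine Finsupp.sum_add_index' (fun σ => by simp) fun σ k k' => ?_
  rw [← Finset.sum_add_distrib]
  refine Finset.sum_congr rfl fun i _ => ?_
  rw [mul_add, Finsupp.single_add]

theorem singBoundary_single {n : ℕ} (σ : C(Splx (n + 1), X)) (k : ℤ) :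
    singBoundary n (Finsupp.single σ k) =
      ∑ i : Fin (n + 2), Finsupp.single (σ.comp (faceMap n i)) ((-1) ^ (i : ℕ) * k) :=
  Finsupp.sum_single_index (by simp)

/-- A triangle whose edges lie in `A` is a relative cycle. -/
theorem isRelCycle_of_edges {B : Set X} {σ : C(Splx 2, X)} (hB : ∀ μ, σ μ ∈ B)
    (hA : ∀ (μ : Splx 2) (i : Fin 3), μ i = 0 → σ μ ∈ A) : IsRelCycle B A σ := by
  refine ⟨range_subset_iff.2 hB, ?_⟩
  have h : ∀ i : Fin 3, ∀ x, (σ.comp (faceMap 1 i)) x ∈ A := fun i x =>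
    hA _ i (faceMap_self 1 i x)
  rw [singBoundary_single, Fin.sum_univ_three]
  exact ((ChainIn.single (h 0) _).add (ChainIn.single (h 1) _)).add (ChainIn.single (h 2) _)

end Chains

/-- The three simplices into which the prism `[0,1] × Δ²` is divided. -/
def prismMap (i : Fin 3) : C(Splx 3, unitInterval × Splx 2) where
  toFun x := (⟨![x 1 + x 2 + x 3, x 2 + x 3, x 3] i, by
      have h := x.2.1
      have hs : x 0 + x 1 + x 2 + x 3 = 1 := by rw [← x.2.2, Fin.sum_univ_four]; rfl
      have h0 : 0 ≤ x 0 := h 0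
      have h1 : 0 ≤ x 1 := h 1
      have h2 : 0 ≤ x 2 := h 2
      have h3 : 0 ≤ x 3 := h 3
      fin_cases i <;> constructor <;> simp <;> linarith⟩,
    ⟨![![x 0 + x 1, x 2, x 3], ![x 0, x 1 + x 2, x 3], ![x 0, x 1, x 2 + x 3]] i, by
      have h := x.2.1
      have hs : x 0 + x 1 + x 2 + x 3 = 1 := by rw [← x.2.2, Fin.sum_univ_four]; rfl
      have h0 : 0 ≤ x 0 := h 0
      have h1 : 0 ≤ x 1 := h 1
      have h2 : 0 ≤ x 2 := h 2
      have h3 : 0 ≤ x 3 := h 3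
      refine ⟨fun k => ?_, ?_⟩
      · fin_cases i <;> fin_cases k <;> simp <;> linarith
      · rw [Fin.sum_univ_three, ← hs]
        fin_cases i <;> simp <;> ring⟩)
  continuous_toFun := by
    have hc : ∀ k : Fin 4, Continuous fun x : Splx 3 => x k := fun k =>
      (continuous_apply k).comp continuous_subtype_val
    have h0 := hc 0
    have h1 := hc 1
    have h2 := hc 2
    have h3 := hc 3
    refine Continuous.prodMk (Continuous.subtype_mk ?_ _) (Continuous.subtype_mk ?_ _)
    · fin_cases i
      exacts [(h1.add h2).add h3, h2.add h3, h3]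
    · refine continuous_pi fun k => ?_
      fin_cases i <;> fin_cases k
      exacts [h0.add h1, h2, h3, h0, h1.add h2, h3, h0, h1, h2.add h3]

/-- Triangles which are homotopic in `B`, with edges moving in `A`, are relatively homologous: the prism
over the triangle bounds their difference up to simplices in `A`. -/
theorem relHomologous_of_homotopy {X : Type} [TopologicalSpace X] {A B : Set X}
    {H : C(unitInterval × Splx 2, X)} {σ σ' : C(Splx 2, X)} (h0 : ∀ μ, H (0, μ) = σ μ)
    (h1 : ∀ μ, H (1, μ) = σ' μ) (hB : ∀ x, H x ∈ B)
    (hA : ∀ r (μ : Splx 2) (i : Fin 3), μ i = 0 → H (r, μ) ∈ A) : RelHomologous B A σ σ' := by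
  refine ⟨isRelCycle_of_edges (fun μ => h0 μ ▸ hB _) (fun μ i h => h0 μ ▸ hA 0 μ i h),
    isRelCycle_of_edges (fun μ => h1 μ ▸ hB _) (fun μ i h => h1 μ ▸ hA 1 μ i h), ?_⟩
  let s : Fin 3 → C(Splx 3, X) := fun i => H.comp (prismMap i)
  let f : Fin 3 → Fin 4 → C(Splx 2, X) := fun i k => (s i).comp (faceMap 2 k)
  -- the coordinates of a point on each face of the three-simplex
  have c0 : ∀ y : Splx 2, faceMap 2 0 y 0 = 0 ∧ faceMap 2 0 y 1 = y 0 ∧ faceMap 2 0 y 2 = y 1 ∧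
      faceMap 2 0 y 3 = y 2 := fun y => ⟨faceMap_self 2 0 y, faceMap_succAbove 2 0 y 0,
    faceMap_succAbove 2 0 y 1, faceMap_succAbove 2 0 y 2⟩
  have c1 : ∀ y : Splx 2, faceMap 2 1 y 0 = y 0 ∧ faceMap 2 1 y 1 = 0 ∧ faceMap 2 1 y 2 = y 1 ∧
      faceMap 2 1 y 3 = y 2 := fun y => ⟨faceMap_succAbove 2 1 y 0, faceMap_self 2 1 y,
    faceMap_succAbove 2 1 y 1, faceMap_succAbove 2 1 y 2⟩
  have c2 : ∀ y : Splx 2, faceMap 2 2 y 0 = y 0 ∧ faceMap 2 2 y 1 = y 1 ∧ faceMap 2 2 y 2 = 0 ∧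
      faceMap 2 2 y 3 = y 2 := fun y => ⟨faceMap_succAbove 2 2 y 0, faceMap_succAbove 2 2 y 1,
    faceMap_self 2 2 y, faceMap_succAbove 2 2 y 2⟩
  have c3 : ∀ y : Splx 2, faceMap 2 3 y 0 = y 0 ∧ faceMap 2 3 y 1 = y 1 ∧ faceMap 2 3 y 2 = y 2 ∧
      faceMap 2 3 y 3 = 0 := fun y => ⟨faceMap_succAbove 2 3 y 0, faceMap_succAbove 2 3 y 1,
    faceMap_succAbove 2 3 y 2, faceMap_self 2 3 y⟩
  have hs : ∀ y : Splx 2, y 0 + y 1 + y 2 = 1 := fun y => by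
    rw [← y.2.2, Fin.sum_univ_three]; rfl
  have key : ∀ {p q : unitInterval × Splx 2}, (p.1 : ℝ) = q.1 → (∀ k, p.2 k = q.2 k) → H p = H q :=
    fun {p q} e1 e2 => congrArg H (Prod.ext (Subtype.ext e1) (Subtype.ext (funext e2)))
  have e00 : f 0 0 = σ' := by
    ext y
    obtain ⟨a0, a1, a2, a3⟩ := c0 y
    rw [← h1 y]
    refine key ?_ fun k => ?_
    · simp [prismMap, a1, a2, a3, hs]
    · fin_cases k
      · change faceMap 2 0 y 0 + faceMap 2 0 y 1 = y 0
        rw [a0, a1, zero_add]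
      · exact a2
      · exact a3
  have e23 : f 2 3 = σ := by
    ext y
    obtain ⟨a0, a1, a2, a3⟩ := c3 y
    rw [← h0 y]
    refine key ?_ fun k => ?_
    · simp [prismMap, a3]
    · fin_cases k
      · exact a0
      · exact a1
      · change faceMap 2 3 y 2 + faceMap 2 3 y 3 = y 2
        rw [a2, a3, add_zero]
  have e01 : f 0 1 = f 1 1 := by
    ext y
    obtain ⟨a0, a1, a2, a3⟩ := c1 y
    refine key ?_ fun k => ?_
    · simp [prismMap, a1, a2, a3]
    · fin_cases k
      · change faceMap 2 1 y 0 + faceMap 2 1 y 1 = faceMap 2 1 y 0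
        rw [a1, add_zero]
      · change faceMap 2 1 y 2 = faceMap 2 1 y 1 + faceMap 2 1 y 2
        rw [a1, zero_add]
      · rfl
  have e12 : f 1 2 = f 2 2 := by
    ext y
    obtain ⟨a0, a1, a2, a3⟩ := c2 y
    refine key ?_ fun k => ?_
    · simp [prismMap, a2, a3]
    · fin_cases k
      · rfl
      · change faceMap 2 2 y 1 + faceMap 2 2 y 2 = faceMap 2 2 y 1
        rw [a2, add_zero]
      · change faceMap 2 2 y 3 = faceMap 2 2 y 2 + faceMap 2 2 y 3
        rw [a2, zero_add]
  have s02 : ∀ y, f 0 2 y ∈ A := fun y => hA _ _ 1 (c2 y).2.2.1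
  have s03 : ∀ y, f 0 3 y ∈ A := fun y => hA _ _ 2 (c3 y).2.2.2
  have s10 : ∀ y, f 1 0 y ∈ A := fun y => hA _ _ 0 (c0 y).1
  have s13 : ∀ y, f 1 3 y ∈ A := fun y => hA _ _ 2 (c3 y).2.2.2
  have s20 : ∀ y, f 2 0 y ∈ A := fun y => hA _ _ 0 (c0 y).1
  have s21 : ∀ y, f 2 1 y ∈ A := fun y => hA _ _ 1 (c1 y).2.1
  have sB : ∀ i x, s i x ∈ B := fun i x => hB _
  refine ⟨Finsupp.single (s 0) (-1) + Finsupp.single (s 1) 1 + Finsupp.single (s 2) (-1),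
    Finsupp.single (f 0 2) 1 + Finsupp.single (f 0 3) (-1) + Finsupp.single (f 1 0) (-1) +
      Finsupp.single (f 1 3) 1 + Finsupp.single (f 2 0) 1 + Finsupp.single (f 2 1) (-1),
    ((ChainIn.single (sB 0) _).add (ChainIn.single (sB 1) _)).add (ChainIn.single (sB 2) _),
    (((((ChainIn.single s02 _).add (ChainIn.single s03 _)).add (ChainIn.single s10 _)).add
      (ChainIn.single s13 _)).add (ChainIn.single s20 _)).add (ChainIn.single s21 _), ?_⟩
  have hb : ∀ i k, singBoundary 2 (Finsupp.single (s i) k) = k • (Finsupp.single (f i 0) 1 -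
      Finsupp.single (f i 1) 1 + Finsupp.single (f i 2) 1 - Finsupp.single (f i 3) (1 : ℤ)) := by
    intro i k
    rw [singBoundary_single, Fin.sum_univ_four]
    have e : ∀ (g : C(Splx 2, X)), Finsupp.single g k = k • Finsupp.single g (1 : ℤ) := fun g => by
      rw [Finsupp.smul_single, smul_eq_mul, mul_one]
    have e' : ∀ (g : C(Splx 2, X)), Finsupp.single g (-k) = -(k • Finsupp.single g (1 : ℤ)) :=
      fun g => by rw [Finsupp.single_neg, e]
    simp only [Fin.val_zero, Fin.val_one, Fin.val_two, pow_zero, pow_one, one_mul, neg_mul, e']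
    change Finsupp.single (f i 0) k + -(k • Finsupp.single (f i 1) (1 : ℤ)) +
      Finsupp.single (f i 2) ((-1) ^ 2 * k) + Finsupp.single (f i 3) ((-1) ^ 3 * k) = _
    rw [show (-1 : ℤ) ^ 2 * k = k by ring, show (-1 : ℤ) ^ 3 * k = -k by ring, e', e, e]
    module
  have hneg : ∀ g : C(Splx 2, X), Finsupp.single g (-1 : ℤ) = -Finsupp.single g 1 := fun g =>
    Finsupp.single_neg g 1
  rw [singBoundary_add, singBoundary_add, hb, hb, hb, e00, e23, e01, e12]
  simp only [hneg]
  module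

/-! ### Continuity and lifting -/

/-- A function on a closed subset of the target of a quotient map is continuous if its pull-back is. -/
theorem continuousOn_of_quotient {X Y T : Type*} [TopologicalSpace X] [TopologicalSpace Y]
    [TopologicalSpace T] {q : X → Y} (hq : IsQuotientMap q) {Z : Set Y} (hZ : IsClosed Z) {f : Y → T}
    (hf : ContinuousOn (f ∘ q) (q ⁻¹' Z)) : ContinuousOn f Z := by
  rw [continuousOn_iff_isClosed]
  intro C hC
  refine ⟨f ⁻¹' C ∩ Z, hq.isClosed_preimage.1 ?_, by rw [inter_assoc, inter_self]⟩
  have h := hf.preimage_isClosed_of_isClosed (hZ.preimage hq.continuous) hC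
  rwa [inter_comm] at h

/-- A function on the image of a compact space is continuous if its pull-back is. -/
theorem continuousOn_of_compact {K X Q T : Type*} [TopologicalSpace K] [CompactSpace K]
    [TopologicalSpace X] [T2Space X] [TopologicalSpace Q] [TopologicalSpace T] {f : K → X}
    (hf : Continuous f) {h : K × Q → T} (hh : Continuous h) {g : X × Q → T}
    (hg : ∀ k p, g (f k, p) = h (k, p)) : ContinuousOn g (range f ×ˢ univ) := by
  rw [continuousOn_iff_isClosed]
  intro C hC
  have hcl : IsClosedMap (Prod.map f (id : Q → Q)) := (hf.isProperMap.prodMap isProperMap_id).isClosedMap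
  refine ⟨_, hcl _ (hC.preimage hh), ?_⟩
  ext ⟨x, p⟩
  constructor
  · rintro ⟨h1, ⟨⟨k, rfl⟩, h2⟩⟩
    refine ⟨⟨(k, p), ?_, rfl⟩, ⟨k, rfl⟩, h2⟩
    change h (k, p) ∈ C
    rw [← hg]; exact h1
  · rintro ⟨⟨⟨k, p'⟩, h1, h2⟩, h3⟩
    have e1 : f k = x := congrArg Prod.fst h2
    have e2 : p' = p := congrArg Prod.snd h2
    subst e1 e2
    refine ⟨?_, h3⟩
    change g (f k, p') ∈ C
    rw [hg]; exact h1

theorem circleExp_eq_unitExp (x : ℝ) : (Circle.exp (2 * Real.pi * x) : ℂ) = unitExp x := by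
  rw [Circle.coe_exp, unitExp]; push_cast; ring_nf

/-- A continuous function from a contractible space to the circle has a continuous argument: lift the
contraction, starting with a constant. -/
theorem exists_lift_unitExp {X : Type} [TopologicalSpace X] {C : unitInterval × X → X}
    (hC : Continuous C) {x₀ : X} (h0 : ∀ x, C (0, x) = x₀) (h1 : ∀ x, C (1, x) = x) {f : X → ℂ}
    (hf : Continuous f) (hr : ∀ x, ∃ a, f x = unitExp a) : ∃ a : X → ℝ, Continuous a ∧
      ∀ x, unitExp (a x) = f x := by
  have hn : ∀ x, f x ∈ Submonoid.unitSphere ℂ := by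
    intro x
    obtain ⟨a, ha⟩ := hr x
    rw [ha, ← circleExp_eq_unitExp]
    exact (Circle.exp _).2
  let F : X → Circle := fun x => ⟨f x, hn x⟩
  have hF : Continuous F := hf.subtype_mk hn
  obtain ⟨e, he⟩ : ∃ e, Circle.exp e = F x₀ := by
    obtain ⟨a, ha⟩ := hr x₀
    exact ⟨2 * Real.pi * a, Subtype.ext ((circleExp_eq_unitExp a).trans ha.symm)⟩
  let H : C(unitInterval × X, Circle) := ⟨fun p => F (C p), hF.comp hC⟩
  have H0 : ∀ x, H (0, x) = Circle.exp ((ContinuousMap.const X e) x) := fun x => by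
    change F (C (0, x)) = Circle.exp e
    rw [h0, he]
  let L := Circle.isCoveringMap_exp.liftHomotopy H (ContinuousMap.const X e) H0
  have hL := Circle.isCoveringMap_exp.liftHomotopy_lifts H (ContinuousMap.const X e) H0
  refine ⟨fun x => L (1, x) / (2 * Real.pi), by fun_prop, fun x => ?_⟩
  have h2 : Circle.exp (L (1, x)) = F (C (1, x)) := congrFun hL (1, x)
  have hpi := Real.pi_ne_zero
  rw [← circleExp_eq_unitExp, mul_div_cancel₀ _ (by positivity), h2, h1]

/-- A continuous function with integral values is constant on connected sets. -/
theorem exists_int_of_connected {X : Type*} [TopologicalSpace X] {s : Set X} (hs : IsPreconnected s)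
    (hne : s.Nonempty) {f : X → ℝ} (hf : ContinuousOn f s) (h : ∀ x ∈ s, ∃ n : ℤ, f x = n) :
    ∃ n : ℤ, ∀ x ∈ s, f x = n := by
  obtain ⟨x₀, hx₀⟩ := hne
  obtain ⟨n, hn⟩ := h x₀ hx₀
  refine ⟨n, fun x hx => ?_⟩
  obtain ⟨k, hk⟩ := h x hx
  have hI : IsPreconnected (f '' s) := hs.image f hf
  -- two distinct integral values would have a non-integral value between them
  have key : ∀ a b : ℤ, (a : ℝ) ∈ f '' s → (b : ℝ) ∈ f '' s → ¬a < b := by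
    intro a b ha hb hab
    have h1 : (a : ℝ) + 1 ≤ b := by exact_mod_cast hab
    obtain ⟨z, hz, hz'⟩ := hI.Icc_subset ha hb
      (show (a : ℝ) + 1 / 2 ∈ Icc (a : ℝ) b from ⟨by linarith, by linarith⟩)
    obtain ⟨l, hl⟩ := h z hz
    rw [hl] at hz'
    have h2 : (2 * l : ℤ) = 2 * a + 1 := by
      have : (2 * l : ℝ) = 2 * a + 1 := by linarith
      exact_mod_cast this
    omega
  have m1 : (k : ℝ) ∈ f '' s := hk ▸ ⟨x, hx, rfl⟩
  have m2 : (n : ℝ) ∈ f '' s := hn ▸ ⟨x₀, hx₀, rfl⟩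
  rw [hk, le_antisymm (not_lt.1 (key _ _ m2 m1)) (not_lt.1 (key _ _ m1 m2))]

namespace BaseTriangle

open LGParams ToricKaehler

variable {P : LGParams} {γ₁ γ₂ : UPath P} {κ : KPath P} (Δ : BaseTriangle P γ₁ γ₂ κ)

/-! ### The trivialization over the triangle -/

theorem δ_mem_region {s t : ℝ} (hs : s ∈ Icc (0 : ℝ) 1) (ht : t ∈ Icc (0 : ℝ) 1) : Δ.δ s t ∈ Δ.region :=
  ⟨(s, t), ⟨hs, ht⟩, rfl⟩

theorem neg_S_mem_region : -(P.S : ℂ) ∈ Δ.region := by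
  rw [← Δ.apex 0 zero_mem]
  exact Δ.δ_mem_region one_mem zero_mem

theorem region_subset_reg : Δ.region ⊆ P.reg := by
  rintro _ ⟨⟨s, t⟩, ⟨hs, ht⟩, rfl⟩
  exact Δ.mem_reg hs ht

theorem ne_zero_of_mem_region {b : ℂ} (hb : b ∈ Δ.region) : b ≠ 0 := by
  obtain ⟨⟨s, t⟩, ⟨hs, ht⟩, rfl⟩ := hb
  exact (Δ.in_disc s hs t ht).2.2

theorem eq_or_apex {s t s' t' : ℝ} (hs : s ∈ Icc (0 : ℝ) 1) (ht : t ∈ Icc (0 : ℝ) 1)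
    (hs' : s' ∈ Icc (0 : ℝ) 1) (ht' : t' ∈ Icc (0 : ℝ) 1) (h : Δ.δ s t = Δ.δ s' t') :
    (s = s' ∧ t = t') ∨ (s = 1 ∧ s' = 1) := by
  rcases hs.2.lt_or_eq with h1 | h1 <;> rcases hs'.2.lt_or_eq with h2 | h2
  · have := Δ.inj (x₁ := (s, t)) (x₂ := (s', t')) ⟨⟨hs.1, h1⟩, ht⟩ ⟨⟨hs'.1, h2⟩, ht'⟩ h
    exact Or.inl ⟨congrArg Prod.fst this, congrArg Prod.snd this⟩
  · exact absurd (by rw [h, h2, Δ.apex t' ht']) (Δ.apex_only s ⟨hs.1, h1⟩ t ht)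
  · exact absurd (by rw [← h, h1, Δ.apex t ht]) (Δ.apex_only s' ⟨hs'.1, h2⟩ t' ht')
  · exact Or.inr ⟨h1, h2⟩

/-- The parametrization of the triangle on the compact square. -/
def sq (k : unitInterval × unitInterval) : ℂ := Δ.δ k.1 k.2

theorem continuous_sq : Continuous Δ.sq :=
  Δ.smooth.continuous.comp (f := fun k : unitInterval × unitInterval => ((k.1 : ℝ), (k.2 : ℝ)))
    (by fun_prop)

theorem range_sq : range Δ.sq = Δ.region := by
  ext b
  constructor
  · rintro ⟨k, rfl⟩; exact Δ.δ_mem_region k.1.2 k.2.2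
  · rintro ⟨⟨s, t⟩, ⟨hs, ht⟩, rfl⟩; exact ⟨(⟨s, hs⟩, ⟨t, ht⟩), rfl⟩

theorem isClosed_region : IsClosed Δ.region := by
  rw [← Δ.range_sq]
  exact (isCompact_range Δ.continuous_sq).isClosed

/-- A parameter value of a point of the triangle. -/
def param (b : ℂ) : ℝ × ℝ := (fun k : unitInterval × unitInterval => ((k.1 : ℝ), (k.2 : ℝ)))
  (Function.invFun Δ.sq b)

theorem param_mem (b : ℂ) : (Δ.param b).1 ∈ Icc (0 : ℝ) 1 ∧ (Δ.param b).2 ∈ Icc (0 : ℝ) 1 :=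
  ⟨(Function.invFun Δ.sq b).1.2, (Function.invFun Δ.sq b).2.2⟩

theorem δ_param {b : ℂ} (hb : b ∈ Δ.region) : Δ.δ (Δ.param b).1 (Δ.param b).2 = b := by
  rw [← Δ.range_sq] at hb
  exact Function.invFun_eq hb

theorem param_eq_or {s t : ℝ} (hs : s ∈ Icc (0 : ℝ) 1) (ht : t ∈ Icc (0 : ℝ) 1) :
    ((Δ.param (Δ.δ s t)).1 = s ∧ (Δ.param (Δ.δ s t)).2 = t) ∨
      ((Δ.param (Δ.δ s t)).1 = 1 ∧ s = 1) :=
  Δ.eq_or_apex (Δ.param_mem _).1 (Δ.param_mem _).2 hs ht (Δ.δ_param (Δ.δ_mem_region hs ht))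

/-- The radial contraction of the triangle to its apex. -/
def contr (x : ℂ × ℝ) : ℂ :=
  Δ.δ ((Δ.param x.1).1 + x.2 * (1 - (Δ.param x.1).1)) (Δ.param x.1).2

theorem contr_mem_unit {s r : ℝ} (hs : s ∈ Icc (0 : ℝ) 1) (hr : r ∈ Icc (0 : ℝ) 1) :
    s + r * (1 - s) ∈ Icc (0 : ℝ) 1 :=
  ⟨by nlinarith [hs.1, hs.2, hr.1], by nlinarith [hs.1, hs.2, hr.2]⟩

theorem contr_δ {s t r : ℝ} (hs : s ∈ Icc (0 : ℝ) 1) (ht : t ∈ Icc (0 : ℝ) 1) :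
    Δ.contr (Δ.δ s t, r) = Δ.δ (s + r * (1 - s)) t := by
  rcases Δ.param_eq_or hs ht with ⟨h1, h2⟩ | ⟨h1, rfl⟩
  · rw [contr, h1, h2]
  · rw [contr, h1, sub_self, mul_zero, add_zero, Δ.apex t ht, Δ.apex _ (Δ.param_mem _).2]

theorem contr_mem {b : ℂ} {r : ℝ} (hr : r ∈ Icc (0 : ℝ) 1) : Δ.contr (b, r) ∈ Δ.region :=
  Δ.δ_mem_region (contr_mem_unit (Δ.param_mem b).1 hr) (Δ.param_mem b).2

theorem contr_zero {b : ℂ} (hb : b ∈ Δ.region) : Δ.contr (b, 0) = b := by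
  rw [contr, zero_mul, add_zero]; exact Δ.δ_param hb

theorem contr_one (b : ℂ) : Δ.contr (b, 1) = -(P.S : ℂ) := by
  rw [contr, one_mul, add_sub_cancel]; exact Δ.apex _ (Δ.param_mem b).2

theorem continuousOn_contr : ContinuousOn Δ.contr (Δ.region ×ˢ univ) := by
  rw [← Δ.range_sq]
  refine continuousOn_of_compact Δ.continuous_sq
    (h := fun x : (unitInterval × unitInterval) × ℝ => Δ.δ (x.1.1 + x.2 * (1 - x.1.1)) x.1.2) ?_
    fun k r => Δ.contr_δ k.1.2 k.2.2
  exact Δ.smooth.continuous.comp (f := fun x : (unitInterval × unitInterval) × ℝ =>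
    ((x.1.1 + x.2 * (1 - x.1.1) : ℝ), (x.1.2 : ℝ))) (by fun_prop)

variable (Ω : ToricKaehler P)

/-- The change of the angles under radial parallel transport from the apex to a point of the triangle. -/
def radial (x : ℂ × (Fin 2 → ℝ)) : Fin 2 → ℝ :=
  Ω.hol (fun s => Δ.δ s (Δ.param x.1).2) 1 (Δ.param x.1).1 x.2

theorem radial_δ {s t : ℝ} (hs : s ∈ Icc (0 : ℝ) 1) (ht : t ∈ Icc (0 : ℝ) 1) (ξ : Fin 2 → ℝ) :
    Δ.radial Ω (Δ.δ s t, ξ) = Ω.hol (fun s => Δ.δ s t) 1 s ξ := by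
  rcases Δ.param_eq_or hs ht with ⟨h1, h2⟩ | ⟨h1, rfl⟩
  · rw [radial, h1, h2]
  · simp only [radial]
    rw [h1, hol, hol, intervalIntegral.integral_same, intervalIntegral.integral_same]

theorem radial_apex (ξ : Fin 2 → ℝ) : Δ.radial Ω (-(P.S : ℂ), ξ) = 0 := by
  rw [← Δ.apex 0 zero_mem, Δ.radial_δ Ω one_mem zero_mem, hol, intervalIntegral.integral_same]

theorem radial_reg {s t : ℝ} (hs : s ∈ Icc (0 : ℝ) 1) (ht : t ∈ Icc (0 : ℝ) 1) {r : ℝ}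
    (hr : r ∈ uIcc 1 s) : Δ.δ r t ∈ P.reg := Δ.mem_reg (uIcc_subset_unit one_mem hs hr) ht

theorem exists_isArg_radial {b : ℂ} (hb : b ∈ Δ.region) : ∃ w, P.IsArg w b ∧ ∀ ξ m,
    Δ.radial Ω (b, ξ + latt m) = fun j => Δ.radial Ω (b, ξ) j - w / (2 * Real.pi) * m j := by
  obtain ⟨⟨s, t⟩, ⟨hs, ht⟩, rfl⟩ := hb
  have h0 : P.IsArg 0 (Δ.δ 1 t) := by rw [Δ.apex t ht]; exact P.isArg_neg_S
  refine ⟨_, wind_isArg (Δ.smooth_left t) (fun r hr => Δ.radial_reg hs ht hr) h0, fun ξ m => ?_⟩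
  change Δ.radial Ω (Δ.δ s t, _) = fun j => Δ.radial Ω (Δ.δ s t, ξ) j - _
  rw [Δ.radial_δ Ω hs ht, Δ.radial_δ Ω hs ht,
    Ω.hol_add_latt (Δ.smooth_left t) fun r hr => Δ.radial_reg hs ht hr]
  simp only [zero_add]

theorem continuousOn_radial : ContinuousOn (Δ.radial Ω) (Δ.region ×ˢ univ) := by
  rw [← Δ.range_sq]
  refine continuousOn_of_compact Δ.continuous_sq
    (h := fun x : (unitInterval × unitInterval) × (Fin 2 → ℝ) =>
      Ω.hol (fun s => Δ.δ s x.1.2) 1 x.1.1 x.2) ?_ fun k ξ => Δ.radial_δ Ω k.1.2 k.2.2 ξ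
  rw [continuous_iff_continuousAt]
  intro x
  have h := Ω.contDiffAt_hol (E := ℝ × ℝ × (Fin 2 → ℝ)) (Γ := fun y r => Δ.δ r y.2.1)
    (a := fun _ => 1) (b := fun y => y.1) (ξ := fun y => y.2.2)
    (x := ((x.1.1 : ℝ), (x.1.2 : ℝ), x.2))
    (Δ.smooth.comp (f := fun q : (ℝ × ℝ × (Fin 2 → ℝ)) × ℝ => (q.2, q.1.2.1)) (by fun_prop))
    contDiff_const contDiff_fst (by fun_prop) fun r hr => Δ.radial_reg x.1.1.2 x.1.2.2 hr
  exact h.continuousAt.comp (f := fun y : (unitInterval × unitInterval) × (Fin 2 → ℝ) =>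
    ((y.1.1 : ℝ), (y.1.2 : ℝ), y.2)) (by fun_prop)

/-- The radial trivialization: the point over `b` obtained by radial parallel transport from the point
of the fibre over `-S` with coordinates `(a, θ)`. -/
def triv (x : ℂ × (Fin 2 → ℝ) × (Fin 2 → ℝ)) : P.Y :=
  Ω.pt (matM x.2.1, x.2.2 + Δ.radial Ω (x.1, matM x.2.1), x.1)

theorem W_triv {b : ℂ} (hb : b ∈ Δ.region) (a θ : Fin 2 → ℝ) : P.W (Δ.triv Ω (b, a, θ)) = b :=
  Ω.W_pt (Δ.region_subset_reg hb)

theorem triv_apex (a θ : Fin 2 → ℝ) :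
    Δ.triv Ω (-(P.S : ℂ), a, θ) = Ω.pt (matM a, θ, -(P.S : ℂ)) := by
  simp only [triv]
  rw [Δ.radial_apex, add_zero]

theorem _root_.ToricKaehler.continuousOn_pt : ContinuousOn Ω.pt P.logReg := by
  rw [continuousOn_iff_continuous_domRestrict]
  have h1 : Continuous (fun x : P.logReg => P.torusPt true (Ω.act x)) :=
    (contDiff_torusPt (n := ∞) true).continuous.comp
      (continuousOn_iff_continuous_domRestrict.1 fun x hx =>
        (Ω.contDiffAt_act hx).continuousAt.continuousWithinAt)
  have h2 : Continuous (fun x : P.logReg => (⟨(true, P.torusPt true (Ω.act x)),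
      torusPt_mem_region.2 x.2.1⟩ : P.Charts)) := (continuous_const.prodMk h1).subtype_mk _
  have h3 : Continuous (Quot.mk P.glue) := continuous_quot_mk
  refine (h3.comp h2).congr fun x => ?_
  exact (toY_eq (q := Ω.act x) x.2.1).symm

theorem continuousOn_triv : ContinuousOn (Δ.triv Ω) (Δ.region ×ˢ univ) := by
  refine Ω.continuousOn_pt.comp (f := fun x : ℂ × (Fin 2 → ℝ) × (Fin 2 → ℝ) =>
    (matM x.2.1, x.2.2 + Δ.radial Ω (x.1, matM x.2.1), x.1)) ?_
    fun x hx => Δ.region_subset_reg hx.1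
  have hM : Continuous (matM : (Fin 2 → ℝ) → _) := (contDiff_matM (n := 0)).continuous
  have h1 : ContinuousOn (fun x : ℂ × (Fin 2 → ℝ) × (Fin 2 → ℝ) => Δ.radial Ω (x.1, matM x.2.1))
      (Δ.region ×ˢ univ) :=
    (Δ.continuousOn_radial Ω).comp (by fun_prop) fun x hx => ⟨hx.1, mem_univ _⟩
  exact ContinuousOn.prodMk (by fun_prop) (ContinuousOn.prodMk (by fun_prop) (by fun_prop))

/-! ### Coordinates over the triangle -/

/-- The angles of a point over the triangle, transported radially to the fibre over `-S`. -/
def fibΘ (p : P.Y) (j : Fin 2) : ℂ :=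
  open Classical in if h : P.W p ≠ -(P.crit : ℂ) then
    unitExp ((Ω.exists_pt h).choose.2.1 j - Δ.radial Ω (P.W p, (Ω.exists_pt h).choose.1) j) else 0

theorem fibΘ_pt {x : LogPt} (hx : x.2.2 ∈ Δ.region) (j : Fin 2) :
    Δ.fibΘ Ω (Ω.pt x) j = unitExp (x.2.1 j - Δ.radial Ω (x.2.2, x.1) j) := by
  have hx' : x ∈ P.logReg := Δ.region_subset_reg hx
  have h : P.W (Ω.pt x) ≠ -(P.crit : ℂ) := by rw [Ω.W_pt hx']; exact hx'.2
  obtain ⟨φ, hφ, hR⟩ := Δ.exists_isArg_radial Ω hx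
  rw [fibΘ, dif_pos h]
  have hs := (Ω.exists_pt h).choose_spec
  obtain ⟨m, n, hmn⟩ := (Ω.pt_eq_pt_iff hx' hs.1 hφ).1 hs.2.symm
  rw [hmn, Ω.W_pt hx', hR]
  refine unitExp_eq_iff.2 ⟨-n j, ?_⟩
  push_cast
  ring

theorem eq_triv {p : P.Y} (hp : P.W p ∈ Δ.region) {a θ : Fin 2 → ℝ}
    (ha : ∀ j, Ω.fibXi p j = unitExp (a j)) (hθ : ∀ j, Δ.fibΘ Ω p j = unitExp (θ j)) :
    p = Δ.triv Ω (P.W p, a, θ) := by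
  have hp' := Δ.region_subset_reg hp
  obtain ⟨θ', h⟩ := Ω.exists_pt_of_fibXi (ξ := matM a) hp'.2 (by rwa [invM_matM])
  obtain ⟨n, hn⟩ := exists_vec_int fun j =>
    (hθ j).symm.trans ((congrArg (fun q => Δ.fibΘ Ω q j) h).trans (Δ.fibΘ_pt Ω (x := (_, _, _)) hp j))
  conv_lhs => rw [h]
  simp only [triv]
  rw [← Ω.pt_add_int (θ := θ + _) hp' n]
  congr 1
  refine Prod.ext rfl (Prod.ext (funext fun j => ?_) rfl)
  have h1 : θ' j - Δ.radial Ω (P.W p, matM a) j = θ j + n j := congrFun hn j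
  simp only [Pi.add_apply]
  linarith

theorem fibXi_triv {b : ℂ} (hb : b ∈ Δ.region) (a θ : Fin 2 → ℝ) (j : Fin 2) :
    Ω.fibXi (Δ.triv Ω (b, a, θ)) j = unitExp (a j) := by
  simp only [triv]
  rw [Ω.fibXi_pt (x := (_, _, b)) (Δ.region_subset_reg hb), invM_matM]

theorem fibΘ_triv {b : ℂ} (hb : b ∈ Δ.region) (a θ : Fin 2 → ℝ) (j : Fin 2) :
    Δ.fibΘ Ω (Δ.triv Ω (b, a, θ)) j = unitExp (θ j) := by
  simp only [triv]
  rw [Δ.fibΘ_pt Ω (x := (_, _, b)) hb]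
  congr 1
  simp

theorem exists_triv {p : P.Y} (hp : P.W p ∈ Δ.region) : ∃ a θ, p = Δ.triv Ω (P.W p, a, θ) := by
  obtain ⟨x, hx, rfl⟩ := Ω.exists_pt (Δ.region_subset_reg hp).2
  rw [Ω.W_pt hx] at hp ⊢
  refine ⟨invM x.1, x.2.1 - Δ.radial Ω (x.2.2, x.1), ?_⟩
  simp only [triv]
  rw [matM_invM, sub_add_cancel]

end BaseTriangle

/-! ### Continuity of the coordinates -/

theorem LGParams.continuousOn_charts {P : LGParams} {T : Type*} [TopologicalSpace T] {D : Set C3}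
    {G : Bool → C3 → T} (hG : ∀ s, ContinuousOn (G s) D) :
    ContinuousOn (fun x : P.Charts => G x.1.1 x.1.2) {x | x.1.2 ∈ D} := by
  intro x hx
  have h1 : ContinuousWithinAt (fun y : P.Charts => G x.1.1 y.1.2) {x | x.1.2 ∈ D} x :=
    (hG x.1.1 x.1.2 hx).comp (f := fun y : P.Charts => y.1.2)
      (by fun_prop) fun y hy => hy
  refine h1.congr_of_eventuallyEq ?_ rfl
  have h2 : ∀ᶠ y : P.Charts in 𝓝 x, y.1.1 = x.1.1 :=
    (continuous_fst.comp continuous_subtype_val).continuousAt.eventually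
      (p := fun c : Bool => c = x.1.1) (by rw [nhds_discrete]; exact eventually_pure.2 rfl)
  filter_upwards [nhdsWithin_le_nhds h2] with y hy
  rw [hy]

theorem LGParams.continuous_Wc {P : LGParams} : Continuous P.Wc := by
  unfold Wc v0
  fun_prop

/-- The projection of the charts to `Y`. -/
def LGParams.mkY (P : LGParams) (x : P.Charts) : P.Y := Quot.mk P.glue x

theorem LGParams.isQuotientMap_mkY {P : LGParams} : IsQuotientMap P.mkY :=
  isQuotientMap_quot_mk (r := P.glue)

theorem LGParams.continuous_W {P : LGParams} : Continuous P.W :=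
  isQuotientMap_mkY.continuous_iff.2
    (continuous_Wc.comp (continuous_snd.comp continuous_subtype_val))

namespace BaseTriangle

open LGParams ToricKaehler

variable {P : LGParams} {γ₁ γ₂ : UPath P} {κ : KPath P} (Δ : BaseTriangle P γ₁ γ₂ κ)
  (Ω : ToricKaehler P)

theorem pt_logPt {s : Bool} {y : C3} {p : P.Y} (hy : P.IsLift s y p) (hp : P.Wc y ∈ P.reg) :
    p = Ω.pt (Ω.xi s y, (P.logPt s y).2.1, P.Wc y) ∧ ∀ j : Fin 2, y j.succ ≠ 0 := by
  have hv : v0 y ≠ 0 := by rw [Wc_eq.1 (rfl : P.Wc y = P.Wc y)]; exact P.nu_ne_zero.2 hp.2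
  have hne : ∀ j : Fin 2, y j.succ ≠ 0 := fun j => ne_zero_of_v0 hv j.succ
  have hq : P.logPt s y ∈ P.logReg := hp
  refine ⟨?_, hne⟩
  have h1 := torusPt_logPt (P := P) (s := s) hne
  rw [← h1] at hy
  rw [hy.eq_toY hp.2, Ω.toY_eq_pt hq, mom, ← Ω.xi_torusPt s hq, h1]
  rfl

theorem preimage_mkY_region : P.mkY ⁻¹' (P.W ⁻¹' Δ.region) =
    {x : P.Charts | x.1.2 ∈ {y | y ∈ P.region ∧ P.Wc y ∈ Δ.region}} := by
  ext x
  exact ⟨fun h => ⟨x.2, h⟩, fun h => h.2⟩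

theorem isClosed_preimage_region : IsClosed (P.W ⁻¹' Δ.region) :=
  Δ.isClosed_region.preimage P.continuous_W

theorem continuous_unitExp : Continuous unitExp := by unfold unitExp; fun_prop

theorem continuousOn_fibXi (j : Fin 2) : ContinuousOn (fun p => Ω.fibXi p j) (P.W ⁻¹' Δ.region) := by
  refine continuousOn_of_quotient isQuotientMap_mkY
    Δ.isClosed_preimage_region ?_
  rw [preimage_mkY_region]
  refine (continuousOn_charts (G := fun s y => unitExp (invM (Ω.xi s y) j)) fun s => ?_).congr ?_
  · refine (continuous_unitExp.comp ((continuous_apply j).comp continuous_invM)).comp_continuousOn ?_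
    exact (Ω.xi_smooth s).continuousOn.mono fun y hy => hy.1
  · rintro ⟨⟨s, y⟩, hy⟩ h
    have hW : P.Wc y ∈ Δ.region := h.2
    have h1 := (pt_logPt Ω (p := Quot.mk P.glue ⟨(s, y), hy⟩) ⟨hy, rfl⟩ (Δ.region_subset_reg hW)).1
    change Ω.fibXi (Quot.mk P.glue ⟨(s, y), hy⟩) j = _
    rw [h1, Ω.fibXi_pt (x := (_, _, P.Wc y)) (Δ.region_subset_reg hW)]

theorem continuousOn_fibΘ (j : Fin 2) : ContinuousOn (fun p => Δ.fibΘ Ω p j) (P.W ⁻¹' Δ.region) := by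
  refine continuousOn_of_quotient isQuotientMap_mkY
    Δ.isClosed_preimage_region ?_
  rw [preimage_mkY_region]
  refine (continuousOn_charts (G := fun s y => (y j.succ / ‖y j.succ‖) ^ (-sgn s) *
    unitExp (-Δ.radial Ω (P.Wc y, Ω.xi s y) j)) fun s => ?_).congr ?_
  · have h1 : ContinuousOn (fun y => Δ.radial Ω (P.Wc y, Ω.xi s y))
        {y | y ∈ P.region ∧ P.Wc y ∈ Δ.region} :=
      (Δ.continuousOn_radial Ω).comp (continuous_Wc.continuousOn.prodMk
        ((Ω.xi_smooth s).continuousOn.mono fun y hy => hy.1)) fun y hy => ⟨hy.2, mem_univ _⟩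
    refine ContinuousOn.mul ?_ (continuous_unitExp.comp_continuousOn
      ((continuous_apply j).comp_continuousOn h1).neg)
    intro y hy
    have hne : y j.succ ≠ 0 := (pt_logPt Ω (s := s) ⟨hy.1, rfl⟩ (Δ.region_subset_reg hy.2)).2 j
    have h3 : Continuous fun y : C3 => y j.succ := continuous_apply _
    have h2 : ContinuousAt (fun y : C3 => y j.succ / (‖y j.succ‖ : ℂ)) y :=
      h3.continuousAt.div (Complex.continuous_ofReal.comp h3.norm).continuousAt (by simpa using hne)
    exact (h2.zpow₀ _ (Or.inl (div_ne_zero hne (by simpa using hne)))).continuousWithinAt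
  · rintro ⟨⟨s, y⟩, hy⟩ h
    have hW : P.Wc y ∈ Δ.region := h.2
    obtain ⟨h1, hne⟩ := pt_logPt Ω (p := Quot.mk P.glue ⟨(s, y), hy⟩) ⟨hy, rfl⟩
      (Δ.region_subset_reg hW)
    change Δ.fibΘ Ω (Quot.mk P.glue ⟨(s, y), hy⟩) j = _
    rw [h1, Δ.fibΘ_pt Ω (x := (_, _, P.Wc y)) hW]
    have h2 : y j.succ / ‖y j.succ‖ = unitExp ((y j.succ).arg / (2 * Real.pi)) := by
      have hpi : (Real.pi : ℂ) ≠ 0 := by exact_mod_cast Real.pi_ne_zero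
      rw [unitExp, div_eq_iff (by simpa using hne j)]
      conv_lhs => rw [← Complex.norm_mul_exp_arg_mul_I (y j.succ)]
      rw [mul_comm]
      congr 2
      push_cast
      field_simp
    dsimp only
    rw [h2, unitExp_zpow, ← unitExp_add]
    congr 1
    simp only [logPt]
    push_cast
    ring

end BaseTriangle

/-! ### The Lagrangians in the radial trivialization -/

namespace UPath

variable {P : LGParams} (γ : UPath P)

theorem smooth : ContDiff ℝ ∞ γ.path := by
  rw [show γ.path = fun τ => (γ.r τ : ℂ) * Complex.exp (2 * Real.pi * Complex.I * (γ.θ τ : ℂ)) from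
    funext γ.path_eq]
  have h1 : ContDiff ℝ ∞ fun τ => (γ.r τ : ℂ) := Complex.ofRealCLM.contDiff.comp γ.r_smooth
  have h2 : ContDiff ℝ ∞ fun τ => (γ.θ τ : ℂ) := Complex.ofRealCLM.contDiff.comp γ.θ_smooth
  exact h1.mul (contDiff_const.mul h2).cexp

theorem path_zero : γ.path 0 = -(P.S : ℂ) := by
  rw [γ.path_eq, γ.r_zero, γ.θ_zero,
    show 2 * Real.pi * Complex.I * ((-(1 / 2) : ℝ) : ℂ) = -(Real.pi * Complex.I) by push_cast; ring,
    Complex.exp_neg, Complex.exp_pi_mul_I]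
  norm_num

end UPath

namespace BaseTriangle

open LGParams ToricKaehler

variable {P : LGParams} {γ₁ γ₂ : UPath P} {κ : KPath P} (Δ : BaseTriangle P γ₁ γ₂ κ)
  (Ω : ToricKaehler P)

theorem triv_eq_triv {b : ℂ} (hb : b ∈ Δ.region) {a θ a' θ' : Fin 2 → ℝ}
    (ha : ∀ j, unitExp (a j) = unitExp (a' j)) (hθ : ∀ j, unitExp (θ j) = unitExp (θ' j)) :
    Δ.triv Ω (b, a, θ) = Δ.triv Ω (b, a', θ') := by
  have h := Δ.eq_triv Ω (p := Δ.triv Ω (b, a, θ)) (a := a') (θ := θ')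
    (by rwa [Δ.W_triv Ω hb]) (fun j => by rw [Δ.fibXi_triv Ω hb, ha])
    (fun j => by rw [Δ.fibΘ_triv Ω hb, hθ])
  rwa [Δ.W_triv Ω hb] at h

/-- The equation of the linear Lagrangian of slope `-k`, lifted to the universal cover. -/
theorem exists_triv_eq_linear {b : ℂ} (hb : b ∈ Δ.region) {a θ : Fin 2 → ℝ} {k : ℤ} :
    (∃ a', Δ.triv Ω (b, a, θ) = Δ.triv Ω (b, a', fun j => -(k : ℝ) * a' j)) ↔
      ∀ i, ∃ n : ℤ, θ i + k * a i = n := by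
  constructor
  · rintro ⟨a', h⟩ i
    obtain ⟨m, hm⟩ := unitExp_eq_iff.1 (show unitExp (a i) = unitExp (a' i) by
      rw [← Δ.fibXi_triv Ω hb a θ, h, Δ.fibXi_triv Ω hb])
    obtain ⟨n, hn⟩ := unitExp_eq_iff.1 (show unitExp (θ i) = unitExp (-(k : ℝ) * a' i) by
      rw [← Δ.fibΘ_triv Ω hb a θ, h, Δ.fibΘ_triv Ω hb])
    refine ⟨-n - k * m, ?_⟩
    rw [hm] at hn
    push_cast
    linarith
  · intro h
    refine ⟨a, Δ.triv_eq_triv Ω hb (fun j => rfl) fun j => ?_⟩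
    obtain ⟨n, hn⟩ := h j
    refine unitExp_eq_iff.2 ⟨-n, ?_⟩
    push_cast
    linarith

theorem triv_mem_ell {a θ : Fin 2 → ℝ} {k : ℤ} : Δ.triv Ω (-(P.S : ℂ), a, θ) ∈ Ω.ell k ↔
    ∀ i, ∃ n : ℤ, θ i + k * a i = n := by
  rw [← Δ.exists_triv_eq_linear Ω Δ.neg_S_mem_region, Ω.mem_ell]
  constructor
  · rintro ⟨ξ, h⟩
    exact ⟨invM ξ, by rw [Δ.triv_apex Ω (invM ξ), matM_invM]; exact h⟩
  · rintro ⟨a', h⟩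
    exact ⟨matM a', by rw [h, Δ.triv_apex, invM_matM]⟩

/-- Over the triangle, the Lagrangian over a U-shaped path which follows the side `t = t₀` is the
radial transport of a linear Lagrangian along this side. -/
theorem triv_mem_lagL {γ : UPath P} {α : ℝ → ℝ} {t₀ : ℝ} (ht₀ : t₀ ∈ Icc (0 : ℝ) 1)
    (hα : ContDiff ℝ ∞ α) (hside : ∀ s ∈ Icc (0 : ℝ) 1, Δ.δ s t₀ = γ.path (α s))
    (hmeet : ∀ τ, ∀ s ∈ Icc (0 : ℝ) 1, ∀ t ∈ Icc (0 : ℝ) 1, γ.path τ = Δ.δ s t →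
      ∃ s' ∈ Icc (0 : ℝ) 1, γ.path τ = Δ.δ s' t₀)
    {b : ℂ} (hb : b ∈ Δ.region) {a θ : Fin 2 → ℝ} {k : ℤ} :
    Δ.triv Ω (b, a, θ) ∈ Ω.lagL γ k ↔
      (∃ s ∈ Icc (0 : ℝ) 1, b = Δ.δ s t₀) ∧ ∀ i, ∃ n : ℤ, θ i + k * a i = n := by
  have h1 : α 1 = 0 := γ.inj (by rw [← hside 1 one_mem, Δ.apex t₀ ht₀, γ.path_zero])
  have hreg : ∀ s ∈ Icc (0 : ℝ) 1, ∀ r ∈ uIcc 0 (α s), γ.path r ∈ P.reg := by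
    intro s hs r hr
    rw [← h1] at hr
    obtain ⟨x, hx, rfl⟩ := intermediate_value_uIcc hα.continuous.continuousOn hr
    have hx' := uIcc_subset_unit one_mem hs hx
    rw [← hside x hx']
    exact Δ.mem_reg hx' ht₀
  have hhol : ∀ s ∈ Icc (0 : ℝ) 1, ∀ ξ, Ω.hol γ.path 0 (α s) ξ = Δ.radial Ω (Δ.δ s t₀, ξ) := by
    intro s hs ξ
    rw [Δ.radial_δ Ω hs ht₀, Ω.hol_comp γ.smooth (Δ.smooth_left t₀) hα
      (fun x hx => hside x (uIcc_subset_unit one_mem hs hx)) (fun x hx => Δ.radial_reg hs ht₀ hx), h1]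
  have key : ∀ s ∈ Icc (0 : ℝ) 1, ∀ p, p ∈ Ω.transport γ.path 0 (α s) (Ω.ell k) ↔
      ∃ a', p = Δ.triv Ω (Δ.δ s t₀, a', fun j => -(k : ℝ) * a' j) := by
    intro s hs p
    rw [Ω.mem_transport_ell_iff γ.smooth (hreg s hs) γ.path_zero]
    constructor
    · rintro ⟨ξ, rfl⟩
      refine ⟨invM ξ, ?_⟩
      rw [triv, matM_invM, hhol s hs, hside s hs]
      rfl
    · rintro ⟨a', rfl⟩
      refine ⟨matM a', ?_⟩
      rw [triv, invM_matM, hhol s hs, hside s hs]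
      rfl
  rw [lagL, mem_iUnion, ← Δ.exists_triv_eq_linear Ω hb]
  constructor
  · rintro ⟨τ, hτ⟩
    have hW : b = γ.path τ := by
      obtain ⟨c, hc, -, h3⟩ := hτ
      rw [← (hc τ right_mem_uIcc).1, h3, Δ.W_triv Ω hb]
    obtain ⟨⟨s, t⟩, ⟨hs, ht⟩, h2⟩ := id hb
    obtain ⟨s', hs', h3⟩ := hmeet τ s hs t ht (hW.symm.trans h2.symm)
    have h4 : τ = α s' := γ.inj (h3.trans (hside s' hs'))
    have h5 : b = Δ.δ s' t₀ := hW.trans h3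
    rw [h4, key s' hs', ← h5] at hτ
    exact ⟨⟨s', hs', h5⟩, hτ⟩
  · rintro ⟨⟨s, hs, rfl⟩, h⟩
    exact ⟨α s, (key s hs _).2 h⟩

theorem triv_mem_lagL₁ {b : ℂ} (hb : b ∈ Δ.region) {a θ : Fin 2 → ℝ} {k : ℤ} :
    Δ.triv Ω (b, a, θ) ∈ Ω.lagL γ₁ k ↔
      (∃ s ∈ Icc (0 : ℝ) 1, b = Δ.δ s 1) ∧ ∀ i, ∃ n : ℤ, θ i + k * a i = n :=
  Δ.triv_mem_lagL Ω one_mem Δ.a₁_smooth Δ.side₁ Δ.meets₁ hb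

theorem triv_mem_lagL₂ {b : ℂ} (hb : b ∈ Δ.region) {a θ : Fin 2 → ℝ} {k : ℤ} :
    Δ.triv Ω (b, a, θ) ∈ Ω.lagL γ₂ k ↔
      (∃ s ∈ Icc (0 : ℝ) 1, b = Δ.δ s 0) ∧ ∀ i, ∃ n : ℤ, θ i + k * a i = n :=
  Δ.triv_mem_lagL Ω zero_mem Δ.a₂_smooth Δ.side₂ Δ.meets₂ hb

end BaseTriangle

/-! ### The moved triangle -/

theorem LGParams.IsLift.continuousWithinAt {P : LGParams} {X : Type*} [TopologicalSpace X] {c : Bool}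
    {F : X → C3} {f : X → P.Y} {D : Set X} {x : X} (hx : x ∈ D) (hF : ContinuousWithinAt F D x)
    (h : ∀ᶠ q in 𝓝[D] x, P.IsLift c (F q) (f q)) : ContinuousWithinAt f D x := by
  obtain ⟨h0, hf⟩ := h.self_of_nhdsWithin hx
  rw [ContinuousWithinAt, tendsto_def]
  intro U hU
  rw [hf] at hU
  have h1 := (LGParams.isQuotientMap_mkY (P := P)).continuous.continuousAt
    (x := (⟨(c, F x), h0⟩ : P.Charts)) hU
  rw [nhds_subtype_eq_comap, mem_map, mem_comap] at h1
  obtain ⟨V, hV, hVU⟩ := h1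
  have h2 : ContinuousWithinAt (fun q => (c, F q)) D x := continuousWithinAt_const.prodMk hF
  have h5 : ∀ᶠ q in 𝓝[D] x, (c, F q) ∈ V := h2 hV
  filter_upwards [h, h5] with q hq hqV
  obtain ⟨h3, h4⟩ := hq
  change f q ∈ U
  rw [h4]
  exact hVU (show (⟨(c, F q), h3⟩ : P.Charts) ∈ Subtype.val ⁻¹' V from hqV)

namespace BaseTriangle

open LGParams ToricKaehler

variable {P : LGParams} {γ₁ γ₂ : UPath P} {κ : KPath P} {Δ : BaseTriangle P γ₁ γ₂ κ}
  {Ω : ToricKaehler P} {k : ℤ} {K : Set P.Y} {Ψ : ℝ → ℝ → (Fin 2 → ℝ) → P.Y}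

namespace IsIsotopy

theorem continuous (h : Δ.IsIsotopy Ω k K Ψ) :
    Continuous fun x : unitInterval × unitInterval × (Fin 2 → ℝ) => Ψ x.1 x.2.1 x.2.2 := by
  have h1 : ContinuousOn (fun x : ℝ × ℝ × (Fin 2 → ℝ) => Ψ x.1 x.2.1 x.2.2)
      (Icc 0 1 ×ˢ Icc 0 1 ×ˢ univ) := by
    rintro ⟨s, t, a⟩ hx
    obtain ⟨c, F, hF, hl, -⟩ := h.smooth_lagrangian s hx.1 t hx.2.1 a
    exact IsLift.continuousWithinAt hx hF.continuousAt.continuousWithinAt hl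
  exact h1.comp_continuous (f := fun x : unitInterval × unitInterval × (Fin 2 → ℝ) =>
    ((x.1 : ℝ), (x.2.1 : ℝ), x.2.2)) (by fun_prop) fun x => ⟨x.1.2, x.2.1.2, mem_univ _⟩

theorem eq_of_start (h : Δ.IsIsotopy Ω k K Ψ) {t t' : ℝ} (ht : t ∈ Icc (0 : ℝ) 1)
    (ht' : t' ∈ Icc (0 : ℝ) 1) {a a' : Fin 2 → ℝ} (he : Ψ 0 t a = Ψ 0 t' a') :
    t = t' ∧ ∃ m : Fin 2 → ℤ, a' = fun i => a i + m i := by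
  have h1 : Δ.δ 0 t = Δ.δ 0 t' := by
    rw [← h.covers 0 zero_mem t ht a, he, h.covers 0 zero_mem t' ht']
  rcases Δ.eq_or_apex zero_mem ht zero_mem ht' h1 with ⟨-, rfl⟩ | ⟨h2, -⟩
  · obtain ⟨m, hm⟩ := h.inj 0 ⟨le_rfl, one_pos⟩ t ht a a' he
    exact ⟨rfl, m, funext hm⟩
  · exact absurd h2 zero_ne_one

/-- A path in the part of `K` over the triangle lifts to the parametrizing product of an interval and
a plane. -/
theorem exists_lift_path (h : Δ.IsIsotopy Ω k K Ψ) {e : unitInterval → P.Y} (he : Continuous e)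
    (hK : ∀ r, e r ∈ K) (hW : ∀ r, P.W (e r) ∈ Δ.region) :
    ∃ (t : unitInterval → unitInterval) (a : unitInterval → Fin 2 → ℝ), Continuous t ∧ Continuous a ∧
      ∀ r, Ψ 0 (t r) (a r) = e r := by
  -- the coordinates over the triangle, by which points over the triangle are separated
  let crd : P.Y → ℂ × (Fin 2 → ℂ) × (Fin 2 → ℂ) := fun p => (P.W p, Ω.fibXi p, Δ.fibΘ Ω p)
  have hcrd : ContinuousOn crd (P.W ⁻¹' Δ.region) :=
    P.continuous_W.continuousOn.prodMk ((continuousOn_pi.2 fun j => Δ.continuousOn_fibXi Ω j).prodMk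
      (continuousOn_pi.2 fun j => Δ.continuousOn_fibΘ Ω j))
  have hinj : ∀ {p p'}, P.W p ∈ Δ.region → crd p = crd p' → p = p' := by
    intro p p' hp hpp
    have e1 : P.W p = P.W p' := congrArg Prod.fst hpp
    have e2 : Ω.fibXi p = Ω.fibXi p' := congrArg (fun x => x.2.1) hpp
    have e3 : Δ.fibΘ Ω p = Δ.fibΘ Ω p' := congrArg (fun x => x.2.2) hpp
    obtain ⟨a, θ, h1⟩ := Δ.exists_triv Ω hp
    have ha : ∀ j, Ω.fibXi p j = unitExp (a j) := fun j => by
      conv_lhs => rw [h1]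
      exact Δ.fibXi_triv Ω hp a θ j
    have hθ : ∀ j, Δ.fibΘ Ω p j = unitExp (θ j) := fun j => by
      conv_lhs => rw [h1]
      exact Δ.fibΘ_triv Ω hp a θ j
    rw [h1, Δ.eq_triv Ω (p := p') (a := a) (θ := θ) (e1 ▸ hp) (fun j => by rw [← e2, ha])
      (fun j => by rw [← e3, hθ]), e1]
  let Ψ' : unitInterval × (Fin 2 → unitInterval) → P.Y := fun x => Ψ 0 x.1 fun j => x.2 j
  have hΨW : ∀ x, P.W (Ψ' x) ∈ Δ.region := fun x => by
    change P.W (Ψ 0 x.1 _) ∈ _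
    rw [h.covers 0 zero_mem _ x.1.2]
    exact Δ.δ_mem_region zero_mem x.1.2
  have hΨ' : Continuous Ψ' := h.continuous.comp
    (f := fun x : unitInterval × (Fin 2 → unitInterval) =>
      ((0 : unitInterval), x.1, fun j => (x.2 j : ℝ))) (by fun_prop)
  let out : unitInterval × (Fin 2 → unitInterval) → unitInterval × (Fin 2 → ℂ) :=
    fun x => (x.1, fun j => unitExp (x.2 j))
  have hout : Continuous out := continuous_fst.prodMk (continuous_pi fun j =>
    continuous_unitExp.comp (by fun_prop))
  let f := crd ∘ Ψ'
  have hf : Continuous f := hcrd.comp_continuous hΨ' hΨW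
  have hfo : ∀ {x x'}, f x = f x' → out x = out x' := by
    intro x x' hx
    obtain ⟨h1, m, h2⟩ := h.eq_of_start x.1.2 x'.1.2 (hinj (hΨW x) hx)
    refine Prod.ext (Subtype.ext h1) (funext fun j => ?_)
    exact unitExp_eq_iff.2 ⟨m j, congrFun h2 j⟩
  let g : (ℂ × (Fin 2 → ℂ) × (Fin 2 → ℂ)) × Unit → unitInterval × (Fin 2 → ℂ) :=
    fun y => out (Function.invFun f y.1)
  have hg : ContinuousOn g (range f ×ˢ univ) :=
    continuousOn_of_compact hf (h := fun x => out x.1) (hout.comp continuous_fst) fun x _ =>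
      hfo (Function.invFun_eq ⟨x, rfl⟩)
  have hex : ∀ r, ∃ x, Ψ' x = e r := by
    intro r
    have h1 : e r ∈ {p | ∃ t ∈ Icc (0 : ℝ) 1, ∃ a, p = Ψ 0 t a} := by
      rw [h.start]; exact ⟨hK r, hW r⟩
    obtain ⟨t, ht, a, h2⟩ := h1
    refine ⟨(⟨t, ht⟩, fun j => ⟨Int.fract (a j), Int.fract_nonneg _, (Int.fract_lt_one _).le⟩), ?_⟩
    rw [h2]
    refine (h.periodic 0 zero_mem t ht (fun j => Int.fract (a j)) fun j => ⌊a j⌋).symm.trans ?_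
    congr 1
    funext j
    exact Int.fract_add_floor _
  let q : unitInterval → unitInterval × (Fin 2 → ℂ) := fun r => g (crd (e r), ())
  have hq : Continuous q := hg.comp_continuous
    ((hcrd.comp_continuous he hW).prodMk continuous_const) fun r => by
      obtain ⟨x, hx⟩ := hex r
      exact ⟨⟨x, congrArg crd hx⟩, mem_univ _⟩
  have hqx : ∀ {r x}, Ψ' x = e r → q r = out x := by
    intro r x hx
    refine hfo (Function.invFun_eq (f := f) (b := crd (e r)) ⟨x, congrArg crd hx⟩ |>.trans ?_)
    exact (congrArg crd hx).symm
  have hlift : ∀ j, ∃ a : unitInterval → ℝ, Continuous a ∧ ∀ r, unitExp (a r) = (q r).2 j := by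
    intro j
    refine exists_lift_unitExp (C := fun x => x.1 * x.2) (by fun_prop) (x₀ := 0) (fun x => zero_mul x)
      (fun x => one_mul x) ((continuous_apply j).comp (continuous_snd.comp hq)) fun r => ?_
    obtain ⟨x, hx⟩ := hex r
    exact ⟨x.2 j, congrFun (congrArg Prod.snd (hqx hx)) j⟩
  choose a ha ha' using hlift
  refine ⟨fun r => (q r).1, fun r j => a j r, continuous_fst.comp hq, continuous_pi ha, fun r => ?_⟩
  obtain ⟨x, hx⟩ := hex r
  have h1 : (q r).1 = x.1 := by rw [hqx hx]
  obtain ⟨n, hn⟩ := exists_vec_int (x := fun j => (x.2 j : ℝ)) (y := fun j => a j r) fun j => by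
    rw [ha' j r, hqx hx]
  change Ψ 0 (q r).1 (fun j => a j r) = e r
  rw [h1, hn, h.periodic 0 zero_mem _ x.1.2]
  exact hx

end IsIsotopy

end BaseTriangle

/-! ### Attaching the trace of an edge -/

theorem splx_sum (μ : Splx 2) : μ 0 + μ 1 + μ 2 = 1 := by
  rw [← μ.2.2, Fin.sum_univ_three]; rfl

theorem splx_ext {μ ν : Splx 2} (h1 : μ 1 = ν 1) (h2 : μ 2 = ν 2) : μ = ν := by
  have h := splx_sum μ
  have h' := splx_sum ν
  refine Subtype.ext (funext fun k => ?_)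
  fin_cases k
  · change μ 0 = ν 0
    linarith
  · exact h1
  · exact h2

theorem continuous_splx (k : Fin 3) : Continuous fun μ : Splx 2 => μ k :=
  (continuous_apply k).comp continuous_subtype_val

theorem squeeze_le (μ : Splx 2) : μ 1 / max (μ 1 + μ 2) (1 / 2) + μ 2 / max (μ 1 + μ 2) (1 / 2) ≤ 1 := by
  rw [← add_div, div_le_one (lt_of_lt_of_le one_half_pos (le_max_right _ _))]
  exact le_max_left _ _

/-- The map of the triangle which stretches the half `μ₀ ≥ 1/2` and projects the other half radially
to the edge opposite to the vertex `0`. -/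
def squeeze (μ : Splx 2) : Splx 2 :=
  ⟨![1 - (μ 1 / max (μ 1 + μ 2) (1 / 2) + μ 2 / max (μ 1 + μ 2) (1 / 2)),
    μ 1 / max (μ 1 + μ 2) (1 / 2), μ 2 / max (μ 1 + μ 2) (1 / 2)], by
    have h1 : 0 ≤ μ 1 := μ.2.1 1
    have h2 : 0 ≤ μ 2 := μ.2.1 2
    have h3 : 0 < max (μ 1 + μ 2) (1 / 2) := lt_of_lt_of_le one_half_pos (le_max_right _ _)
    refine ⟨fun k => ?_, ?_⟩
    · fin_cases k
      · exact sub_nonneg.2 (squeeze_le μ)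
      · exact div_nonneg h1 h3.le
      · exact div_nonneg h2 h3.le
    · rw [Fin.sum_univ_three]
      exact (add_assoc _ _ _).trans (sub_add_cancel _ _)⟩

theorem continuous_squeeze : Continuous squeeze := by
  have c1 := continuous_splx 1
  have c2 := continuous_splx 2
  have c3 : Continuous fun μ : Splx 2 => max (μ 1 + μ 2) (1 / 2) := (c1.add c2).max continuous_const
  have h3 : ∀ μ : Splx 2, max (μ 1 + μ 2) (1 / 2) ≠ 0 := fun μ =>
    (lt_of_lt_of_le one_half_pos (le_max_right _ _)).ne'
  refine Continuous.subtype_mk (continuous_pi fun k => ?_) _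
  fin_cases k
  exacts [continuous_const.sub ((c1.div c3 h3).add (c2.div c3 h3)), c1.div c3 h3, c2.div c3 h3]

theorem squeeze_apply (μ : Splx 2) : squeeze μ 1 = μ 1 / max (μ 1 + μ 2) (1 / 2) ∧
    squeeze μ 2 = μ 2 / max (μ 1 + μ 2) (1 / 2) := ⟨rfl, rfl⟩

theorem squeeze_of_ge {μ : Splx 2} (h : 1 / 2 ≤ μ 0) : squeeze μ 1 = 2 * μ 1 ∧ squeeze μ 2 = 2 * μ 2 := by
  have hm : max (μ 1 + μ 2) (1 / 2) = 1 / 2 := max_eq_right (by linarith [splx_sum μ])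
  rw [(squeeze_apply μ).1, (squeeze_apply μ).2, hm]
  constructor <;> ring

theorem squeeze_of_le {μ : Splx 2} (h : μ 0 ≤ 1 / 2) : squeeze μ 0 = 0 ∧
    squeeze μ 1 = μ 1 / (μ 1 + μ 2) ∧ squeeze μ 2 = μ 2 / (μ 1 + μ 2) := by
  have h1 := splx_sum μ
  have h2 := splx_sum (squeeze μ)
  have hm : max (μ 1 + μ 2) (1 / 2) = μ 1 + μ 2 := max_eq_left (by linarith)
  rw [(squeeze_apply μ).1, (squeeze_apply μ).2, hm] at h2 ⊢
  have h3 : μ 1 / (μ 1 + μ 2) + μ 2 / (μ 1 + μ 2) = 1 := by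
    rw [← add_div, div_self (by linarith)]
  exact ⟨by linarith, rfl, rfl⟩

/-- The edge opposite to the vertex `0`. -/
def edge (r : unitInterval) : Splx 2 :=
  ⟨![0, 1 - r, r], by
    refine ⟨fun k => ?_, ?_⟩
    · fin_cases k
      exacts [le_rfl, sub_nonneg.2 r.2.2, r.2.1]
    · rw [Fin.sum_univ_three]
      change (0 : ℝ) + (1 - r) + r = 1
      ring⟩

theorem continuous_edge : Continuous edge := by
  refine Continuous.subtype_mk (continuous_pi fun k => ?_) _
  fin_cases k
  exacts [continuous_const, continuous_const.sub continuous_subtype_val, continuous_subtype_val]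

/-- The last barycentric coordinate, as a point of the unit interval. -/
def lastCoord (μ : Splx 2) : unitInterval :=
  ⟨μ 2, μ.2.1 2, by linarith [splx_sum μ, show 0 ≤ μ 0 from μ.2.1 0, show 0 ≤ μ 1 from μ.2.1 1]⟩

theorem edge_lastCoord {μ : Splx 2} (h : μ 0 = 0) : edge (lastCoord μ) = μ := by
  refine splx_ext ?_ rfl
  change 1 - μ 2 = μ 1
  linarith [splx_sum μ]

/-- How far a point of the triangle has entered the collar `μ₀ ≤ 1/2`. -/
def depth (μ : Splx 2) : unitInterval :=
  ⟨max (1 - 2 * μ 0) 0, le_max_right _ _,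
    max_le (by linarith [show 0 ≤ μ 0 from μ.2.1 0]) zero_le_one⟩

theorem vertex_apply (i k : Fin 3) : (stdSimplex.vertex (S := ℝ) i : Splx 2) k = if k = i then 1 else 0 :=
  Pi.single_apply i 1 k

namespace BaseTriangle

open LGParams ToricKaehler

variable {P : LGParams} {γ₁ γ₂ : UPath P} {κ : KPath P} {Δ : BaseTriangle P γ₁ γ₂ κ}
  {Ω : ToricKaehler P} {k : ℤ} {K : Set P.Y} {Ψ : ℝ → ℝ → (Fin 2 → ℝ) → P.Y}

/-- The triangle obtained by attaching the trace of an edge: it exists as a continuous map, lies over the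
base triangle, has its edges on the three Lagrangians, and its corners over `-S`. -/
theorem IsIsotopy.exists_movedTriangle (h : Δ.IsIsotopy Ω k K Ψ) {j₁ j₂ : ℤ} {u : C(Splx 2, P.Y)}
    (hb : HasBoundaryOn u (Ω.lagL γ₁ j₁) (Ω.lagL γ₂ j₂) K) (hW : ∀ μ, P.W (u μ) ∈ Δ.region)
    (hc : CarriesCorners Ψ u (Ω.lagL γ₁ j₁) (Ω.lagL γ₂ j₂)) :
    ∃ u' : C(Splx 2, P.Y), IsMovedTriangle Ψ u u' ∧ (∀ μ, P.W (u' μ) ∈ Δ.region) ∧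
      HasBoundaryOn u' (Ω.lagL γ₁ j₁) (Ω.lagL γ₂ j₂) (Ω.ell k) ∧
      ∀ i, P.W (u' (stdSimplex.vertex (S := ℝ) i)) = -(P.S : ℂ) := by
  obtain ⟨t, a, ht, ha, hta⟩ := h.exists_lift_path (e := fun r => u (edge r))
    (u.continuous.comp continuous_edge) (fun r => (hb (edge r)).2.2 rfl) fun r => hW _
  -- `v` is the trace of the edge, parametrized by the collar `μ₀ ≤ 1/2`
  let v : Splx 2 → P.Y := fun μ => Ψ (depth μ) (t (lastCoord (squeeze μ))) (a (lastCoord (squeeze μ)))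
  have hlast : Continuous fun μ => lastCoord (squeeze μ) :=
    ((continuous_splx 2).comp continuous_squeeze).subtype_mk _
  have hdepth : Continuous depth :=
    ((continuous_const.sub (continuous_const.mul (continuous_splx 0))).max continuous_const).subtype_mk _
  have hv : Continuous v := h.continuous.comp
    (hdepth.prodMk ((ht.comp hlast).prodMk (ha.comp hlast)))
  classical
  let w : Splx 2 → P.Y := fun μ => if 1 / 2 ≤ μ 0 then u (squeeze μ) else v μ
  have hvu : ∀ μ, μ 0 = 1 / 2 → u (squeeze μ) = v μ := by
    intro μ hμ
    have h1 : (depth μ : ℝ) = 0 := by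
      change max (1 - 2 * μ 0) 0 = 0
      rw [hμ]; norm_num
    change _ = Ψ (depth μ) _ _
    rw [h1, hta, edge_lastCoord (squeeze_of_le hμ.le).1]
  have hw : Continuous w := Continuous.if_le (u.continuous.comp continuous_squeeze) hv
    continuous_const (continuous_splx 0) fun μ hμ => hvu μ hμ.symm
  have w1 : ∀ μ, 1 / 2 ≤ μ 0 → w μ = u (squeeze μ) := fun μ hμ => if_pos hμ
  have w2 : ∀ μ, μ 0 ≤ 1 / 2 → w μ = v μ := fun μ hμ => by
    rcases hμ.lt_or_eq with h1 | h1
    · exact if_neg (not_le.2 h1)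
    · rw [w1 μ h1.ge, hvu μ h1]
  have hd : ∀ μ, μ 0 ≤ 1 / 2 → (depth μ : ℝ) = 1 - 2 * μ 0 := fun μ hμ => max_eq_left (by linarith)
  have hBW : ∀ μ, P.W (w μ) ∈ Δ.region := by
    intro μ
    rcases le_total (1 / 2) (μ 0) with h1 | h1
    · rw [w1 μ h1]; exact hW _
    · rw [w2 μ h1]
      change P.W (Ψ _ _ _) ∈ _
      rw [h.covers _ (depth μ).2 _ (t _).2]
      exact Δ.δ_mem_region (depth μ).2 (t _).2
  have hB : ∀ μ : Splx 2, (μ 1 = 0 → w μ ∈ Ω.lagL γ₁ j₁) ∧ (μ 2 = 0 → w μ ∈ Ω.lagL γ₂ j₂) ∧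
      (μ 0 = 0 → w μ ∈ Ω.ell k) := by
    intro μ
    refine ⟨fun hμ => ?_, fun hμ => ?_, fun hμ => ?_⟩
    · rcases le_total (1 / 2) (μ 0) with h1 | h1
      · rw [w1 μ h1]
        exact (hb _).1 (by rw [(squeeze_of_ge h1).1, hμ, mul_zero])
      · rw [w2 μ h1]
        obtain ⟨e0, e1, -⟩ := squeeze_of_le h1
        rw [hμ, zero_div] at e1
        refine (hc _ (t _).2 _).2 ?_ _ (depth μ).2
        rw [hta, edge_lastCoord e0]
        congr 1
        exact splx_ext (by rw [e1, vertex_apply]; rfl)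
          (by rw [vertex_apply, if_pos rfl]; linarith [splx_sum (squeeze μ)])
    · rcases le_total (1 / 2) (μ 0) with h1 | h1
      · rw [w1 μ h1]
        exact (hb _).2.1 (by rw [(squeeze_of_ge h1).2, hμ, mul_zero])
      · rw [w2 μ h1]
        obtain ⟨e0, -, e1⟩ := squeeze_of_le h1
        rw [hμ, zero_div] at e1
        refine (hc _ (t _).2 _).1 ?_ _ (depth μ).2
        rw [hta, edge_lastCoord e0]
        congr 1
        exact splx_ext (by rw [vertex_apply, if_pos rfl]; linarith [splx_sum (squeeze μ)])
          (by rw [e1, vertex_apply]; rfl)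
    · have h1 : μ 0 ≤ 1 / 2 := by rw [hμ]; norm_num
      have h2 : (depth μ : ℝ) = 1 := by rw [hd μ h1, hμ]; norm_num
      rw [w2 μ h1, ← h.finish _ (t (lastCoord (squeeze μ))).2]
      change Ψ (depth μ) _ _ ∈ _
      rw [h2]
      exact mem_range_self _
  have hell : ∀ p ∈ Ω.ell k, P.W p = -(P.S : ℂ) := fun p ⟨a, ha⟩ => ha.1
  refine ⟨⟨w, hw⟩, fun μ ν => ⟨fun h0 h1 h2 h3 => ?_, fun h0 h1 h2 h3 t' ht' a' he => ?_⟩, hBW, hB,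
    fun i => ?_⟩
  · change w μ = _
    rw [w1 μ h0]
    congr 1
    exact splx_ext (by rw [h2, (squeeze_of_ge h0).1]) (by rw [h3, (squeeze_of_ge h0).2])
  · change w μ = _
    have hpos : μ 1 + μ 2 ≠ 0 := by linarith [splx_sum μ]
    obtain ⟨e0, e1, e2⟩ := squeeze_of_le h0
    have hν : squeeze μ = ν :=
      splx_ext (e1.trans (eq_div_of_mul_eq hpos h2).symm)
        (e2.trans (eq_div_of_mul_eq hpos h3).symm)
    rw [w2 μ h0]
    change Ψ (depth μ) _ _ = _
    rw [hν, hd μ h0]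
    have h4 := hta (lastCoord ν)
    rw [edge_lastCoord h1, ← he] at h4
    obtain ⟨h5, m, h6⟩ := h.eq_of_start (t _).2 ht' h4
    rw [← h5, h6, h.periodic _ (by rw [← hd μ h0]; exact (depth μ).2) _ (t _).2]
  -- The vertex `0` lies over both sides of the triangle through the apex, the other two on `ℓ_k`.
  · change P.W (w _) = _
    fin_cases i
    · have b1 := (hB (stdSimplex.vertex (S := ℝ) 0)).1 (by rw [vertex_apply]; rfl)
      have b2 := (hB (stdSimplex.vertex (S := ℝ) 0)).2.1 (by rw [vertex_apply]; rfl)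
      have hr := hBW (stdSimplex.vertex (S := ℝ) 0)
      obtain ⟨x, θ, hx⟩ := Δ.exists_triv Ω hr
      rw [hx] at b1 b2
      obtain ⟨s, hs, e1⟩ := ((Δ.triv_mem_lagL₁ Ω hr).1 b1).1
      obtain ⟨s', hs', e2⟩ := ((Δ.triv_mem_lagL₂ Ω hr).1 b2).1
      rcases Δ.eq_or_apex hs one_mem hs' zero_mem (e1.symm.trans e2) with ⟨-, h1⟩ | ⟨h1, -⟩
      · exact absurd h1 one_ne_zero
      · exact e1.trans (by rw [h1, Δ.apex 1 one_mem])
    · exact hell _ ((hB _).2.2 (by rw [vertex_apply]; rfl))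
    · exact hell _ ((hB _).2.2 (by rw [vertex_apply]; rfl))

end BaseTriangle

/-! ### The flat triangle -/

/-- The degree condition says that the slopes determine a positively oriented triangle. -/
theorem slopes_pos {j₁ j₂ j₃ : ℤ} (h₁₂ : j₁ ≠ j₂) (h₂₃ : j₂ ≠ j₃) (h₁₃ : j₁ ≠ j₃)
    (h : fibreDeg j₁ j₃ = fibreDeg j₂ j₃ + fibreDeg j₁ j₂) :
    0 < (j₃ - j₁) * (j₃ - j₂) * (j₂ - j₁) := by
  unfold fibreDeg at h
  rcases lt_or_gt_of_ne h₁₂ with a | a <;> rcases lt_or_gt_of_ne h₂₃ with b | b <;>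
    rcases lt_or_gt_of_ne h₁₃ with c | c <;> simp [a, b, c, a.not_gt, b.not_gt, c.not_gt] at h
  · exact mul_pos (mul_pos (by linarith) (by linarith)) (by linarith)
  · exact mul_pos (mul_pos_of_neg_of_neg (by linarith) (by linarith)) (by linarith)
  · exact mul_pos_of_neg_of_neg (mul_neg_of_neg_of_pos (by linarith) (by linarith)) (by linarith)

/-- An affine triangle in the plane with coordinates `(a, θ)`, whose edges have the slopes `-j₁`, `-j₂`,
`-j₃`, in all components is the image of one triangle of `ℂ` under a complex affine map. -/
theorem exists_complex_affine {j₁ j₂ j₃ : ℤ} (h₂₃ : j₂ ≠ j₃) (h₁₃ : j₁ ≠ j₃)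
    (hpos : 0 < (j₃ - j₁) * (j₃ - j₂) * (j₂ - j₁)) {a θ : Fin 3 → Fin 2 → ℝ}
    (h1 : ∀ i, θ 0 i + j₁ * a 0 i = θ 2 i + j₁ * a 2 i)
    (h2 : ∀ i, θ 0 i + j₂ * a 0 i = θ 1 i + j₂ * a 1 i)
    (h3 : ∀ i, θ 1 i + j₃ * a 1 i = θ 2 i + j₃ * a 2 i) {c : ℝ} (hc : 0 < c) :
    ∃ τ, IsPositive τ ∧ ∃ A B : Fin 2 → ℂ, ∀ (μ : Splx 2) (i : Fin 2),
      (A i + B i * triPoint τ μ).re = ∑ k, μ k * a k i ∧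
      (A i + B i * triPoint τ μ).im / c = ∑ k, μ k * θ k i := by
  have n13 : ((j₃ : ℝ) - j₁) ≠ 0 := sub_ne_zero.2 (by exact_mod_cast h₁₃.symm)
  have n23 : ((j₃ : ℝ) - j₂) ≠ 0 := sub_ne_zero.2 (by exact_mod_cast h₂₃.symm)
  let x : ℝ := (j₃ : ℝ) - j₁
  let y : ℝ := (j₃ : ℝ) - j₂
  refine ⟨![0, ⟨x, -(c * j₂ * x)⟩, ⟨y, -(c * j₁ * y)⟩], ?_,
    fun i => ⟨a 0 i, c * θ 0 i⟩, fun i => (((a 1 i - a 0 i) / x : ℝ) : ℂ), fun μ i => ?_⟩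
  · have h : (0 : ℝ) < ((j₃ - j₁) * (j₃ - j₂) * (j₂ - j₁) : ℤ) := by exact_mod_cast hpos
    push_cast at h
    simp only [IsPositive, Matrix.cons_val_zero, Matrix.cons_val_one, Matrix.cons_val, sub_zero,
      Complex.mul_im, Complex.conj_re, Complex.conj_im]
    have := mul_pos hc h
    calc (0 : ℝ) < c * (x * y * (j₂ - j₁)) := this
      _ = _ := by ring
  · have hs := splx_sum μ
    -- the edges are the multiples `x β` and `y β` of one real vector `β`
    have e1 : (a 1 i - a 0 i) / x * x = a 1 i - a 0 i := div_mul_cancel₀ _ n13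
    have e2 : (a 1 i - a 0 i) / x * y = a 2 i - a 0 i := by
      rw [div_mul_eq_mul_div, div_eq_iff n13]
      simp only [y]
      linear_combination h2 i + h3 i - h1 i
    set β := (a 1 i - a 0 i) / x
    have h1 := h1 i
    have h2 := h2 i
    rw [Fin.sum_univ_three, Fin.sum_univ_three]
    have er : (triPoint ![0, ⟨x, -(c * j₂ * x)⟩, ⟨y, -(c * j₁ * y)⟩] μ).re = μ 1 * x + μ 2 * y := by
      simp [triPoint, Fin.sum_univ_three]
    have ei : (triPoint ![0, ⟨x, -(c * j₂ * x)⟩, ⟨y, -(c * j₁ * y)⟩] μ).im =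
        -(c * (μ 1 * j₂ * x + μ 2 * j₁ * y)) := by
      simp [triPoint, Fin.sum_univ_three]
      ring
    constructor
    · rw [Complex.add_re, Complex.re_ofReal_mul, er]
      linear_combination μ 1 * e1 + μ 2 * e2 - a 0 i * hs
    · rw [Complex.add_im, Complex.im_ofReal_mul, ei, div_eq_iff hc.ne']
      change c * θ 0 i + _ = _
      linear_combination (-c * μ 1 * j₂) * e1 - (c * μ 2 * j₁) * e2 - (c * θ 0 i) * hs +
        c * μ 2 * h1 + c * μ 1 * h2

/-! ### The homotopy to the flat triangle -/

theorem isPreconnected_edge (i : Fin 3) : IsPreconnected {μ : Splx 2 | μ i = 0} := by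
  rw [← Topology.IsInducing.subtypeVal.isPreconnected_image]
  have h : (Subtype.val '' {μ : Splx 2 | μ i = 0} : Set (Fin 3 → ℝ)) =
      stdSimplex ℝ (Fin 3) ∩ {x | x i = 0} := by
    ext x
    constructor
    · rintro ⟨μ, hμ, rfl⟩; exact ⟨μ.2, hμ⟩
    · rintro ⟨h1, h2⟩; exact ⟨⟨x, h1⟩, h2, rfl⟩
  rw [h]
  refine ((convex_stdSimplex ℝ (Fin 3)).inter ?_).isPreconnected
  exact convex_hyperplane (f := fun x : Fin 3 → ℝ => x i) ⟨fun _ _ => rfl, fun _ _ => rfl⟩ 0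

/-- The affine function on the triangle with the same values at the vertices. -/
def affineInterp (f : Splx 2 → Fin 2 → ℝ) (μ : Splx 2) (i : Fin 2) : ℝ :=
  ∑ k, μ k * f (stdSimplex.vertex (S := ℝ) k) i

theorem continuous_affineInterp (f : Splx 2 → Fin 2 → ℝ) : Continuous (affineInterp f) :=
  continuous_pi fun _ => continuous_finsetSum _ fun k _ => (continuous_splx k).mul continuous_const

theorem affineInterp_vertex (f : Splx 2 → Fin 2 → ℝ) (k : Fin 3) :
    affineInterp f (stdSimplex.vertex (S := ℝ) k) = f (stdSimplex.vertex (S := ℝ) k) := by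
  funext i
  simp only [affineInterp, vertex_apply]
  simp

/-- An affine relation with constant value on an edge persists under affine interpolation. -/
theorem affineInterp_edge {a θ : Splx 2 → Fin 2 → ℝ} {l : Fin 3} {j : Fin 2} {k n : ℝ}
    (h : ∀ μ, μ l = 0 → θ μ j + k * a μ j = n) {μ : Splx 2} (hμ : μ l = 0) :
    affineInterp θ μ j + k * affineInterp a μ j = n := by
  have h1 : ∀ i : Fin 3, μ i * (θ (stdSimplex.vertex (S := ℝ) i) j +
      k * a (stdSimplex.vertex (S := ℝ) i) j) = μ i * n := by
    intro i
    by_cases hi : l = i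
    · rw [← hi, hμ, zero_mul, zero_mul]
    · rw [h _ (by rw [vertex_apply, if_neg hi])]
  have h2 : ∑ i, μ i * n = n := by
    rw [← Finset.sum_mul, Fin.sum_univ_three, splx_sum, one_mul]
  rw [affineInterp, affineInterp, Finset.mul_sum, ← Finset.sum_add_distrib, ← h2]
  refine Finset.sum_congr rfl fun i _ => ?_
  rw [← h1]
  ring

namespace BaseTriangle

open LGParams ToricKaehler

variable {P : LGParams} {γ₁ γ₂ : UPath P} {κ : KPath P} (Δ : BaseTriangle P γ₁ γ₂ κ)
  (Ω : ToricKaehler P)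

/-- A triangle over the base triangle lifts to the universal cover of the fibres, in the coordinates of the
radial trivialization. -/
theorem exists_lift_triangle {u : C(Splx 2, P.Y)} (hW : ∀ μ, P.W (u μ) ∈ Δ.region) :
    ∃ a θ : Splx 2 → Fin 2 → ℝ, Continuous a ∧ Continuous θ ∧
      ∀ μ, u μ = Δ.triv Ω (P.W (u μ), a μ, θ μ) := by
  let C : unitInterval × Splx 2 → Splx 2 := fun x =>
    ⟨(1 - x.1 : ℝ) • (stdSimplex.vertex (S := ℝ) (0 : Fin 3)).1 + (x.1 : ℝ) • x.2.1,
      convex_stdSimplex ℝ (Fin 3) (Subtype.property _) x.2.2 (sub_nonneg.2 x.1.2.2) x.1.2.1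
        (sub_add_cancel _ _)⟩
  have hC : Continuous C := by
    refine Continuous.subtype_mk (Continuous.add ?_ ?_) _
    · exact (continuous_const.sub (continuous_subtype_val.comp continuous_fst)).smul continuous_const
    · exact (continuous_subtype_val.comp continuous_fst).smul
        (continuous_subtype_val.comp continuous_snd)
  have h0 : ∀ μ, C (0, μ) = stdSimplex.vertex (S := ℝ) 0 := fun μ => Subtype.ext (by simp [C])
  have h1 : ∀ μ, C (1, μ) = μ := fun μ => Subtype.ext (by simp [C])
  have h2 : ∀ j, ∃ a : Splx 2 → ℝ, Continuous a ∧ ∀ μ, unitExp (a μ) = Ω.fibXi (u μ) j := fun j => by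
    refine exists_lift_unitExp hC h0 h1 ((Δ.continuousOn_fibXi Ω j).comp_continuous u.continuous hW)
      fun μ => ?_
    obtain ⟨a, θ, h⟩ := Δ.exists_triv Ω (hW μ)
    exact ⟨a j, (congrArg (fun p => Ω.fibXi p j) h).trans (Δ.fibXi_triv Ω (hW μ) a θ j)⟩
  have h3 : ∀ j, ∃ a : Splx 2 → ℝ, Continuous a ∧ ∀ μ, unitExp (a μ) = Δ.fibΘ Ω (u μ) j := fun j => by
    refine exists_lift_unitExp hC h0 h1 ((Δ.continuousOn_fibΘ Ω j).comp_continuous u.continuous hW)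
      fun μ => ?_
    obtain ⟨a, θ, h⟩ := Δ.exists_triv Ω (hW μ)
    exact ⟨θ j, (congrArg (fun p => Δ.fibΘ Ω p j) h).trans (Δ.fibΘ_triv Ω (hW μ) a θ j)⟩
  choose a ha ha' using h2
  choose θ hθ hθ' using h3
  exact ⟨fun μ j => a j μ, fun μ j => θ j μ, continuous_pi ha, continuous_pi hθ, fun μ =>
    Δ.eq_triv Ω (hW μ) (fun j => (ha' j μ).symm) fun j => (hθ' j μ).symm⟩

/-- A triangle over the base triangle with edges on the three Lagrangians and corners over `-S` is
homologous to a flat holomorphic triangle in the fibre over `-S`. -/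
theorem exists_flat {j₁ j₂ j₃ : ℤ} (h₂₃ : j₂ ≠ j₃) (h₁₃ : j₁ ≠ j₃)
    (hpos : 0 < (j₃ - j₁) * (j₃ - j₂) * (j₂ - j₁)) {A : Set P.Y}
    (hA₁ : Ω.lagL γ₁ j₁ ⊆ A) (hA₂ : Ω.lagL γ₂ j₂ ⊆ A) (hA₃ : Ω.ell j₃ ⊆ A) {u : C(Splx 2, P.Y)}
    (hW : ∀ μ, P.W (u μ) ∈ Δ.region)
    (hb : HasBoundaryOn u (Ω.lagL γ₁ j₁) (Ω.lagL γ₂ j₂) (Ω.ell j₃))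
    (hv : ∀ i, P.W (u (stdSimplex.vertex (S := ℝ) i)) = -(P.S : ℂ)) {c : ℝ} (hc : 0 < c) :
    ∃ u' : C(Splx 2, P.Y), IsFlatHolomorphic Ω c u' ∧
      HasBoundaryOn u' (Ω.ell j₁) (Ω.ell j₂) (Ω.ell j₃) ∧
      (∀ i : Fin 3, u' (stdSimplex.vertex (S := ℝ) i) = u (stdSimplex.vertex (S := ℝ) i)) ∧
      RelHomologous P.Y0 A u u' := by
  obtain ⟨a, θ, ha, hθ, hu⟩ := Δ.exists_lift_triangle Ω hW
  have hS := Δ.neg_S_mem_region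
  have hell : ∀ μ : Splx 2, μ 0 = 0 → P.W (u μ) = -(P.S : ℂ) := fun μ h => by
    obtain ⟨x, hx⟩ := (hb μ).2.2 h
    exact hx.1
  have s1 : ∀ μ : Splx 2, μ 1 = 0 → (∃ s ∈ Icc (0 : ℝ) 1, P.W (u μ) = Δ.δ s 1) ∧
      ∀ i, ∃ n : ℤ, θ μ i + j₁ * a μ i = n := fun μ h =>
    (Δ.triv_mem_lagL₁ Ω (hW μ)).1 (by rw [← hu μ]; exact (hb μ).1 h)
  have s2 : ∀ μ : Splx 2, μ 2 = 0 → (∃ s ∈ Icc (0 : ℝ) 1, P.W (u μ) = Δ.δ s 0) ∧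
      ∀ i, ∃ n : ℤ, θ μ i + j₂ * a μ i = n := fun μ h =>
    (Δ.triv_mem_lagL₂ Ω (hW μ)).1 (by rw [← hu μ]; exact (hb μ).2.1 h)
  have s3 : ∀ μ : Splx 2, μ 0 = 0 → ∀ i, ∃ n : ℤ, θ μ i + j₃ * a μ i = n := fun μ h =>
    (Δ.triv_mem_ell Ω).1 (by rw [← hell μ h, ← hu μ]; exact (hb μ).2.2 h)
  -- along each edge the integers are constant, so that the lifted edge lies on an affine plane
  have hconst : ∀ (l l' : Fin 3) (_ : l ≠ l') (k : ℤ),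
      (∀ μ : Splx 2, μ l = 0 → ∀ i, ∃ n : ℤ, θ μ i + k * a μ i = n) →
      ∀ i, ∃ n : ℤ, ∀ μ : Splx 2, μ l = 0 → θ μ i + k * a μ i = n := fun l l' hl k h i =>
    exists_int_of_connected (isPreconnected_edge l)
      ⟨stdSimplex.vertex (S := ℝ) l', by
        change (stdSimplex.vertex (S := ℝ) l' : Splx 2) l = 0
        rw [vertex_apply, if_neg hl]⟩
      (f := fun μ => θ μ i + k * a μ i) (Continuous.continuousOn
        (((continuous_apply i).comp hθ).add
          (continuous_const.mul ((continuous_apply i).comp ha)))) fun μ hμ => h μ hμ i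
  choose n₁ hn₁ using hconst 1 0 (by decide) j₁ fun μ h => (s1 μ h).2
  choose n₂ hn₂ using hconst 2 0 (by decide) j₂ fun μ h => (s2 μ h).2
  choose n₃ hn₃ using hconst 0 1 (by decide) j₃ s3
  -- the segment from a function to the affine function with the same values at the vertices
  let L : (Splx 2 → Fin 2 → ℝ) → ℝ → Splx 2 → Fin 2 → ℝ := fun f r μ =>
    (1 - r) • f μ + r • affineInterp f μ
  have hL : ∀ {f}, Continuous f → Continuous fun x : unitInterval × Splx 2 => L f x.1 x.2 := by
    intro f hf
    have hr : Continuous fun x : unitInterval × Splx 2 => (x.1 : ℝ) :=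
      continuous_subtype_val.comp continuous_fst
    exact ((continuous_const.sub hr).smul (hf.comp continuous_snd)).add
      (hr.smul ((continuous_affineInterp f).comp continuous_snd))
  have hLe : ∀ {l k} {n : Fin 2 → ℤ}, (∀ i, ∀ μ : Splx 2, μ l = 0 → θ μ i + (k : ℤ) * a μ i = n i) →
      ∀ r, ∀ μ : Splx 2, μ l = 0 → ∀ i, ∃ n : ℤ, L θ r μ i + k * L a r μ i = n := by
    intro l k n h r μ hμ i
    refine ⟨n i, ?_⟩
    have e1 := h i μ hμ
    have e2 := affineInterp_edge (h i) hμ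
    simp only [L, Pi.add_apply, Pi.smul_apply, smul_eq_mul]
    linear_combination (1 - r) * e1 + r * e2
  have L0 : ∀ f μ, L f 0 μ = f μ := fun f μ => by simp [L]
  have L1 : ∀ f μ, L f 1 μ = affineInterp f μ := fun f μ => by simp [L]
  -- straighten the triangle in the fibres while contracting its projection to the apex; both keep the edges
  -- on the three Lagrangians
  let H : C(unitInterval × Splx 2, P.Y) :=
    ⟨fun x => Δ.triv Ω (Δ.contr (P.W (u x.2), x.1), L a x.1 x.2, L θ x.1 x.2), by
      refine (Δ.continuousOn_triv Ω).comp_continuous (Continuous.prodMk ?_ ((hL ha).prodMk (hL hθ)))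
        fun x => ⟨Δ.contr_mem x.1.2, mem_univ _⟩
      exact Δ.continuousOn_contr.comp_continuous
        ((P.continuous_W.comp (u.continuous.comp continuous_snd)).prodMk
          (continuous_subtype_val.comp continuous_fst)) fun x => ⟨hW _, mem_univ _⟩⟩
  let u' : C(Splx 2, P.Y) := H.comp ⟨fun μ => (1, μ), by fun_prop⟩
  have hu' : ∀ μ, u' μ = Δ.triv Ω (-(P.S : ℂ), affineInterp a μ, affineInterp θ μ) := fun μ => by
    change Δ.triv Ω (Δ.contr (_, 1), L a 1 μ, L θ 1 μ) = _
    rw [L1, L1, Δ.contr_one]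
  have hcS : ∀ r : unitInterval, Δ.contr (-(P.S : ℂ), r) = -(P.S : ℂ) := fun r => by
    rw [← Δ.apex 0 zero_mem, Δ.contr_δ one_mem zero_mem, sub_self, mul_zero, add_zero]
  refine ⟨u', ?_, fun μ => ⟨fun h => ?_, fun h => ?_, fun h => ?_⟩, fun i => ?_,
    relHomologous_of_homotopy (H := H) (fun μ => ?_) (fun μ => rfl) (fun x => ?_) fun r μ i hi => ?_⟩
  · have hvert : ∀ i k : Fin 3, i ≠ k → (stdSimplex.vertex (S := ℝ) k : Splx 2) i = 0 := fun i k h => by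
      rw [vertex_apply, if_neg h]
    obtain ⟨τ, hτ, B, B', h⟩ := exists_complex_affine h₂₃ h₁₃ hpos
      (a := fun k => a (stdSimplex.vertex (S := ℝ) k)) (θ := fun k => θ (stdSimplex.vertex (S := ℝ) k))
      (fun i => (hn₁ i _ (hvert 1 0 (by decide))).trans (hn₁ i _ (hvert 1 2 (by decide))).symm)
      (fun i => (hn₂ i _ (hvert 2 0 (by decide))).trans (hn₂ i _ (hvert 2 1 (by decide))).symm)
      (fun i => (hn₃ i _ (hvert 0 1 (by decide))).trans (hn₃ i _ (hvert 0 2 (by decide))).symm) hc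
    refine ⟨τ, hτ, B, B', fun μ => Ω.hasCoord_iff.2 ?_⟩
    rw [hu', Δ.triv_apex, funext fun i => (h μ i).1, funext fun i => (h μ i).2]
    rfl
  · rw [hu', ← L1, ← L1]
    exact (Δ.triv_mem_ell Ω).2 (hLe hn₁ 1 μ h)
  · rw [hu', ← L1, ← L1]
    exact (Δ.triv_mem_ell Ω).2 (hLe hn₂ 1 μ h)
  · rw [hu', ← L1, ← L1]
    exact (Δ.triv_mem_ell Ω).2 (hLe hn₃ 1 μ h)
  · rw [hu', affineInterp_vertex, affineInterp_vertex, ← hv i]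
    exact (hu _).symm
  · change Δ.triv Ω (Δ.contr (_, 0), L a 0 μ, L θ 0 μ) = _
    rw [L0, L0, Δ.contr_zero (hW μ)]
    exact (hu μ).symm
  · change P.W (Δ.triv Ω _) ≠ 0
    rw [Δ.W_triv Ω (Δ.contr_mem x.1.2)]
    exact Δ.ne_zero_of_mem_region (Δ.contr_mem x.1.2)
  · change Δ.triv Ω (Δ.contr (_, r), L a r μ, L θ r μ) ∈ A
    have hm := Δ.contr_mem (b := P.W (u μ)) r.2
    fin_cases i
    · refine hA₃ ?_
      rw [hell μ hi, hcS]
      exact (Δ.triv_mem_ell Ω).2 (hLe hn₃ r μ hi)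
    · refine hA₁ ((Δ.triv_mem_lagL₁ Ω hm).2 ⟨?_, hLe hn₁ r μ hi⟩)
      obtain ⟨s, hs, h⟩ := (s1 μ hi).1
      exact ⟨_, contr_mem_unit hs r.2, by rw [h, Δ.contr_δ hs one_mem]⟩
    · refine hA₂ ((Δ.triv_mem_lagL₂ Ω hm).2 ⟨?_, hLe hn₂ r μ hi⟩)
      obtain ⟨s, hs, h⟩ := (s2 μ hi).1
      exact ⟨_, contr_mem_unit hs r.2, by rw [h, Δ.contr_δ hs zero_mem]⟩

end BaseTriangle

end

theorem mainTheorem6 (P : LGParams) (Ω : ToricKaehler P) (γ₁ γ₂ : UPath P) (κ : KPath P)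
    (Δ : BaseTriangle P γ₁ γ₂ κ) (j₁ j₂ j₃ : ℤ) (h₁₂ : j₁ ≠ j₂) (h₂₃ : j₂ ≠ j₃) (h₁₃ : j₁ ≠ j₃) :
    (∃ (Φ : P.Y → P.Y) (Ψ : ℝ → ℝ → (Fin 2 → ℝ) → P.Y),
      Ω.IsHamiltonianDiffeo Φ ∧ Δ.IsIsotopy Ω j₃ (Φ '' Ω.lagK κ j₃) Ψ) ∧
    ∀ (Φ : P.Y → P.Y) (Ψ : ℝ → ℝ → (Fin 2 → ℝ) → P.Y) (J : CompatibleJ Ω) (u : C(Splx 2, P.Y)),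
      Ω.IsHamiltonianDiffeo Φ → Δ.IsIsotopy Ω j₃ (Φ '' Ω.lagK κ j₃) Ψ →
      ContributesToProduct Δ J j₁ j₂ j₃ (Φ '' Ω.lagK κ j₃) u →
      CarriesCorners Ψ u (Ω.lagL γ₁ j₁) (Ω.lagL γ₂ j₂) →
      ∃ u' : C(Splx 2, P.Y), IsMovedTriangle Ψ u u' ∧
        ∀ c : ℝ, 0 < c → ∃ u'' : C(Splx 2, P.Y),
          IsFlatHolomorphic Ω c u'' ∧
          HasBoundaryOn u'' (Ω.ell j₁) (Ω.ell j₂) (Ω.ell j₃) ∧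
          (∀ i : Fin 3, u'' (stdSimplex.vertex (S := ℝ) i) = u' (stdSimplex.vertex (S := ℝ) i)) ∧
          RelHomologous P.Y0
            (Ω.lagL γ₁ j₁ ∪ Ω.lagL γ₂ j₂ ∪ {p | ∃ t ∈ Icc (0 : ℝ) 1, ∃ a, p = Ψ 1 t a}) u' u'' := by
  refine ⟨Δ.exists_isotopy Ω j₃, fun Φ Ψ J u _ hΨ hu hc => ?_⟩
  obtain ⟨-, hb, hW, hdeg⟩ := hu
  obtain ⟨u', hmoved, hW', hb', hv⟩ := hΨ.exists_movedTriangle hb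
    (fun μ => hW ▸ ⟨u μ, mem_range_self μ, rfl⟩) hc
  refine ⟨u', hmoved, fun c hpos => ?_⟩
  refine Δ.exists_flat Ω h₂₃ h₁₃ (slopes_pos h₁₂ h₂₃ h₁₃ hdeg)
    (subset_union_left.trans subset_union_left) (subset_union_right.trans subset_union_left)
    (subset_union_of_subset_right ?_ _) hW' hb' hv hpos
  intro p hp
  rw [← hΨ.finish 0 BaseTriangle.zero_mem] at hp
  obtain ⟨a, rfl⟩ := hp
  exact ⟨0, BaseTriangle.zero_mem, a, rfl⟩
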